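/- **Setting.** Let $f:\mathbb R^n\to\mathbb R^n$, $g:\mathbb R^n\to\mathbb R^{n\times m}$, $Q:\mathbb R^n\to\mathbb R$, $R:\mathbb R^m\to\mathbb R$ with $f,g,Q,R$ real analytic near the origin, such that: (A1) $f(0)=0$ and $(F_1,G_0)$ is stabilizable, where $F_1=\partial f/\partial x(0)$, $G_0=g(0)$; (A2) $Q(0)=0$, $Q(x)>0$ for $x\ne0$, $Q_1=\partial^2Q/\partial x^2(0)\ge0$, and no eigenvector of $F_1$ with purely imaginary (possibly zero) eigenvalue lies in $\ker Q_1$ (automatic if $Q_1>0$ or $(F_1,Q_1)$ is detectable); (A3) $R$ is differentiable on $\mathbb R^m$, even, $R(0)=0$, $R(u)>0$ for $u\neq0$, $R_1=\partial^2R/\partial u^2(0)>0$, and $\rho=(\partial R/\partial u)^T$ is injective on $\mathbb R^m$; $\phi=\rho^{-1}$ and $\Psi(v)=v^T\phi(v)-R(\phi(v))$. Let $V^*(x_0)=\inf\int_0^\infty Q(x)+R(u)\,dt$ over all $u\in L_2(0,\infty)$ and all continuous solutions $x$ on $[0,\infty)$ of $\dot x=f(x)+g(x)u$, $x(0)=x_0$.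 The HJB equation is $V_x^{T}f-\Psi(g^TV_x)+Q=0$. **Notation.** $x^k\in\mathbb R^{m_k}$, $m_k=\binom{n+k-1}{k}$, has the entries $\sqrt{k!/(k_1!\cdots k_n!)}\,x_1^{k_1}\cdots x_n^{k_n}$, $k_1+\dots+k_n=k$; $K_k$ and $K_{i,j}$ are the matrices with $x^k\otimes x=K_k^Tx^{k+1}$ and $x^i\otimes x^j=K_{i,j}^Tx^{i+j}$; $[s]_l$ is the coefficient (vector) of $x^l$ in a power series $s$. $F_k$, $G_{ik}$ are the coefficients of $x^k$ in $f$ and in the $i$-th column of $g$; $x^TQ_kx^k$ and $v^T\tilde R_kv^k$ ($k\ge2$) are the parts of degree $k+1$ of $Q$ and $\Psi$, with $Q_k,\tilde R_k$ symmetric tensors. **Algorithm 1** (order $\bar k$). Read $F_k,G_{ik},Q_k,\tilde R_k$ ($k\le\bar k$). Take for $P_1$ the symmetric positive semidefinite solution of $F_1^TP_1+P_1F_1+Q_1-P_1G_0R_1^{-1}G_0^TP_1=0$ for which $F_c=F_1-G_0R_1^{-1}G_0^TP_1$ is Hurwitz. For $k=2,\dots,\bar k$ put $h_k=\sum_{j<k}P_jx^j$,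 $M_k=K_k(I\otimes F_c^T)K_k^T$, and $$\mathrm{vec}(P_k)=K_k^TM_k^{-1}\big([\Psi(g^Th_k)-f^Th_k]_{k+1}-K_k\mathrm{vec}(Q_k)\big).$$ Products of series are computed by $[s^Tl]_k=\sum_{j\le k}K_{k-j,j}\mathrm{vec}([s]_j^T[l]_{k-j})$, powers by $v^{j+1}=K_j(v^j\otimes v)$, and $M_k^{-1}$ is applied by Gauss–Jordan elimination. **Algorithm 2** (order $\bar k$, threshold $\theta\in\mathbb R$). If $\bar F_c=-\frac12(F_c+F_c^T)>0$ and $1/\lambda_{\min}(\bar F_c)<\theta$, put $T=I$. Otherwise put $T=\sqrt{P_c}$, where $P_c>0$ solves $F_c^TP_c+P_cF_c+I=0$. Run Algorithm 1 on the transformed data $Tf(T^{-1}z)$, $Tg(T^{-1}z)$, $Q(T^{-1}z)$, $R$. **Cost.** A step is an arithmetic operation, square root or zero test on reals, the writing of a table entry, the reading of one Taylor coefficient of the (possibly transformed) data or other input entry, or the comparison of one exponent in two multi-indices. The quantities that do not depend on $\bar k$ ($P_1$, the test of Algorithm 2, and $T$) are regarded as supplied in one step each. **Theorem.** 1. For each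 $n,m$ there is a polynomial $c$ such that for all data as above, all $\bar k$ and all $\theta$, each of the two algorithms takes at most $c(\bar k)$ steps. 2. Algorithm 1 is well defined: $P_1$ exists and is unique, and $M_k$ is invertible for all $k\ge1$. The computed $P_k$ do not depend on $\bar k\ge k$ and are exactly the coefficients of $V^*$: $V^*$ is finite and real analytic near $0$, and near $0$ $$V^*(x)=\sum_{k\ge1}\frac{x^TP_kx^k}{k+1},\qquad V^*_x(x)=\sum_{k\ge1}P_kx^k,$$ and $V^*$ satisfies the HJB equation. For each $\bar k$ the truncation $\sum_{k\le\bar k}P_kx^k$, put in place of $V_x$, satisfies the HJB equation up to an error $O(\|x\|^{\bar k+2})$. Each $P_k$ satisfies the symmetry condition: $\mathrm{vec}(P_k)=K_k^Tp_k$ for some $p_k\in\mathbb R^{m_{k+1}}$, and $P_kx^k$ is the gradient of $x^TP_kx^k/(k+1)$. For every $x_0$ near $0$ the infimum $V^*(x_0)$ is attained by a trajectory with the feedback $u^*(x)=-\phi\big(\sum_{k\ge1}g(x)^TP_kx^k\big)$. 3. For every $\theta$, Algorithm 2 is well defined, $T$ is symmetric positive definite and independent of $\bar k$, and in the coordinates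 $z=Tx$ everything in 2 holds for the transformed problem and the computed $P_k$; its value function takes at $Tx$ the value $V^*(x)$ for every $x$, so that $V^*(x)=\sum_{k\ge1}(Tx)^TP_k(Tx)^k/(k+1)$ near $0$. Moreover the matrices $M_k$ of the transformed problem are invertible and their condition numbers $\|M_k\|\,\|M_k^{-1}\|$ (spectral norm) are bounded uniformly in $k\ge1$. -/

import Mathlib

open Set Filter Topology MeasureTheory

noncomputable section

namespace NLR

/-! ### Monomials, reduced powers and reduction matrices

A multi-index of degree `k` in `d` variables is an element of `Sym (Fin d) k`, so the number of
them is `m_k = (d + k - 1).choose k`. -/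

/-- `c_{k₁,…,k_d}`, the square root of the multinomial coefficient `k! / (k₁! ⋯ k_d!)`. -/
def mcoef {d k : ℕ} (s : Sym (Fin d) k) : ℝ :=
  Real.sqrt ((k.factorial : ℝ) / ∏ i : Fin d, ((s.1.count i).factorial : ℝ))

/-- The reduced power `x^k ∈ ℝ^{m_k}` with entries `c_{k₁,…,k_d} x₁^{k₁} ⋯ x_d^{k_d}`. -/
def powVec {d : ℕ} (x : Fin d → ℝ) (k : ℕ) : Sym (Fin d) k → ℝ :=
  fun s => mcoef s * (s.1.map x).prod

/-- `K_k`, the matrix with `x^k ⊗ x = K_kᵀ x^{k+1}`. -/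
def redOne (d k : ℕ) : Matrix (Sym (Fin d) (k + 1)) (Sym (Fin d) k × Fin d) ℝ :=
  Matrix.of fun c b => if c.1 = b.2 ::ₘ b.1.1 then mcoef b.1 / mcoef c else 0

/-- `M_k = K_k (I ⊗ F_cᵀ) K_kᵀ`. -/
def Mmat {n : ℕ} (Fc : Matrix (Fin n) (Fin n) ℝ) (k : ℕ) :
    Matrix (Sym (Fin n) (k + 1)) (Sym (Fin n) (k + 1)) ℝ :=
  redOne n k * Matrix.kronecker (1 : Matrix (Sym (Fin n) k) (Sym (Fin n) k) ℝ) Fc.transpose *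
    (redOne n k).transpose

/-- The symmetry condition on `P ∈ ℝ^{n × m_k}`: `vec P = K_kᵀ p` for some `p ∈ ℝ^{m_{k+1}}`. -/
def IsSymTensor {n k : ℕ} (P : Matrix (Fin n) (Sym (Fin n) k) ℝ) : Prop :=
  ∃ p : Sym (Fin n) (k + 1) → ℝ, P.vec = Matrix.mulVec (redOne n k).transpose p

/-! ### Derivatives at the origin -/

/-- The gradient, as the vector of the partial derivatives. -/
def grad {d : ℕ} (s : (Fin d → ℝ) → ℝ) (x : Fin d → ℝ) : Fin d → ℝ :=
  fun i => fderiv ℝ s x (Pi.single i 1)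

/-- The Hessian matrix at the origin. -/
def hess {d : ℕ} (s : (Fin d → ℝ) → ℝ) : Matrix (Fin d) (Fin d) ℝ :=
  Matrix.of fun i j => iteratedFDeriv ℝ 2 s 0 ![Pi.single i 1, Pi.single j 1]

/-- The degree `k` Taylor coefficients of `s` at the origin with respect to the reduced power
`x^k`, so that `s(x) = ∑ₖ taylor s k ⬝ x^k`: the entry at a multi-index `i₁,…,i_k` is
`c ∂_{i₁} ⋯ ∂_{i_k} s(0) / k!`. -/
def taylor {d : ℕ} (s : (Fin d → ℝ) → ℝ) (k : ℕ) : Sym (Fin d) k → ℝ :=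
  fun a => mcoef a / (k.factorial : ℝ) *
    iteratedFDeriv ℝ k s 0 fun j : Fin k =>
      Pi.single (a.1.toList.get (j.cast (by rw [Multiset.length_toList]; exact a.2.symm))) 1

/-- The symmetric tensor `S ∈ ℝ^{d × m_k}` for which `xᵀ S x^k` is the homogeneous part of
degree `k + 1` of `s`. -/
def symTaylor {d : ℕ} (s : (Fin d → ℝ) → ℝ) (k : ℕ) : Matrix (Fin d) (Sym (Fin d) k) ℝ :=
  Matrix.of fun i a => Matrix.mulVec (redOne d k).transpose (taylor s (k + 1)) (a, i)

/-! ### The optimal control problem -/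

/-- All eigenvalues lie in the open left half plane. -/
def IsHurwitz {n : ℕ} (A : Matrix (Fin n) (Fin n) ℝ) : Prop :=
  ∀ z ∈ spectrum ℂ (A.map (algebraMap ℝ ℂ)), z.re < 0

/-- The dynamics `ẋ = f(x) + g(x) u` and the running cost `Q(x) + R(u)`. -/
structure Problem (n m : ℕ) where
  f : (Fin n → ℝ) → (Fin n → ℝ)
  g : (Fin n → ℝ) → Matrix (Fin n) (Fin m) ℝ
  Q : (Fin n → ℝ) → ℝ
  R : (Fin m → ℝ) → ℝ

namespace Problem

variable {n m : ℕ} (p : Problem n m)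

/-- `ρ = (∂R/∂u)ᵀ`. -/
def rho : (Fin m → ℝ) → (Fin m → ℝ) := grad p.R

/-- `φ = ρ⁻¹` (on the range of `ρ`). -/
def phi : (Fin m → ℝ) → (Fin m → ℝ) := Function.invFun p.rho

/-- `Ψ(v) = vᵀ φ(v) - R(φ(v))`. -/
def Psi (v : Fin m → ℝ) : ℝ := v ⬝ᵥ p.phi v - p.R (p.phi v)

/-- `F₁ = ∂f/∂x (0)`. -/
def F1 : Matrix (Fin n) (Fin n) ℝ :=
  Matrix.of fun i j => fderiv ℝ p.f 0 (Pi.single j 1) i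

/-- `G₀ = g(0)`. -/
def G0 : Matrix (Fin n) (Fin m) ℝ := p.g 0

/-- `Q₁ = ∂²Q/∂x² (0)`. -/
def Q1 : Matrix (Fin n) (Fin n) ℝ := hess p.Q

/-- `R₁ = ∂²R/∂u² (0)`. -/
def R1 : Matrix (Fin m) (Fin m) ℝ := hess p.R

/-- The standing assumptions on the problem data. -/
structure Assumptions : Prop where
  f_analytic : AnalyticAt ℝ p.f 0
  g_analytic : ∀ i j, AnalyticAt ℝ (fun x => p.g x i j) 0
  f_zero : p.f 0 = 0
  /-- `(F₁, G₀)` is stabilizable. -/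
  stabilizable : ∃ L : Matrix (Fin m) (Fin n) ℝ, IsHurwitz (p.F1 + p.G0 * L)
  Q_analytic : AnalyticAt ℝ p.Q 0
  Q_zero : p.Q 0 = 0
  Q_pos : ∀ x, x ≠ 0 → 0 < p.Q x
  Q1_nonneg : p.Q1.PosSemidef
  /-- No eigenvector of `F₁` with purely imaginary eigenvalue lies in the kernel of `Q₁`
  (automatic if `Q₁ > 0` or if `(F₁, Q₁)` is detectable). -/
  no_imaginary_mode : ∀ (w : ℝ) (z : Fin n → ℂ),
    Matrix.mulVec (p.F1.map (algebraMap ℝ ℂ)) z = ((w : ℂ) * Complex.I) • z →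
    Matrix.mulVec (p.Q1.map (algebraMap ℝ ℂ)) z = 0 → z = 0
  R_differentiable : Differentiable ℝ p.R
  R_analytic : AnalyticAt ℝ p.R 0
  R_even : ∀ u, p.R (-u) = p.R u
  R_zero : p.R 0 = 0
  R_pos : ∀ u, u ≠ 0 → 0 < p.R u
  R1_pos : p.R1.PosDef
  rho_injective : Function.Injective p.rho

/-- `(x, u)` is an admissible pair started at `x₀`: `u ∈ L²(0, ∞)` and `x` is a continuous
(Carathéodory) solution of `ẋ = f(x) + g(x) u`, `x(0) = x₀`, on `[0, ∞)`. -/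
structure IsTrajectory (x₀ : Fin n → ℝ) (x : ℝ → Fin n → ℝ) (u : ℝ → Fin m → ℝ) : Prop where
  continuousOn : ContinuousOn x (Ici 0)
  memLp : MemLp u 2 (volume.restrict (Ioi 0))
  integrable : ∀ t, 0 ≤ t → IntervalIntegrable
    (fun s => p.f (x s) + Matrix.mulVec (p.g (x s)) (u s)) volume 0 t
  eq_integral : ∀ t, 0 ≤ t →
    x t = x₀ + ∫ s in (0 : ℝ)..t, (p.f (x s) + Matrix.mulVec (p.g (x s)) (u s))

/-- The cost `∫₀^∞ Q(x(t)) + R(u(t)) dt ∈ [0, ∞]`. -/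
def cost (x : ℝ → Fin n → ℝ) (u : ℝ → Fin m → ℝ) : ENNReal :=
  ∫⁻ t in Ioi (0 : ℝ), ENNReal.ofReal (p.Q (x t) + p.R (u t))

/-- The value function `V*`. -/
def value (x₀ : Fin n → ℝ) : ENNReal :=
  ⨅ (x : ℝ → Fin n → ℝ) (u : ℝ → Fin m → ℝ) (_ : p.IsTrajectory x₀ x u), p.cost x u

/-- The value function with real values. -/
def valueR (x₀ : Fin n → ℝ) : ℝ := (p.value x₀).toReal

/-- The closed-loop matrix `F₁ - G₀ R₁⁻¹ G₀ᵀ P₁`. -/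
def closedLoop (P₁ : Matrix (Fin n) (Fin n) ℝ) : Matrix (Fin n) (Fin n) ℝ :=
  p.F1 - p.G0 * p.R1⁻¹ * p.G0.transpose * P₁

/-- `P₁` is the symmetric positive semidefinite stabilizing solution of the algebraic Riccati
equation. -/
structure IsStabilizingARE (P₁ : Matrix (Fin n) (Fin n) ℝ) : Prop where
  posSemidef : P₁.PosSemidef
  are : p.F1.transpose * P₁ + P₁ * p.F1 + p.Q1
    - P₁ * p.G0 * p.R1⁻¹ * p.G0.transpose * P₁ = 0
  hurwitz : IsHurwitz (p.closedLoop P₁)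

/-- The stabilizing solution of the algebraic Riccati equation. -/
def areSol : Matrix (Fin n) (Fin n) ℝ := Classical.epsilon p.IsStabilizingARE

/-- The closed-loop matrix `F_c` at the stabilizing solution. -/
def Fc : Matrix (Fin n) (Fin n) ℝ := p.closedLoop p.areSol

/-- The problem in the coordinates `z = T x`. -/
def transform (T : Matrix (Fin n) (Fin n) ℝ) : Problem n m where
  f z := Matrix.mulVec T (p.f (Matrix.mulVec T⁻¹ z))
  g z := T * p.g (Matrix.mulVec T⁻¹ z)
  Q z := p.Q (Matrix.mulVec T⁻¹ z)
  R := p.R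

end Problem

/-- Positive definite solutions of the Lyapunov equation `Fᵀ P + P F + I = 0`. -/
def IsLyapunov {n : ℕ} (F P : Matrix (Fin n) (Fin n) ℝ) : Prop :=
  P.PosDef ∧ F.transpose * P + P * F + 1 = 0

/-- `T = √P_c`, the positive definite square root of the positive definite solution `P_c` of the
Lyapunov equation of `F`. -/
def lyapunovSqrt {n : ℕ} (F : Matrix (Fin n) (Fin n) ℝ) : Matrix (Fin n) (Fin n) ℝ :=
  Classical.epsilon fun T : Matrix (Fin n) (Fin n) ℝ =>
    T.PosDef ∧ T * T = Classical.epsilon (IsLyapunov F)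

/-- The operator norm of a matrix for the Euclidean norm. -/
def opNorm {ι : Type} [Fintype ι] [DecidableEq ι] (A : Matrix ι ι ℝ) : ℝ :=
  ‖Matrix.toEuclideanCLM (n := ι) (𝕜 := ℝ) A‖

/-- The condition number `‖A‖ ‖A⁻¹‖`. -/
def condNumber {ι : Type} [Fintype ι] [DecidableEq ι] (A : Matrix ι ι ℝ) : ℝ :=
  opNorm A * opNorm A⁻¹

/-! ### Computations with a step count

The two algorithms are written as programs over the reals. A step is an arithmetic operation, a
square root or a zero test on real numbers, the writing of one table entry, the reading of one
entry of the input, or the comparison of the exponents of one variable in two multi-indices. -/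

/-- The result of a computation together with its number of steps. -/
structure Comp (α : Type) where
  val : α
  steps : ℕ

namespace Comp

instance : Monad Comp where
  pure a := ⟨a, 0⟩
  bind c k := ⟨(k c.val).val, c.steps + (k c.val).steps⟩

/-- One step, with result `a`. Used only for the primitive operations below, for reading the
input and for the quantities of the first two steps of the algorithms, which do not depend on
the order. -/
def op {α : Type} (a : α) : Comp α := ⟨a, 1⟩

def add (a b : ℝ) : Comp ℝ := op (a + b)
def sub (a b : ℝ) : Comp ℝ := op (a - b)
def mul (a b : ℝ) : Comp ℝ := op (a * b)
def div (a b : ℝ) : Comp ℝ := op (a / b)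
def sqrt (a : ℝ) : Comp ℝ := op (Real.sqrt a)

open Classical in
def isZero (a : ℝ) : Comp Bool := op (decide (a = 0))

/-- Comparison of two multi-indices in `d` variables. -/
def sameIndex {d : ℕ} (s t : Multiset (Fin d)) : Comp Bool := ⟨decide (s = t), d + 1⟩

/-- Fill a table, one entry after the other. -/
def tab {ι : Type} [Fintype ι] {α : ι → Type} (c : ∀ i, Comp (α i)) : Comp (∀ i, α i) :=
  ⟨fun i => (c i).val, ∑ i, ((c i).steps + 1)⟩

/-- Fill a table indexed by the degrees `0, …, N` (and by convention zero beyond). -/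
def tabTo {α : ℕ → Type} [∀ d, Zero (α d)] (N : ℕ) (c : ∀ d, Comp (α d)) : Comp (∀ d, α d) :=
  ⟨fun d => if d ≤ N then (c d).val else 0, ∑ d ∈ Finset.range (N + 1), ((c d).steps + 1)⟩

/-- Fill a matrix. -/
def mat {ι κ : Type} [Fintype ι] [Fintype κ] (c : ι → κ → Comp ℝ) : Comp (Matrix ι κ ℝ) :=
  tab fun i => tab fun j => c i j

/-- Add up finitely many computed numbers. -/
def sum {ι : Type} [Fintype ι] (c : ι → Comp ℝ) : Comp ℝ :=
  ⟨∑ i, (c i).val, ∑ i, ((c i).steps + 1)⟩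

/-- Multiply finitely many computed numbers. -/
def prod {ι : Type} [Fintype ι] (c : ι → Comp ℝ) : Comp ℝ :=
  ⟨∏ i, (c i).val, ∑ i, ((c i).steps + 1)⟩

variable {ι κ τ : Type} [Fintype ι] [Fintype κ] [Fintype τ]

def mulMat (A : Matrix ι κ ℝ) (B : Matrix κ τ ℝ) : Comp (Matrix ι τ ℝ) :=
  mat fun i j => sum fun k => mul (A i k) (B k j)

def subMat (A B : Matrix ι κ ℝ) : Comp (Matrix ι κ ℝ) :=
  mat fun i j => sub (A i j) (B i j)

def mulVec (A : Matrix ι κ ℝ) (v : κ → ℝ) : Comp (ι → ℝ) :=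
  tab fun i => sum fun k => mul (A i k) (v k)

/-- The factorial as a real number. -/
def fact : ℕ → Comp ℝ
  | 0 => op 1
  | k + 1 => do
    let a ← fact k
    let b ← op ((k + 1 : ℕ) : ℝ)
    mul b a

/-- The coefficient `c_{k₁,…,k_d}`. -/
def coef {d k : ℕ} (s : Sym (Fin d) k) : Comp ℝ := do
  let a ← fact k
  let b ← prod fun i : Fin d => fact (s.1.count i)
  let q ← div a b
  sqrt q

/-- The matrix `K_k`. -/
def redOne (d k : ℕ) : Comp (Matrix (Sym (Fin d) (k + 1)) (Sym (Fin d) k × Fin d) ℝ) :=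
  mat fun c b => do
    let t ← sameIndex c.1 (b.2 ::ₘ b.1.1)
    if t then do
      let p ← coef b.1
      let q ← coef c
      div p q
    else pure 0

/-- The matrix `K_{i,j}` with `(x^i ⊗ x^j)ᵀ = (x^l)ᵀ K_{i,j}`, where `l = i + j`. -/
def red (d i j l : ℕ) : Comp (Matrix (Sym (Fin d) l) (Sym (Fin d) i × Sym (Fin d) j) ℝ) :=
  mat fun c b => do
    let t ← sameIndex c.1 (b.1.1 + b.2.1)
    if t then do
      let p ← coef b.1
      let q ← coef b.2
      let r ← mul p q
      let s ← coef c
      div r s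
    else pure 0

/-! #### Linear systems -/

/-- The first row in the list whose entry in column `c` is not zero. -/
def pivot (A : Matrix ι ι ℝ) (c : ι) : List ι → Comp ι
  | [] => pure c
  | r :: rs => do
    let t ← isZero (A r c)
    if t then pivot A c rs else pure r

/-- Gauss-Jordan elimination of the columns in the list, with row interchanges, on the augmented
matrix `[A | b]`. -/
def eliminate [DecidableEq ι] : List ι → Matrix ι ι ℝ → (ι → ℝ) → Comp (ι → ℝ)
  | [], _, b => pure b
  | c :: cs, A, b => do
    let r ← pivot A c (c :: cs)
    let A₁ ← mat fun i j => pure (A (Equiv.swap r c i) j)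
    let b₁ ← tab fun i => pure (b (Equiv.swap r c i))
    let row ← tab fun j => div (A₁ c j) (A₁ c c)
    let e ← div (b₁ c) (A₁ c c)
    let A₂ ← mat fun i j =>
      if i = c then pure (row j) else do
        let t ← mul (A₁ i c) (row j)
        sub (A₁ i j) t
    let b₂ ← tab fun i =>
      if i = c then pure e else do
        let t ← mul (A₁ i c) e
        sub (b₁ i) t
    eliminate cs A₂ b₂

/-- `A⁻¹ b` by Gauss-Jordan elimination. -/
def solve [DecidableEq ι] (A : Matrix ι ι ℝ) (b : ι → ℝ) : Comp (ι → ℝ) :=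
  eliminate (Finset.univ : Finset ι).toList A b

/-! #### Power series -/

/-- A vector valued power series `∑_k S_k x^k` in `n` variables, with components indexed by `κ`,
as the table of its coefficient matrices `S_k`. -/
abbrev Series (n : ℕ) (κ : Type) : Type := ∀ k : ℕ, Matrix κ (Sym (Fin n) k) ℝ

/-- The degree `l` coefficient `[sᵀ t]_l = ∑_{j ≤ l} K_{l-j,j} vec (S_jᵀ T_{l-j})` of the dot
product of two series. -/
def dot {n : ℕ} (S T : Series n κ) (l : ℕ) : Comp (Sym (Fin n) l → ℝ) := do
  let parts ← tab fun j : Fin (l + 1) => do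
    let A ← mulMat (S j).transpose (T (l - j))
    let K ← red n (l - j) j l
    mulVec K A.vec
  tab fun c => sum fun j => pure (parts j c)

/-- The series `gᵀ s` up to degree `N`, for the columns `g_i` of `g`. -/
def gradProd {n m : ℕ} (G : Fin m → Series n (Fin n)) (S : Series n (Fin n)) (N : ℕ) :
    Comp (Series n (Fin m)) :=
  tabTo N fun d => do
    let rows ← tab fun i => dot S (G i) d
    pure (Matrix.of rows)

/-- A component of a series, as a series with one component. -/
def comp {n : ℕ} (S : Series n κ) (i : κ) : Series n Unit := fun d => Matrix.of fun _ s => S d i s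

/-- The reduced power `v^j` of a vector valued series `v`, up to degree `N`, computed from
`v^{j+1} = K_j (v^j ⊗ v)`. -/
def powSeries {n m : ℕ} (v : Series n (Fin m)) (N : ℕ) : (j : ℕ) → Comp (Series n (Sym (Fin m) j))
  | 0 => tabTo N fun d => mat fun _ _ => pure (if d = 0 then 1 else 0)
  | j + 1 => do
    let W ← powSeries v N j
    let K ← redOne m j
    tabTo N fun d => do
      let rows ← tab fun b : Sym (Fin m) j × Fin m => dot (comp W b.1) (comp v b.2) d
      mulMat K (Matrix.of rows)

/-- The degree `l` coefficient of `½ vᵀ R̃₁ v + ∑_{2 ≤ j ≤ J} vᵀ R̃_j v^j`. -/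
def psiCoef {n m : ℕ} (Rinv : Matrix (Fin m) (Fin m) ℝ)
    (Rt : ∀ j, Matrix (Fin m) (Sym (Fin m) j) ℝ) (v : Series n (Fin m)) (J l : ℕ) :
    Comp (Sym (Fin n) l → ℝ) := do
  let w ← tabTo l fun d => mulMat Rinv (v d)
  let quad ← dot v w l
  let parts ← tab fun i : Fin (J - 1) => do
    let W ← powSeries v l (i + 2)
    let U ← tabTo l fun d => mulMat (Rt (i + 2)) (W d)
    dot v U l
  tab fun c => do
    let h ← div (quad c) 2
    let s ← sum fun i => pure (parts i c)
    add h s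

/-! #### The algorithms -/

/-- The Taylor data determined in the first step: `F_k`, `G_{ik}`, `Q_k` and `R̃_k`, together
with `R₁⁻¹`. -/
structure Data (n m : ℕ) where
  F : Series n (Fin n)
  G : Fin m → Series n (Fin n)
  Q : ∀ k, Matrix (Fin n) (Sym (Fin n) k) ℝ
  Rt : ∀ k, Matrix (Fin m) (Sym (Fin m) k) ℝ
  Rinv : Matrix (Fin m) (Fin m) ℝ

variable {n m : ℕ}

/-- Read the Taylor data up to order `N`. -/
def readData (p : Problem n m) (N : ℕ) : Comp (Data n m) := do
  let F ← tabTo N fun k => mat fun i a => op (taylor (fun x => p.f x i) k a)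
  let G ← tab fun j : Fin m => tabTo N fun k => mat fun i a => op (taylor (fun x => p.g x i j) k a)
  let Q ← tabTo N fun k => mat fun i a => op (symTaylor p.Q k i a)
  let Rt ← tabTo N fun k => mat fun i a => op (symTaylor p.Psi k i a)
  let Rinv ← mat fun i j => op (p.R1⁻¹ i j)
  pure ⟨F, G, Q, Rt, Rinv⟩

/-- The closed-loop matrix `F_c = F₁ - G₀ R₁⁻¹ G₀ᵀ P₁`. -/
def closedLoop (p : Problem n m) (P₁ : Matrix (Fin n) (Fin n) ℝ) :
    Comp (Matrix (Fin n) (Fin n) ℝ) := do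
  let F ← mat fun i j => op (p.F1 i j)
  let G ← mat fun i j => op (p.G0 i j)
  let Rinv ← mat fun i j => op (p.R1⁻¹ i j)
  let A ← mulMat G Rinv
  let B ← mulMat A G.transpose
  let C ← mulMat B P₁
  subMat F C

/-- The computation of `P_k`, `k ≥ 2`, from `P_1, …, P_{k-1}`:
`vec P_k = K_kᵀ M_k⁻¹ ([Ψ(gᵀ h_k) - fᵀ h_k]_{k+1} - q_k)` with `h_k = ∑_{j<k} P_j x^j`,
`M_k = K_k (I ⊗ F_cᵀ) K_kᵀ` and `q_k = K_k vec Q_k`. -/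
def nextP (D : Data n m) (Fc : Matrix (Fin n) (Fin n) ℝ) (P : Series n (Fin n)) (k : ℕ) :
    Comp (Matrix (Fin n) (Sym (Fin n) k) ℝ) := do
  let v ← gradProd D.G P (k + 1)
  let psi ← psiCoef D.Rinv D.Rt v k (k + 1)
  let fh ← dot D.F P (k + 1)
  let K ← redOne n k
  let q ← mulVec K (D.Q k).vec
  let rhs ← tab fun c => do
    let t ← sub (psi c) (fh c)
    sub t (q c)
  let kron ← mat fun a b : Sym (Fin n) k × Fin n => do
    let t ← sameIndex a.1.1 b.1.1
    pure (if t then Fc b.2 a.2 else 0)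
  let KF ← mulMat K kron
  let M ← mulMat KF K.transpose
  let pk ← solve M rhs
  let w ← mulVec K.transpose pk
  pure (Matrix.of fun i a => w (a, i))

/-- The table of `P_1, …, P_N` (all other entries being zero). -/
def loop (D : Data n m) (P₁ Fc : Matrix (Fin n) (Fin n) ℝ) : ℕ → Comp (Series n (Fin n))
  | 0 => pure 0
  | 1 => pure (Function.update 0 1 (P₁.submatrix id Sym.oneEquiv.symm))
  | k + 2 => do
    let P ← loop D P₁ Fc (k + 1)
    let Pk ← nextP D Fc P (k + 2)
    pure (Function.update P (k + 2) Pk)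

end Comp

/-- Algorithm 1 with approximation order `N`: the table of `P_1, …, P_N`. -/
def algorithm1 {n m : ℕ} (p : Problem n m) (N : ℕ) : Comp (Comp.Series n (Fin n)) := do
  let D ← Comp.readData p N
  let P₁ ← Comp.op p.areSol
  let Fc ← Comp.closedLoop p P₁
  Comp.loop D P₁ Fc N

/-- The condition under which no transformation is made: with `F̄ = -½ (F + Fᵀ)`, `F̄ > 0` and
`1 / λ_min(F̄) < θ`. -/
def WellConditioned {n : ℕ} (θ : ℝ) (F : Matrix (Fin n) (Fin n) ℝ) : Prop :=
  (-((1 / 2 : ℝ) • (F + F.transpose))).PosDef ∧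
    1 / sInf (spectrum ℝ (-((1 / 2 : ℝ) • (F + F.transpose)))) < θ

open Classical in
/-- Algorithm 2 with threshold `θ` and approximation order `N`: the transformation matrix `T`
(the identity if no transformation is made) and the table of `P_1, …, P_N` in the coordinates
`z = T x`. -/
def algorithm2 {n m : ℕ} (p : Problem n m) (θ : ℝ) (N : ℕ) :
    Comp (Matrix (Fin n) (Fin n) ℝ × Comp.Series n (Fin n)) := do
  let P₁ ← Comp.op p.areSol
  let Fc ← Comp.closedLoop p P₁
  let ok ← Comp.op (decide (WellConditioned θ Fc))
  if ok then do
    let P ← algorithm1 p N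
    pure (1, P)
  else do
    let T ← Comp.op (lyapunovSqrt Fc)
    let P ← algorithm1 (p.transform T) N
    pure (T, P)

/-! ### What the coefficients have to satisfy -/

/-- The truncated gradient series `∑_{k=1}^N P_k x^k`. -/
def gradTrunc {n : ℕ} (P : Comp.Series n (Fin n)) (N : ℕ) (x : Fin n → ℝ) : Fin n → ℝ :=
  ∑ k ∈ Finset.Icc 1 N, Matrix.mulVec (P k) (powVec x k)

/-- The left hand side of the HJB equation, with `h` in place of the gradient of `V*`. -/
def Problem.hjb {n m : ℕ} (p : Problem n m) (h x : Fin n → ℝ) : ℝ :=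
  h ⬝ᵥ p.f x - p.Psi (Matrix.mulVec (p.g x).transpose h) + p.Q x

/-- The matrices `P_k`, `k ≥ 1`, are the coefficients of the value function and of the optimal
control of the problem `p`, and they have the required symmetry. -/
structure SolvesExactly {n m : ℕ} (p : Problem n m) (P : Comp.Series n (Fin n)) : Prop where
  /-- `V*` is finite and real analytic near the origin. -/
  finite : ∀ᶠ x in 𝓝 (0 : Fin n → ℝ), p.value x ≠ ⊤
  analytic : AnalyticAt ℝ p.valueR 0
  /-- `V*(x) = ∑_{k ≥ 1} xᵀ P_k x^k / (k + 1)` near the origin. -/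
  value_series : ∀ᶠ x in 𝓝 (0 : Fin n → ℝ),
    HasSum (fun k : ℕ => x ⬝ᵥ Matrix.mulVec (P (k + 1)) (powVec x (k + 1)) / ((k : ℝ) + 2))
      (p.valueR x)
  /-- The symmetry condition. -/
  symmetric : ∀ k, 1 ≤ k → IsSymTensor (P k)
  /-- `P_k x^k` is the gradient of `xᵀ P_k x^k / (k + 1)`. -/
  grad_term : ∀ k, 1 ≤ k → ∀ x : Fin n → ℝ,
    grad (fun y => y ⬝ᵥ Matrix.mulVec (P k) (powVec y k) / ((k : ℝ) + 1)) x =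
      Matrix.mulVec (P k) (powVec x k)
  /-- `V*_x(x) = ∑_{k ≥ 1} P_k x^k` near the origin. -/
  grad_series : ∀ᶠ x in 𝓝 (0 : Fin n → ℝ),
    HasSum (fun k : ℕ => Matrix.mulVec (P (k + 1)) (powVec x (k + 1))) (grad p.valueR x)
  /-- `V*` satisfies the HJB equation near the origin. -/
  hjb : ∀ᶠ x in 𝓝 (0 : Fin n → ℝ), p.hjb (grad p.valueR x) x = 0
  /-- The truncation at order `N` satisfies the HJB equation through the terms of degree
  `N + 1`, the ones that determine `P_N`. -/
  hjb_trunc : ∀ N : ℕ,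
    (fun x : Fin n → ℝ => p.hjb (gradTrunc P N x) x) =O[𝓝 0] fun x => ‖x‖ ^ (N + 2)
  /-- From every initial state near the origin, the feedback
  `u*(x) = -φ(∑_{k ≥ 1} g(x)ᵀ P_k x^k)` generates an admissible pair that attains `V*`. -/
  optimal : ∀ᶠ x₀ in 𝓝 (0 : Fin n → ℝ), ∃ x u, p.IsTrajectory x₀ x u ∧
    p.cost x u = p.value x₀ ∧ ∀ t, 0 ≤ t → ∃ w,
      HasSum (fun k : ℕ => Matrix.mulVec (p.g (x t)).transpose
        (Matrix.mulVec (P (k + 1)) (powVec (x t) (k + 1)))) w ∧ u t = -p.phi w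

end NLR

end

namespace NLR
open Matrix

/-! ### Hurwitz matrices and the Lyapunov equation -/

/-! Write a candidate gradient as `h = Π x + (higher terms)`, with `Π` the stabilizing Riccati
solution. In the HJB equation the quadratic terms cancel by the Riccati equation, and what remains
is `∑ᵢ (F_c x)ᵢ (h - Π x)ᵢ = rest h` (`FormalData.lhs_eq`). The part of degree `k + 1` of `rest h`
depends only on the terms of `h` of degree below `k`. On a field of degree `k` with the gradient
symmetry `K_kᵀ q` the left side is `M_k q`. So, as soon as the `M_k` are invertible, there is
exactly one formal solution with this symmetry, and it is what the recursion computes. Invertibility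
holds because a kernel vector of `M_k` is a homogeneous polynomial that is constant along the
solutions of `ẋ = F_c x`; these tend to the origin, so the polynomial is zero
(`isUnit_det_Mmat_of_isHurwitz`).

Convergence of the formal solution needs bounds that are uniform in the degree. The square-root
normalization of `x^k` makes `K_k` a coisometry (`redOne_mul_transpose`). If `F_c + F_cᵀ` is
negative definite, the quadratic form of `M_k` is therefore at most `-μ |p|²` with `μ` independent
of `k`, which bounds the inverses and the condition numbers. The same normalization makes the
Bombieri norm submultiplicative, and an induction in a weighted `ℓ¹` norm then bounds the
coefficients geometrically (`IsSolution.exists_l2_le`). Dissipativity can always be arranged: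
conjugating the Lyapunov equation by `T = √P_c` turns it into `F + Fᵀ = -T⁻²`. An analytic solution
found in these coordinates is carried back, and uniqueness of the formal solution identifies its
Taylor coefficients with the output of the algorithm in the original coordinates as well.

The analytic solution `V` equals `V*` by a verification argument. For small `v` one has `v · u -
R(u) ≤ Ψ(v)` for all `u`, although `R` need not be convex (`eventually_fenchel`); so while a
trajectory stays in a small ball, `V` decreases no faster than cost accrues. Leaving the ball costs
a fixed positive amount because `R` grows at least linearly, and a trajectory of finite cost that
stays must come near the origin because `Q > 0` elsewhere. Conversely the feedback `-φ(gᵀ V_x)`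
gives equality, and its closed loop has linearization `F_c`, hence decays exponentially
(`eventually_optimal`).

The stabilizing Riccati solution is the limit of Kleinman's policy iteration; facts about Hurwitz
matrices come from powers of the Cayley transform instead of the matrix exponential. For the step
count, every piece of the programs is bounded by a power of `N + 4` whose exponent depends only on
`n` and `m`. -/

theorem mem_spectrum_iff_exists_mulVec {n : ℕ} (M : Matrix (Fin n) (Fin n) ℂ) (z : ℂ) :
    z ∈ spectrum ℂ M ↔ ∃ v, v ≠ 0 ∧ M *ᵥ v = z • v := by
  have h : z ∈ spectrum ℂ M ↔ (algebraMap ℂ (Matrix (Fin n) (Fin n) ℂ) z - M).det = 0 := by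
    rw [spectrum.mem_iff, Matrix.isUnit_iff_isUnit_det, isUnit_iff_ne_zero, not_not]
  rw [h, ← Matrix.exists_mulVec_eq_zero_iff]
  refine exists_congr fun v => and_congr_right fun _ => ?_
  rw [Matrix.sub_mulVec, sub_eq_zero, eq_comm, Algebra.algebraMap_eq_smul_one,
    Matrix.smul_mulVec, Matrix.one_mulVec]

theorem complex_mulVec_eq_smul_iff {n : ℕ} (A : Matrix (Fin n) (Fin n) ℝ) (v : Fin n → ℂ) (z : ℂ) :
    A.map (algebraMap ℝ ℂ) *ᵥ v = z • v ↔
      A *ᵥ (fun i => (v i).re) = z.re • (fun i => (v i).re) - z.im • (fun i => (v i).im) ∧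
      A *ᵥ (fun i => (v i).im) = z.im • (fun i => (v i).re) + z.re • (fun i => (v i).im) := by
  simp only [funext_iff, Complex.ext_iff, Matrix.mulVec, dotProduct, Matrix.map_apply,
    Complex.re_sum, Complex.im_sum, Pi.smul_apply, Pi.sub_apply, Pi.add_apply, smul_eq_mul,
    Complex.mul_re, Complex.mul_im, Complex.coe_algebraMap, Complex.ofReal_re, Complex.ofReal_im,
    zero_mul, sub_zero, add_zero, forall_and]
  refine and_congr_right fun _ => forall_congr' fun i => ?_
  rw [add_comm (z.re * (v i).im)]

/-- Real form of the eigenvalue condition. -/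
theorem isHurwitz_iff {n : ℕ} (A : Matrix (Fin n) (Fin n) ℝ) :
    IsHurwitz A ↔ ∀ (a b : ℝ) (x y : Fin n → ℝ), A *ᵥ x = a • x - b • y →
      A *ᵥ y = b • x + a • y → (x ≠ 0 ∨ y ≠ 0) → a < 0 := by
  constructor
  · intro h a b x y hx hy hne
    have := h ⟨a, b⟩ ((mem_spectrum_iff_exists_mulVec _ _).2
      ⟨fun i => ⟨x i, y i⟩, ?_, (complex_mulVec_eq_smul_iff A _ _).2 ⟨hx, hy⟩⟩)
    · exact this
    · intro h0
      rcases hne with hne | hne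
      · exact hne (funext fun i => congrArg Complex.re (congrFun h0 i))
      · exact hne (funext fun i => congrArg Complex.im (congrFun h0 i))
  · intro h z hz
    obtain ⟨v, hv, hzv⟩ := (mem_spectrum_iff_exists_mulVec _ _).1 hz
    obtain ⟨h1, h2⟩ := (complex_mulVec_eq_smul_iff A _ _).1 hzv
    refine h _ _ _ _ h1 h2 ?_
    by_contra! h0
    exact hv (funext fun i => Complex.ext (congrFun h0.1 i) (congrFun h0.2 i))

/-- Gelfand's formula: `‖B ^ k‖ ^ (1 / k)` tends to the spectral radius, which lies strictly below
one. Any `q` in between gives `‖B ^ k‖ ≤ q ^ k` for large `k`. -/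
theorem tendsto_pow_of_spectrum_lt_one {n : ℕ} (B : Matrix (Fin n) (Fin n) ℂ)
    (h : ∀ z ∈ spectrum ℂ B, ‖z‖ < 1) : Tendsto (fun k : ℕ => B ^ k) atTop (𝓝 0) := by
  rcases Nat.eq_zero_or_pos n with rfl | hn
  · rw [show (fun k : ℕ => B ^ k) = fun _ => 0 from funext fun k => Subsingleton.elim _ _]
    exact tendsto_const_nhds
  have : Nonempty (Fin n) := ⟨⟨0, hn⟩⟩
  let : NormedRing (Matrix (Fin n) (Fin n) ℂ) := Matrix.linftyOpNormedRing
  let : NormedAlgebra ℂ (Matrix (Fin n) (Fin n) ℂ) := Matrix.linftyOpNormedAlgebra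
  have : CompleteSpace (Matrix (Fin n) (Fin n) ℂ) := FiniteDimensional.complete ℂ _
  have h1 : spectralRadius ℂ B < (1 : NNReal) :=
    spectrum.spectralRadius_lt_of_forall_lt B fun z hz => by exact_mod_cast h z hz
  obtain ⟨q, hq1, hq2⟩ := ENNReal.lt_iff_exists_nnreal_btwn.1 h1
  have hq3 : q < 1 := by exact_mod_cast hq2
  have h2 := (spectrum.pow_nnnorm_pow_one_div_tendsto_nhds_spectralRadius B).eventually
    (gt_mem_nhds hq1)
  refine squeeze_zero_norm' (a := fun k : ℕ => (q : ℝ) ^ k) ?_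
    (tendsto_pow_atTop_nhds_zero_of_lt_one q.2 (by exact_mod_cast hq3))
  filter_upwards [h2, eventually_gt_atTop 0] with k hk hk0
  have h3 : ((‖B ^ k‖₊ : ENNReal) ^ (1 / (k : ℝ))) ^ k ≤ (q : ENNReal) ^ k := by gcongr
  rw [← ENNReal.rpow_natCast, ← ENNReal.rpow_mul, one_div,
    inv_mul_cancel₀ (by exact_mod_cast hk0.ne'), ENNReal.rpow_one] at h3
  exact_mod_cast h3

theorem IsHurwitz.isUnit_one_sub {n : ℕ} {A : Matrix (Fin n) (Fin n) ℝ} (hA : IsHurwitz A) :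
    IsUnit (1 - A).det := by
  rw [isUnit_iff_ne_zero]
  intro h
  obtain ⟨v, hv, h0⟩ := Matrix.exists_mulVec_eq_zero_iff.2 h
  rw [Matrix.sub_mulVec, Matrix.one_mulVec, sub_eq_zero] at h0
  have := (isHurwitz_iff A).1 hA 1 0 v 0 (by simp [← h0]) (by simp) (Or.inl hv)
  linarith

/-- The powers of the Cayley transform of a Hurwitz matrix tend to zero. -/
theorem IsHurwitz.tendsto_cayley_pow {n : ℕ} {A : Matrix (Fin n) (Fin n) ℝ} (hA : IsHurwitz A) :
    Tendsto (fun k : ℕ => ((1 + A) * (1 - A)⁻¹) ^ k) atTop (𝓝 0) := by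
  set B := (1 + A) * (1 - A)⁻¹ with hB
  have hBA : B * (1 - A) = 1 + A := by
    rw [hB, Matrix.mul_assoc, Matrix.nonsing_inv_mul _ hA.isUnit_one_sub, Matrix.mul_one]
  have hC : ∀ z ∈ spectrum ℂ (B.map (algebraMap ℝ ℂ)), ‖z‖ < 1 := by
    intro z hz
    obtain ⟨v, hv, hzv⟩ := (mem_spectrum_iff_exists_mulVec _ _).1 hz
    set AC := A.map (algebraMap ℝ ℂ) with hAC
    have hcomm : ((1 - A)⁻¹).map (algebraMap ℝ ℂ) * (1 - AC) = 1 := by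
      have := congrArg (algebraMap ℝ ℂ).mapMatrix (Matrix.nonsing_inv_mul _ hA.isUnit_one_sub)
      rwa [map_mul, map_sub, map_one] at this
    have hcomm' : (1 - AC) * ((1 - A)⁻¹).map (algebraMap ℝ ℂ) = 1 :=
      mul_eq_one_comm.1 hcomm
    set w := ((1 - A)⁻¹).map (algebraMap ℝ ℂ) *ᵥ v with hw
    have hvw : (1 - AC) *ᵥ w = v := by rw [hw, Matrix.mulVec_mulVec, hcomm', Matrix.one_mulVec]
    have hw0 : w ≠ 0 := fun h0 => hv (by rw [← hvw, h0, Matrix.mulVec_zero])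
    have h1 : (1 + AC) *ᵥ w = z • ((1 - AC) *ᵥ w) := by
      have := congrArg (algebraMap ℝ ℂ).mapMatrix hBA
      rw [map_mul, map_sub, map_add, map_one] at this
      calc (1 + AC) *ᵥ w = (B.map (algebraMap ℝ ℂ) * (1 - AC)) *ᵥ w :=
            congrArg (· *ᵥ w) this.symm
        _ = _ := by rw [← Matrix.mulVec_mulVec, hvw, hzv]
    have h2 : (1 + z) • (AC *ᵥ w) = (z - 1) • w := by
      ext i
      have h1i := congrFun h1 i
      simp only [Matrix.add_mulVec, Matrix.sub_mulVec, Matrix.one_mulVec, Pi.add_apply,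
        Pi.smul_apply, Pi.sub_apply, smul_eq_mul] at h1i ⊢
      linear_combination h1i
    have hz1 : 1 + z ≠ 0 := by
      intro h0
      rw [h0, zero_smul] at h2
      have hz' : z = -1 := by linear_combination h0
      rw [hz'] at h2
      exact hw0 ((smul_eq_zero.1 h2.symm).resolve_left (by norm_num))
    have h3 : AC *ᵥ w = ((z - 1) / (1 + z)) • w := by
      rw [div_eq_inv_mul, mul_smul, ← h2, smul_smul, inv_mul_cancel₀ hz1, one_smul]
    have h4 := hA _ ((mem_spectrum_iff_exists_mulVec _ _).2 ⟨w, hw0, h3⟩)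
    -- If `z` is an eigenvalue of the Cayley transform, `(z - 1) / (1 + z)` is one of `A`. Its real
    -- part has the sign of `|z|² - 1`, so the left half plane corresponds to the unit disc.
    have h5 : ((z - 1) / (1 + z)).re = (Complex.normSq z - 1) / Complex.normSq (1 + z) := by
      rw [Complex.div_re, ← add_div]
      congr 1
      simp [Complex.normSq_apply]; ring
    rw [h5, div_neg_iff] at h4
    have h6 : 0 < Complex.normSq (1 + z) := Complex.normSq_pos.2 hz1
    rcases h4 with h4 | h4
    · linarith [h4.2]
    · have := h4.1
      rw [Complex.normSq_eq_norm_sq] at this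
      nlinarith [norm_nonneg z]
  have := tendsto_pow_of_spectrum_lt_one _ hC
  have hre : Continuous fun M : Matrix (Fin n) (Fin n) ℂ => M.map Complex.re :=
    continuous_id.matrix_map Complex.continuous_re
  have h2 := (hre.tendsto 0).comp this
  have h3 : (0 : Matrix (Fin n) (Fin n) ℂ).map Complex.re = 0 := by ext; simp
  rw [h3] at h2
  refine h2.congr fun k => ?_
  have h4 : (B.map (algebraMap ℝ ℂ)) ^ k = (B ^ k).map (algebraMap ℝ ℂ) :=
    (map_pow (algebraMap ℝ ℂ).mapMatrix B k).symm
  ext i j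
  rw [Function.comp_apply, h4, Matrix.map_apply, Matrix.map_apply, Complex.coe_algebraMap,
    Complex.ofReal_re]

/-- Makes the Lyapunov equation discrete: with `B` the Cayley transform, `P - Bᵀ P B` is, up to a
factor, a congruence of `-(Aᵀ P + P A)`. Iterating `B` then plays the role of the flow `exp (t A)`.
-/
theorem cayley_lyapunov {n : ℕ} {A : Matrix (Fin n) (Fin n) ℝ} (hA : IsHurwitz A)
    (P : Matrix (Fin n) (Fin n) ℝ) :
    P = ((1 + A) * (1 - A)⁻¹)ᵀ * P * ((1 + A) * (1 - A)⁻¹) -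
      (2 : ℝ) • (((1 - A)⁻¹)ᵀ * (Aᵀ * P + P * A) * (1 - A)⁻¹) := by
  have h := Matrix.mul_nonsing_inv _ hA.isUnit_one_sub
  have ht : ((1 - A)⁻¹)ᵀ * (1 - A)ᵀ = 1 := by rw [← Matrix.transpose_mul, h, Matrix.transpose_one]
  have : (1 + A)ᵀ * P * (1 + A) - (2 : ℝ) • (Aᵀ * P + P * A) = (1 - A)ᵀ * P * (1 - A) := by
    simp only [Matrix.transpose_add, Matrix.transpose_sub, Matrix.transpose_one, two_smul]
    noncomm_ring
  calc P = (((1 - A)⁻¹)ᵀ * (1 - A)ᵀ) * P * ((1 - A) * (1 - A)⁻¹) := by rw [h, ht]; simp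
    _ = ((1 - A)⁻¹)ᵀ * ((1 - A)ᵀ * P * (1 - A)) * (1 - A)⁻¹ := by simp only [Matrix.mul_assoc]
    _ = _ := by
      rw [← this, Matrix.transpose_mul]
      simp only [Matrix.mul_sub, Matrix.sub_mul, Matrix.mul_smul, Matrix.smul_mul, Matrix.mul_assoc]

theorem tendsto_conj_pow {n : ℕ} {B : Matrix (Fin n) (Fin n) ℝ}
    (hB : Tendsto (fun k : ℕ => B ^ k) atTop (𝓝 0)) (P : Matrix (Fin n) (Fin n) ℝ) :
    Tendsto (fun k : ℕ => (B ^ k)ᵀ * P * B ^ k) atTop (𝓝 0) := by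
  have hc : Continuous fun M : Matrix (Fin n) (Fin n) ℝ => Mᵀ * P * M :=
    (continuous_id.matrix_transpose.matrix_mul continuous_const).matrix_mul continuous_id
  have h := (hc.tendsto 0).comp hB
  rw [Matrix.mul_zero] at h
  exact h

/-- A solution of the homogeneous equation is fixed by `P ↦ Bᵀ P B`, whose iterates tend to zero. -/
theorem IsHurwitz.lyapunov_injective {n : ℕ} {A : Matrix (Fin n) (Fin n) ℝ} (hA : IsHurwitz A)
    {P : Matrix (Fin n) (Fin n) ℝ} (h : Aᵀ * P + P * A = 0) : P = 0 := by
  set B := (1 + A) * (1 - A)⁻¹ with hB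
  have h1 : P = Bᵀ * P * B := by
    have := cayley_lyapunov hA P
    rwa [h, Matrix.mul_zero, Matrix.zero_mul, smul_zero, sub_zero] at this
  have h2 : ∀ k : ℕ, P = (B ^ k)ᵀ * P * B ^ k := by
    intro k
    induction k with
    | zero => simp
    | succ k ih =>
      rw [pow_succ, Matrix.transpose_mul]
      calc P = Bᵀ * P * B := h1
        _ = Bᵀ * ((B ^ k)ᵀ * P * B ^ k) * B := by rw [← ih]
        _ = _ := by simp only [Matrix.mul_assoc]
  have h3 := tendsto_conj_pow hA.tendsto_cayley_pow P
  rw [← hB] at h3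
  simp only [← h2] at h3
  exact tendsto_nhds_unique tendsto_const_nhds h3

theorem isSymm_of_isHermitian {n : ℕ} {A : Matrix (Fin n) (Fin n) ℝ} (h : A.IsHermitian) : Aᵀ = A := by
  rw [← Matrix.conjTranspose_eq_transpose_of_trivial]; exact h

theorem posSemidef_iff_real {ι : Type*} [Fintype ι] {A : Matrix ι ι ℝ} :
    A.PosSemidef ↔ Aᵀ = A ∧ ∀ x, 0 ≤ x ⬝ᵥ A *ᵥ x := by
  rw [Matrix.posSemidef_iff_dotProduct_mulVec, Matrix.IsHermitian,
    Matrix.conjTranspose_eq_transpose_of_trivial]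
  simp

theorem posDef_iff_real {ι : Type*} [Fintype ι] {A : Matrix ι ι ℝ} :
    A.PosDef ↔ Aᵀ = A ∧ ∀ x, x ≠ 0 → 0 < x ⬝ᵥ A *ᵥ x := by
  rw [Matrix.posDef_iff_dotProduct_mulVec, Matrix.IsHermitian,
    Matrix.conjTranspose_eq_transpose_of_trivial]
  simp

theorem mulVec_eq_zero_of_posSemidef {n : ℕ} {A : Matrix (Fin n) (Fin n) ℝ} (hA : A.PosSemidef)
    {x : Fin n → ℝ} (h : x ⬝ᵥ A *ᵥ x = 0) : A *ᵥ x = 0 :=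
  (hA.dotProduct_mulVec_zero_iff x).1 (by simpa using h)

theorem dotProduct_transpose_mul_mul {m n : ℕ} (L : Matrix (Fin m) (Fin n) ℝ)
    (R : Matrix (Fin m) (Fin m) ℝ) (x : Fin n → ℝ) :
    x ⬝ᵥ (Lᵀ * R * L) *ᵥ x = (L *ᵥ x) ⬝ᵥ R *ᵥ (L *ᵥ x) := by
  rw [Matrix.mul_assoc, ← Matrix.mulVec_mulVec, ← Matrix.mulVec_mulVec, Matrix.dotProduct_mulVec,
    Matrix.vecMul_transpose]

theorem posSemidef_transpose_mul_mul {m n : ℕ} (L : Matrix (Fin m) (Fin n) ℝ)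
    {R : Matrix (Fin m) (Fin m) ℝ} (hR : R.PosSemidef) : (Lᵀ * R * L).PosSemidef := by
  have := hR.conjTranspose_mul_mul_same L
  rwa [Matrix.conjTranspose_eq_transpose_of_trivial] at this

/-- Symmetry is injectivity applied to `Pᵀ - P`. The quadratic form of `P` does not increase under
`x ↦ B x` and tends to zero along `B ^ k x`, so it was nonnegative at the start. -/
theorem IsHurwitz.posSemidef_of_lyapunov {n : ℕ} {A : Matrix (Fin n) (Fin n) ℝ} (hA : IsHurwitz A)
    {P W : Matrix (Fin n) (Fin n) ℝ} (hW : W.PosSemidef) (h : Aᵀ * P + P * A + W = 0) :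
    P.PosSemidef := by
  have hsym : Pᵀ = P := by
    rw [← sub_eq_zero]
    apply hA.lyapunov_injective
    have h1 := congrArg Matrix.transpose h
    simp only [Matrix.transpose_add, Matrix.transpose_mul, Matrix.transpose_transpose,
      Matrix.transpose_zero, isSymm_of_isHermitian hW.1] at h1
    calc Aᵀ * (Pᵀ - P) + (Pᵀ - P) * A
        = (Pᵀ * A + Aᵀ * Pᵀ + W) - (Aᵀ * P + P * A + W) := by noncomm_ring
      _ = 0 := by rw [h1, h, sub_zero]
  refine posSemidef_iff_real.2 ⟨hsym, fun x => ?_⟩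
  set B := (1 + A) * (1 - A)⁻¹ with hB
  set W' := ((1 - A)⁻¹)ᵀ * W * (1 - A)⁻¹ with hW'
  have hW'p : W'.PosSemidef := posSemidef_transpose_mul_mul _ hW
  have h1 : P = Bᵀ * P * B + (2 : ℝ) • W' := by
    have := cayley_lyapunov hA P
    rw [eq_neg_of_add_eq_zero_left h, ← hB, Matrix.mul_neg, Matrix.neg_mul, smul_neg,
      sub_neg_eq_add] at this
    exact this
  have hmono : ∀ y, (B *ᵥ y) ⬝ᵥ P *ᵥ (B *ᵥ y) ≤ y ⬝ᵥ P *ᵥ y := by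
    intro y
    have h2 := (posSemidef_iff_real.1 hW'p).2 y
    conv_rhs => rw [h1]
    rw [Matrix.add_mulVec, dotProduct_add, dotProduct_transpose_mul_mul, Matrix.smul_mulVec,
      dotProduct_smul, smul_eq_mul]
    linarith
  have hk : ∀ k : ℕ, x ⬝ᵥ ((B ^ k)ᵀ * P * B ^ k) *ᵥ x ≤ x ⬝ᵥ P *ᵥ x := by
    intro k
    rw [dotProduct_transpose_mul_mul]
    induction k with
    | zero => simp
    | succ k ih =>
      refine le_trans ?_ ih
      rw [pow_succ', ← Matrix.mulVec_mulVec]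
      exact hmono _
  have h3 := tendsto_conj_pow hA.tendsto_cayley_pow P
  have hc : Continuous fun M : Matrix (Fin n) (Fin n) ℝ => x ⬝ᵥ M *ᵥ x := by fun_prop
  have h4 := (hc.tendsto 0).comp h3
  simp only [Matrix.zero_mulVec, dotProduct_zero] at h4
  exact le_of_tendsto h4 (Eventually.of_forall hk)

theorem IsHurwitz.exists_lyapunov {n : ℕ} {A : Matrix (Fin n) (Fin n) ℝ} (hA : IsHurwitz A)
    (W : Matrix (Fin n) (Fin n) ℝ) : ∃ P, Aᵀ * P + P * A + W = 0 := by
  let L : Matrix (Fin n) (Fin n) ℝ →ₗ[ℝ] Matrix (Fin n) (Fin n) ℝ :=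
    LinearMap.mulLeft ℝ Aᵀ + LinearMap.mulRight ℝ A
  have hL : ∀ P, L P = Aᵀ * P + P * A := fun P => rfl
  have hinj : Function.Injective L := by
    rw [← LinearMap.ker_eq_bot, LinearMap.ker_eq_bot']
    exact fun P hP => hA.lyapunov_injective (by rw [← hL, hP])
  obtain ⟨P, hP⟩ := LinearMap.injective_iff_surjective.1 hinj (-W)
  exact ⟨P, by rw [← hL, hP, neg_add_cancel]⟩

/-- For definiteness: if the semidefinite form vanishes at `x` then `P x = 0`, and testing the
Lyapunov equation on `x` leaves `xᵀ x = 0`. -/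
theorem IsHurwitz.exists_isLyapunov {n : ℕ} {A : Matrix (Fin n) (Fin n) ℝ} (hA : IsHurwitz A) :
    ∃ P, IsLyapunov A P := by
  obtain ⟨P, hP⟩ := hA.exists_lyapunov 1
  have hps := hA.posSemidef_of_lyapunov Matrix.PosSemidef.one hP
  refine ⟨P, posDef_iff_real.2 ⟨(posSemidef_iff_real.1 hps).1, fun x hx => ?_⟩, hP⟩
  refine lt_of_le_of_ne ((posSemidef_iff_real.1 hps).2 x) fun h0 => ?_
  have h1 := mulVec_eq_zero_of_posSemidef hps h0.symm
  have h2 : x ᵥ* P = 0 := by rw [← Matrix.mulVec_transpose, (posSemidef_iff_real.1 hps).1, h1]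
  have h3 := congrArg (fun M => x ⬝ᵥ M *ᵥ x) hP
  simp only [Matrix.add_mulVec, dotProduct_add, Matrix.one_mulVec, Matrix.zero_mulVec,
    dotProduct_zero, ← Matrix.mulVec_mulVec, h1, Matrix.mulVec_zero, zero_add] at h3
  rw [Matrix.dotProduct_mulVec, h2, zero_dotProduct, zero_add] at h3
  exact hx (dotProduct_self_eq_zero.1 h3)

/-- A quadratic Lyapunov function excludes eigenvalues with nonnegative real part. -/
theorem lyapunov_eigen {n : ℕ} {A P W : Matrix (Fin n) (Fin n) ℝ} (hP : Pᵀ = P)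
    (h : Aᵀ * P + P * A + W = 0) {a b : ℝ} {x y : Fin n → ℝ} (hx : A *ᵥ x = a • x - b • y)
    (hy : A *ᵥ y = b • x + a • y) :
    2 * a * (x ⬝ᵥ P *ᵥ x + y ⬝ᵥ P *ᵥ y) + (x ⬝ᵥ W *ᵥ x + y ⬝ᵥ W *ᵥ y) = 0 := by
  have hs : ∀ u v : Fin n → ℝ, u ⬝ᵥ P *ᵥ v = v ⬝ᵥ P *ᵥ u := by
    intro u v
    rw [Matrix.dotProduct_mulVec, ← Matrix.mulVec_transpose, hP, dotProduct_comm]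
  have key : ∀ u : Fin n → ℝ, u ⬝ᵥ (Aᵀ * P + P * A + W) *ᵥ u =
      2 * (u ⬝ᵥ P *ᵥ (A *ᵥ u)) + u ⬝ᵥ W *ᵥ u := by
    intro u
    rw [Matrix.add_mulVec, Matrix.add_mulVec, dotProduct_add, dotProduct_add,
      ← Matrix.mulVec_mulVec, ← Matrix.mulVec_mulVec, Matrix.dotProduct_mulVec u Aᵀ,
      Matrix.vecMul_transpose, hs (A *ᵥ u) u]
    ring
  have h1 := key x
  have h2 := key y
  rw [h, Matrix.zero_mulVec, dotProduct_zero] at h1 h2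
  rw [hx] at h1
  rw [hy] at h2
  simp only [Matrix.mulVec_add, Matrix.mulVec_sub, Matrix.mulVec_smul, dotProduct_add,
    dotProduct_sub, dotProduct_smul, smul_eq_mul] at h1 h2
  rw [hs y x] at h2
  linear_combination -h1 - h2

/-- The characteristic polynomial at `z` is a product of differences `z - a` over the eigenvalues,
each of norm at least `Re z`. Unlike the Hurwitz property this inequality is closed, so it passes to
limits of matrices and stands in for the continuity of eigenvalues. -/
theorem norm_det_sub_ge_of_isHurwitz {n : ℕ} {A : Matrix (Fin n) (Fin n) ℝ} (hA : IsHurwitz A)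
    {z : ℂ} (hz : 0 < z.re) :
    z.re ^ n ≤ ‖(algebraMap ℂ (Matrix (Fin n) (Fin n) ℂ) z - A.map (algebraMap ℝ ℂ)).det‖ := by
  set AC := A.map (algebraMap ℝ ℂ)
  have h1 : (algebraMap ℂ (Matrix (Fin n) (Fin n) ℂ) z - AC).det = AC.charpoly.eval z := by
    rw [Matrix.eval_charpoly]; rfl
  have hs := IsAlgClosed.splits AC.charpoly
  have hc : Multiset.card AC.charpoly.roots = n := by
    rw [← hs.natDegree_eq_card_roots, Matrix.charpoly_natDegree_eq_dim, Fintype.card_fin]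
  rw [h1, hs.eval_eq_prod_roots_of_monic AC.charpoly_monic]
  have : ∀ s : Multiset ℂ, (∀ w ∈ s, w.re < 0) →
      z.re ^ Multiset.card s ≤ ‖(s.map (fun a => z - a)).prod‖ := by
    intro s
    induction s using Multiset.induction_on with
    | empty => intro _; simp
    | cons a s ih =>
      intro hs
      rw [Multiset.card_cons, pow_succ', Multiset.map_cons, Multiset.prod_cons, norm_mul]
      have h2 := ih fun w hw => hs w (Multiset.mem_cons_of_mem hw)
      have h3 : z.re ≤ ‖z - a‖ := by
        refine le_trans ?_ (Complex.re_le_norm _)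
        have := hs a (Multiset.mem_cons_self a s)
        rw [Complex.sub_re]; linarith
      exact mul_le_mul h3 h2 (by positivity) (norm_nonneg _)
  have h2 := this AC.charpoly.roots fun w hw => hA w (by
    rw [Matrix.mem_spectrum_iff_isRoot_charpoly]
    exact Polynomial.isRoot_of_mem_roots hw)
  rwa [hc] at h2

theorem re_nonpos_of_tendsto_isHurwitz {n : ℕ} {A : ℕ → Matrix (Fin n) (Fin n) ℝ}
    {A' : Matrix (Fin n) (Fin n) ℝ} (hA : ∀ k, IsHurwitz (A k)) (h : Tendsto A atTop (𝓝 A')) :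
    ∀ z ∈ spectrum ℂ (A'.map (algebraMap ℝ ℂ)), z.re ≤ 0 := by
  intro z hz
  by_contra! hre
  have hc : Continuous fun M : Matrix (Fin n) (Fin n) ℝ =>
      ‖(algebraMap ℂ (Matrix (Fin n) (Fin n) ℂ) z - M.map (algebraMap ℝ ℂ)).det‖ :=
    (Continuous.matrix_det (continuous_const.sub
      (continuous_id.matrix_map Complex.continuous_ofReal))).norm
  have h1 := ge_of_tendsto ((hc.tendsto A').comp h)
    (Eventually.of_forall fun k => norm_det_sub_ge_of_isHurwitz (hA k) hre)
  rw [spectrum.mem_iff, Matrix.isUnit_iff_isUnit_det, isUnit_iff_ne_zero, not_not] at hz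
  rw [hz, norm_zero] at h1
  exact absurd h1 (not_le.2 (pow_pos hre n))

theorem isHurwitz_conj {n : ℕ} {A T : Matrix (Fin n) (Fin n) ℝ} (hT : IsUnit T.det)
    (hA : IsHurwitz A) : IsHurwitz (T * A * T⁻¹) := by
  rw [isHurwitz_iff] at hA ⊢
  intro a b x y hx hy hne
  have hTi := Matrix.nonsing_inv_mul _ hT
  have key : ∀ u v, (T * A * T⁻¹) *ᵥ u = v → A *ᵥ (T⁻¹ *ᵥ u) = T⁻¹ *ᵥ v := by
    rintro u v rfl
    rw [Matrix.mulVec_mulVec, Matrix.mulVec_mulVec, ← Matrix.mul_assoc, ← Matrix.mul_assoc, hTi,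
      Matrix.one_mul]
  refine hA a b (T⁻¹ *ᵥ x) (T⁻¹ *ᵥ y) ?_ ?_ ?_
  · rw [key _ _ hx, Matrix.mulVec_sub, Matrix.mulVec_smul, Matrix.mulVec_smul]
  · rw [key _ _ hy, Matrix.mulVec_add, Matrix.mulVec_smul, Matrix.mulVec_smul]
  · have hz : ∀ u, T⁻¹ *ᵥ u = 0 → u = 0 := fun u hu => by
      rw [← Matrix.one_mulVec u, ← Matrix.mul_nonsing_inv _ hT, ← Matrix.mulVec_mulVec, hu,
        Matrix.mulVec_zero]
    exact hne.imp (fun h h0 => h (hz _ h0)) (fun h h0 => h (hz _ h0))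

end NLR

namespace NLR
open Matrix

/-! ### The algebraic Riccati equation -/

section Riccati

variable {n m : ℕ} {F Q : Matrix (Fin n) (Fin n) ℝ} {G : Matrix (Fin n) (Fin m) ℝ}
  {R : Matrix (Fin m) (Fin m) ℝ}

/-- The policy improvement identity of Kleinman's iteration. -/
theorem kleinman_identity {P : Matrix (Fin n) (Fin n) ℝ} {L L' : Matrix (Fin m) (Fin n) ℝ}
    (hR : Rᵀ = R) (hP : Pᵀ = P) (hL' : R * L' = -(Gᵀ * P))
    (h : (F + G * L)ᵀ * P + P * (F + G * L) + (Q + Lᵀ * R * L) = 0) :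
    (F + G * L')ᵀ * P + P * (F + G * L') + (Q + L'ᵀ * R * L') + (L - L')ᵀ * R * (L - L') = 0 := by
  have h1 : Gᵀ * P = -(R * L') := by rw [hL', neg_neg]
  have h2 : P * G = -(L'ᵀ * R) := by
    have := congrArg Matrix.transpose h1
    simpa [Matrix.transpose_mul, hR, hP] using this
  have e1 : ∀ K : Matrix (Fin m) (Fin n) ℝ, (F + G * K)ᵀ * P + P * (F + G * K) =
      Fᵀ * P + P * F - Kᵀ * R * L' - L'ᵀ * R * K := by
    intro K
    rw [Matrix.transpose_add, Matrix.transpose_mul, Matrix.add_mul, Matrix.mul_add,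
      Matrix.mul_assoc Kᵀ, h1, ← Matrix.mul_assoc P, h2]
    simp only [Matrix.mul_neg, Matrix.neg_mul, Matrix.mul_assoc]
    abel
  rw [e1] at h ⊢
  calc _ = Fᵀ * P + P * F - Lᵀ * R * L' - L'ᵀ * R * L + (Q + Lᵀ * R * L) := by
        rw [Matrix.transpose_sub]
        simp only [Matrix.sub_mul, Matrix.mul_sub]
        abel
    _ = 0 := h

/-- An eigenvector of the new closed loop with `Re ≥ 0` would make each nonnegative term of the
policy improvement identity vanish, so `L` and `L'` agree on it. It would then be an eigenvector of
the old closed loop for the same eigenvalue, which is Hurwitz. -/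
theorem kleinman_hurwitz (hQ : Q.PosSemidef) (hR : R.PosDef)
    {P : Matrix (Fin n) (Fin n) ℝ} {L L' : Matrix (Fin m) (Fin n) ℝ}
    (hA : IsHurwitz (F + G * L)) (hP : P.PosSemidef) (hL' : R * L' = -(Gᵀ * P))
    (h : (F + G * L)ᵀ * P + P * (F + G * L) + (Q + Lᵀ * R * L) = 0) :
    IsHurwitz (F + G * L') := by
  have hk := kleinman_identity (posDef_iff_real.1 hR).1 (posSemidef_iff_real.1 hP).1 hL' h
  rw [isHurwitz_iff] at hA ⊢
  intro a b x y hx hy hne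
  by_contra! ha
  rw [add_assoc (_ + _)] at hk
  have h1 := lyapunov_eigen (posSemidef_iff_real.1 hP).1 hk hx hy
  have hps := fun u => (posSemidef_iff_real.1 hP).2 u
  have hqs := fun u => (posSemidef_iff_real.1 hQ).2 u
  have hrs := fun (K : Matrix (Fin m) (Fin n) ℝ) u =>
    (posSemidef_iff_real.1 (posSemidef_transpose_mul_mul K hR.posSemidef)).2 u
  simp only [Matrix.add_mulVec, dotProduct_add] at h1
  have hz : ∀ u, (L - L')ᵀ * R * (L - L') = (L - L')ᵀ * R * (L - L') → 
      u ⬝ᵥ ((L - L')ᵀ * R * (L - L')) *ᵥ u = 0 → L *ᵥ u = L' *ᵥ u := by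
    intro u _ hu
    rw [dotProduct_transpose_mul_mul] at hu
    by_contra hne'
    have : (L - L') *ᵥ u ≠ 0 := by rwa [Matrix.sub_mulVec, sub_ne_zero]
    exact ((posDef_iff_real.1 hR).2 _ this).ne' hu
  have h2 := mul_nonneg (mul_nonneg two_pos.le ha) (add_nonneg (hps x) (hps y))
  have hx' := hz x rfl (by
    linarith [hqs x, hqs y, hrs L' x, hrs L' y, hrs (L - L') x, hrs (L - L') y])
  have hy' := hz y rfl (by
    linarith [hqs x, hqs y, hrs L' x, hrs L' y, hrs (L - L') x, hrs (L - L') y])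
  have e : ∀ u, L *ᵥ u = L' *ᵥ u → (F + G * L) *ᵥ u = (F + G * L') *ᵥ u := by
    intro u hu
    rw [Matrix.add_mulVec, Matrix.add_mulVec, ← Matrix.mulVec_mulVec, hu, Matrix.mulVec_mulVec]
  exact absurd (hA a b x y (by rw [e x hx', hx]) (by rw [e y hy', hy]) hne) (not_lt.2 ha)

/-- A step of Kleinman's iteration. -/
theorem exists_kleinman_step (hQ : Q.PosSemidef) (hR : R.PosDef)
    {L : Matrix (Fin m) (Fin n) ℝ} (hA : IsHurwitz (F + G * L)) :
    ∃ P : Matrix (Fin n) (Fin n) ℝ, P.PosSemidef ∧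
      (F + G * L)ᵀ * P + P * (F + G * L) + (Q + Lᵀ * R * L) = 0 := by
  obtain ⟨P, hP⟩ := hA.exists_lyapunov (Q + Lᵀ * R * L)
  exact ⟨P, hA.posSemidef_of_lyapunov
    (hQ.add (posSemidef_transpose_mul_mul L hR.posSemidef)) hP, hP⟩

/-- The quadratic forms decrease and are bounded below by zero, hence converge at each point;
polarization recovers the entries. -/
theorem exists_tendsto_of_antitone_posSemidef {P : ℕ → Matrix (Fin n) (Fin n) ℝ}
    (hP : ∀ k, (P k).PosSemidef) (hd : ∀ k, (P k - P (k + 1)).PosSemidef) :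
    ∃ P', Tendsto P atTop (𝓝 P') ∧ P'.PosSemidef := by
  have hq : ∀ x : Fin n → ℝ, ∃ l, Tendsto (fun k => x ⬝ᵥ P k *ᵥ x) atTop (𝓝 l) := by
    intro x
    refine ⟨_, tendsto_atTop_ciInf (antitone_nat_of_succ_le fun k => ?_) ⟨0, ?_⟩⟩
    · have := (posSemidef_iff_real.1 (hd k)).2 x
      rw [Matrix.sub_mulVec, dotProduct_sub] at this
      linarith
    · rintro _ ⟨k, rfl⟩
      exact (posSemidef_iff_real.1 (hP k)).2 x
  choose l hl using hq
  have hpol : ∀ k i j, P k i j = ((Pi.single i 1 + Pi.single j 1) ⬝ᵥ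
      P k *ᵥ (Pi.single i 1 + Pi.single j 1) - Pi.single i 1 ⬝ᵥ P k *ᵥ Pi.single i 1
      - Pi.single j 1 ⬝ᵥ P k *ᵥ Pi.single j 1) / 2 := by
    intro k i j
    have hs : P k j i = P k i j := by
      conv_lhs => rw [← (posSemidef_iff_real.1 (hP k)).1]
      rfl
    simp only [Matrix.mulVec_add, Matrix.mulVec_single_one, dotProduct_add, add_dotProduct,
      single_one_dotProduct, Matrix.col_apply]
    rw [hs]; ring
  have ht : Tendsto P atTop (𝓝 (Matrix.of fun i j => (l (Pi.single i 1 + Pi.single j 1)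
      - l (Pi.single i 1) - l (Pi.single j 1)) / 2)) := by
    refine tendsto_pi_nhds.2 fun i => tendsto_pi_nhds.2 fun j => ?_
    simp only [hpol _ i j, Matrix.of_apply]
    exact (((hl _).sub (hl _)).sub (hl _)).div_const 2
  refine ⟨_, ht, posSemidef_iff_real.2 ⟨?_, fun x => ?_⟩⟩
  · have hc : Continuous fun M : Matrix (Fin n) (Fin n) ℝ => Mᵀ := continuous_id.matrix_transpose
    refine tendsto_nhds_unique ((hc.tendsto _).comp ht) (ht.congr fun k => ?_)
    exact (posSemidef_iff_real.1 (hP k)).1.symm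
  · have hc : Continuous fun M : Matrix (Fin n) (Fin n) ℝ => x ⬝ᵥ M *ᵥ x := by fun_prop
    exact ge_of_tendsto ((hc.tendsto _).comp ht)
      (Eventually.of_forall fun k => (posSemidef_iff_real.1 (hP k)).2 x)

/-- Existence of the stabilizing solution of the algebraic Riccati equation. -/
theorem exists_stabilizing_riccati (hQ : Q.PosSemidef) (hR : R.PosDef)
    (hst : ∃ L : Matrix (Fin m) (Fin n) ℝ, IsHurwitz (F + G * L))
    (him : ∀ (w : ℝ) (z : Fin n → ℂ), F.map (algebraMap ℝ ℂ) *ᵥ z = ((w : ℂ) * Complex.I) • z →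
      Q.map (algebraMap ℝ ℂ) *ᵥ z = 0 → z = 0) :
    ∃ P : Matrix (Fin n) (Fin n) ℝ, P.PosSemidef ∧
      Fᵀ * P + P * F + Q - P * G * R⁻¹ * Gᵀ * P = 0 ∧
      IsHurwitz (F - G * R⁻¹ * Gᵀ * P) := by
  have hRu : IsUnit R.det := isUnit_iff_ne_zero.2 hR.det_pos.ne'
  have hRs := (posDef_iff_real.1 hR).1
  -- Kleinman's iteration runs on the type of stabilizing gains, so that each iterate carries the
  -- solvability of its own Lyapunov equation.
  let X := {L : Matrix (Fin m) (Fin n) ℝ // IsHurwitz (F + G * L)}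
  choose p hp0 hp using fun L : X => exists_kleinman_step (Q := Q) hQ hR L.2
  have hL' : ∀ L : X, R * (-(R⁻¹ * Gᵀ * p L)) = -(Gᵀ * p L) := fun L => by
    rw [Matrix.mul_neg, ← Matrix.mul_assoc, ← Matrix.mul_assoc, Matrix.mul_nonsing_inv _ hRu,
      Matrix.one_mul]
  let step : X → X := fun L => ⟨-(R⁻¹ * Gᵀ * p L),
    kleinman_hurwitz hQ hR L.2 (hp0 L) (hL' L) (hp L)⟩
  obtain ⟨L0, hL0⟩ := hst
  let Ls : ℕ → X := fun k => step^[k] ⟨L0, hL0⟩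
  have hLs : ∀ k, (Ls (k + 1)).1 = -(R⁻¹ * Gᵀ * p (Ls k)) := fun k => by
    show (step^[k + 1] _).1 = _
    rw [Function.iterate_succ_apply']
  -- The difference of consecutive iterates solves the Lyapunov equation of the new closed loop with
  -- the semidefinite inhomogeneity `(L - L')ᵀ R (L - L')`.
  have hdec : ∀ k, (p (Ls k) - p (Ls (k + 1))).PosSemidef := by
    intro k
    have h1 := kleinman_identity hRs (posSemidef_iff_real.1 (hp0 (Ls k))).1 (hL' (Ls k)) (hp (Ls k))
    rw [← hLs] at h1
    refine (Ls (k + 1)).2.posSemidef_of_lyapunov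
      (posSemidef_transpose_mul_mul ((Ls k).1 - (Ls (k + 1)).1) hR.posSemidef) ?_
    have h2 := hp (Ls (k + 1))
    rw [← sub_eq_zero.2 (h1.trans h2.symm)]
    simp only [Matrix.mul_sub, Matrix.sub_mul]
    abel
  obtain ⟨P, hP, hP0⟩ := exists_tendsto_of_antitone_posSemidef (fun k => hp0 (Ls k)) hdec
  have hRi : (R⁻¹)ᵀ = R⁻¹ := by rw [Matrix.transpose_nonsing_inv, hRs]
  have hPs := (posSemidef_iff_real.1 hP0).1
  have hA : Tendsto (fun k => F + G * (Ls (k + 1)).1) atTop (𝓝 (F - G * R⁻¹ * Gᵀ * P)) := by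
    have hc : Continuous fun M : Matrix (Fin n) (Fin n) ℝ => F + G * (-(R⁻¹ * Gᵀ * M)) := by fun_prop
    have := (hc.tendsto P).comp hP
    have e : F + G * (-(R⁻¹ * Gᵀ * P)) = F - G * R⁻¹ * Gᵀ * P := by
      simp only [Matrix.mul_neg, Matrix.mul_assoc, sub_eq_add_neg]
    rw [e] at this
    exact this.congr fun k => by simp only [Function.comp_apply, hLs]
  have hare : Fᵀ * P + P * F + Q - P * G * R⁻¹ * Gᵀ * P = 0 := by
    have hP' : Tendsto (fun k => p (Ls (k + 1))) atTop (𝓝 P) := hP.comp (tendsto_add_atTop_nat 1)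
    have hc : Continuous fun M : Matrix (Fin n) (Fin n) ℝ × Matrix (Fin n) (Fin n) ℝ =>
        (F + G * (-(R⁻¹ * Gᵀ * M.1)))ᵀ * M.2 + M.2 * (F + G * (-(R⁻¹ * Gᵀ * M.1))) +
        (Q + (-(R⁻¹ * Gᵀ * M.1))ᵀ * R * (-(R⁻¹ * Gᵀ * M.1))) := by fun_prop
    have h1 := (hc.tendsto (P, P)).comp (hP.prodMk_nhds hP')
    have h0 : Tendsto (fun _ : ℕ => (0 : Matrix (Fin n) (Fin n) ℝ)) atTop (𝓝 0) :=
      tendsto_const_nhds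
    have h2 := tendsto_nhds_unique h1 (h0.congr fun k => by
      have := hp (Ls (k + 1))
      rw [hLs] at this
      exact this.symm)
    rw [← h2]
    have e : (R⁻¹ * Gᵀ * P)ᵀ = P * G * R⁻¹ := by
      simp [Matrix.transpose_mul, hRi, hPs, Matrix.mul_assoc]
    have e2 : P * G * R⁻¹ * R * (R⁻¹ * Gᵀ * P) = P * G * R⁻¹ * Gᵀ * P := by
      rw [Matrix.mul_assoc (P * G), Matrix.nonsing_inv_mul _ hRu]
      simp only [Matrix.mul_one, Matrix.mul_assoc]
    simp only [Matrix.transpose_add, Matrix.transpose_mul G, Matrix.transpose_neg, e,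
      Matrix.neg_mul, Matrix.mul_neg, neg_neg, e2, Matrix.add_mul, Matrix.mul_add]
    simp only [Matrix.mul_assoc]
    abel
  refine ⟨P, hP0, hare, ?_⟩
  -- The limit inherits only `Re z ≤ 0`. For `Re z = 0`, the Lyapunov form of the Riccati equation
  -- shows that `Q` and `Gᵀ P` annihilate the eigenvector, which is then an eigenvector of `F`
  -- itself; `him` excludes this.
  have hre := re_nonpos_of_tendsto_isHurwitz (fun k => (Ls (k + 1)).2) hA
  set Fc := F - G * R⁻¹ * Gᵀ * P with hFc
  intro z hz
  refine lt_of_le_of_ne (hre z hz) fun hz0 => ?_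
  obtain ⟨v, hv, hzv⟩ := (mem_spectrum_iff_exists_mulVec _ _).1 hz
  obtain ⟨hx, hy⟩ := (complex_mulVec_eq_smul_iff Fc _ _).1 hzv
  have hlyap : Fcᵀ * P + P * Fc + (Q + (Gᵀ * P)ᵀ * R⁻¹ * (Gᵀ * P)) = 0 := by
    rw [← hare, hFc]
    simp only [Matrix.transpose_sub, Matrix.transpose_mul, Matrix.transpose_transpose, hRi, hPs,
      Matrix.sub_mul, Matrix.mul_sub, Matrix.mul_assoc]
    abel
  have h1 := lyapunov_eigen hPs hlyap hx hy
  simp only [hz0, mul_zero, zero_mul, zero_add, Matrix.add_mulVec, dotProduct_add] at h1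
  have hRip : (R⁻¹).PosDef := hR.inv
  have hq := fun u => (posSemidef_iff_real.1 hQ).2 u
  have hr := fun u => (posSemidef_iff_real.1
    (posSemidef_transpose_mul_mul (Gᵀ * P) hRip.posSemidef)).2 u
  have key : ∀ u, u ⬝ᵥ Q *ᵥ u = 0 → u ⬝ᵥ ((Gᵀ * P)ᵀ * R⁻¹ * (Gᵀ * P)) *ᵥ u = 0 →
      Q *ᵥ u = 0 ∧ Fc *ᵥ u = F *ᵥ u := by
    intro u hu1 hu2
    refine ⟨mulVec_eq_zero_of_posSemidef hQ hu1, ?_⟩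
    rw [dotProduct_transpose_mul_mul] at hu2
    have h3 : (Gᵀ * P) *ᵥ u = 0 := by
      by_contra hne
      exact ((posDef_iff_real.1 hRip).2 _ hne).ne' hu2
    rw [hFc, Matrix.sub_mulVec, Matrix.mul_assoc (G * R⁻¹), ← Matrix.mulVec_mulVec, h3,
      Matrix.mulVec_zero, sub_zero]
  set x : Fin n → ℝ := fun i => (v i).re
  set y : Fin n → ℝ := fun i => (v i).im
  obtain ⟨hqx, hfx⟩ := key x (by linarith [hq x, hq y, hr x, hr y])
    (by linarith [hq x, hq y, hr x, hr y])
  obtain ⟨hqy, hfy⟩ := key y (by linarith [hq x, hq y, hr x, hr y])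
    (by linarith [hq x, hq y, hr x, hr y])
  refine hv (him z.im v ?_ ?_)
  · rw [complex_mulVec_eq_smul_iff]
    have e1 : ((z.im : ℂ) * Complex.I).re = z.re := by simp [hz0]
    have e2 : ((z.im : ℂ) * Complex.I).im = z.im := by simp
    rw [e1, e2]
    exact ⟨hfx ▸ hx, hfy ▸ hy⟩
  · have := (complex_mulVec_eq_smul_iff Q v 0).2 ⟨by simpa using hqx, by simpa using hqy⟩
    simpa using this

/-- Uniqueness of the stabilizing solution. -/
theorem stabilizing_riccati_le (hR : R.PosDef) {P P' : Matrix (Fin n) (Fin n) ℝ} (hP : Pᵀ = P)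
    (hP' : P'ᵀ = P')
    (h : Fᵀ * P + P * F + Q - P * G * R⁻¹ * Gᵀ * P = 0)
    (h' : Fᵀ * P' + P' * F + Q - P' * G * R⁻¹ * Gᵀ * P' = 0)
    (hs : IsHurwitz (F - G * R⁻¹ * Gᵀ * P)) : (P - P').PosSemidef := by
  have hRi : (R⁻¹)ᵀ = R⁻¹ := by rw [Matrix.transpose_nonsing_inv, (posDef_iff_real.1 hR).1]
  refine hs.posSemidef_of_lyapunov
    (posSemidef_transpose_mul_mul (Gᵀ * (P - P')) hR.inv.posSemidef) ?_
  have h2 := sub_eq_zero.2 (h.trans h'.symm)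
  rw [← h2]
  simp only [Matrix.transpose_sub, Matrix.transpose_mul, Matrix.transpose_transpose, hRi, hP, hP',
    Matrix.sub_mul, Matrix.mul_sub, Matrix.mul_assoc]
  abel

end Riccati

namespace Problem

variable {n m : ℕ} {p : Problem n m}

theorem Assumptions.existsUnique_isStabilizingARE (hp : p.Assumptions) :
    ∃! P₁, p.IsStabilizingARE P₁ := by
  obtain ⟨P, h1, h2, h3⟩ := exists_stabilizing_riccati hp.Q1_nonneg hp.R1_pos hp.stabilizable
    hp.no_imaginary_mode
  refine ⟨P, ⟨h1, h2, h3⟩, fun P' hP' => ?_⟩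
  -- Each of two stabilizing solutions dominates the other, so their quadratic forms coincide.
  have a := stabilizing_riccati_le hp.R1_pos (posSemidef_iff_real.1 h1).1
    (posSemidef_iff_real.1 hP'.posSemidef).1 h2 hP'.are h3
  have b := stabilizing_riccati_le hp.R1_pos (posSemidef_iff_real.1 hP'.posSemidef).1
    (posSemidef_iff_real.1 h1).1 hP'.are h2 hP'.hurwitz
  have hz : ∀ x : Fin n → ℝ, x ⬝ᵥ (P' - P) *ᵥ x = 0 := fun x => by
    have ha := (posSemidef_iff_real.1 a).2 x
    have hb := (posSemidef_iff_real.1 b).2 x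
    rw [Matrix.sub_mulVec, dotProduct_sub] at ha hb ⊢
    linarith
  rw [← sub_eq_zero]
  ext i j
  have := congrFun (mulVec_eq_zero_of_posSemidef b (hz (Pi.single j 1))) i
  simpa using this

theorem Assumptions.isStabilizingARE_areSol (hp : p.Assumptions) :
    p.IsStabilizingARE p.areSol :=
  Classical.epsilon_spec hp.existsUnique_isStabilizingARE.exists

theorem Assumptions.areSol_eq (hp : p.Assumptions) {P : Matrix (Fin n) (Fin n) ℝ}
    (h : p.IsStabilizingARE P) : p.areSol = P :=
  hp.existsUnique_isStabilizingARE.unique hp.isStabilizingARE_areSol h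

theorem Assumptions.isHurwitz_Fc (hp : p.Assumptions) : IsHurwitz p.Fc :=
  hp.isStabilizingARE_areSol.hurwitz

end Problem

open scoped MatrixOrder in
theorem exists_posDef_mul_self_eq {n : ℕ} {P : Matrix (Fin n) (Fin n) ℝ} (hP : P.PosDef) :
    ∃ T : Matrix (Fin n) (Fin n) ℝ, T.PosDef ∧ T * T = P := by
  have h1 : CFC.sqrt P * CFC.sqrt P = P := CFC.sqrt_mul_sqrt_self P hP.posSemidef.nonneg
  refine ⟨CFC.sqrt P, (CFC.sqrt_nonneg P).posSemidef.posDef_iff_det_ne_zero.2 fun h => ?_, h1⟩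
  have h2 := hP.det_pos
  rw [← h1, Matrix.det_mul, h, mul_zero] at h2
  exact lt_irrefl _ h2

/-- The square root of the Lyapunov matrix. -/
theorem IsHurwitz.lyapunovSqrt_spec {n : ℕ} {A : Matrix (Fin n) (Fin n) ℝ} (hA : IsHurwitz A) :
    (lyapunovSqrt A).PosDef ∧ IsLyapunov A (lyapunovSqrt A * lyapunovSqrt A) := by
  have h1 : IsLyapunov A (Classical.epsilon (IsLyapunov A)) :=
    Classical.epsilon_spec hA.exists_isLyapunov
  have h2 : ∃ T : Matrix (Fin n) (Fin n) ℝ, T.PosDef ∧ T * T = Classical.epsilon (IsLyapunov A) :=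
    exists_posDef_mul_self_eq h1.1
  have h3 := Classical.epsilon_spec h2
  exact ⟨h3.1, by rw [lyapunovSqrt, h3.2]; exact h1⟩

end NLR

namespace NLR
open Matrix

/-! ### Multinomial coefficients -/

section Multinomial

variable {d k : ℕ}

theorem mcoef_pos (s : Sym (Fin d) k) : 0 < mcoef s :=
  Real.sqrt_pos.2 (div_pos (by positivity) (Finset.prod_pos fun i _ => by positivity))

theorem mcoef_ne_zero (s : Sym (Fin d) k) : mcoef s ≠ 0 := (mcoef_pos s).ne'

theorem mcoef_sq (s : Sym (Fin d) k) :
    mcoef s ^ 2 = (k.factorial : ℝ) / ∏ i : Fin d, ((s.1.count i).factorial : ℝ) :=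
  Real.sq_sqrt (div_nonneg (by positivity) (Finset.prod_nonneg fun i _ => by positivity))

/-- `mcoef c ^ 2` counts the orderings of `c`. The fraction `count i / (k + 1)` of them begins with
`i`, and removing that letter leaves the orderings of `b`. -/
theorem mcoef_sq_eq_of_cons {b : Sym (Fin d) k} {c : Sym (Fin d) (k + 1)} {i : Fin d}
    (h : c.1 = i ::ₘ b.1) : mcoef b ^ 2 = (c.1.count i : ℝ) / (k + 1) * mcoef c ^ 2 := by
  rw [mcoef_sq, mcoef_sq]
  have h1 : ∏ j : Fin d, ((c.1.count j).factorial : ℝ) =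
      (c.1.count i : ℝ) * ∏ j : Fin d, ((b.1.count j).factorial : ℝ) := by
    rw [← Finset.mul_prod_erase _ _ (Finset.mem_univ i),
      ← Finset.mul_prod_erase (s := Finset.univ) (fun j => ((b.1.count j).factorial : ℝ))
        (Finset.mem_univ i), ← mul_assoc]
    congr 1
    · rw [h, Multiset.count_cons_self, Nat.factorial_succ, Nat.cast_mul]
    · refine Finset.prod_congr rfl fun j hj => ?_
      rw [h, Multiset.count_cons_of_ne (Finset.ne_of_mem_erase hj)]
  have h2 : (c.1.count i : ℝ) ≠ 0 := by rw [h, Multiset.count_cons_self]; positivity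
  have h3 : ∏ j : Fin d, ((b.1.count j).factorial : ℝ) ≠ 0 :=
    Finset.prod_ne_zero_iff.2 fun j _ => by positivity
  rw [h1, Nat.factorial_succ, Nat.cast_mul]
  push_cast
  field_simp

/-- Pascal's rule for multinomial coefficients: the multiplicities in `c` add up to `k + 1`.
Equivalently, the rows of `K_k` are unit vectors. -/
theorem sum_ite_cons_mcoef_sq (c : Sym (Fin d) (k + 1)) :
    ∑ b : Sym (Fin d) k × Fin d, (if c.1 = b.2 ::ₘ b.1.1 then mcoef b.1 ^ 2 else 0) =
      mcoef c ^ 2 := by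
  rw [Fintype.sum_prod_type_right]
  have h : ∀ i : Fin d, ∑ b : Sym (Fin d) k, (if c.1 = i ::ₘ b.1 then mcoef b ^ 2 else 0) =
      (c.1.count i : ℝ) / (k + 1) * mcoef c ^ 2 := by
    intro i
    by_cases hi : i ∈ c.1
    · have hc : Multiset.card (c.1.erase i) = k := by
        rw [Multiset.card_erase_of_mem hi, c.2]; rfl
      refine (Finset.sum_eq_single (Sym.mk (c.1.erase i) hc) ?_ ?_).trans ?_
      · intro b _ hb
        refine if_neg fun h => hb (Subtype.ext ?_)
        refine (Multiset.erase_cons_head i b.1).symm.trans ?_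
        rw [← h]
      · intro h; exact absurd (Finset.mem_univ _) h
      · refine (if_pos (Multiset.cons_erase hi).symm).trans ?_
        exact mcoef_sq_eq_of_cons (Multiset.cons_erase hi).symm
    · rw [Multiset.count_eq_zero.2 hi, Nat.cast_zero, zero_div, zero_mul]
      refine Finset.sum_eq_zero fun b _ => if_neg fun h => hi ?_
      rw [h]; exact Multiset.mem_cons_self _ _
  simp only [h]
  rw [← Finset.sum_mul, ← Finset.sum_div, ← Nat.cast_sum, Multiset.sum_count_eq_card, c.2]
  · push_cast
    rw [div_self (by positivity), one_mul]
  · intro a _; exact Finset.mem_univ a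

/-- Summation over the multi-indices of degree `k + 1` by removing one variable. -/
theorem sum_mcoef_sq_smul_succ {E : Type*} [AddCommGroup E] [Module ℝ E] (f : Multiset (Fin d) → E) :
    ∑ a : Sym (Fin d) (k + 1), mcoef a ^ 2 • f a.1 =
      ∑ b : Sym (Fin d) k × Fin d, mcoef b.1 ^ 2 • f (b.2 ::ₘ b.1.1) := by
  have h1 : ∀ a : Sym (Fin d) (k + 1), mcoef a ^ 2 • f a.1 = ∑ b : Sym (Fin d) k × Fin d,
      if a.1 = b.2 ::ₘ b.1.1 then mcoef b.1 ^ 2 • f (b.2 ::ₘ b.1.1) else 0 := by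
    intro a
    rw [← sum_ite_cons_mcoef_sq, Finset.sum_smul]
    refine Finset.sum_congr rfl fun b _ => ?_
    split_ifs with h
    · rw [h]
    · rw [zero_smul]
  simp only [h1]
  rw [Finset.sum_comm]
  refine Finset.sum_congr rfl fun b _ => ?_
  rw [Finset.sum_eq_single (b.2 ::ₛ b.1)]
  · exact if_pos rfl
  · intro a _ ha
    exact if_neg fun h => ha (Subtype.ext h)
  · intro h; exact absurd (Finset.mem_univ _) h

/-- Both sides count the words of length `k`. This is the price, geometric in `k`, of passing
between bounds for multilinear maps and Euclidean norms of coefficient vectors. -/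
theorem sum_mcoef_sq (d k : ℕ) : ∑ a : Sym (Fin d) k, mcoef a ^ 2 = (d : ℝ) ^ k := by
  induction k with
  | zero =>
    rw [Fintype.sum_eq_single (Sym.nil : Sym (Fin d) 0) fun a ha => absurd (Subsingleton.elim _ _) ha,
      mcoef_sq]
    simp [Sym.nil]
  | succ k ih =>
    have := sum_mcoef_sq_smul_succ (d := d) (k := k) (fun _ => (1 : ℝ))
    simp only [smul_eq_mul, mul_one] at this
    rw [this, Fintype.sum_prod_type]
    simp only [Finset.sum_const, Finset.card_univ, Fintype.card_fin, nsmul_eq_mul]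
    rw [← Finset.mul_sum, ih, pow_succ, mul_comm]

/-- Summation over tuples in terms of multi-indices. -/
theorem sum_tuple_eq {E : Type*} [AddCommGroup E] [Module ℝ E] (f : Multiset (Fin d) → E) :
    ∑ v : Fin k → Fin d, f (Multiset.ofList (List.ofFn v)) =
      ∑ a : Sym (Fin d) k, mcoef a ^ 2 • f a.1 := by
  induction k generalizing f with
  | zero =>
    rw [Fintype.sum_eq_single (Sym.nil : Sym (Fin d) 0) fun a ha => absurd (Subsingleton.elim _ _) ha,
      mcoef_sq]
    simp [Sym.nil]
  | succ k ih =>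
    rw [sum_mcoef_sq_smul_succ, Fintype.sum_prod_type_right,
      ← (Fin.consEquiv fun _ : Fin (k + 1) => Fin d).sum_comp, Fintype.sum_prod_type]
    refine Finset.sum_congr rfl fun i _ => ?_
    rw [← ih fun s => f (i ::ₘ s)]
    refine Finset.sum_congr rfl fun v _ => ?_
    rw [Multiset.cons_coe]
    congr 2
    simp [Fin.consEquiv, List.ofFn_succ]

/-- Vandermonde's identity for multinomial coefficients. -/
theorem sum_ite_add_mcoef_sq {i j l : ℕ} (hl : i + j = l) (c : Sym (Fin d) l) :
    ∑ b : Sym (Fin d) i × Sym (Fin d) j,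
      (if c.1 = b.1.1 + b.2.1 then mcoef b.1 ^ 2 * mcoef b.2 ^ 2 else 0) = mcoef c ^ 2 := by
  induction j generalizing l with
  | zero =>
    obtain rfl : i = l := hl
    rw [Fintype.sum_prod_type]
    have h0 : ∀ a : Sym (Fin d) i, ∑ b : Sym (Fin d) 0,
        (if c.1 = a.1 + b.1 then mcoef a ^ 2 * mcoef b ^ 2 else 0) =
        if c = a then mcoef a ^ 2 else 0 := by
      intro a
      rw [Fintype.sum_eq_single (Sym.nil : Sym (Fin d) 0)
        fun a ha => absurd (Subsingleton.elim _ _) ha, mcoef_sq Sym.nil]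
      simp [Sym.nil]
    simp only [h0, Finset.sum_ite_eq, Finset.mem_univ, if_true]
  | succ j ih =>
    obtain ⟨l, rfl⟩ : ∃ l', l = l' + 1 := ⟨i + j, by omega⟩
    have hl' : i + j = l := by omega
    rw [← sum_ite_cons_mcoef_sq c, Fintype.sum_prod_type]
    have h1 : ∀ a : Sym (Fin d) i, ∑ b : Sym (Fin d) (j + 1),
        (if c.1 = a.1 + b.1 then mcoef a ^ 2 * mcoef b ^ 2 else 0) =
        ∑ b : Sym (Fin d) j × Fin d,
          (if c.1 = b.2 ::ₘ (a.1 + b.1.1) then mcoef a ^ 2 * mcoef b.1 ^ 2 else 0) := by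
      intro a
      have := sum_mcoef_sq_smul_succ (d := d) (k := j)
        (fun s => if c.1 = a.1 + s then mcoef a ^ 2 else 0)
      simp only [smul_eq_mul, mul_ite, mul_zero, Multiset.add_cons] at this
      simpa only [mul_comm] using this
    simp only [h1]
    have h2 : ∀ e : Sym (Fin d) l × Fin d, (if c.1 = e.2 ::ₘ e.1.1 then mcoef e.1 ^ 2 else 0) =
        ∑ a : Sym (Fin d) i, ∑ b : Sym (Fin d) j, if e.1.1 = a.1 + b.1 then
          (if c.1 = e.2 ::ₘ (a.1 + b.1) then mcoef a ^ 2 * mcoef b ^ 2 else 0) else 0 := by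
      intro e
      rw [← ih hl' e.1, Fintype.sum_prod_type]
      split_ifs with h
      · refine Finset.sum_congr rfl fun a _ => Finset.sum_congr rfl fun b _ => ?_
        split_ifs with h3 h4
        · rfl
        · exact absurd (by rw [← h3]; exact h) h4
        · rfl
      · symm
        refine Finset.sum_eq_zero fun a _ => Finset.sum_eq_zero fun b _ => ?_
        split_ifs with h3 h4
        · exact absurd (by rw [h3]; exact h4) h
        · rfl
        · rfl
    simp only [h2]
    refine Eq.trans (Finset.sum_congr rfl fun a _ => ?_) Finset.sum_comm
    refine Eq.trans ?_ Finset.sum_comm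
    rw [Fintype.sum_prod_type]
    refine Finset.sum_congr rfl fun b _ => ?_
    rw [Fintype.sum_prod_type_right]
    refine Finset.sum_congr rfl fun t _ => ?_
    have hcard : Multiset.card (a.1 + b.1) = l := by rw [Multiset.card_add, a.2, b.2, hl']
    refine Eq.symm ((Finset.sum_eq_single (Sym.mk (a.1 + b.1) hcard) ?_ ?_).trans ?_)
    · intro e _ he
      exact if_neg fun h => he (Subtype.ext h)
    · intro h; exact absurd (Finset.mem_univ _) h
    · exact if_pos rfl

theorem redOne_apply (c : Sym (Fin d) (k + 1)) (b : Sym (Fin d) k × Fin d) :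
    redOne d k c b = if c.1 = b.2 ::ₘ b.1.1 then mcoef b.1 / mcoef c else 0 := rfl

/-- Distinct rows of `K_k` have disjoint supports, and each is a unit vector by Pascal's rule. This
is what the square-root normalization of `x^k` achieves, and the degree-uniform bounds for `M_k`
rest on it. -/
theorem redOne_mul_transpose (d k : ℕ) : redOne d k * (redOne d k)ᵀ = 1 := by
  ext c c'
  rw [Matrix.mul_apply]
  simp only [Matrix.transpose_apply, redOne_apply]
  rcases eq_or_ne c c' with rfl | hne
  · have h : mcoef c ^ 2 ≠ 0 := pow_ne_zero 2 (mcoef_ne_zero c)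
    rw [Matrix.one_apply_eq, ← div_self h, ← sum_ite_cons_mcoef_sq c, Finset.sum_div]
    refine Finset.sum_congr rfl fun b _ => ?_
    rw [sum_ite_cons_mcoef_sq c]
    split_ifs
    · rw [div_mul_div_comm, ← pow_two, ← pow_two]
    · simp
  · rw [Matrix.one_apply_ne hne]
    refine Finset.sum_eq_zero fun b _ => ?_
    split_ifs with h1 h2
    · exact absurd (Subtype.ext (h1.trans h2.symm)) hne
    · exact mul_zero _
    · exact zero_mul _
    · exact zero_mul _

theorem redOne_mulVec_transpose (v : Sym (Fin d) (k + 1) → ℝ) :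
    redOne d k *ᵥ ((redOne d k)ᵀ *ᵥ v) = v := by
  rw [Matrix.mulVec_mulVec, redOne_mul_transpose, Matrix.one_mulVec]

theorem redOne_transpose_mulVec_apply (p : Sym (Fin d) (k + 1) → ℝ) (b : Sym (Fin d) k) (i : Fin d) :
    ((redOne d k)ᵀ *ᵥ p) (b, i) = mcoef b / mcoef (i ::ₛ b) * p (i ::ₛ b) := by
  refine (Finset.sum_eq_single (i ::ₛ b) ?_ ?_).trans ?_
  · intro c _ hc
    exact mul_eq_zero_of_left (if_neg fun h => hc (Subtype.ext h)) _
  · intro h; exact absurd (Finset.mem_univ _) h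
  · exact congrArg (· * p (i ::ₛ b)) (if_pos rfl)

end Multinomial

/-! ### The Euclidean norm of coefficient vectors -/

/-- The Euclidean norm. -/
noncomputable def l2 {ι : Type*} [Fintype ι] (v : ι → ℝ) : ℝ := ‖WithLp.toLp 2 v‖

section L2

variable {ι κ : Type*} [Fintype ι] [Fintype κ]

theorem l2_sq (v : ι → ℝ) : l2 v ^ 2 = ∑ i, v i ^ 2 := by
  rw [l2, EuclideanSpace.norm_sq_eq]; simp

theorem l2_sq_eq_dotProduct (v : ι → ℝ) : l2 v ^ 2 = v ⬝ᵥ v := by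
  rw [l2_sq, dotProduct]; simp only [pow_two]

theorem l2_nonneg (v : ι → ℝ) : 0 ≤ l2 v := norm_nonneg _

theorem l2_le_of_sq_le {v : ι → ℝ} {C : ℝ} (hC : 0 ≤ C) (h : ∑ i, v i ^ 2 ≤ C ^ 2) : l2 v ≤ C :=
  le_of_sq_le_sq₀ (by rw [l2_sq]; exact h) hC
where
  le_of_sq_le_sq₀ {a b : ℝ} (h : a ^ 2 ≤ b ^ 2) (hb : 0 ≤ b) : a ≤ b := by
    nlinarith [abs_le_of_sq_le_sq' h hb]

theorem l2_zero : l2 (0 : ι → ℝ) = 0 := by simp [l2]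

theorem l2_add_le (v w : ι → ℝ) : l2 (v + w) ≤ l2 v + l2 w := by
  rw [l2, WithLp.toLp_add]; exact norm_add_le _ _

theorem l2_smul (c : ℝ) (v : ι → ℝ) : l2 (c • v) = |c| * l2 v := by
  rw [l2, WithLp.toLp_smul, norm_smul]; rfl

theorem l2_neg (v : ι → ℝ) : l2 (-v) = l2 v := by
  rw [l2, WithLp.toLp_neg, norm_neg]; rfl

theorem l2_sum_le {τ : Type*} (s : Finset τ) (f : τ → ι → ℝ) :
    l2 (∑ t ∈ s, f t) ≤ ∑ t ∈ s, l2 (f t) := by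
  rw [l2, WithLp.toLp_sum]; exact norm_sum_le _ _

theorem abs_dotProduct_le (v w : ι → ℝ) : |v ⬝ᵥ w| ≤ l2 v * l2 w := by
  refine abs_le_of_sq_le_sq ?_ (mul_nonneg (l2_nonneg v) (l2_nonneg w))
  rw [mul_pow, l2_sq, l2_sq, dotProduct]
  exact Finset.sum_mul_sq_le_sq_mul_sq _ _ _

theorem abs_le_l2 (v : ι → ℝ) (i : ι) : |v i| ≤ l2 v := by
  have h := Finset.single_le_sum (f := fun i => v i ^ 2) (fun i _ => sq_nonneg _) (Finset.mem_univ i)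
  refine abs_le_of_sq_le_sq ?_ (l2_nonneg v)
  rw [l2_sq]; exact h

theorem l2_transpose_mulVec_of_coisometry [DecidableEq ι] {K : Matrix ι κ ℝ} (hK : K * Kᵀ = 1) (v : ι → ℝ) :
    l2 (Kᵀ *ᵥ v) = l2 v := by
  have h : l2 (Kᵀ *ᵥ v) ^ 2 = l2 v ^ 2 := by
    rw [l2_sq_eq_dotProduct, l2_sq_eq_dotProduct, Matrix.mulVec_transpose,
      ← Matrix.dotProduct_mulVec, ← Matrix.mulVec_transpose, Matrix.mulVec_mulVec, hK,
      Matrix.one_mulVec]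
  exact (pow_left_inj₀ (l2_nonneg _) (l2_nonneg _) two_ne_zero).1 h

theorem l2_mulVec_le_of_coisometry [DecidableEq ι] {K : Matrix ι κ ℝ} (hK : K * Kᵀ = 1) (v : κ → ℝ) :
    l2 (K *ᵥ v) ≤ l2 v := by
  have h1 : l2 (K *ᵥ v) ^ 2 ≤ l2 v * l2 (K *ᵥ v) := by
    rw [l2_sq_eq_dotProduct, Matrix.dotProduct_mulVec, ← Matrix.mulVec_transpose, dotProduct_comm]
    refine (le_abs_self _).trans ((abs_dotProduct_le _ _).trans ?_)
    rw [l2_transpose_mulVec_of_coisometry hK]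
  rcases (l2_nonneg (K *ᵥ v)).eq_or_lt with h0 | h0
  · rw [← h0]; exact l2_nonneg v
  · rw [pow_two] at h1; exact le_of_mul_le_mul_right h1 h0

end L2

/-! ### The matrices of the linear systems -/

section Mmat

variable {n : ℕ} {Fc : Matrix (Fin n) (Fin n) ℝ} {k : ℕ}

theorem kronecker_one_mulVec_apply {ι : Type*} [Fintype ι] [DecidableEq ι]
    (A : Matrix (Fin n) (Fin n) ℝ) (v : ι × Fin n → ℝ)
    (a : ι) (i : Fin n) :
    (Matrix.kronecker (1 : Matrix ι ι ℝ) A *ᵥ v) (a, i) = (A *ᵥ fun j => v (a, j)) i := by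
  rw [Matrix.mulVec, dotProduct, Fintype.sum_prod_type, Finset.sum_eq_single a]
  · simp [Matrix.mulVec, dotProduct]
  · intro b _ hb
    simp [Matrix.kronecker, Matrix.kroneckerMap_apply, Matrix.one_apply_ne hb.symm]
  · intro h; exact absurd (Finset.mem_univ _) h

theorem Mmat_mulVec (Fc : Matrix (Fin n) (Fin n) ℝ) (k : ℕ) (p : Sym (Fin n) (k + 1) → ℝ) :
    Mmat Fc k *ᵥ p = redOne n k *ᵥ
      (Matrix.kronecker (1 : Matrix (Sym (Fin n) k) (Sym (Fin n) k) ℝ) Fcᵀ *ᵥ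
        ((redOne n k)ᵀ *ᵥ p)) := by
  rw [Mmat, Matrix.mulVec_mulVec, Matrix.mulVec_mulVec]

/-- With `v = K_kᵀ p`, of the same norm as `p`, the number `p · M_k p` is the sum over multi-indices
of `v_a · F_cᵀ v_a`, hence at most `-μ |p|²`. Cauchy–Schwarz turns this into a lower bound with the
same `μ` in every degree. -/
theorem mul_l2_le_l2_Mmat_mulVec {μ : ℝ} (hF : ∀ x : Fin n → ℝ, x ⬝ᵥ Fc *ᵥ x ≤ -(μ * (x ⬝ᵥ x)))
    (p : Sym (Fin n) (k + 1) → ℝ) : μ * l2 p ≤ l2 (Mmat Fc k *ᵥ p) := by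
  have h1 : p ⬝ᵥ Mmat Fc k *ᵥ p ≤ -(μ * l2 p ^ 2) := by
    rw [Mmat_mulVec, Matrix.dotProduct_mulVec, ← Matrix.mulVec_transpose,
      ← l2_transpose_mulVec_of_coisometry (redOne_mul_transpose n k) p, l2_sq_eq_dotProduct]
    generalize (redOne n k)ᵀ *ᵥ p = v
    rw [dotProduct, dotProduct, Fintype.sum_prod_type, Fintype.sum_prod_type, Finset.mul_sum,
      ← Finset.sum_neg_distrib]
    refine Finset.sum_le_sum fun a _ => ?_
    simp only [kronecker_one_mulVec_apply]
    have := hF fun j => v (a, j)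
    rw [Matrix.dotProduct_mulVec, ← Matrix.mulVec_transpose, dotProduct_comm] at this
    exact this
  have h2 := (neg_le_abs _).trans (abs_dotProduct_le p (Mmat Fc k *ᵥ p))
  have h3 : l2 p * (μ * l2 p) ≤ l2 p * l2 (Mmat Fc k *ᵥ p) := by nlinarith
  rcases (l2_nonneg p).eq_or_lt with h0 | h0
  · rw [← h0, mul_zero]; exact l2_nonneg _
  · exact le_of_mul_le_mul_left h3 h0

/-- `M_k` is the compression by a coisometry of a block diagonal matrix with all blocks equal to
`F_cᵀ`, so the Frobenius norm of `F_c` bounds it in every degree. -/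
theorem l2_Mmat_mulVec_le (p : Sym (Fin n) (k + 1) → ℝ) :
    l2 (Mmat Fc k *ᵥ p) ≤ Real.sqrt (∑ i, ∑ j, Fc i j ^ 2) * l2 p := by
  rw [Mmat_mulVec]
  refine (l2_mulVec_le_of_coisometry (redOne_mul_transpose n k) _).trans ?_
  rw [← l2_transpose_mulVec_of_coisometry (redOne_mul_transpose n k) p]
  generalize (redOne n k)ᵀ *ᵥ p = v
  have hnn : 0 ≤ ∑ i, ∑ j, Fc i j ^ 2 :=
    Finset.sum_nonneg fun _ _ => Finset.sum_nonneg fun _ _ => sq_nonneg _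
  refine l2_le_of_sq_le (mul_nonneg (Real.sqrt_nonneg _) (l2_nonneg v)) ?_
  rw [mul_pow, Real.sq_sqrt hnn, l2_sq, Fintype.sum_prod_type, Fintype.sum_prod_type, Finset.mul_sum]
  refine Finset.sum_le_sum fun a _ => ?_
  simp only [kronecker_one_mulVec_apply]
  rw [Finset.sum_comm, Finset.sum_mul]
  refine Finset.sum_le_sum fun i _ => ?_
  rw [Matrix.mulVec, dotProduct]
  exact Finset.sum_mul_sq_le_sq_mul_sq _ _ _

theorem isUnit_det_Mmat_of_dissipative {μ : ℝ} (hμ : 0 < μ)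
    (hF : ∀ x : Fin n → ℝ, x ⬝ᵥ Fc *ᵥ x ≤ -(μ * (x ⬝ᵥ x))) (k : ℕ) : IsUnit (Mmat Fc k).det := by
  rw [isUnit_iff_ne_zero]
  intro h
  obtain ⟨v, hv, h0⟩ := Matrix.exists_mulVec_eq_zero_iff.2 h
  have h1 := mul_l2_le_l2_Mmat_mulVec hF v
  rw [h0, l2_zero] at h1
  have h2 : l2 v ≤ 0 := by by_contra! h3; exact absurd h1 (not_le.2 (mul_pos hμ h3))
  exact hv (funext fun i => abs_nonpos_iff.1 ((abs_le_l2 v i).trans h2))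

theorem opNorm_le {ι : Type} [Fintype ι] [DecidableEq ι] {A : Matrix ι ι ℝ} {C : ℝ} (hC : 0 ≤ C)
    (h : ∀ v, l2 (A *ᵥ v) ≤ C * l2 v) : opNorm A ≤ C := by
  refine ContinuousLinearMap.opNorm_le_bound _ hC fun v => ?_
  have := h (WithLp.ofLp v)
  rwa [l2, ← Matrix.toEuclideanCLM_toLp (𝕜 := ℝ)] at this

/-- The condition numbers are bounded uniformly in the degree. -/
theorem condNumber_Mmat_le {μ : ℝ} (hμ : 0 < μ)
    (hF : ∀ x : Fin n → ℝ, x ⬝ᵥ Fc *ᵥ x ≤ -(μ * (x ⬝ᵥ x))) (k : ℕ) :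
    condNumber (Mmat Fc k) ≤ Real.sqrt (∑ i, ∑ j, Fc i j ^ 2) * μ⁻¹ := by
  refine mul_le_mul (opNorm_le (Real.sqrt_nonneg _) l2_Mmat_mulVec_le)
    (opNorm_le (inv_nonneg.2 hμ.le) fun v => ?_) (norm_nonneg _) (Real.sqrt_nonneg _)
  have h := mul_l2_le_l2_Mmat_mulVec hF ((Mmat Fc k)⁻¹ *ᵥ v)
  rw [Matrix.mulVec_mulVec, Matrix.mul_nonsing_inv _ (isUnit_det_Mmat_of_dissipative hμ hF k),
    Matrix.one_mulVec] at h
  rw [inv_mul_eq_div, le_div_iff₀ hμ, mul_comm]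
  exact h

theorem exists_pos_mul_dotProduct_le_of_posDef {A : Matrix (Fin n) (Fin n) ℝ} (h : A.PosDef) :
    ∃ μ : ℝ, 0 < μ ∧ ∀ x : Fin n → ℝ, μ * (x ⬝ᵥ x) ≤ x ⬝ᵥ A *ᵥ x := by
  have hc : Continuous fun x : EuclideanSpace ℝ (Fin n) => x.ofLp ⬝ᵥ A *ᵥ x.ofLp := by fun_prop
  -- The minimum of the form on the unit sphere serves as `μ`. If the sphere is empty the space is
  -- zero and any constant will do.
  rcases (Metric.sphere (0 : EuclideanSpace ℝ (Fin n)) 1).eq_empty_or_nonempty with he | hne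
  · refine ⟨1, one_pos, fun x => ?_⟩
    have hx : x = 0 := by
      by_contra hx
      have h0 : ‖WithLp.toLp 2 x‖ ≠ 0 := by simpa using hx
      have h1 : (‖WithLp.toLp 2 x‖⁻¹ • WithLp.toLp 2 x) ∈
          Metric.sphere (0 : EuclideanSpace ℝ (Fin n)) 1 := by
        simp [norm_smul, inv_mul_cancel₀ h0]
      rw [he] at h1
      exact h1
    simp [hx]
  · obtain ⟨x0, hx0, hmin⟩ := (isCompact_sphere (0 : EuclideanSpace ℝ (Fin n)) 1).exists_isMinOn
      hne hc.continuousOn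
    have hx0' : x0.ofLp ≠ 0 := by
      intro h0
      have : x0 = 0 := by ext i; exact congrFun h0 i
      rw [this] at hx0
      simp at hx0
    refine ⟨_, (posDef_iff_real.1 h).2 _ hx0', fun x => ?_⟩
    rcases eq_or_ne x 0 with rfl | hx
    · simp
    have h0 : 0 < ‖WithLp.toLp 2 x‖ := by simpa using hx
    have h1 : (‖WithLp.toLp 2 x‖⁻¹ • WithLp.toLp 2 x) ∈
        Metric.sphere (0 : EuclideanSpace ℝ (Fin n)) 1 := by
      simp [norm_smul, inv_mul_cancel₀ h0.ne']
    have h2 := hmin h1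
    simp only [Set.mem_ofPred_eq, WithLp.ofLp_smul, Matrix.mulVec_smul, dotProduct_smul,
      smul_dotProduct, smul_eq_mul] at h2
    rw [← l2_sq_eq_dotProduct, l2]
    have h3 := mul_le_mul_of_nonneg_right h2 (sq_nonneg ‖WithLp.toLp 2 x‖)
    refine h3.trans (le_of_eq ?_)
    field_simp

theorem exists_dissipative_of_posDef (h : (-(Fc + Fcᵀ)).PosDef) :
    ∃ μ : ℝ, 0 < μ ∧ ∀ x : Fin n → ℝ, x ⬝ᵥ Fc *ᵥ x ≤ -(μ * (x ⬝ᵥ x)) := by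
  obtain ⟨μ, hμ, hx⟩ := exists_pos_mul_dotProduct_le_of_posDef h
  refine ⟨μ / 2, by positivity, fun x => ?_⟩
  have h1 := hx x
  rw [Matrix.neg_mulVec, Matrix.add_mulVec, dotProduct_neg, dotProduct_add,
    Matrix.dotProduct_mulVec x Fcᵀ, Matrix.vecMul_transpose, dotProduct_comm (Fc *ᵥ x)] at h1
  linarith

end Mmat

end NLR

namespace NLR
open Matrix

/-! ### Formal power series and their homogeneous parts -/

/-- Formal power series in `n` variables. -/
abbrev PS (n : ℕ) : Type := MvPowerSeries (Fin n) ℝ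

section PowerSeries

variable {n : ℕ}

/-- The coefficient vector of the homogeneous part of degree `k` with respect to the reduced
power `x^k`. -/
noncomputable def hom (k : ℕ) (s : PS n) : Sym (Fin n) k → ℝ :=
  fun a => MvPowerSeries.coeff (Multiset.toFinsupp a.1) s / mcoef a

/-- The power series with given coefficient vectors. -/
noncomputable def ofHom (S : ∀ k, Sym (Fin n) k → ℝ) : PS n :=
  fun α => mcoef (Sym.mk (Finsupp.toMultiset α) rfl) * S _ (Sym.mk (Finsupp.toMultiset α) rfl)

theorem coeff_ofHom (S : ∀ k, Sym (Fin n) k → ℝ) (k : ℕ) (a : Sym (Fin n) k) :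
    MvPowerSeries.coeff (Multiset.toFinsupp a.1) (ofHom S) = mcoef a * S k a := by
  obtain ⟨s, rfl⟩ := a
  show mcoef (Sym.mk (Finsupp.toMultiset (Multiset.toFinsupp s)) rfl) *
    S _ (Sym.mk (Finsupp.toMultiset (Multiset.toFinsupp s)) rfl) = _
  have h : Finsupp.toMultiset (Multiset.toFinsupp s) = s := Multiset.toFinsupp_toMultiset s
  generalize hs : Finsupp.toMultiset (Multiset.toFinsupp s) = s' at *
  subst h
  rfl

theorem hom_ofHom (S : ∀ k, Sym (Fin n) k → ℝ) (k : ℕ) : hom k (ofHom S) = S k := by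
  ext a
  rw [hom, coeff_ofHom, mul_div_cancel_left₀ _ (mcoef_ne_zero a)]

theorem ps_ext {s t : PS n} (h : ∀ k, hom k s = hom k t) : s = t := by
  ext α
  have h1 := congrFun (h _) (Sym.mk (Finsupp.toMultiset α) rfl)
  rw [hom, hom, div_left_inj' (mcoef_ne_zero _)] at h1
  have h2 : Multiset.toFinsupp (Finsupp.toMultiset α) = α := Finsupp.toMultiset_toFinsupp α
  change MvPowerSeries.coeff (Multiset.toFinsupp (Finsupp.toMultiset α)) s =
    MvPowerSeries.coeff (Multiset.toFinsupp (Finsupp.toMultiset α)) t at h1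
  rwa [h2] at h1

theorem hom_zero (k : ℕ) : hom k (0 : PS n) = 0 := by ext a; simp [hom]

theorem hom_add (k : ℕ) (s t : PS n) : hom k (s + t) = hom k s + hom k t := by
  ext a; simp [hom, add_div]

theorem hom_neg (k : ℕ) (s : PS n) : hom k (-s) = -hom k s := by
  ext a; simp [hom, neg_div]

theorem hom_sub (k : ℕ) (s t : PS n) : hom k (s - t) = hom k s - hom k t := by
  ext a; simp [hom, sub_div]

theorem hom_smul (k : ℕ) (c : ℝ) (s : PS n) : hom k (c • s) = c • hom k s := by
  ext a; simp [hom, mul_div_assoc]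

theorem hom_sum {ι : Type*} (k : ℕ) (S : Finset ι) (f : ι → PS n) :
    hom k (∑ i ∈ S, f i) = ∑ i ∈ S, hom k (f i) := by
  ext a; simp [hom, Finset.sum_div]

theorem hom_one_of_pos {k : ℕ} (hk : k ≠ 0) : hom k (1 : PS n) = 0 := by
  ext a
  have : a.1 ≠ 0 := fun h => hk (by rw [← a.2]; exact congrArg Multiset.card h)
  have h : MvPowerSeries.coeff (Multiset.toFinsupp a.1) (1 : PS n) = 0 := by
    rw [MvPowerSeries.coeff_one, if_neg]
    simpa using this
  rw [hom, h, zero_div, Pi.zero_apply]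

theorem hom_zero_one (a : Sym (Fin n) 0) : hom 0 (1 : PS n) a = 1 := by
  obtain rfl : a = Sym.nil := Subsingleton.elim _ _
  have h := mcoef_sq (Sym.nil : Sym (Fin n) 0)
  have h1 : mcoef (Sym.nil : Sym (Fin n) 0) = 1 := by
    rw [← Real.sqrt_one, mcoef]; simp [Sym.nil]
  rw [hom, h1]
  simp [Sym.nil]

/-- The homogeneous parts of a product. -/
theorem hom_mul (l : ℕ) (s t : PS n) (c : Sym (Fin n) l) :
    hom l (s * t) c = ∑ j : Fin (l + 1), ∑ b : Sym (Fin n) (l - j) × Sym (Fin n) j,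
      (if c.1 = b.1.1 + b.2.1 then mcoef b.1 * mcoef b.2 / mcoef c else 0) *
        (hom j s b.2 * hom (l - j) t b.1) := by
  have h1 : ∀ (j : Fin (l + 1)) (b : Sym (Fin n) (l - j) × Sym (Fin n) j),
      (if c.1 = b.1.1 + b.2.1 then mcoef b.1 * mcoef b.2 / mcoef c else 0) *
        (hom j s b.2 * hom (l - j) t b.1) =
      if c.1 = b.1.1 + b.2.1 then MvPowerSeries.coeff (Multiset.toFinsupp b.2.1) s *
        MvPowerSeries.coeff (Multiset.toFinsupp b.1.1) t / mcoef c else 0 := by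
    intro j b
    split_ifs
    · have := mcoef_ne_zero b.1
      have := mcoef_ne_zero b.2
      rw [hom, hom]; field_simp
    · rw [zero_mul]
  simp only [h1]
  rw [hom, MvPowerSeries.coeff_mul, Finset.sum_div]
  simp only [← Finset.sum_filter]
  rw [Finset.sum_sigma']
  symm
  refine Finset.sum_nbij (fun x => (Multiset.toFinsupp x.2.2.1, Multiset.toFinsupp x.2.1.1)) ?_ ?_ ?_ ?_
  · rintro ⟨j, b⟩ h
    simp only [Finset.mem_sigma, Finset.mem_univ, Finset.mem_filter, true_and] at h
    refine Finset.HasAntidiagonal.mem_antidiagonal.2 ?_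
    rw [← Multiset.toFinsupp_add, add_comm]
    exact congrArg _ h.symm
  · rintro ⟨j, b⟩ h ⟨j', b'⟩ h' heq
    simp only [Prod.mk.injEq, EmbeddingLike.apply_eq_iff_eq] at heq
    have hj : j = j' := by
      apply Fin.ext
      rw [← b.2.2, ← b'.2.2]
      exact congrArg Multiset.card heq.1
    subst hj
    congr 1
    exact Prod.ext (Subtype.ext heq.2) (Subtype.ext heq.1)
  · rintro ⟨α, β⟩ h
    replace h : α + β = Multiset.toFinsupp c.1 :=
      Finset.HasAntidiagonal.mem_antidiagonal.1 (Finset.mem_coe.1 h)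
    have h2 : Finsupp.toMultiset β + Finsupp.toMultiset α = c.1 := by
      apply Multiset.toFinsupp.injective
      rw [map_add, Finsupp.toMultiset_toFinsupp, Finsupp.toMultiset_toFinsupp, add_comm, h]
    have h3 : Multiset.card (Finsupp.toMultiset β) + Multiset.card (Finsupp.toMultiset α) = l := by
      rw [← Multiset.card_add, h2, c.2]
    refine ⟨⟨⟨Multiset.card (Finsupp.toMultiset α), by omega⟩,
      (Sym.mk (Finsupp.toMultiset β) (by simp only []; omega), Sym.mk (Finsupp.toMultiset α) rfl)⟩, ?_, ?_⟩
    · simp only [Finset.coe_sigma, Set.mem_sigma_iff, Finset.mem_coe, Finset.mem_univ,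
        Finset.mem_filter, true_and]
      exact h2.symm
    · exact Prod.ext (Finsupp.toMultiset_toFinsupp α) (Finsupp.toMultiset_toFinsupp β)
  · rintro ⟨j, b⟩ h
    rfl

/-- All homogeneous parts of degree less than `N` vanish. -/
def LowOrd (N : ℕ) (s : PS n) : Prop := ∀ k < N, hom k s = 0

theorem LowOrd.mono {N N' : ℕ} {s : PS n} (h : LowOrd N s) (hN : N' ≤ N) : LowOrd N' s :=
  fun k hk => h k (hk.trans_le hN)

theorem lowOrd_zero (s : PS n) : LowOrd 0 s := fun _ hk => absurd hk (Nat.not_lt_zero _)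

theorem LowOrd.add {N : ℕ} {s t : PS n} (hs : LowOrd N s) (ht : LowOrd N t) : LowOrd N (s + t) :=
  fun k hk => by rw [hom_add, hs k hk, ht k hk, add_zero]

theorem LowOrd.sub {N : ℕ} {s t : PS n} (hs : LowOrd N s) (ht : LowOrd N t) : LowOrd N (s - t) :=
  fun k hk => by rw [hom_sub, hs k hk, ht k hk, sub_zero]

theorem LowOrd.smul {N : ℕ} {s : PS n} (c : ℝ) (hs : LowOrd N s) : LowOrd N (c • s) :=
  fun k hk => by rw [hom_smul, hs k hk, smul_zero]

theorem LowOrd.sum {ι : Type*} {N : ℕ} {S : Finset ι} {f : ι → PS n}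
    (h : ∀ i ∈ S, LowOrd N (f i)) : LowOrd N (∑ i ∈ S, f i) :=
  fun k hk => by rw [hom_sum]; exact Finset.sum_eq_zero fun i hi => h i hi k hk

theorem LowOrd.mul {N N' : ℕ} {s t : PS n} (hs : LowOrd N s) (ht : LowOrd N' t) :
    LowOrd (N + N') (s * t) := by
  intro l hl
  ext c
  rw [hom_mul]
  refine Finset.sum_eq_zero fun j _ => Finset.sum_eq_zero fun b _ => ?_
  rcases lt_or_ge (j : ℕ) N with h | h
  · rw [hs _ h]; simp
  · rw [ht (l - j) (by omega)]; simp

theorem LowOrd.multiset_prod {ι : Type*} {N : ℕ} {f : ι → PS n} (h : ∀ i, LowOrd N (f i))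
    (a : Multiset ι) : LowOrd (Multiset.card a * N) (a.map f).prod := by
  induction a using Multiset.induction_on with
  | empty => simpa using lowOrd_zero _
  | cons i a ih =>
    rw [Multiset.map_cons, Multiset.prod_cons, Multiset.card_cons, add_mul, one_mul, add_comm]
    exact (h i).mul ih

/-- Replacing the factors of a product changes it only in high degree. -/
theorem LowOrd.multiset_prod_sub {ι : Type*} {N : ℕ} {f g : ι → PS n} (hf : ∀ i, LowOrd 1 (f i))
    (hg : ∀ i, LowOrd 1 (g i)) (hfg : ∀ i, LowOrd N (f i - g i)) (a : Multiset ι) :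
    LowOrd (Multiset.card a - 1 + N) ((a.map f).prod - (a.map g).prod) := by
  induction a using Multiset.induction_on with
  | empty => intro k _; simp [hom_zero]
  | cons i a ih =>
    rw [Multiset.map_cons, Multiset.prod_cons, Multiset.map_cons, Multiset.prod_cons]
    have e : f i * (a.map f).prod - g i * (a.map g).prod =
        f i * ((a.map f).prod - (a.map g).prod) + (f i - g i) * (a.map g).prod := by ring
    rw [e]
    have h2 := (hfg i).mul (LowOrd.multiset_prod hg a)
    rw [Multiset.card_cons]
    refine LowOrd.add ?_ (h2.mono (by omega))
    rcases Multiset.empty_or_exists_mem a with rfl | ⟨b, hb⟩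
    · intro k _; simp [hom_zero]
    · have : 0 < Multiset.card a := Multiset.card_pos_iff_exists_mem.2 ⟨b, hb⟩
      exact ((hf i).mul ih).mono (by omega)

/-! ### The Bombieri norm -/

/-- The Bombieri norm of the homogeneous part of degree `k`. -/
noncomputable def bn (k : ℕ) (s : PS n) : ℝ := l2 (hom k s)

theorem bn_nonneg (k : ℕ) (s : PS n) : 0 ≤ bn k s := l2_nonneg _

/-- For fixed `j`, coefficient `c` of the product pairs the products of coefficients with row `c` of
`K_{l-j,j}`, a unit vector by Vandermonde's identity. Cauchy–Schwarz leaves the squares of the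
products over the pairs that add up to `c`, and each pair belongs to exactly one `c`. -/
theorem bn_mul_le (l : ℕ) (s t : PS n) :
    bn l (s * t) ≤ ∑ j : Fin (l + 1), bn j s * bn (l - j) t := by
  have h : hom l (s * t) = ∑ j : Fin (l + 1), fun c =>
      ∑ b : Sym (Fin n) (l - j) × Sym (Fin n) j,
      (if c.1 = b.1.1 + b.2.1 then mcoef b.1 * mcoef b.2 / mcoef c else 0) *
        (hom j s b.2 * hom (l - j) t b.1) := by
    ext c; rw [hom_mul, Finset.sum_apply]
  rw [bn, h]
  refine (l2_sum_le _ _).trans (Finset.sum_le_sum fun j _ => ?_)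
  have hj : l - j + j = l := Nat.sub_add_cancel (Nat.lt_succ_iff.1 j.2)
  refine l2_le_of_sq_le (mul_nonneg (bn_nonneg _ _) (bn_nonneg _ _)) ?_
  set F : Sym (Fin n) (l - j) × Sym (Fin n) j → ℝ := fun b => hom j s b.2 * hom (l - j) t b.1
  have h1 : ∀ c : Sym (Fin n) l, (∑ b : Sym (Fin n) (l - j) × Sym (Fin n) j,
      (if c.1 = b.1.1 + b.2.1 then mcoef b.1 * mcoef b.2 / mcoef c else 0) * F b) ^ 2 ≤
      ∑ b : Sym (Fin n) (l - j) × Sym (Fin n) j, if c.1 = b.1.1 + b.2.1 then F b ^ 2 else 0 := by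
    intro c
    have e : ∀ b : Sym (Fin n) (l - j) × Sym (Fin n) j,
        (if c.1 = b.1.1 + b.2.1 then mcoef b.1 * mcoef b.2 / mcoef c else 0) * F b =
        (if c.1 = b.1.1 + b.2.1 then mcoef b.1 * mcoef b.2 / mcoef c else 0) *
          (if c.1 = b.1.1 + b.2.1 then F b else 0) := by
      intro b; split_ifs <;> simp
    simp only [e]
    refine (Finset.sum_mul_sq_le_sq_mul_sq _ _ _).trans (le_of_eq ?_)
    have e2 : ∑ b : Sym (Fin n) (l - j) × Sym (Fin n) j,
        (if c.1 = b.1.1 + b.2.1 then mcoef b.1 * mcoef b.2 / mcoef c else 0) ^ 2 = 1 := by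
      have hc : mcoef c ^ 2 ≠ 0 := pow_ne_zero 2 (mcoef_ne_zero c)
      rw [← div_self hc]
      conv_rhs => rw [← sum_ite_add_mcoef_sq hj c]
      rw [Finset.sum_div]
      refine Finset.sum_congr rfl fun b _ => ?_
      rw [sum_ite_add_mcoef_sq hj c]
      split_ifs
      · rw [div_pow, mul_pow]
      · simp
    rw [e2, one_mul]
    refine Finset.sum_congr rfl fun b _ => ?_
    split_ifs <;> simp
  refine (Finset.sum_le_sum fun c _ => h1 c).trans ?_
  rw [Finset.sum_comm]
  have h2 : ∀ b : Sym (Fin n) (l - j) × Sym (Fin n) j,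
      ∑ c : Sym (Fin n) l, (if c.1 = b.1.1 + b.2.1 then F b ^ 2 else 0) = F b ^ 2 := by
    intro b
    have hcard : Multiset.card (b.1.1 + b.2.1) = l := by rw [Multiset.card_add, b.1.2, b.2.2, hj]
    refine (Finset.sum_eq_single (Sym.mk (b.1.1 + b.2.1) hcard) ?_ ?_).trans ?_
    · intro e _ he
      exact if_neg fun h => he (Subtype.ext h)
    · intro h; exact absurd (Finset.mem_univ _) h
    · exact if_pos rfl
  simp only [h2]
  rw [mul_pow, bn, bn, l2_sq, l2_sq, Fintype.sum_prod_type_right, Finset.sum_mul]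
  refine le_of_eq (Finset.sum_congr rfl fun b _ => ?_)
  rw [Finset.mul_sum]
  refine Finset.sum_congr rfl fun b' _ => ?_
  rw [← mul_pow]

/-- The weighted `ℓ¹` norm of the terms of degree less than `N`. -/
noncomputable def wn (N : ℕ) (r : ℝ) (s : PS n) : ℝ := ∑ k ∈ Finset.range N, bn k s * r ^ k

variable {N : ℕ} {r : ℝ}

theorem wn_nonneg (hr : 0 ≤ r) (s : PS n) : 0 ≤ wn N r s :=
  Finset.sum_nonneg fun _ _ => mul_nonneg (bn_nonneg _ _) (pow_nonneg hr _)

theorem wn_zero : wn N r (0 : PS n) = 0 :=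
  Finset.sum_eq_zero fun k _ => by rw [bn, hom_zero, l2_zero, zero_mul]

theorem wn_add_le (hr : 0 ≤ r) (s t : PS n) : wn N r (s + t) ≤ wn N r s + wn N r t := by
  rw [wn, wn, wn, ← Finset.sum_add_distrib]
  refine Finset.sum_le_sum fun k _ => ?_
  rw [← add_mul, bn, hom_add]
  exact mul_le_mul_of_nonneg_right (l2_add_le _ _) (pow_nonneg hr _)

theorem wn_neg (s : PS n) : wn N r (-s) = wn N r s := by
  refine Finset.sum_congr rfl fun k _ => ?_
  rw [bn, hom_neg, l2_neg, bn]

theorem wn_sub_le (hr : 0 ≤ r) (s t : PS n) : wn N r (s - t) ≤ wn N r s + wn N r t := by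
  rw [sub_eq_add_neg, ← wn_neg t]; exact wn_add_le hr _ _

theorem wn_smul (c : ℝ) (s : PS n) : wn N r (c • s) = |c| * wn N r s := by
  rw [wn, wn, Finset.mul_sum]
  refine Finset.sum_congr rfl fun k _ => ?_
  rw [bn, hom_smul, l2_smul, bn, mul_assoc]

theorem wn_sum_le {ι : Type*} (hr : 0 ≤ r) (S : Finset ι) (f : ι → PS n) :
    wn N r (∑ i ∈ S, f i) ≤ ∑ i ∈ S, wn N r (f i) := by
  induction S using Finset.cons_induction with
  | empty => simp [wn_zero]
  | cons i S hi ih =>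
    rw [Finset.sum_cons, Finset.sum_cons]
    exact (wn_add_le hr _ _).trans (by gcongr)

theorem wn_one_le : wn N r (1 : PS n) ≤ 1 := by
  rcases N with _ | N
  · simp [wn]
  · rw [wn, Finset.sum_range_succ']
    have h1 : bn 0 (1 : PS n) = 1 := by
      have : bn 0 (1 : PS n) ^ 2 = 1 := by
        rw [bn, l2_sq, Fintype.sum_eq_single (Sym.nil : Sym (Fin n) 0)
          fun a ha => absurd (Subsingleton.elim _ _) ha, hom_zero_one, one_pow]
      exact (pow_eq_one_iff_of_nonneg (bn_nonneg _ _) two_ne_zero).1 this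
    rw [h1, Finset.sum_eq_zero, pow_zero, zero_add, one_mul]
    intro k _
    rw [bn, hom_one_of_pos (Nat.succ_ne_zero k), l2_zero, zero_mul]

/-- Weight `bn_mul_le` by `r ^ l = r ^ i * r ^ j` and sum; the pairs with `i + j < N` lie in the
square `i, j < N`. Because of the truncation the norm is defined before convergence is known. -/
theorem wn_mul_le (hr : 0 ≤ r) (s t : PS n) : wn N r (s * t) ≤ wn N r s * wn N r t := by
  have h1 : ∀ l, bn l (s * t) * r ^ l ≤
      ∑ p ∈ Finset.HasAntidiagonal.antidiagonal l, (bn p.1 s * r ^ p.1) * (bn p.2 t * r ^ p.2) := by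
    intro l
    rw [Finset.Nat.sum_antidiagonal_eq_sum_range_succ
      (fun i j => (bn i s * r ^ i) * (bn j t * r ^ j))]
    refine (mul_le_mul_of_nonneg_right (bn_mul_le l s t) (pow_nonneg hr l)).trans (le_of_eq ?_)
    rw [Finset.sum_mul, ← Fin.sum_univ_eq_sum_range
      (fun i => (bn i s * r ^ i) * (bn (l - i) t * r ^ (l - i))) (l + 1)]
    refine Finset.sum_congr rfl fun j _ => ?_
    have : r ^ l = r ^ (j : ℕ) * r ^ (l - j) := by
      rw [← pow_add, Nat.add_sub_cancel' (Nat.lt_succ_iff.1 j.2)]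
    rw [this]; ring
  refine (Finset.sum_le_sum fun l _ => h1 l).trans ?_
  rw [wn, wn, Finset.sum_mul_sum, ← Finset.sum_product', ← Finset.sum_biUnion]
  · refine Finset.sum_le_sum_of_subset_of_nonneg (fun p hp => ?_) fun p _ _ => by
      have := bn_nonneg p.1 s
      have := bn_nonneg p.2 t
      positivity
    simp only [Finset.mem_biUnion, Finset.mem_range, Finset.HasAntidiagonal.mem_antidiagonal] at hp
    obtain ⟨l, hl, h⟩ := hp
    simp only [Finset.mem_product, Finset.mem_range]
    omega
  · intro l _ l' _ hne
    refine Finset.disjoint_left.2 fun p hp hp' => hne ?_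
    rw [Finset.HasAntidiagonal.mem_antidiagonal] at hp hp'
    omega

theorem wn_multiset_prod_le {ι : Type*} (hr : 0 ≤ r) {f : ι → PS n} {C : ℝ}
    (h : ∀ i, wn N r (f i) ≤ C) (a : Multiset ι) :
    wn N r (a.map f).prod ≤ C ^ Multiset.card a := by
  induction a using Multiset.induction_on with
  | empty => simpa using wn_one_le
  | cons i a ih =>
    rw [Multiset.map_cons, Multiset.prod_cons, Multiset.card_cons, pow_succ']
    exact (wn_mul_le hr _ _).trans (mul_le_mul (h i) ih (wn_nonneg hr _)
      ((wn_nonneg hr _).trans (h i)))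

end PowerSeries

end NLR

namespace NLR
open Matrix Asymptotics

/-! ### Asymptotic expansions at the origin -/

section Expansions

variable {n : ℕ}

theorem isBigO_finset_sum {ι α : Type*} {S : Finset ι} {F : ι → α → ℝ} {g : α → ℝ} {l : Filter α}
    (h : ∀ i ∈ S, F i =O[l] g) : (fun x => ∑ i ∈ S, F i x) =O[l] g := by
  refine (IsBigO.sum h).congr_left fun x => ?_
  rw [Finset.sum_apply]

/-- The homogeneous part of degree `k` of a power series, as a function. -/
noncomputable def ev (k : ℕ) (s : PS n) (x : Fin n → ℝ) : ℝ := hom k s ⬝ᵥ powVec x k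

theorem ev_zero_series (k : ℕ) (x : Fin n → ℝ) : ev k (0 : PS n) x = 0 := by
  rw [ev, hom_zero, zero_dotProduct]

theorem ev_add (k : ℕ) (s t : PS n) (x : Fin n → ℝ) : ev k (s + t) x = ev k s x + ev k t x := by
  rw [ev, hom_add, add_dotProduct]; rfl

theorem ev_neg (k : ℕ) (s : PS n) (x : Fin n → ℝ) : ev k (-s) x = -ev k s x := by
  rw [ev, hom_neg, neg_dotProduct]; rfl

theorem ev_sub (k : ℕ) (s t : PS n) (x : Fin n → ℝ) : ev k (s - t) x = ev k s x - ev k t x := by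
  rw [ev, hom_sub, sub_dotProduct]; rfl

theorem ev_smul (k : ℕ) (c : ℝ) (s : PS n) (x : Fin n → ℝ) : ev k (c • s) x = c * ev k s x := by
  rw [ev, hom_smul, smul_dotProduct]; rfl

theorem abs_multiset_prod_le (x : Fin n → ℝ) (s : Multiset (Fin n)) :
    |(s.map x).prod| ≤ ‖x‖ ^ Multiset.card s := by
  induction s using Multiset.induction_on with
  | empty => simp
  | cons i s ih =>
    rw [Multiset.map_cons, Multiset.prod_cons, Multiset.card_cons, pow_succ', abs_mul]
    exact mul_le_mul (norm_le_pi_norm x i) ih (abs_nonneg _) (norm_nonneg _)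

theorem powVec_smul (t : ℝ) (x : Fin n → ℝ) (k : ℕ) : powVec (t • x) k = t ^ k • powVec x k := by
  ext a
  have : ∀ s : Multiset (Fin n), (s.map (t • x)).prod = t ^ Multiset.card s * (s.map x).prod := by
    intro s
    induction s using Multiset.induction_on with
    | empty => simp
    | cons i s ih =>
      rw [Multiset.map_cons, Multiset.prod_cons, ih, Multiset.card_cons, pow_succ',
        Multiset.map_cons, Multiset.prod_cons, Pi.smul_apply, smul_eq_mul]
      ring
  rw [powVec, this, a.2, Pi.smul_apply, powVec, smul_eq_mul]; ring

theorem ev_smul_point (k : ℕ) (s : PS n) (t : ℝ) (x : Fin n → ℝ) :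
    ev k s (t • x) = t ^ k * ev k s x := by
  rw [ev, powVec_smul, dotProduct_smul]; rfl

theorem abs_ev_le (k : ℕ) (s : PS n) (x : Fin n → ℝ) :
    |ev k s x| ≤ (∑ a : Sym (Fin n) k, |hom k s a| * mcoef a) * ‖x‖ ^ k := by
  rw [ev, dotProduct, Finset.sum_mul]
  refine (Finset.abs_sum_le_sum_abs _ _).trans (Finset.sum_le_sum fun a _ => ?_)
  have h := abs_multiset_prod_le x a.1
  rw [a.2] at h
  rw [abs_mul, powVec, abs_mul, abs_of_pos (mcoef_pos a), ← mul_assoc]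
  exact mul_le_mul_of_nonneg_left h (mul_nonneg (abs_nonneg _) (mcoef_pos a).le)

theorem ev_isBigO (k : ℕ) (s : PS n) : ev k s =O[𝓝 0] fun x => ‖x‖ ^ k :=
  IsBigO.of_bound _ (Eventually.of_forall fun x => by
    rw [Real.norm_eq_abs, Real.norm_of_nonneg (by positivity)]; exact abs_ev_le k s x)

theorem norm_pow_isBigO {N N' : ℕ} (h : N' ≤ N) :
    (fun x : Fin n → ℝ => ‖x‖ ^ N) =O[𝓝 0] fun x => ‖x‖ ^ N' := by
  refine IsBigO.of_bound 1 ?_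
  filter_upwards [Metric.ball_mem_nhds (0 : Fin n → ℝ) one_pos] with x hx
  rw [mem_ball_zero_iff] at hx
  rw [Real.norm_of_nonneg (by positivity), Real.norm_of_nonneg (by positivity), one_mul]
  exact pow_le_pow_of_le_one (norm_nonneg _) hx.le h

theorem ev_mul (l : ℕ) (s t : PS n) (x : Fin n → ℝ) :
    ev l (s * t) x = ∑ j ∈ Finset.range (l + 1), ev j s x * ev (l - j) t x := by
  rw [← Fin.sum_univ_eq_sum_range (fun j => ev j s x * ev (l - j) t x) (l + 1), ev, dotProduct]
  simp only [hom_mul, Finset.sum_mul]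
  rw [Finset.sum_comm]
  refine Finset.sum_congr rfl fun j _ => ?_
  have hj : l - j + j = l := Nat.sub_add_cancel (Nat.lt_succ_iff.1 j.2)
  have hR : ev j s x * ev (l - j) t x = ∑ b : Sym (Fin n) (l - j) × Sym (Fin n) j,
      hom j s b.2 * powVec x j b.2 * (hom (l - j) t b.1 * powVec x (l - j) b.1) := by
    rw [ev, ev, dotProduct, dotProduct, Finset.sum_mul_sum, Fintype.sum_prod_type_right]
  rw [hR, Finset.sum_comm]
  refine Finset.sum_congr rfl fun b _ => ?_
  have hcard : Multiset.card (b.1.1 + b.2.1) = l := by rw [Multiset.card_add, b.1.2, b.2.2, hj]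
  refine (Finset.sum_eq_single (Sym.mk (b.1.1 + b.2.1) hcard) ?_ ?_).trans ?_
  · intro c _ hc
    refine mul_eq_zero_of_left (mul_eq_zero_of_left (if_neg fun h => hc (Subtype.ext h)) _) _
  · intro h; exact absurd (Finset.mem_univ _) h
  · have h1 : powVec x l (Sym.mk (b.1.1 + b.2.1) hcard) =
        mcoef (Sym.mk (b.1.1 + b.2.1) hcard) * ((b.1.1.map x).prod * (b.2.1.map x).prod) := by
      rw [powVec, ← Multiset.prod_add, ← Multiset.map_add]
    have h2 := mcoef_ne_zero (Sym.mk (b.1.1 + b.2.1) hcard)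
    rw [h1]
    refine (congrArg (fun y => y * _ * _) (if_pos rfl)).trans ?_
    simp only [powVec]
    field_simp

/-- `f` has the expansion `s` up to an error of order `N`. -/
def Expands (N : ℕ) (f : (Fin n → ℝ) → ℝ) (s : PS n) : Prop :=
  (fun x => f x - ∑ k ∈ Finset.range N, ev k s x) =O[𝓝 0] fun x => ‖x‖ ^ N

variable {N : ℕ} {f g : (Fin n → ℝ) → ℝ} {s t : PS n}

theorem Expands.add (hf : Expands N f s) (hg : Expands N g t) :
    Expands N (fun x => f x + g x) (s + t) := by
  refine (IsBigO.add hf hg).congr_left fun x => ?_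
  simp only [ev_add, Finset.sum_add_distrib]; ring

theorem Expands.neg (hf : Expands N f s) : Expands N (fun x => -f x) (-s) := by
  refine (IsBigO.neg_left hf).congr_left fun x => ?_
  simp only [ev_neg, Finset.sum_neg_distrib]; ring

theorem Expands.sub (hf : Expands N f s) (hg : Expands N g t) :
    Expands N (fun x => f x - g x) (s - t) := by
  simpa only [sub_eq_add_neg] using hf.add hg.neg

theorem Expands.smul (c : ℝ) (hf : Expands N f s) : Expands N (fun x => c * f x) (c • s) := by
  refine (IsBigO.const_mul_left hf c).congr_left fun x => ?_
  simp only [ev_smul, ← Finset.mul_sum]; ring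

theorem expands_zero : Expands N (fun _ => 0) (0 : PS n) := by
  refine (isBigO_zero _ _).congr_left fun x => ?_
  simp [ev_zero_series]

theorem Expands.sum {ι : Type*} {S : Finset ι} {F : ι → (Fin n → ℝ) → ℝ} {T : ι → PS n}
    (h : ∀ i ∈ S, Expands N (F i) (T i)) : Expands N (fun x => ∑ i ∈ S, F i x) (∑ i ∈ S, T i) := by
  induction S using Finset.cons_induction with
  | empty => simpa using expands_zero
  | cons i S hi ih =>
    simp only [Finset.sum_cons]
    exact (h i (Finset.mem_cons_self i S)).add (ih fun j hj => h j (Finset.mem_cons_of_mem hj))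

theorem Expands.congr' (hf : Expands N f s) (h : f =ᶠ[𝓝 0] g) : Expands N g s :=
  IsBigO.congr' hf (h.mono fun x hx => by simp only [hx]) EventuallyEq.rfl

theorem Expands.of_isBigO_sub (hf : Expands N f s) (h : (fun x => g x - f x) =O[𝓝 0] fun x => ‖x‖ ^ N) :
    Expands N g s := (h.add hf).congr_left fun x => by ring

theorem isBigO_one_of_ev (k : ℕ) (s : PS n) : ev k s =O[𝓝 0] fun _ => (1 : ℝ) := by
  refine (ev_isBigO k s).trans ?_
  simpa using norm_pow_isBigO (n := n) (Nat.zero_le k)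

theorem Expands.isBigO_one (hf : Expands N f s) : f =O[𝓝 0] fun _ => (1 : ℝ) := by
  have h1 : (fun x => f x - ∑ k ∈ Finset.range N, ev k s x) =O[𝓝 0] fun _ => (1 : ℝ) :=
    IsBigO.trans (g := fun x => ‖x‖ ^ N) hf (by simpa using norm_pow_isBigO (n := n) (Nat.zero_le N))
  refine (h1.add (isBigO_finset_sum (S := Finset.range N) fun k _ => isBigO_one_of_ev k s)).congr_left
    fun x => by ring

/-- The product of two truncations differs from the truncated product only by terms of degree at
least `N`, so expansions multiply like formal series. -/
theorem sum_range_ev_mul_sub (N : ℕ) (s t : PS n) (x : Fin n → ℝ) :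
    (∑ i ∈ Finset.range N, ev i s x) * (∑ j ∈ Finset.range N, ev j t x) -
      ∑ l ∈ Finset.range N, ev l (s * t) x =
      ∑ p ∈ (Finset.range N ×ˢ Finset.range N) with ¬ p.1 + p.2 < N, ev p.1 s x * ev p.2 t x := by
  have h1 : ∑ l ∈ Finset.range N, ev l (s * t) x =
      ∑ p ∈ (Finset.range N ×ˢ Finset.range N) with p.1 + p.2 < N, ev p.1 s x * ev p.2 t x := by
    have h2 : ∀ l, ev l (s * t) x =
        ∑ p ∈ Finset.HasAntidiagonal.antidiagonal l, ev p.1 s x * ev p.2 t x := fun l => by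
      rw [ev_mul, Finset.Nat.sum_antidiagonal_eq_sum_range_succ fun i j => ev i s x * ev j t x]
    simp only [h2]
    rw [← Finset.sum_biUnion]
    · refine Finset.sum_congr ?_ fun _ _ => rfl
      ext p
      simp only [Finset.mem_biUnion, Finset.mem_range, Finset.HasAntidiagonal.mem_antidiagonal,
        Finset.mem_filter, Finset.mem_product]
      constructor
      · rintro ⟨l, hl, h⟩; omega
      · intro h; exact ⟨_, h.2, rfl⟩
    · intro l _ l' _ hne
      refine Finset.disjoint_left.2 fun p hp hp' => hne ?_
      rw [Finset.HasAntidiagonal.mem_antidiagonal] at hp hp'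
      omega
  rw [h1, Finset.sum_mul_sum, ← Finset.sum_product',
    ← Finset.sum_filter_add_sum_filter_not _ (fun p : ℕ × ℕ => p.1 + p.2 < N)]
  ring

theorem Expands.mul (hf : Expands N f s) (hg : Expands N g t) :
    Expands N (fun x => f x * g x) (s * t) := by
  have h1 : (fun x => f x * (g x - ∑ k ∈ Finset.range N, ev k t x)) =O[𝓝 0] fun x => ‖x‖ ^ N := by
    simpa using hf.isBigO_one.mul hg
  have ht : (fun x => ∑ k ∈ Finset.range N, ev k t x) =O[𝓝 0] fun _ => (1 : ℝ) :=
    isBigO_finset_sum fun k _ => isBigO_one_of_ev k t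
  have h2 : (fun x => (f x - ∑ k ∈ Finset.range N, ev k s x) * ∑ k ∈ Finset.range N, ev k t x)
      =O[𝓝 0] fun x => ‖x‖ ^ N := by simpa using IsBigO.mul hf ht
  have h3 : (fun x => ∑ p ∈ (Finset.range N ×ˢ Finset.range N) with ¬ p.1 + p.2 < N,
      ev p.1 s x * ev p.2 t x) =O[𝓝 0] fun x => ‖x‖ ^ N := by
    refine isBigO_finset_sum fun p hp => ?_
    rw [Finset.mem_filter] at hp
    refine ((ev_isBigO p.1 s).mul (ev_isBigO p.2 t)).trans ?_
    simp only [← pow_add]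
    exact norm_pow_isBigO (not_lt.1 hp.2)
  refine ((h1.add h2).add h3).congr_left fun x => ?_
  rw [← sum_range_ev_mul_sub]; ring

theorem expands_one : Expands N (fun _ => 1) (1 : PS n) := by
  have h : ∀ N : ℕ, ∀ x : Fin n → ℝ, ∑ k ∈ Finset.range (N + 1), ev k (1 : PS n) x = 1 := by
    intro N x
    rw [Finset.sum_range_succ', Finset.sum_eq_zero, zero_add, ev, dotProduct,
      Fintype.sum_eq_single (Sym.nil : Sym (Fin n) 0) fun a ha => absurd (Subsingleton.elim _ _) ha,
      hom_zero_one]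
    · have := mcoef_sq (Sym.nil : Sym (Fin n) 0)
      rw [powVec, mcoef]; simp [Sym.nil]
    · intro k _
      rw [ev, hom_one_of_pos (Nat.succ_ne_zero k), zero_dotProduct]
  rcases N with _ | N
  · refine (isBigO_const_const (1 : ℝ) one_ne_zero _).congr (fun x => ?_) (fun x => ?_) <;> simp
  · refine (isBigO_zero _ _).congr_left fun x => ?_
    rw [h, sub_self]

theorem Expands.multiset_prod {ι : Type*} {F : ι → (Fin n → ℝ) → ℝ} {T : ι → PS n}
    (h : ∀ i, Expands N (F i) (T i)) (a : Multiset ι) :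
    Expands N (fun x => (a.map fun i => F i x).prod) (a.map T).prod := by
  induction a using Multiset.induction_on with
  | empty => simpa using expands_one
  | cons i a ih =>
    simp only [Multiset.map_cons, Multiset.prod_cons]
    exact (h i).mul ih

theorem Expands.isBigO_of_lowOrd {N' : ℕ} (hN : N' ≤ N) (hf : Expands N f s) (h : LowOrd N' s) :
    f =O[𝓝 0] fun x => ‖x‖ ^ N' := by
  have h1 : (fun x => ∑ k ∈ Finset.range N, ev k s x) =O[𝓝 0] fun x => ‖x‖ ^ N' := by
    refine isBigO_finset_sum fun k _ => ?_
    rcases lt_or_ge k N' with hk | hk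
    · refine (isBigO_zero _ _).congr_left fun x => ?_
      rw [ev, h k hk, zero_dotProduct]
    · exact (ev_isBigO k s).trans (norm_pow_isBigO hk)
  exact ((IsBigO.trans hf (norm_pow_isBigO hN)).add h1).congr_left fun x => by ring

theorem Expands.mono {N' : ℕ} (hN : N' ≤ N) (hf : Expands N f s) : Expands N' f s := by
  have h1 : (fun x => ∑ k ∈ Finset.range N with ¬ k < N', ev k s x) =O[𝓝 0] fun x => ‖x‖ ^ N' := by
    refine isBigO_finset_sum fun k hk => ?_
    rw [Finset.mem_filter] at hk
    exact (ev_isBigO k s).trans (norm_pow_isBigO (not_lt.1 hk.2))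
  refine ((IsBigO.trans hf (norm_pow_isBigO hN)).add h1).congr_left fun x => ?_
  rw [← Finset.sum_filter_add_sum_filter_not (Finset.range N) (fun k => k < N')]
  have : (Finset.range N).filter (fun k => k < N') = Finset.range N' := by
    ext k; simp only [Finset.mem_filter, Finset.mem_range]; omega
  rw [this]; ring

/-- The weaker estimate of one order less removes the lower coefficients by induction. What is left
is `c t ^ N = O(t ^ (N + 1))`; divide by `t ^ N` and let `t` decrease to zero. -/
theorem eq_zero_of_polynomial_isBigO {N : ℕ} {c : ℕ → ℝ}
    (h : (fun t : ℝ => ∑ k ∈ Finset.range N, c k * t ^ k) =O[𝓝 0] fun t => ‖t‖ ^ N) :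
    ∀ k < N, c k = 0 := by
  induction N with
  | zero => intro k hk; exact absurd hk (Nat.not_lt_zero k)
  | succ N ih =>
    have hp : (fun t : ℝ => ‖t‖ ^ (N + 1)) =O[𝓝 0] fun t => ‖t‖ ^ N := by
      refine IsBigO.of_bound 1 ?_
      filter_upwards [Metric.ball_mem_nhds (0 : ℝ) one_pos] with x hx
      rw [mem_ball_zero_iff] at hx
      rw [norm_pow, norm_pow, norm_norm, one_mul]
      exact pow_le_pow_of_le_one (norm_nonneg _) hx.le N.le_succ
    have h1 : (fun t : ℝ => c N * t ^ N) =O[𝓝 0] fun t => ‖t‖ ^ N :=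
      IsBigO.const_mul_left (IsBigO.of_bound 1 (Eventually.of_forall fun t => by simp)) _
    have h2 : ∀ k < N, c k = 0 := ih (((h.trans hp).sub h1).congr_left fun t => by
      rw [Finset.sum_range_succ]; ring)
    have h3 : (fun t : ℝ => c N * t ^ N) =O[𝓝 0] fun t => ‖t‖ ^ (N + 1) := by
      refine h.congr_left fun t => ?_
      rw [Finset.sum_range_succ, Finset.sum_eq_zero fun k hk => ?_, zero_add]
      rw [h2 k (Finset.mem_range.1 hk), zero_mul]
    have h4 : c N = 0 := by
      obtain ⟨C, hC⟩ := h3.bound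
      by_contra hne
      have h5 : ∀ᶠ t : ℝ in 𝓝[>] 0, |c N| ≤ C * t := by
        filter_upwards [nhdsWithin_le_nhds hC, self_mem_nhdsWithin] with t ht ht0
        have ht0' : (0 : ℝ) < t := ht0
        rw [norm_mul, norm_pow, norm_pow, norm_norm, Real.norm_of_nonneg ht0'.le, pow_succ,
          Real.norm_eq_abs] at ht
        have := pow_pos ht0' N
        refine le_of_mul_le_mul_right (ht.trans (le_of_eq ?_)) this
        ring
      have h6 : Tendsto (fun t : ℝ => C * t) (𝓝[>] 0) (𝓝 0) := by
        have : Tendsto (fun t : ℝ => C * t) (𝓝 0) (𝓝 (C * 0)) :=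
          (continuous_const.mul continuous_id).tendsto 0
        rw [mul_zero] at this
        exact this.mono_left nhdsWithin_le_nhds
      exact absurd (ge_of_tendsto h6 h5) (not_le.2 (abs_pos.2 hne))
    intro k hk
    rcases Nat.lt_succ_iff_lt_or_eq.1 hk with hk | rfl
    · exact h2 k hk
    · exact h4

theorem hom_eq_zero_of_ev {k : ℕ} (h : ∀ x, ev k s x = 0) : hom k s = 0 := by
  set p : MvPolynomial (Fin n) ℝ := ∑ a : Sym (Fin n) k,
    MvPolynomial.monomial (Multiset.toFinsupp a.1) (hom k s a * mcoef a) with hp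
  have hev : ∀ x, MvPolynomial.eval x p = ev k s x := by
    intro x
    rw [hp, map_sum, ev, dotProduct]
    refine Finset.sum_congr rfl fun a _ => ?_
    rw [MvPolynomial.eval_monomial, powVec, mul_assoc]
    congr 2
    rw [Finset.prod_multiset_map_count, Finsupp.prod, Multiset.toFinsupp_support]
    rfl
  have hp0 : p = 0 := MvPolynomial.funext fun x => by rw [hev, h, map_zero]
  ext a
  have h1 := congrArg (MvPolynomial.coeff (Multiset.toFinsupp a.1)) hp0
  rw [hp, MvPolynomial.coeff_sum, MvPolynomial.coeff_zero] at h1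
  simp only [MvPolynomial.coeff_monomial] at h1
  rw [Finset.sum_eq_single a] at h1
  · rw [if_pos rfl] at h1
    exact (mul_eq_zero.1 h1).resolve_right (mcoef_ne_zero a)
  · intro b _ hb
    exact if_neg fun h => hb (Subtype.ext (Multiset.toFinsupp.injective h))
  · intro h; exact absurd (Finset.mem_univ _) h

/-- Homogeneous parts of an expansion which is small. -/
theorem Expands.lowOrd_of_isBigO (hf : Expands N f s) (h : f =O[𝓝 0] fun x => ‖x‖ ^ N) :
    LowOrd N s := by
  have h1 : (fun x => ∑ k ∈ Finset.range N, ev k s x) =O[𝓝 0] fun x => ‖x‖ ^ N :=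
    (h.sub hf).congr_left fun x => by ring
  intro k hk
  refine hom_eq_zero_of_ev fun x => ?_
  -- On the ray `t ↦ t • x` the homogeneous parts become monomials in `t`.
  have hc : Tendsto (fun t : ℝ => t • x) (𝓝 0) (𝓝 0) := by
    have : Tendsto (fun t : ℝ => t • x) (𝓝 0) (𝓝 ((0 : ℝ) • x)) :=
      (continuous_id.smul continuous_const).tendsto 0
    rwa [zero_smul] at this
  refine eq_zero_of_polynomial_isBigO (c := fun k => ev k s x) (N := N) ?_ k hk
  have h2 := h1.comp_tendsto hc
  refine (h2.congr_left fun t => ?_).trans ?_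
  · simp only [Function.comp_apply, ev_smul_point]
    exact Finset.sum_congr rfl fun k _ => mul_comm _ _
  · refine IsBigO.of_bound (‖x‖ ^ N) (Eventually.of_forall fun t => ?_)
    simp only [Function.comp_apply, norm_smul, norm_pow, norm_mul, norm_norm, mul_pow]
    exact le_of_eq (mul_comm _ _)

theorem Expands.hom_eq (hs : Expands N f s) (ht : Expands N f t) {k : ℕ} (hk : k < N) :
    hom k s = hom k t := by
  have h := hs.sub ht
  simp only [sub_self] at h
  have := h.lowOrd_of_isBigO (isBigO_zero _ _) k hk
  rwa [hom_sub, sub_eq_zero] at this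

end Expansions

end NLR

namespace NLR
open Matrix Asymptotics

/-! ### Taylor series of analytic functions -/

section Taylor

variable {n : ℕ}

/-- Both tuples have the same sorted list. With the symmetry of higher derivatives this makes Taylor
coefficients depend on the multi-index only. -/
theorem exists_perm_of_ofFn_eq {α : Type*} [LinearOrder α] {k : ℕ} {v w : Fin k → α}
    (h : (List.ofFn v : Multiset α) = List.ofFn w) : ∃ σ : Equiv.Perm (Fin k), v = w ∘ σ := by
  have hs : ∀ u : Fin k → α, (List.ofFn (u ∘ Tuple.sort u)).SortedLE ∧
      (List.ofFn (u ∘ Tuple.sort u)).Perm (List.ofFn u) := fun u =>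
    ⟨(Tuple.monotone_sort u).sortedLE_ofFn, Equiv.Perm.ofFn_comp_perm _ _⟩
  have h1 := List.Perm.eq_of_sortedLE (hs v).1 (hs w).1
    ((hs v).2.trans ((Multiset.coe_eq_coe.1 h).trans (hs w).2.symm))
  have h2 : v ∘ Tuple.sort v = w ∘ Tuple.sort w := List.ofFn_injective h1
  refine ⟨(Tuple.sort v).symm.trans (Tuple.sort w), ?_⟩
  ext i
  have h3 := congrFun h2 ((Tuple.sort v).symm i)
  simpa using h3

/-- The value of the iterated derivative at basis vectors depends only on the multi-index. -/
theorem iteratedFDeriv_single_eq {f : (Fin n → ℝ) → ℝ} (hf : AnalyticAt ℝ f 0) {k : ℕ}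
    (a : Sym (Fin n) k) (v : Fin k → Fin n) (h : (List.ofFn v : Multiset (Fin n)) = a.1) :
    iteratedFDeriv ℝ k f 0 (fun j => Pi.single (v j) 1) =
      iteratedFDeriv ℝ k f 0 fun j : Fin k => Pi.single
        (a.1.toList.get (j.cast (by rw [Multiset.length_toList]; exact a.2.symm))) 1 := by
  have hl : k = a.1.toList.length := by rw [Multiset.length_toList]; exact a.2.symm
  have h2 : (List.ofFn (fun j : Fin k => a.1.toList.get (j.cast hl)) : Multiset (Fin n)) = a.1 := by
    conv_rhs => rw [← Multiset.coe_toList a.1]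
    congr 1
    refine List.ext_get (by simp) fun i h1 h2 => ?_
    simp only [List.get_eq_getElem, List.getElem_ofFn]
    rfl
  obtain ⟨σ, hσ⟩ := exists_perm_of_ofFn_eq (h.trans h2.symm)
  have h3 := (hf.contDiffAt (n := ⊤)).iteratedFDeriv_comp_perm
    (fun j : Fin k => (Pi.single (a.1.toList.get (j.cast hl)) 1 : Fin n → ℝ)) σ
  rw [← h3]
  congr 1
  ext1 j
  rw [hσ]
  rfl

theorem taylor_eq_of_ofFn {f : (Fin n → ℝ) → ℝ} (hf : AnalyticAt ℝ f 0) {k : ℕ}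
    (a : Sym (Fin n) k) (v : Fin k → Fin n) (h : (List.ofFn v : Multiset (Fin n)) = a.1) :
    taylor f k a = mcoef a / (k.factorial : ℝ) *
      iteratedFDeriv ℝ k f 0 (fun j => Pi.single (v j) 1) := by
  rw [iteratedFDeriv_single_eq hf a v h]; rfl

theorem exists_ofFn_eq {k : ℕ} (a : Sym (Fin n) k) :
    ∃ v : Fin k → Fin n, (List.ofFn v : Multiset (Fin n)) = a.1 := by
  have hl : k = a.1.toList.length := by rw [Multiset.length_toList]; exact a.2.symm
  refine ⟨fun j : Fin k => a.1.toList.get (j.cast hl), ?_⟩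
  conv_rhs => rw [← Multiset.coe_toList a.1]
  congr 1
  refine List.ext_get (by simp) fun i h1 h2 => ?_
  simp only [List.get_eq_getElem, List.getElem_ofFn]
  rfl

/-- The Taylor series. -/
noncomputable def tay (f : (Fin n → ℝ) → ℝ) : PS n := ofHom (taylor f)

theorem hom_tay (f : (Fin n → ℝ) → ℝ) (k : ℕ) : hom k (tay f) = taylor f k := hom_ofHom _ k

/-- Expanding the multilinear derivative at `(x, …, x)` gives a sum over tuples of indices. There
are `mcoef a ^ 2` tuples with multi-index `a`; one factor `mcoef a` goes into the Taylor coefficient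
and one into `powVec`. -/
theorem ev_tay {f : (Fin n → ℝ) → ℝ} (hf : AnalyticAt ℝ f 0) (k : ℕ) (x : Fin n → ℝ) :
    ev k (tay f) x = (k.factorial : ℝ)⁻¹ * iteratedFDeriv ℝ k f 0 (fun _ => x) := by
  have hx : x = ∑ i, x i • (Pi.single i 1 : Fin n → ℝ) := by
    ext j; simp [Finset.sum_apply, Pi.single_apply]
  have h1 : iteratedFDeriv ℝ k f 0 (fun _ => x) = ∑ v : Fin k → Fin n,
      (∏ j, x (v j)) * iteratedFDeriv ℝ k f 0 (fun j => Pi.single (v j) 1) := by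
    conv_lhs => rw [hx]
    rw [ContinuousMultilinearMap.map_sum]
    refine Finset.sum_congr rfl fun v _ => ?_
    rw [ContinuousMultilinearMap.map_smul_univ, smul_eq_mul]
  set F : Multiset (Fin n) → ℝ := fun s => if h : Multiset.card s = k then
    (s.map x).prod * (taylor f k (Sym.mk s h) / mcoef (Sym.mk s h)) else 0 with hF
  have h2 : ∀ v : Fin k → Fin n, (∏ j, x (v j)) *
      iteratedFDeriv ℝ k f 0 (fun j => Pi.single (v j) 1) =
      k.factorial * F (Multiset.ofList (List.ofFn v)) := by
    intro v
    have hc : Multiset.card (Multiset.ofList (List.ofFn v)) = k := by simp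
    rw [hF]
    simp only [dif_pos hc]
    rw [taylor_eq_of_ofFn hf (Sym.mk _ hc) v rfl]
    have h3 : (Multiset.map x (Multiset.ofList (List.ofFn v))).prod = ∏ j, x (v j) := by
      simp [List.map_ofFn, List.prod_ofFn]
    have h4 := mcoef_ne_zero (Sym.mk (Multiset.ofList (List.ofFn v)) hc)
    have h5 : (k.factorial : ℝ) ≠ 0 := by positivity
    rw [h3]; field_simp
  rw [h1, Finset.sum_congr rfl fun v _ => h2 v, ← Finset.mul_sum, sum_tuple_eq, ← mul_assoc,
    inv_mul_cancel₀ (by positivity), one_mul, ev, hom_tay, dotProduct]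
  refine Finset.sum_congr rfl fun a _ => ?_
  have h6 : F a.1 = (a.1.map x).prod * (taylor f k a / mcoef a) := dif_pos a.2
  have h7 := mcoef_ne_zero a
  rw [h6, powVec, smul_eq_mul]; field_simp

theorem expands_tay {f : (Fin n → ℝ) → ℝ} (hf : AnalyticAt ℝ f 0) (N : ℕ) : Expands N f (tay f) := by
  obtain ⟨p, hp⟩ := hf
  have h := hp.isBigO_sub_partialSum_pow N
  obtain ⟨r, hr⟩ := hp
  refine h.congr_left fun x => ?_
  rw [zero_add, FormalMultilinearSeries.partialSum]
  congr 1
  refine Finset.sum_congr rfl fun k _ => ?_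
  rw [ev_tay hr.analyticAt, ← hr.factorial_smul, nsmul_eq_mul, ← mul_assoc,
    inv_mul_cancel₀ (by positivity), one_mul]

theorem hasSum_ev_tay {f : (Fin n → ℝ) → ℝ} (hf : AnalyticAt ℝ f 0) :
    ∀ᶠ x in 𝓝 (0 : Fin n → ℝ), HasSum (fun k => ev k (tay f) x) (f x) := by
  have hf' := hf
  obtain ⟨p, r, hr⟩ := hf'
  filter_upwards [Metric.eball_mem_nhds (0 : Fin n → ℝ) hr.r_pos] with x hx
  have h := hr.hasSum_iteratedFDeriv hx
  rw [zero_add] at h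
  refine h.congr_fun fun k => ?_
  rw [ev_tay hf, smul_eq_mul]

/-- An analytic function with vanishing expansion is zero near the origin. -/
theorem eventually_eq_zero_of_tay {f : (Fin n → ℝ) → ℝ} (hf : AnalyticAt ℝ f 0)
    (h : ∀ k, hom k (tay f) = 0) : ∀ᶠ x in 𝓝 (0 : Fin n → ℝ), f x = 0 := by
  filter_upwards [hasSum_ev_tay hf] with x hx
  refine hx.unique ?_
  simp only [ev, h, zero_dotProduct]
  exact hasSum_zero

theorem Expands.hom_tay_eq {f : (Fin n → ℝ) → ℝ} {s : PS n} {N k : ℕ} (h : Expands N f s)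
    (hf : AnalyticAt ℝ f 0) (hk : k < N) : hom k s = taylor f k := by
  rw [← hom_tay]; exact h.hom_eq (expands_tay hf N) hk

/-- The Taylor coefficients of an analytic function grow at most geometrically. -/
theorem exists_bn_tay_le {f : (Fin n → ℝ) → ℝ} (hf : AnalyticAt ℝ f 0) :
    ∃ C ρ : ℝ, 0 < C ∧ 0 < ρ ∧ ∀ k, bn k (tay f) ≤ C * ρ ^ k := by
  have hf' := hf
  obtain ⟨p, r, hr⟩ := hf'
  obtain ⟨r', hr'0, hr'⟩ : ∃ r' : NNReal, 0 < r' ∧ (r' : ENNReal) < p.radius := by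
    obtain ⟨q, hq0, hq⟩ := ENNReal.lt_iff_exists_nnreal_btwn.1 (hr.r_pos.trans_le hr.r_le)
    exact ⟨q, by exact_mod_cast hq0, hq⟩
  obtain ⟨C, hC, hp⟩ := p.norm_mul_pow_le_of_lt_radius hr'
  have hr0 : (0 : ℝ) < r' := by exact_mod_cast hr'0
  -- Each coefficient is at most `mcoef a * (C / r' ^ k)`, and the squares of `mcoef` add up to `n ^
  -- k`, whence a factor `√n` per degree. Using `n + 1` keeps the rate positive when `n = 0`.
  refine ⟨C, Real.sqrt (n + 1) / r', hC, by positivity, fun k => ?_⟩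
  have h1 : ∀ a : Sym (Fin n) k, |taylor f k a| ≤ mcoef a * (C / r' ^ k) := by
    intro a
    obtain ⟨v, hv⟩ := exists_ofFn_eq a
    rw [taylor_eq_of_ofFn hf a v hv, abs_mul, abs_of_nonneg (div_nonneg (mcoef_pos a).le (by positivity)),
      div_mul_eq_mul_div, mul_div_assoc]
    refine mul_le_mul_of_nonneg_left ?_ (mcoef_pos a).le
    rw [div_le_iff₀ (by positivity), hr.iteratedFDeriv_eq_sum_of_completeSpace]
    refine (Finset.abs_sum_le_sum_abs _ _).trans ?_
    have h2 : ∀ σ ∈ (Finset.univ : Finset (Equiv.Perm (Fin k))),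
        |p k fun i => (Pi.single (v (σ i)) 1 : Fin n → ℝ)| ≤ C / r' ^ k := by
      intro σ _
      have h3 := (p k).le_opNorm fun i => (Pi.single (v (σ i)) 1 : Fin n → ℝ)
      have h4 : ∀ i : Fin n, ‖(Pi.single i 1 : Fin n → ℝ)‖ = 1 := fun i => by
        rw [Pi.norm_single, norm_one]
      simp only [h4, Finset.prod_const_one, mul_one] at h3
      refine h3.trans ?_
      rw [le_div_iff₀ (by positivity)]
      exact hp k
    refine (Finset.sum_le_sum h2).trans (le_of_eq ?_)
    rw [Finset.sum_const, Finset.card_univ, Fintype.card_perm, Fintype.card_fin, nsmul_eq_mul,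
      mul_comm]
  rw [bn, hom_tay]
  refine l2_le_of_sq_le (by positivity) ?_
  have h5 : ∀ a ∈ (Finset.univ : Finset (Sym (Fin n) k)),
      taylor f k a ^ 2 ≤ mcoef a ^ 2 * (C / r' ^ k) ^ 2 := by
    intro a _
    rw [← mul_pow, ← sq_abs]
    exact pow_le_pow_left₀ (abs_nonneg _) (h1 a) 2
  refine (Finset.sum_le_sum h5).trans ?_
  have h6 : (C * (Real.sqrt (n + 1) / r') ^ k) ^ 2 = ((n : ℝ) + 1) ^ k * (C / r' ^ k) ^ 2 := by
    have h7 : Real.sqrt ((n : ℝ) + 1) ^ 2 = n + 1 := Real.sq_sqrt (by positivity)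
    generalize Real.sqrt ((n : ℝ) + 1) = w at h7
    rw [div_pow, ← h7, mul_pow, div_pow, div_pow, ← pow_mul w 2 k, ← pow_mul w k 2, mul_comm k 2]
    ring
  rw [← Finset.sum_mul, sum_mcoef_sq, h6]
  gcongr
  linarith

/-- A power series with geometrically bounded coefficients converges to an analytic function. -/
theorem exists_analytic_of_bn_le {s : PS n} {C ρ : ℝ} (hρ : 0 < ρ) (h : ∀ k, bn k s ≤ C * ρ ^ k) :
    ∃ f : (Fin n → ℝ) → ℝ, AnalyticAt ℝ f 0 ∧ tay f = s := by
  choose idx hidx using fun (k : ℕ) (a : Sym (Fin n) k) => exists_ofFn_eq a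
  -- An arbitrary ordering of each multi-index is chosen, so these multilinear maps need not be
  -- symmetric. Only their diagonal values matter, and those are the homogeneous parts of `s`.
  let P : FormalMultilinearSeries ℝ (Fin n → ℝ) ℝ := fun k =>
    ∑ a : Sym (Fin n) k, (hom k s a * mcoef a) •
      (ContinuousMultilinearMap.mkPiAlgebra ℝ (Fin k) ℝ).compContinuousLinearMap
        (fun j => ContinuousLinearMap.proj (R := ℝ) (φ := fun _ : Fin n => ℝ) (idx k a j))
  have hPapp : ∀ k (v : Fin k → Fin n → ℝ), P k v =
      ∑ a : Sym (Fin n) k, (hom k s a * mcoef a) * ∏ j, v j (idx k a j) := by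
    intro k v
    simp only [P, _root_.sum_apply, _root_.smul_apply,
      smul_eq_mul]
    rfl
  have hdiag : ∀ k x, P k (fun _ => x) = ev k s x := by
    intro k x
    rw [hPapp, ev, dotProduct]
    refine Finset.sum_congr rfl fun a _ => ?_
    rw [powVec, mul_assoc, ← hidx k a]
    simp [List.map_ofFn, List.prod_ofFn]
  have hnorm : ∀ k, ‖P k‖ ≤ Real.sqrt ((n : ℝ) ^ k) * bn k s := by
    intro k
    have h1 : ‖P k‖ ≤ ∑ a : Sym (Fin n) k, mcoef a * |hom k s a| := by
      refine ContinuousMultilinearMap.opNorm_le_bound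
        (Finset.sum_nonneg fun a _ => mul_nonneg (mcoef_pos a).le (abs_nonneg _)) fun v => ?_
      rw [hPapp, Finset.sum_mul]
      refine (norm_sum_le _ _).trans (Finset.sum_le_sum fun a _ => ?_)
      rw [norm_mul, norm_mul, Real.norm_of_nonneg (mcoef_pos a).le, Real.norm_eq_abs,
        mul_comm (|hom k s a|), norm_prod]
      refine mul_le_mul_of_nonneg_left ?_ (mul_nonneg (mcoef_pos a).le (abs_nonneg _))
      exact Finset.prod_le_prod (fun _ _ => norm_nonneg _) fun j _ => norm_le_pi_norm _ _
    have h2 := abs_dotProduct_le (fun a : Sym (Fin n) k => mcoef a) (fun a => |hom k s a|)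
    have h3 : l2 (fun a : Sym (Fin n) k => mcoef a) = Real.sqrt ((n : ℝ) ^ k) := by
      rw [← sum_mcoef_sq, ← l2_sq, Real.sqrt_sq (l2_nonneg _)]
    have h4 : l2 (fun a => |hom k s a|) = bn k s := by
      have : l2 (fun a => |hom k s a|) ^ 2 = bn k s ^ 2 := by
        rw [bn, l2_sq, l2_sq]; simp only [sq_abs]
      exact (pow_left_inj₀ (l2_nonneg _) (bn_nonneg _ _) two_ne_zero).1 this
    rw [h3, h4] at h2
    exact h1.trans ((le_abs_self _).trans h2)
  have hrad : 0 < P.radius := by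
    set q : ℝ := (ρ * Real.sqrt (n + 1))⁻¹ with hq
    have hq0 : 0 < q := by positivity
    refine lt_of_lt_of_le ?_ (P.le_radius_of_bound C (r := ⟨q, hq0.le⟩) fun k => ?_)
    · exact ENNReal.coe_pos.2 (show (0 : NNReal) < ⟨q, hq0.le⟩ from hq0)
    · have hC : 0 ≤ C := by
        have := (bn_nonneg 0 s).trans (h 0)
        simpa using this
      have h1 : Real.sqrt ((n : ℝ) ^ k) ≤ Real.sqrt (n + 1) ^ k := by
        refine Real.sqrt_le_iff.2 ⟨by positivity, ?_⟩
        rw [← pow_mul, mul_comm k 2, pow_mul, Real.sq_sqrt (by positivity)]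
        exact pow_le_pow_left₀ (by positivity) (by linarith) k
      calc ‖P k‖ * q ^ k ≤ (Real.sqrt (n + 1) ^ k * (C * ρ ^ k)) * q ^ k := by
            refine mul_le_mul_of_nonneg_right ((hnorm k).trans ?_) (by positivity)
            exact mul_le_mul h1 (h k) (bn_nonneg _ _) (by positivity)
        _ = C * ((ρ * Real.sqrt (n + 1)) * q) ^ k := by rw [mul_pow, mul_pow]; ring
        _ = C := by rw [hq, mul_inv_cancel₀ (by positivity), one_pow, mul_one]
  have hP := P.hasFPowerSeriesOnBall hrad
  refine ⟨P.sum, hP.analyticAt, ps_ext fun k => ?_⟩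
  -- Because `P` need not be symmetric, the Taylor coefficients of its sum are found through
  -- uniqueness of expansions.
  have hE : Expands (k + 1) P.sum s := by
    refine (hP.hasFPowerSeriesAt.isBigO_sub_partialSum_pow (k + 1)).congr_left fun x => ?_
    rw [zero_add, FormalMultilinearSeries.partialSum]
    simp only [hdiag]
  rw [hom_tay]
  exact (hE.hom_tay_eq hP.analyticAt k.lt_succ_self).symm

/-! ### Gradients -/

theorem AnalyticAt.grad {f : (Fin n → ℝ) → ℝ} (hf : AnalyticAt ℝ f 0) (i : Fin n) :
    AnalyticAt ℝ (fun x => NLR.grad f x i) 0 :=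
  ((ContinuousLinearMap.apply ℝ ℝ (Pi.single i 1 : Fin n → ℝ)).analyticAt _).comp hf.fderiv

/-- The coefficient at `b` of the partial derivative in direction `i` is the mixed derivative for
`b` with `i` added. The entry of `K_kᵀ` accounts for the change of `mcoef`, the factor `k + 1` for
the change of the factorial. -/
theorem taylor_grad {f : (Fin n → ℝ) → ℝ} (hf : AnalyticAt ℝ f 0) (i : Fin n) (k : ℕ)
    (b : Sym (Fin n) k) :
    taylor (fun x => NLR.grad f x i) k b =
      (k + 1) * ((redOne n k)ᵀ *ᵥ taylor f (k + 1)) (b, i) := by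
  obtain ⟨v, hv⟩ := exists_ofFn_eq b
  have hw : (List.ofFn (Fin.snoc v i : Fin (k + 1) → Fin n) : Multiset (Fin n)) = (i ::ₛ b).1 := by
    rw [List.ofFn_succ']
    simp only [Fin.snoc_castSucc, Fin.snoc_last, List.concat_eq_append]
    rw [← Multiset.coe_add, Multiset.coe_singleton, add_comm, Multiset.singleton_add, hv]
    rfl
  rw [redOne_transpose_mulVec_apply, taylor_eq_of_ofFn (AnalyticAt.grad hf i) b v hv,
    taylor_eq_of_ofFn hf (i ::ₛ b) _ hw]
  have h1 : iteratedFDeriv ℝ k (fun x => NLR.grad f x i) 0 (fun j => Pi.single (v j) 1) =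
      iteratedFDeriv ℝ (k + 1) f 0
        (fun j => Pi.single ((Fin.snoc v i : Fin (k + 1) → Fin n) j) 1) := by
    rw [iteratedFDeriv_succ_apply_right]
    have h2 := ((hf.fderiv.contDiffAt (n := ⊤)).of_le le_top : ContDiffAt ℝ k (fderiv ℝ f) 0)
    have h3 := (ContinuousLinearMap.apply ℝ ℝ (Pi.single i 1 : Fin n → ℝ)).iteratedFDeriv_comp_left
      h2 (i := k) le_rfl
    have h4 : (fun x => NLR.grad f x i) =
      (ContinuousLinearMap.apply ℝ ℝ (Pi.single i 1 : Fin n → ℝ)) ∘ fderiv ℝ f := rfl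
    rw [h4, h3]
    simp only [ContinuousLinearMap.compContinuousMultilinearMap_coe, Function.comp_apply,
      ContinuousLinearMap.apply_apply, Fin.snoc_last]
    congr 2
    ext j
    simp [Fin.init]
  rw [h1, Nat.factorial_succ]
  have := mcoef_ne_zero (i ::ₛ b)
  push_cast
  field_simp

end Taylor

end NLR

namespace NLR
open Matrix Asymptotics

/-! ### Linear power series -/

section Linear

variable {n : ℕ}

theorem hom_X_mul (j : Fin n) (s : PS n) (k : ℕ) (c : Sym (Fin n) (k + 1)) :
    hom (k + 1) (MvPowerSeries.X j * s) c =
      ∑ b : Sym (Fin n) k, redOne n k c (b, j) * hom k s b := by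
  have hc : MvPowerSeries.coeff (Multiset.toFinsupp c.1) (MvPowerSeries.X j * s) =
      if j ∈ c.1 then MvPowerSeries.coeff (Multiset.toFinsupp (c.1.erase j)) s else 0 := by
    split_ifs with h
    · have h1 : Multiset.toFinsupp c.1 = Finsupp.single j 1 + Multiset.toFinsupp (c.1.erase j) := by
        conv_lhs => rw [← Multiset.cons_erase h, ← Multiset.singleton_add, map_add,
          Multiset.toFinsupp_singleton]
      rw [h1, MvPowerSeries.X, MvPowerSeries.coeff_add_monomial_mul, one_mul]
    · rw [MvPowerSeries.X, MvPowerSeries.coeff_monomial_mul, if_neg]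
      rw [Finsupp.single_le_iff, Multiset.toFinsupp_apply, Nat.one_le_iff_ne_zero, not_not]
      exact Multiset.count_eq_zero_of_notMem h
  rw [hom, hc]
  split_ifs with h
  · obtain ⟨t, ht⟩ := Multiset.exists_cons_of_mem h
    have htc : Multiset.card t = k := by
      have := c.2; rw [ht, Multiset.card_cons] at this; omega
    refine Eq.trans ?_ (Fintype.sum_eq_single (Sym.mk t htc) fun b hb => ?_).symm
    · have h2 : redOne n k c (Sym.mk t htc, j) = mcoef (Sym.mk t htc) / mcoef c := if_pos ht
      have h3 := mcoef_ne_zero (Sym.mk t htc)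
      have h4 : c.1.erase j = t := by rw [ht, Multiset.erase_cons_head]
      rw [h2, h4, hom]
      show _ = mcoef (Sym.mk t htc) / mcoef c * (MvPowerSeries.coeff (Multiset.toFinsupp t) s /
        mcoef (Sym.mk t htc))
      field_simp
    · have h2 : redOne n k c (b, j) = 0 := if_neg fun h3 => hb (Subtype.ext
        ((Multiset.cons_inj_right j).1 (h3.symm.trans ht)))
      rw [h2, zero_mul]
  · rw [zero_div]
    refine (Finset.sum_eq_zero fun b _ => ?_).symm
    have h2 : redOne n k c (b, j) = 0 := if_neg fun h3 => h (by
      rw [h3]; exact Multiset.mem_cons_self _ _)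
    rw [h2, zero_mul]

theorem lowOrd_one_X (j : Fin n) : LowOrd 1 (MvPowerSeries.X j : PS n) := by
  intro k hk
  obtain rfl : k = 0 := by omega
  ext a
  have h0 : a.1 = 0 := Multiset.card_eq_zero.1 a.2
  rw [hom, h0, map_zero, Pi.zero_apply]
  simp

theorem hom_X_of_ne {k : ℕ} (hk : k ≠ 1) (j : Fin n) : hom k (MvPowerSeries.X j : PS n) = 0 := by
  rcases k with _ | k
  · exact lowOrd_one_X j 0 one_pos
  · ext c
    have := hom_X_mul j (1 : PS n) k c
    rw [mul_one] at this
    rw [this, hom_one_of_pos (by omega)]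
    simp

theorem mcoef_one (a : Sym (Fin n) 1) : mcoef a = 1 := by
  obtain ⟨i, rfl⟩ := (Sym.oneEquiv (α := Fin n)).surjective a
  have h0 : mcoef (Sym.nil : Sym (Fin n) 0) = 1 := by
    rw [mcoef]; simp [Sym.nil]
  have h := mcoef_sq_eq_of_cons (b := (Sym.nil : Sym (Fin n) 0)) (c := Sym.oneEquiv i) (i := i) rfl
  rw [h0] at h
  have h1 : (Sym.oneEquiv i : Sym (Fin n) 1).1.count i = 1 := Multiset.count_singleton_self i
  rw [h1] at h
  have h2 := mcoef_pos (Sym.oneEquiv i : Sym (Fin n) 1)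
  have h3 : mcoef (Sym.oneEquiv i : Sym (Fin n) 1) ^ 2 = 1 := by
    rw [Nat.cast_one, Nat.cast_zero] at h; linarith
  exact (pow_eq_one_iff_of_nonneg h2.le two_ne_zero).1 h3

theorem hom_one_X (j : Fin n) (i : Fin n) :
    hom 1 (MvPowerSeries.X j : PS n) (Sym.oneEquiv i) = if i = j then 1 else 0 := by
  have h := hom_X_mul j (1 : PS n) 0 (Sym.oneEquiv i)
  rw [mul_one] at h
  rw [h, Fintype.sum_eq_single (Sym.nil : Sym (Fin n) 0) fun a ha => absurd (Subsingleton.elim _ _) ha,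
    hom_zero_one, mul_one]
  have h0 : mcoef (Sym.nil : Sym (Fin n) 0) = 1 := by
    rw [mcoef]; simp [Sym.nil]
  rw [redOne_apply, h0, mcoef_one, div_one]
  refine if_congr ?_ rfl rfl
  exact Multiset.singleton_inj

theorem ev_one_X (j : Fin n) (x : Fin n → ℝ) : ev 1 (MvPowerSeries.X j : PS n) x = x j := by
  rw [ev, dotProduct, ← (Sym.oneEquiv (α := Fin n)).sum_comp]
  simp only [hom_one_X, powVec, mcoef_one]
  rw [Finset.sum_eq_single j]
  · rw [if_pos rfl, one_mul, one_mul]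
    show (Multiset.map x {j}).prod = x j
    simp
  · intro i _ hi; rw [if_neg hi, zero_mul]
  · intro h; exact absurd (Finset.mem_univ _) h

theorem expands_X (N : ℕ) (j : Fin n) : Expands N (fun x => x j) (MvPowerSeries.X j : PS n) := by
  have h : Expands (N + 2) (fun x => x j) (MvPowerSeries.X j : PS n) := by
    refine (isBigO_zero _ _).congr_left fun x => ?_
    rw [Finset.sum_eq_single 1, ev_one_X, sub_self]
    · intro k _ hk; rw [ev, hom_X_of_ne hk, zero_dotProduct]
    · intro h; simp at h
  exact h.mono (by omega)

theorem wn_X_le (N : ℕ) {r : ℝ} (hr : 0 ≤ r) (j : Fin n) : wn N r (MvPowerSeries.X j : PS n) ≤ r := by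
  have h1 : bn 1 (MvPowerSeries.X j : PS n) = 1 := by
    have : bn 1 (MvPowerSeries.X j : PS n) ^ 2 = 1 := by
      rw [bn, l2_sq, ← (Sym.oneEquiv (α := Fin n)).sum_comp]
      simp only [hom_one_X, ite_pow, one_pow, zero_pow two_ne_zero, Finset.sum_ite_eq',
        Finset.mem_univ, if_true]
    nlinarith [bn_nonneg 1 (MvPowerSeries.X j : PS n)]
  have h2 : wn (N + 2) r (MvPowerSeries.X j : PS n) = r := by
    rw [wn, Finset.sum_eq_single 1, h1, pow_one, one_mul]
    · intro k _ hk; rw [bn, hom_X_of_ne hk, l2_zero, zero_mul]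
    · intro h; simp at h
  refine le_trans ?_ h2.le
  exact Finset.sum_le_sum_of_subset_of_nonneg (Finset.range_mono (by omega))
    fun k _ _ => mul_nonneg (bn_nonneg _ _) (pow_nonneg hr _)

/-- The linear power series with coefficient matrix `A`. -/
noncomputable def lin {ι : Type*} (A : Matrix ι (Fin n) ℝ) (i : ι) : PS n :=
  ∑ j, A i j • (MvPowerSeries.X j : PS n)

variable {ι : Type*}

theorem lin_add (A B : Matrix ι (Fin n) ℝ) (i : ι) : lin (A + B) i = lin A i + lin B i := by
  simp only [lin, Matrix.add_apply, add_smul, Finset.sum_add_distrib]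

theorem lin_sub (A B : Matrix ι (Fin n) ℝ) (i : ι) : lin (A - B) i = lin A i - lin B i := by
  simp only [lin, Matrix.sub_apply, sub_smul, Finset.sum_sub_distrib]

theorem lin_mul {κ : Type*} [Fintype κ] (A : Matrix ι κ ℝ) (B : Matrix κ (Fin n) ℝ) (i : ι) :
    lin (A * B) i = ∑ k, A i k • lin B k := by
  simp only [lin, Matrix.mul_apply, Finset.sum_smul, Finset.smul_sum, smul_smul]
  rw [Finset.sum_comm]

theorem lowOrd_lin (A : Matrix ι (Fin n) ℝ) (i : ι) : LowOrd 1 (lin A i) :=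
  LowOrd.sum fun j _ => (lowOrd_one_X j).smul _

theorem hom_lin_of_ne {k : ℕ} (hk : k ≠ 1) (A : Matrix ι (Fin n) ℝ) (i : ι) : hom k (lin A i) = 0 := by
  rw [lin, hom_sum]
  exact Finset.sum_eq_zero fun j _ => by rw [hom_smul, hom_X_of_ne hk, smul_zero]

theorem hom_one_lin (A : Matrix ι (Fin n) ℝ) (i : ι) (j : Fin n) :
    hom 1 (lin A i) (Sym.oneEquiv j) = A i j := by
  rw [lin, hom_sum, Finset.sum_apply, Finset.sum_eq_single j]
  · rw [hom_smul, Pi.smul_apply, hom_one_X, if_pos rfl, smul_eq_mul, mul_one]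
  · intro k _ hk
    rw [hom_smul, Pi.smul_apply, hom_one_X, if_neg hk.symm, smul_zero]
  · intro h; exact absurd (Finset.mem_univ _) h

theorem expands_lin (N : ℕ) (A : Matrix ι (Fin n) ℝ) (i : ι) :
    Expands N (fun x => (A *ᵥ x) i) (lin A i) := by
  have := Expands.sum (S := Finset.univ) fun j _ => (expands_X N j).smul (A i j)
  exact this

theorem wn_lin_le (N : ℕ) {r : ℝ} (hr : 0 ≤ r) (A : Matrix ι (Fin n) ℝ) (i : ι) :
    wn N r (lin A i) ≤ (∑ j, |A i j|) * r := by
  refine (wn_sum_le hr _ _).trans ?_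
  rw [Finset.sum_mul]
  refine Finset.sum_le_sum fun j _ => ?_
  rw [wn_smul]
  exact mul_le_mul_of_nonneg_left (wn_X_le N hr j) (abs_nonneg _)

/-- Multiplication by `x_j` acts on coefficients as a block of `K_k`. This is where `M_k` comes
from: if the degree `k` coefficients of `w` have the gradient form `K_kᵀ q`, the result is `K_k (I ⊗
Aᵀ) K_kᵀ q`. -/
theorem hom_sum_lin_mul (A : Matrix (Fin n) (Fin n) ℝ) (w : Fin n → PS n) (k : ℕ) :
    hom (k + 1) (∑ i, lin A i * w i) = redOne n k *ᵥ
      (Matrix.kronecker (1 : Matrix (Sym (Fin n) k) (Sym (Fin n) k) ℝ) Aᵀ *ᵥ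
        fun a => hom k (w a.2) a.1) := by
  ext c
  have h1 : ∑ i, lin A i * w i = ∑ j, MvPowerSeries.X j * ∑ i, A i j • w i := by
    simp only [lin, Finset.sum_mul, Finset.mul_sum]
    rw [Finset.sum_comm]
    refine Finset.sum_congr rfl fun j _ => Finset.sum_congr rfl fun i _ => ?_
    rw [smul_mul_assoc, mul_smul_comm]
  rw [h1, hom_sum, Finset.sum_apply, Matrix.mulVec, dotProduct, Fintype.sum_prod_type_right]
  refine Finset.sum_congr rfl fun j _ => ?_
  rw [hom_X_mul]
  refine Finset.sum_congr rfl fun b _ => ?_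
  rw [kronecker_one_mulVec_apply, hom_sum, Finset.sum_apply, Matrix.mulVec, dotProduct]
  congr 1
  refine Finset.sum_congr rfl fun i _ => ?_
  rw [hom_smul]; rfl

theorem sum_lin_mul_lin [Fintype ι] (A B : Matrix ι (Fin n) ℝ) :
    ∑ i, lin A i * lin B i = ∑ i, MvPowerSeries.X i * lin (Aᵀ * B) i := by
  simp only [lin_mul, Finset.mul_sum]
  rw [Finset.sum_comm]
  refine Finset.sum_congr rfl fun i _ => ?_
  conv_lhs => rw [lin, Finset.sum_mul]
  refine Finset.sum_congr rfl fun j _ => ?_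
  rw [smul_mul_assoc, mul_smul_comm, Matrix.transpose_apply]

end Linear

/-! ### The formal Hamilton-Jacobi-Bellman equation -/

section Formal

variable {n m : ℕ}

/-- The bilinear form of a matrix on vectors of power series. -/
noncomputable def bil (S : Matrix (Fin m) (Fin m) ℝ) (u v : Fin m → PS n) : PS n :=
  ∑ i, ∑ j, S i j • (u i * v j)

theorem bil_add_left (S : Matrix (Fin m) (Fin m) ℝ) (u u' v : Fin m → PS n) :
    bil S (u + u') v = bil S u v + bil S u' v := by
  simp only [bil, Pi.add_apply, add_mul, smul_add, Finset.sum_add_distrib]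

theorem bil_add_right (S : Matrix (Fin m) (Fin m) ℝ) (u v v' : Fin m → PS n) :
    bil S u (v + v') = bil S u v + bil S u v' := by
  simp only [bil, Pi.add_apply, mul_add, smul_add, Finset.sum_add_distrib]

theorem bil_sub_left (S : Matrix (Fin m) (Fin m) ℝ) (u u' v : Fin m → PS n) :
    bil S (u - u') v = bil S u v - bil S u' v := by
  simp only [bil, Pi.sub_apply, sub_mul, smul_sub, Finset.sum_sub_distrib]

theorem bil_sub_right (S : Matrix (Fin m) (Fin m) ℝ) (u v v' : Fin m → PS n) :
    bil S u (v - v') = bil S u v - bil S u v' := by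
  simp only [bil, Pi.sub_apply, mul_sub, smul_sub, Finset.sum_sub_distrib]

theorem bil_comm {S : Matrix (Fin m) (Fin m) ℝ} (hS : Sᵀ = S) (u v : Fin m → PS n) :
    bil S u v = bil S v u := by
  rw [bil, Finset.sum_comm]
  refine Finset.sum_congr rfl fun i _ => Finset.sum_congr rfl fun j _ => ?_
  rw [mul_comm, ← Matrix.transpose_apply S, hS]

theorem LowOrd.bil {N N' : ℕ} (S : Matrix (Fin m) (Fin m) ℝ) {u v : Fin m → PS n}
    (hu : ∀ i, LowOrd N (u i)) (hv : ∀ i, LowOrd N' (v i)) : LowOrd (N + N') (bil S u v) :=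
  LowOrd.sum fun i _ => LowOrd.sum fun j _ => ((hu i).mul (hv j)).smul _

/-- The part of degree `3, …, K + 2` of the power series with coefficients `t`, composed with
`v`. -/
noncomputable def higher (K : ℕ) (t : ∀ k, Sym (Fin m) k → ℝ) (v : Fin m → PS n) : PS n :=
  ∑ j ∈ Finset.range K, ∑ c : Sym (Fin m) (j + 3), (t (j + 3) c * mcoef c) • (c.1.map v).prod

/-- Every monomial has at least three factors. Changing one of them in degree `k` or more leaves at
least two others, each of order one. -/
theorem lowOrd_higher_sub {k K : ℕ} (t : ∀ k, Sym (Fin m) k → ℝ) {u v : Fin m → PS n}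
    (hu : ∀ i, LowOrd 1 (u i)) (hv : ∀ i, LowOrd 1 (v i)) (huv : ∀ i, LowOrd k (u i - v i)) :
    LowOrd (k + 2) (higher K t u - higher K t v) := by
  rw [higher, higher, ← Finset.sum_sub_distrib]
  refine LowOrd.sum fun j _ => ?_
  rw [← Finset.sum_sub_distrib]
  refine LowOrd.sum fun c _ => ?_
  rw [← smul_sub]
  refine (LowOrd.multiset_prod_sub hu hv huv c.1).smul _ |>.mono ?_
  have : Multiset.card c.1 = j + 3 := c.2
  omega

theorem lowOrd_higher {K : ℕ} (t : ∀ k, Sym (Fin m) k → ℝ) {v : Fin m → PS n}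
    (hv : ∀ i, LowOrd 1 (v i)) : LowOrd 3 (higher K t v) := by
  refine LowOrd.sum fun j _ => LowOrd.sum fun c _ => ((LowOrd.multiset_prod hv c.1).smul _).mono ?_
  have : Multiset.card c.1 = j + 3 := c.2
  omega

theorem lowOrd_higher_sub_higher {K K' : ℕ} (hK : K ≤ K') (t : ∀ k, Sym (Fin m) k → ℝ)
    {v : Fin m → PS n} (hv : ∀ i, LowOrd 1 (v i)) :
    LowOrd (K + 3) (higher K' t v - higher K t v) := by
  rw [higher, higher, ← Finset.sum_range_add_sum_Ico _ hK, add_sub_cancel_left]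
  refine LowOrd.sum fun j hj => LowOrd.sum fun c _ =>
    ((LowOrd.multiset_prod hv c.1).smul _).mono ?_
  have : Multiset.card c.1 = j + 3 := c.2
  rw [Finset.mem_Ico] at hj
  omega

/-- The formal power series data of an optimal control problem, with a solution `Π` of its
algebraic Riccati equation. -/
structure FormalData (n m : ℕ) where
  F : Fin n → PS n
  G : Fin n → Fin m → PS n
  Q : PS n
  t : ∀ k, Sym (Fin m) k → ℝ
  F1 : Matrix (Fin n) (Fin n) ℝ
  G0 : Matrix (Fin n) (Fin m) ℝ
  Q1 : Matrix (Fin n) (Fin n) ℝ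
  S : Matrix (Fin m) (Fin m) ℝ
  Pi1 : Matrix (Fin n) (Fin n) ℝ
  lowOrd_F : ∀ i, LowOrd 2 (F i - lin F1 i)
  lowOrd_G : ∀ i j, LowOrd 1 (G i j - G0 i j • 1)
  lowOrd_Q : LowOrd 3 (Q - (1 / 2 : ℝ) • ∑ i, MvPowerSeries.X i * lin Q1 i)
  S_symm : Sᵀ = S
  Pi1_symm : Pi1ᵀ = Pi1
  are : F1ᵀ * Pi1 + Pi1 * F1 + Q1 - Pi1 * G0 * S * G0ᵀ * Pi1 = 0

namespace FormalData

variable (D : FormalData n m)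

/-- `F_c`. -/
def Fc : Matrix (Fin n) (Fin n) ℝ := D.F1 - D.G0 * D.S * D.G0ᵀ * D.Pi1

/-- `gᵀ h`. -/
noncomputable def v (h : Fin n → PS n) (i : Fin m) : PS n := ∑ k, h k * D.G k i

/-- The left hand side of the HJB equation. -/
noncomputable def lhs (K : ℕ) (h : Fin n → PS n) : PS n :=
  ∑ i, D.F i * h i - ((1 / 2 : ℝ) • bil D.S (D.v h) (D.v h) + higher K D.t (D.v h)) + D.Q

/-- `(g - G₀)ᵀ h`. -/
noncomputable def e (h : Fin n → PS n) (i : Fin m) : PS n := ∑ k, h k * (D.G k i - D.G0 k i • 1)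

/-- `G₀ᵀ (h - Π x)`. -/
noncomputable def b (h : Fin n → PS n) (i : Fin m) : PS n := ∑ k, D.G0 k i • (h k - lin D.Pi1 k)

/-- `G₀ᵀ Π x`. -/
noncomputable def a (i : Fin m) : PS n := lin (D.G0ᵀ * D.Pi1) i

/-- The terms of the HJB equation that do not involve the coefficient of the highest degree. -/
noncomputable def rest (K : ℕ) (h : Fin n → PS n) : PS n :=
  bil D.S D.a (D.e h) + (1 / 2 : ℝ) • bil D.S (D.b h + D.e h) (D.b h + D.e h) +
    higher K D.t (D.v h) - ∑ i, (D.F i - lin D.F1 i) * h i -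
    (D.Q - (1 / 2 : ℝ) • ∑ i, MvPowerSeries.X i * lin D.Q1 i)

theorem v_eq (h : Fin n → PS n) : D.v h = D.a + (D.b h + D.e h) := by
  ext1 i
  simp only [v, Pi.add_apply, a, b, e, lin_mul, ← Finset.sum_add_distrib]
  refine Finset.sum_congr rfl fun k _ => ?_
  rw [Matrix.transpose_apply, mul_sub, mul_smul_comm, mul_one, smul_sub]; abel

/-- The Riccati equation, read as an identity of quadratic forms in `x`: twice the left side is the
form of `F1ᵀ Π + Π F1 - Π G0 S G0ᵀ Π + Q1`. -/
theorem quadratic_eq : ∑ i, lin D.F1 i * lin D.Pi1 i - (1 / 2 : ℝ) • bil D.S D.a D.a +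
    (1 / 2 : ℝ) • ∑ i, MvPowerSeries.X i * lin D.Q1 i = 0 := by
  have h1 : bil D.S D.a D.a =
      ∑ i, MvPowerSeries.X i * lin (D.Pi1 * D.G0 * D.S * D.G0ᵀ * D.Pi1) i := by
    have h2 : bil D.S D.a D.a = ∑ i, D.a i * lin (D.S * (D.G0ᵀ * D.Pi1)) i := by
      rw [bil]
      refine Finset.sum_congr rfl fun i _ => ?_
      rw [lin_mul, Finset.mul_sum]
      exact Finset.sum_congr rfl fun j _ => (mul_smul_comm _ _ _).symm
    rw [h2, show (fun i => D.a i * lin (D.S * (D.G0ᵀ * D.Pi1)) i) =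
      fun i => lin (D.G0ᵀ * D.Pi1) i * lin (D.S * (D.G0ᵀ * D.Pi1)) i from rfl, sum_lin_mul_lin,
      Matrix.transpose_mul, Matrix.transpose_transpose, D.Pi1_symm]
    simp only [Matrix.mul_assoc]
  have h4 : ∑ i, lin D.F1 i * lin D.Pi1 i = (1 / 2 : ℝ) • ∑ i, MvPowerSeries.X i *
      lin (D.F1ᵀ * D.Pi1 + D.Pi1 * D.F1) i := by
    have h5 : ∑ i, lin D.F1 i * lin D.Pi1 i = ∑ i, lin D.Pi1 i * lin D.F1 i :=
      Finset.sum_congr rfl fun i _ => mul_comm _ _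
    have h6 : (2 : ℝ) • ∑ i, lin D.F1 i * lin D.Pi1 i = ∑ i, MvPowerSeries.X i *
      lin (D.F1ᵀ * D.Pi1 + D.Pi1 * D.F1) i := by
      simp only [lin_add, mul_add, Finset.sum_add_distrib]
      rw [two_smul]
      nth_rewrite 2 [h5]
      rw [sum_lin_mul_lin, sum_lin_mul_lin, D.Pi1_symm]
    rw [← h6, smul_smul]; norm_num
  rw [h4, h1, ← smul_sub, ← smul_add, ← Finset.sum_sub_distrib, ← Finset.sum_add_distrib]
  have h7 : D.F1ᵀ * D.Pi1 + D.Pi1 * D.F1 - D.Pi1 * D.G0 * D.S * D.G0ᵀ * D.Pi1 + D.Q1 = 0 := by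
    rw [← D.are]; abel
  simp only [← mul_sub, ← mul_add, ← lin_sub, ← lin_add, h7]
  have h8 : ∀ i : Fin n, lin (0 : Matrix (Fin n) (Fin n) ℝ) i = 0 := fun i => by simp [lin]
  simp [h8]

/-- Expand `gᵀ h = a + b + e` around `Π x`. The terms quadratic in `x` cancel by `quadratic_eq`, and
the cross term of `a` and `b` combines with `F1` into the closed-loop matrix. Everything else has
been collected in `rest`. -/
theorem lhs_eq (K : ℕ) (h : Fin n → PS n) :
    D.lhs K h = ∑ i, lin D.Fc i * (h i - lin D.Pi1 i) - D.rest K h := by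
  have h1 : ∑ i, lin D.Fc i * (h i - lin D.Pi1 i) =
      ∑ i, lin D.F1 i * (h i - lin D.Pi1 i) - bil D.S D.a (D.b h) := by
    have h2 : bil D.S D.a (D.b h) =
        ∑ i, lin (D.G0 * D.S * D.G0ᵀ * D.Pi1) i * (h i - lin D.Pi1 i) := by
      rw [bil_comm D.S_symm, bil]
      have h3 : ∀ i, lin (D.G0 * D.S * D.G0ᵀ * D.Pi1) i = ∑ j, D.G0 i j • ∑ l, D.S j l • D.a l := by
        intro i
        rw [Matrix.mul_assoc, Matrix.mul_assoc, lin_mul]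
        simp only [lin_mul, a]
      simp only [h3, Finset.sum_mul, Finset.smul_sum, b]
      rw [Finset.sum_comm' (t' := Finset.univ) (s' := fun _ => Finset.univ) (by simp)]
      rw [Finset.sum_comm (s := (Finset.univ : Finset (Fin n)))]
      rw [Finset.sum_comm]
      refine Finset.sum_congr rfl fun j _ => ?_
      rw [Finset.sum_comm]
      refine Finset.sum_congr rfl fun l _ => ?_
      refine Finset.sum_congr rfl fun k _ => ?_
      rw [smul_mul_assoc, smul_mul_assoc, smul_mul_assoc, smul_smul, smul_smul, mul_comm (D.S _ _),
        mul_comm (D.a _)]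
    simp only [Fc, lin_sub, sub_mul, Finset.sum_sub_distrib, h2]
  have h3 : bil D.S (D.v h) (D.v h) = bil D.S D.a D.a + (2 : ℝ) • bil D.S D.a (D.b h) +
      (2 : ℝ) • bil D.S D.a (D.e h) + bil D.S (D.b h + D.e h) (D.b h + D.e h) := by
    rw [D.v_eq h, bil_add_left, bil_add_right, bil_add_right _ (D.b h + D.e h) D.a,
      bil_comm D.S_symm (D.b h + D.e h) D.a, bil_add_right D.S D.a, two_smul, two_smul]
    abel
  have h4 : ∑ i, D.F i * h i = ∑ i, (D.F i - lin D.F1 i) * h i + ∑ i, lin D.F1 i * lin D.Pi1 i +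
      ∑ i, lin D.F1 i * (h i - lin D.Pi1 i) := by
    rw [← Finset.sum_add_distrib, ← Finset.sum_add_distrib]
    exact Finset.sum_congr rfl fun i _ => by ring
  have h5 := D.quadratic_eq
  rw [lhs, rest, h1, h4, h3, smul_add, smul_add, smul_add, smul_smul, smul_smul]
  norm_num
  norm_num at h5
  linear_combination h5

variable {D}

theorem lowOrd_a (i : Fin m) : LowOrd 1 (D.a i) := lowOrd_lin _ i

theorem lowOrd_v {k : ℕ} {h : Fin n → PS n} (hh : ∀ i, LowOrd k (h i)) (i : Fin m) :
    LowOrd k (D.v h i) := LowOrd.sum fun j _ => (hh j).mul (lowOrd_zero _)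

theorem lowOrd_e {k : ℕ} {h : Fin n → PS n} (hh : ∀ i, LowOrd k (h i)) (i : Fin m) :
    LowOrd (k + 1) (D.e h i) := LowOrd.sum fun j _ => (hh j).mul (D.lowOrd_G j i)

theorem lowOrd_b {k : ℕ} {h : Fin n → PS n} (hh : ∀ i, LowOrd k (h i - lin D.Pi1 i)) (i : Fin m) :
    LowOrd k (D.b h i) := LowOrd.sum fun j _ => (hh j).smul _

theorem v_sub (h h' : Fin n → PS n) : D.v h - D.v h' = D.v (h - h') := by
  ext1 i
  simp only [v, Pi.sub_apply, sub_mul, Finset.sum_sub_distrib]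

theorem e_sub (h h' : Fin n → PS n) : D.e h - D.e h' = D.e (h - h') := by
  ext1 i
  simp only [e, Pi.sub_apply, sub_mul, Finset.sum_sub_distrib]

theorem b_sub (h h' : Fin n → PS n) (i : Fin m) :
    D.b h i - D.b h' i = ∑ k, D.G0 k i • (h k - h' k) := by
  simp only [b]
  rw [← Finset.sum_sub_distrib]
  refine Finset.sum_congr rfl fun k _ => ?_
  rw [← smul_sub]; congr 1; ring

theorem lowOrd_one_of_sub {h : Fin n → PS n} (hh : ∀ i, LowOrd 2 (h i - lin D.Pi1 i)) (i : Fin n) :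
    LowOrd 1 (h i) := by
  have := ((hh i).mono one_le_two).add (lowOrd_lin D.Pi1 i)
  rwa [sub_add_cancel] at this

theorem lowOrd_rest {h : Fin n → PS n} (hh : ∀ i, LowOrd 2 (h i - lin D.Pi1 i)) (K : ℕ) :
    LowOrd 3 (D.rest K h) := by
  have h1 := lowOrd_one_of_sub hh
  have h2 : ∀ i, LowOrd 2 ((D.b h + D.e h) i) := fun i => (lowOrd_b hh i).add (lowOrd_e h1 i)
  refine ((((LowOrd.bil D.S lowOrd_a (lowOrd_e h1)).add
    (((LowOrd.bil D.S h2 h2).mono (by norm_num)).smul _)).add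
    (lowOrd_higher D.t (lowOrd_v h1))).sub ?_).sub D.lowOrd_Q
  exact LowOrd.sum fun i _ => (D.lowOrd_F i).mul (h1 i)

/-- In every term of `rest` the variation of `h` is multiplied by factors of total order at least
two. Hence the part of degree `k + 1` is known before the coefficient of degree `k` is, and the HJB
equation can be solved recursively. -/
theorem lowOrd_rest_sub {k : ℕ} {h h' : Fin n → PS n} (hh : ∀ i, LowOrd 2 (h i - lin D.Pi1 i))
    (hh' : ∀ i, LowOrd 2 (h' i - lin D.Pi1 i)) (hk : ∀ i, LowOrd k (h i - h' i)) (K : ℕ) :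
    LowOrd (k + 2) (D.rest K h - D.rest K h') := by
  have h1 := lowOrd_one_of_sub hh
  have h1' := lowOrd_one_of_sub hh'
  have h2 : ∀ i, LowOrd 2 ((D.b h + D.e h) i) := fun i => (lowOrd_b hh i).add (lowOrd_e h1 i)
  have h2' : ∀ i, LowOrd 2 ((D.b h' + D.e h') i) := fun i => (lowOrd_b hh' i).add (lowOrd_e h1' i)
  have he : ∀ i, LowOrd (k + 1) ((D.e h - D.e h') i) := fun i => by
    rw [e_sub]; exact lowOrd_e hk i
  have hbe : ∀ i, LowOrd k (((D.b h + D.e h) - (D.b h' + D.e h')) i) := fun i => by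
    have : ((D.b h + D.e h) - (D.b h' + D.e h')) i = (D.b h i - D.b h' i) + (D.e h - D.e h') i := by
      simp only [Pi.sub_apply, Pi.add_apply]; ring
    rw [this, b_sub]
    exact (LowOrd.sum fun j _ => (hk j).smul _).add ((he i).mono (Nat.le_succ k))
  have hsum : ∀ i, LowOrd 2 (((D.b h + D.e h) + (D.b h' + D.e h')) i) := fun i => (h2 i).add (h2' i)
  -- The quadratic term is written as a difference of squares, so that one factor is the variation
  -- and the other, a sum, has order two.
  have e1 : D.rest K h - D.rest K h' = bil D.S D.a (D.e h - D.e h') +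
      (1 / 2 : ℝ) • bil D.S ((D.b h + D.e h) - (D.b h' + D.e h'))
        ((D.b h + D.e h) + (D.b h' + D.e h')) +
      (higher K D.t (D.v h) - higher K D.t (D.v h')) -
      ∑ i, (D.F i - lin D.F1 i) * (h i - h' i) := by
    rw [bil_sub_right, bil_sub_left, bil_add_right _ (D.b h + D.e h),
      bil_add_right _ (D.b h' + D.e h'), bil_comm D.S_symm (D.b h' + D.e h') (D.b h + D.e h)]
    simp only [mul_sub, Finset.sum_sub_distrib]
    rw [rest, rest]
    module
  rw [e1]
  have hF : LowOrd (2 + k) (∑ i, (D.F i - lin D.F1 i) * (h i - h' i)) :=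
    LowOrd.sum fun i _ => (D.lowOrd_F i).mul (hk i)
  refine ((((LowOrd.bil D.S lowOrd_a he).mono (by omega)).add
    ((LowOrd.bil D.S hbe hsum).smul _)).add
    (lowOrd_higher_sub D.t (lowOrd_v h1) (lowOrd_v h1') fun i => ?_)).sub (hF.mono (by omega))
  have := congrFun (v_sub (D := D) h h') i
  rw [Pi.sub_apply] at this
  rw [this]; exact lowOrd_v hk i

theorem lowOrd_rest_sub_rest {K K' : ℕ} (hK : K ≤ K') {h : Fin n → PS n} (h1 : ∀ i, LowOrd 1 (h i)) :
    LowOrd (K + 3) (D.rest K' h - D.rest K h) := by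
  have : D.rest K' h - D.rest K h = higher K' D.t (D.v h) - higher K D.t (D.v h) := by
    rw [rest, rest]; abel
  rw [this]
  exact lowOrd_higher_sub_higher hK D.t (lowOrd_v h1)

end FormalData

end Formal

end NLR

namespace NLR
open Matrix Asymptotics

/-! ### The values computed by the programs -/

namespace Comp

theorem ite_val {α : Type} (b : Bool) (x y : Comp α) :
    (if b then x else y).val = if b then x.val else y.val := by cases b <;> rfl

theorem fact_val (k : ℕ) : (fact k).val = k.factorial := by
  induction k with
  | zero => simp [fact, op]
  | succ k ih =>
    show ((k + 1 : ℕ) : ℝ) * (fact k).val = _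
    rw [ih, Nat.factorial_succ]; push_cast; ring

theorem coef_val {d k : ℕ} (s : Sym (Fin d) k) : (coef s).val = mcoef s := by
  show Real.sqrt ((fact k).val / ∏ i, (fact (s.1.count i)).val) = _
  simp only [fact_val]; rfl

theorem redOne_val (d k : ℕ) : (redOne d k).val = NLR.redOne d k := by
  ext c b
  show Comp.val (if decide (c.1 = b.2 ::ₘ b.1.1) = true then _ else _) = _
  rw [ite_val, redOne_apply]
  simp only [decide_eq_true_eq]
  refine if_congr Iff.rfl ?_ rfl
  show (coef b.1).val / (coef c).val = _
  rw [coef_val, coef_val]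

theorem red_val (d i j l : ℕ) (c : Sym (Fin d) l) (b : Sym (Fin d) i × Sym (Fin d) j) :
    (red d i j l).val c b = if c.1 = b.1.1 + b.2.1 then mcoef b.1 * mcoef b.2 / mcoef c else 0 := by
  show Comp.val (if decide (c.1 = b.1.1 + b.2.1) = true then _ else _) = _
  rw [ite_val]
  simp only [decide_eq_true_eq]
  refine if_congr Iff.rfl ?_ rfl
  show (coef b.1).val * (coef b.2).val / (coef c).val = _
  rw [coef_val, coef_val, coef_val]

section

theorem mulVec_val {ι κ : Type} [Fintype ι] [Fintype κ] (A : Matrix ι κ ℝ) (v : κ → ℝ) :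
    (mulVec A v).val = A *ᵥ v := rfl

/-! #### Gauss-Jordan elimination -/

variable {ι : Type}

theorem pivot_cons_val (A : Matrix ι ι ℝ) (c r : ι) (l : List ι) :
    (pivot A c (r :: l)).val = if A r c = 0 then (pivot A c l).val else r := by
  show Comp.val (if @decide (A r c = 0) _ = true then _ else _) = _
  rw [ite_val]
  simp only [decide_eq_true_eq]
  rfl

theorem pivot_mem (A : Matrix ι ι ℝ) (c : ι) (l : List ι) :
    (pivot A c l).val = c ∨ (pivot A c l).val ∈ l := by
  induction l with
  | nil => exact Or.inl rfl
  | cons r rs ih =>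
    rw [pivot_cons_val]
    split_ifs with h
    · exact ih.imp_right fun h => List.mem_cons_of_mem _ h
    · exact Or.inr List.mem_cons_self

theorem pivot_ne_zero (A : Matrix ι ι ℝ) (c : ι) (l : List ι) (h : ∃ r ∈ l, A r c ≠ 0) :
    A (pivot A c l).val c ≠ 0 := by
  induction l with
  | nil => obtain ⟨r, hr, _⟩ := h; exact absurd hr List.not_mem_nil
  | cons r rs ih =>
    rw [pivot_cons_val]
    split_ifs with h0
    · obtain ⟨r', hr', h'⟩ := h
      rcases List.mem_cons.1 hr' with rfl | hr'
      · exact absurd h0 h'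
      · exact ih ⟨r', hr', h'⟩
    · exact h0

variable [Fintype ι] [DecidableEq ι]

/-- Induction with three invariants: the columns already treated are unit columns, the matrix has
trivial kernel, and `x` solves the current system. -/
theorem eliminate_val (l : List ι) (hl : l.Nodup) (A : Matrix ι ι ℝ) (b x : ι → ℝ)
    (hA : ∀ y, A *ᵥ y = 0 → y = 0) (hcol : ∀ d, d ∉ l → ∀ i, A i d = if i = d then 1 else 0)
    (hx : A *ᵥ x = b) : (eliminate l A b).val = x := by
  induction l generalizing A b with
  | nil =>
    have : A = 1 := by
      ext i d
      rw [hcol d List.not_mem_nil i, Matrix.one_apply]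
    rw [this, Matrix.one_mulVec] at hx
    exact hx.symm
  | cons c cs ih =>
    obtain ⟨hc, hcs⟩ := List.nodup_cons.1 hl
    set r := (pivot A c (c :: cs)).val with hr
    have hrmem : r ∈ c :: cs := (pivot_mem A c (c :: cs)).elim
      (fun h => by rw [hr, h]; exact List.mem_cons_self) id
    have hpiv : A r c ≠ 0 := by
      refine pivot_ne_zero A c (c :: cs) ?_
      by_contra! hno
      -- If no pivot existed, column `c` would be supported on the rows already treated and so be a
      -- combination of the finished unit columns; `y` is the resulting null vector.
      set y : ι → ℝ := fun d => if d ∈ c :: cs then (if d = c then 1 else 0) else -A d c with hy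
      have hy0 : A *ᵥ y = 0 := by
        ext i
        have h1 : ∀ d, A i d * y d = (if d = c then A i c else 0) + if i = d then
            (if d ∈ c :: cs then 0 else -A d c) else 0 := by
          intro d
          simp only [hy]
          by_cases hd : d ∈ c :: cs
          · rw [if_pos hd, if_pos hd, ite_self, add_zero]
            by_cases hdc : d = c
            · rw [if_pos hdc, if_pos hdc, mul_one, hdc]
            · rw [if_neg hdc, if_neg hdc, mul_zero]
          · have hdc : d ≠ c := fun h => hd (h ▸ List.mem_cons_self)
            rw [if_neg hd, if_neg hd, if_neg hdc, hcol d hd, zero_add]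
            split_ifs <;> simp
        rw [Matrix.mulVec, dotProduct, Finset.sum_congr rfl fun d _ => h1 d,
          Finset.sum_add_distrib, Finset.sum_ite_eq', Finset.sum_ite_eq, if_pos (Finset.mem_univ _),
          if_pos (Finset.mem_univ _)]
        by_cases hi : i ∈ c :: cs
        · rw [if_pos hi, hno i hi]; simp
        · rw [if_neg hi]; simp
      have := congrFun (hA y hy0) c
      simp [hy] at this
    set A₁ : Matrix ι ι ℝ := fun i j => A (Equiv.swap r c i) j with hA₁
    set b₁ : ι → ℝ := fun i => b (Equiv.swap r c i) with hb₁
    have hcc : A₁ c c = A r c := by simp only [hA₁, Equiv.swap_apply_right]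
    have hcc0 : A₁ c c ≠ 0 := by rwa [hcc]
    set row : ι → ℝ := fun j => A₁ c j / A₁ c c with hrow
    set A₂ : Matrix ι ι ℝ := fun i j => if i = c then row j else A₁ i j - A₁ i c * row j with hA₂
    set b₂ : ι → ℝ := fun i => if i = c then b₁ c / A₁ c c else b₁ i - A₁ i c * (b₁ c / A₁ c c)
      with hb₂
    have hval : (eliminate (c :: cs) A b).val = (eliminate cs A₂ b₂).val := by
      have e1 : A₂ = fun i j => Comp.val (if i = c then pure (row j) else do
          let t ← mul (A₁ i c) (row j)
          sub (A₁ i j) t) := by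
        ext i j; simp only [hA₂]; split_ifs <;> rfl
      have e2 : b₂ = fun i => Comp.val (if i = c then pure (b₁ c / A₁ c c) else do
          let t ← mul (A₁ i c) (b₁ c / A₁ c c)
          sub (b₁ i) t) := by
        ext i; simp only [hb₂]; split_ifs <;> rfl
      rw [e1, e2]; rfl
    have h1 : ∀ y i, (A₁ *ᵥ y) i = (A *ᵥ y) (Equiv.swap r c i) := fun y i => rfl
    have h2 : ∀ y i, (A₂ *ᵥ y) i = if i = c then (A₁ *ᵥ y) c / A₁ c c else
        (A₁ *ᵥ y) i - A₁ i c * ((A₁ *ᵥ y) c / A₁ c c) := by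
      intro y i
      have h3 : ∑ j, row j * y j = (A₁ *ᵥ y) c / A₁ c c := by
        rw [Matrix.mulVec, dotProduct, Finset.sum_div]
        exact Finset.sum_congr rfl fun j _ => by simp only [hrow]; ring
      rw [Matrix.mulVec, dotProduct]
      simp only [hA₂]
      split_ifs with hi
      · exact h3
      · rw [← h3, Matrix.mulVec, dotProduct, Finset.mul_sum, ← Finset.sum_sub_distrib]
        exact Finset.sum_congr rfl fun j _ => by ring
    rw [hval]
    refine ih hcs A₂ b₂ (fun y hy => hA y ?_) (fun d hd i => ?_) ?_
    · have h3 : (A₁ *ᵥ y) c = 0 := by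
        have := congrFun hy c
        rw [h2, if_pos rfl, Pi.zero_apply, div_eq_zero_iff] at this
        exact this.resolve_right hcc0
      have h4 : ∀ i, (A₁ *ᵥ y) i = 0 := by
        intro i
        by_cases hi : i = c
        · rw [hi, h3]
        · have := congrFun hy i
          rw [h2, if_neg hi, h3, zero_div, mul_zero, sub_zero] at this
          exact this
      ext i
      have := h4 (Equiv.swap r c i)
      rw [h1, Equiv.swap_apply_self] at this
      exact this
    · simp only [hA₂, hrow]
      by_cases hdc : d = c
      · subst hdc
        rw [div_self hcc0]
        split_ifs <;> simp
      · have hdl : d ∉ c :: cs := fun h => (List.mem_cons.1 h).elim hdc hd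
        -- The pivot row belongs to the untreated indices, so the interchange does not disturb the
        -- finished columns.
        have hdr : d ≠ r := fun h => hdl (h ▸ hrmem)
        have h5 : ∀ i, A₁ i d = if i = d then 1 else 0 := by
          intro i
          simp only [hA₁]
          rw [hcol d hdl]
          refine if_congr ?_ rfl rfl
          rw [Equiv.swap_apply_eq_iff, Equiv.swap_apply_of_ne_of_ne hdr hdc]
        rw [h5 c, if_neg (Ne.symm hdc), zero_div, mul_zero, sub_zero]
        split_ifs with h6 h7
        · exact absurd (h7.symm.trans h6) hdc
        · rfl
        · rw [h5, if_pos ‹_›]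
        · rw [h5, if_neg ‹_›]
    · ext i
      rw [h2]
      simp only [hb₂, hb₁, h1, hx]

theorem solve_val {A : Matrix ι ι ℝ} (hA : IsUnit A.det) (b : ι → ℝ) :
    (solve A b).val = A⁻¹ *ᵥ b := by
  refine eliminate_val _ (Finset.nodup_toList _) A b _ (fun y hy => ?_)
    (fun d hd => absurd (Finset.mem_toList.2 (Finset.mem_univ d)) hd) ?_
  · rw [← Matrix.one_mulVec y, ← Matrix.nonsing_inv_mul A hA, ← Matrix.mulVec_mulVec, hy,
      Matrix.mulVec_zero]
  · rw [Matrix.mulVec_mulVec, Matrix.mul_nonsing_inv A hA, Matrix.one_mulVec]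

end

/-! #### Power series -/

section

variable {n m j : ℕ} {κ : Type}

/-- A component of a series, as a formal power series. -/
noncomputable def ser (S : Series n κ) (i : κ) : PS n := ofHom fun k a => S k i a

theorem hom_ser (S : Series n κ) (i : κ) (k : ℕ) (a : Sym (Fin n) k) :
    hom k (ser S i) a = S k i a := by rw [ser, hom_ofHom]

theorem ser_comp (S : Series n κ) (i : κ) (u : Unit) : ser (comp S i) u = ser S i := rfl

theorem dot_val [Fintype κ] (S T : Series n κ) (l : ℕ) :
    (dot S T l).val = hom l (∑ i, ser S i * ser T i) := by
  ext c
  show ∑ j : Fin (l + 1), ∑ b : Sym (Fin n) (l - j) × Sym (Fin n) j,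
    (red n (l - j) j l).val c b * ((S j)ᵀ * T (l - j)).vec b = _
  rw [hom_sum, Finset.sum_apply]
  simp only [hom_mul]
  rw [Finset.sum_comm]
  refine Finset.sum_congr rfl fun j _ => ?_
  rw [Finset.sum_comm]
  refine Finset.sum_congr rfl fun b _ => ?_
  rw [red_val, ← Finset.mul_sum, Matrix.vec, Matrix.mul_apply]
  simp only [hom_ser, Matrix.transpose_apply]

theorem hom_mul_congr {l : ℕ} {s s' t t' : PS n} (hs : ∀ k ≤ l, hom k s = hom k s')
    (ht : ∀ k ≤ l, hom k t = hom k t') : hom l (s * t) = hom l (s' * t') := by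
  ext c
  rw [hom_mul, hom_mul]
  refine Finset.sum_congr rfl fun j _ => Finset.sum_congr rfl fun b _ => ?_
  rw [hs _ (Nat.lt_succ_iff.1 j.2), ht _ (Nat.sub_le _ _)]

theorem gradProd_val (G : Fin m → Series n (Fin n)) (S : Series n (Fin n)) (N d : ℕ) (hd : d ≤ N)
    (i : Fin m) : hom d (ser (gradProd G S N).val i) = hom d (∑ k, ser S k * ser (G i) k) := by
  ext c
  rw [hom_ser]
  show (if d ≤ N then (Matrix.of fun i => (dot S (G i) d).val) else 0) i c = _
  rw [if_pos hd, ← dot_val]; rfl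

/-- In `v^{j+1} = K_j (v^j ⊗ v)`, entry `b` sums over the ways of splitting one variable off `b`.
All of them give the same product, and Pascal's rule adds up their weights. -/
theorem powSeries_val (v : Series n (Fin m)) (N j d : ℕ) (hd : d ≤ N) (b : Sym (Fin m) j) :
    hom d (ser (powSeries v N j).val b) = mcoef b • hom d (b.1.map (ser v)).prod := by
  induction j generalizing d with
  | zero =>
    obtain rfl : b = Sym.nil := Subsingleton.elim _ _
    have h0 : mcoef (Sym.nil : Sym (Fin m) 0) = 1 := by
      rw [mcoef]; simp [Sym.nil]
    ext c
    rw [hom_ser, h0, one_smul]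
    show (if d ≤ N then ((fun _ _ => if d = 0 then (1 : ℝ) else 0) :
      Matrix (Sym (Fin m) 0) (Sym (Fin n) d) ℝ) else 0) Sym.nil c = hom d (1 : PS n) c
    rw [if_pos hd]
    split_ifs with h
    · subst h; rw [hom_zero_one]
    · rw [hom_one_of_pos h]; rfl
  | succ j ih =>
    ext c
    rw [hom_ser]
    show (if d ≤ N then (redOne m j).val * Matrix.of fun b' : Sym (Fin m) j × Fin m =>
      (dot (comp (powSeries v N j).val b'.1) (comp v b'.2) d).val else 0) b c = _
    rw [if_pos hd, Matrix.mul_apply, redOne_val]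
    have h1 : ∀ b' : Sym (Fin m) j × Fin m, NLR.redOne m j b b' *
        (dot (comp (powSeries v N j).val b'.1) (comp v b'.2) d).val c =
        (if b.1 = b'.2 ::ₘ b'.1.1 then mcoef b'.1 ^ 2 else 0) *
          ((mcoef b)⁻¹ * hom d (b.1.map (ser v)).prod c) := by
      intro b'
      rw [dot_val]
      show NLR.redOne m j b b' * hom d (∑ i : Unit, _) c = _
      rw [Fintype.sum_unique]
      have h2 : hom d (ser (comp (powSeries v N j).val b'.1) default * ser (comp v b'.2) default) =
          mcoef b'.1 • hom d ((b'.1.1.map (ser v)).prod * ser v b'.2) := by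
        rw [← hom_smul, ← smul_mul_assoc]
        refine hom_mul_congr (fun k hk => ?_) fun k _ => rfl
        rw [ser_comp, ih k (hk.trans hd), hom_smul]
      rw [h2, redOne_apply, Pi.smul_apply, smul_eq_mul]
      split_ifs with h
      · rw [h, Multiset.map_cons, Multiset.prod_cons, mul_comm (ser v b'.2)]
        ring
      · rw [zero_mul, zero_mul]
    have h3 : ∑ b' : Sym (Fin m) j × Fin m, NLR.redOne m j b b' *
        (dot (comp (powSeries v N j).val b'.1) (comp v b'.2) d).val c =
        mcoef b * hom d (b.1.map (ser v)).prod c := by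
      rw [Finset.sum_congr rfl fun b' _ => h1 b', ← Finset.sum_mul, sum_ite_cons_mcoef_sq]
      have := mcoef_ne_zero b
      field_simp
    exact h3

/-- Regroups `vᵀ R̃_j v^j` by multi-indices of degree `j + 1`; the symmetry `K_jᵀ t` of the
coefficients makes the different ways of splitting off a variable fit together. This is the form
used in `higher`. -/
theorem sum_mul_sum_prod (t : Sym (Fin m) (j + 1) → ℝ) (v : Fin m → PS n) :
    ∑ i, v i * ∑ a : Sym (Fin m) j, (((NLR.redOne m j)ᵀ *ᵥ t) (a, i) * mcoef a) • (a.1.map v).prod =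
      ∑ c, (t c * mcoef c) • (c.1.map v).prod := by
  have h := sum_mcoef_sq_smul_succ (d := m) (k := j) fun s =>
    ((if h : Multiset.card s = j + 1 then t (Sym.mk s h) / mcoef (Sym.mk s h) else 0) : ℝ) •
      (s.map v).prod
  have e1 : ∀ c : Sym (Fin m) (j + 1), mcoef c ^ 2 •
      ((if h : Multiset.card c.1 = j + 1 then t (Sym.mk c.1 h) / mcoef (Sym.mk c.1 h) else 0) : ℝ) •
      (c.1.map v).prod = (t c * mcoef c) • (c.1.map v).prod := by
    intro c
    rw [dif_pos c.2, smul_smul]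
    congr 1
    show mcoef c ^ 2 * (t c / mcoef c) = _
    have := mcoef_ne_zero c
    field_simp
  rw [← Finset.sum_congr rfl fun c _ => e1 c, h, Fintype.sum_prod_type_right]
  refine Finset.sum_congr rfl fun i _ => ?_
  rw [Finset.mul_sum]
  refine Finset.sum_congr rfl fun a _ => ?_
  have hc : Multiset.card (i ::ₘ a.1) = j + 1 := by rw [Multiset.card_cons, a.2]
  rw [dif_pos hc, smul_smul, redOne_transpose_mulVec_apply, mul_smul_comm, Multiset.map_cons,
    Multiset.prod_cons]
  congr 1
  show mcoef a / mcoef (i ::ₛ a) * t (i ::ₛ a) * mcoef a = mcoef a ^ 2 * (t (i ::ₛ a) / mcoef (i ::ₛ a))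
  ring

/-- The summands `2 ≤ j ≤ J` have degrees `3, …, J + 1` in `v`, which is the range of `higher (J -
1)`. -/
theorem psiCoef_val (S : Matrix (Fin m) (Fin m) ℝ) (Rt : ∀ j, Matrix (Fin m) (Sym (Fin m) j) ℝ)
    (t : ∀ k, Sym (Fin m) k → ℝ) (v : Series n (Fin m)) (J l : ℕ)
    (hRt : ∀ j, 2 ≤ j → j ≤ J → ∀ i a, Rt j i a = ((NLR.redOne m j)ᵀ *ᵥ t (j + 1)) (a, i)) :
    (psiCoef S Rt v J l).val =
      hom l ((1 / 2 : ℝ) • bil S (ser v) (ser v) + higher (J - 1) t (ser v)) := by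
  have hw : ∀ i, ∀ k ≤ l, hom k (ser (fun d => if d ≤ l then S * v d else 0) i) =
      hom k (∑ j, S i j • ser v j) := by
    intro i k hk
    ext a
    rw [hom_ser, if_pos hk, hom_sum, Finset.sum_apply, Matrix.mul_apply]
    refine Finset.sum_congr rfl fun j _ => ?_
    rw [hom_smul, Pi.smul_apply, hom_ser, smul_eq_mul]
  have hquad : (dot v (fun d => if d ≤ l then S * v d else 0) l).val = hom l (bil S (ser v) (ser v)) := by
    rw [dot_val, bil, hom_sum, hom_sum]
    refine Finset.sum_congr rfl fun i _ => ?_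
    rw [hom_mul_congr (fun _ _ => rfl) (hw i), Finset.mul_sum]
    congr 1
    exact Finset.sum_congr rfl fun j _ => mul_smul_comm _ _ _
  have hU : ∀ j ∈ Finset.range (J - 1), ∀ i, ∀ k ≤ l, hom k (ser (fun d => if d ≤ l then
      Rt (j + 2) * (powSeries v l (j + 2)).val d else 0) i) = hom k (∑ a : Sym (Fin m) (j + 2),
      (((NLR.redOne m (j + 2))ᵀ *ᵥ t (j + 3)) (a, i) * mcoef a) • (a.1.map (ser v)).prod) := by
    intro j hj i k hk
    rw [Finset.mem_range] at hj
    ext a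
    rw [hom_ser, if_pos hk, hom_sum, Finset.sum_apply, Matrix.mul_apply]
    refine Finset.sum_congr rfl fun b _ => ?_
    have h1 : (powSeries v l (j + 2)).val k b a = mcoef b * hom k (b.1.map (ser v)).prod a :=
      (hom_ser (powSeries v l (j + 2)).val b k a).symm.trans
        (congrFun (powSeries_val v l (j + 2) k hk b) a)
    rw [hRt _ (by omega) (by omega), hom_smul, Pi.smul_apply, smul_eq_mul, mul_assoc]
    exact congrArg _ h1
  have hpart : ∀ j ∈ Finset.range (J - 1), (dot v (fun d => if d ≤ l then
      Rt (j + 2) * (powSeries v l (j + 2)).val d else 0) l).val =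
      hom l (∑ c : Sym (Fin m) (j + 3), (t (j + 3) c * mcoef c) • (c.1.map (ser v)).prod) := by
    intro j hj
    rw [dot_val, ← sum_mul_sum_prod, hom_sum, hom_sum]
    exact Finset.sum_congr rfl fun i _ => hom_mul_congr (fun _ _ => rfl) (hU j hj i)
  ext c
  show (dot v (fun d => if d ≤ l then S * v d else 0) l).val c / 2 + ∑ i : Fin (J - 1),
    (dot v (fun d => if d ≤ l then Rt (i + 2) * (powSeries v l (i + 2)).val d else 0) l).val c = _
  rw [hquad, hom_add, hom_smul, higher, hom_sum, Pi.add_apply, Finset.sum_apply,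
    ← Fin.sum_univ_eq_sum_range (fun j => hom l (∑ c : Sym (Fin m) (j + 3),
      (t (j + 3) c * mcoef c) • (c.1.map (ser v)).prod) c) (J - 1), Pi.smul_apply, smul_eq_mul]
  congr 1
  · ring
  · exact Finset.sum_congr rfl fun i _ => congrFun (hpart i (Finset.mem_range.2 i.2)) c

end

end Comp
end NLR

namespace NLR
open Matrix Asymptotics

/-! ### Low order Taylor coefficients -/

section LowOrder

variable {n m : ℕ}

theorem hom_zero_tay (f : (Fin n → ℝ) → ℝ) (a : Sym (Fin n) 0) : hom 0 (tay f) a = f 0 := by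
  obtain rfl : a = Sym.nil := Subsingleton.elim _ _
  have h0 : mcoef (Sym.nil : Sym (Fin n) 0) = 1 := by
    rw [mcoef]; simp [Sym.nil]
  rw [hom_tay, taylor, h0]
  simp

theorem taylor_one {f : (Fin n → ℝ) → ℝ} (hf : AnalyticAt ℝ f 0) (j : Fin n) :
    taylor f 1 (Sym.oneEquiv j) = fderiv ℝ f 0 (Pi.single j 1) := by
  rw [taylor_eq_of_ofFn hf (Sym.oneEquiv j) (fun _ => j) rfl, mcoef_one]
  simp [iteratedFDeriv_one_apply]

theorem lowOrd_one_tay {f : (Fin n → ℝ) → ℝ} (h0 : f 0 = 0) : LowOrd 1 (tay f) := by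
  intro k hk
  obtain rfl : k = 0 := by omega
  ext a; rw [hom_zero_tay, h0]; rfl

theorem lowOrd_two_tay_sub {f : (Fin n → ℝ) → ℝ} (hf : AnalyticAt ℝ f 0) (h0 : f 0 = 0)
    {ι : Type*} {A : Matrix ι (Fin n) ℝ} {i : ι} (hA : ∀ j, fderiv ℝ f 0 (Pi.single j 1) = A i j) :
    LowOrd 2 (tay f - lin A i) := by
  intro k hk
  rw [hom_sub, sub_eq_zero]
  interval_cases k
  · rw [lowOrd_one_tay h0 0 one_pos, lowOrd_lin A i 0 one_pos]
  · ext a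
    obtain ⟨j, rfl⟩ := (Sym.oneEquiv (α := Fin n)).surjective a
    rw [hom_tay, taylor_one hf, hom_one_lin, hA]

theorem ev_finset_sum {ι : Type*} (k : ℕ) (S : Finset ι) (f : ι → PS n) (x : Fin n → ℝ) :
    ev k (∑ i ∈ S, f i) x = ∑ i ∈ S, ev k (f i) x := by
  rw [ev, hom_sum, sum_dotProduct]; rfl

theorem ev_one_lin {ι : Type*} (A : Matrix ι (Fin n) ℝ) (i : ι) (x : Fin n → ℝ) :
    ev 1 (lin A i) x = (A *ᵥ x) i := by
  rw [lin, ev_finset_sum]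
  simp only [ev_smul, ev_one_X]; rfl

theorem ev_two_quadratic (A : Matrix (Fin n) (Fin n) ℝ) (x : Fin n → ℝ) :
    ev 2 (∑ i, MvPowerSeries.X i * lin A i) x = x ⬝ᵥ A *ᵥ x := by
  rw [ev_finset_sum, dotProduct]
  refine Finset.sum_congr rfl fun i _ => ?_
  have h0 : ev 0 (MvPowerSeries.X i : PS n) x = 0 := by
    rw [ev, hom_X_of_ne (by norm_num), zero_dotProduct]
  have h2 : ev 2 (MvPowerSeries.X i : PS n) x = 0 := by
    rw [ev, hom_X_of_ne (by norm_num), zero_dotProduct]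
  rw [ev_mul]
  simp [Finset.sum_range_succ, h0, h2, ev_one_X, ev_one_lin]

theorem iteratedFDeriv_two_eq_hess {f : (Fin n → ℝ) → ℝ} (x : Fin n → ℝ) :
    iteratedFDeriv ℝ 2 f 0 (fun _ => x) = x ⬝ᵥ hess f *ᵥ x := by
  have hx : x = ∑ i, x i • (Pi.single i 1 : Fin n → ℝ) := by
    ext j; simp [Finset.sum_apply, Pi.single_apply]
  rw [iteratedFDeriv_two_apply]
  have h1 : ∀ y : Fin n → ℝ, fderiv ℝ (fderiv ℝ f) 0 y x =
      ∑ j, x j * fderiv ℝ (fderiv ℝ f) 0 y (Pi.single j 1) := by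
    intro y
    conv_lhs => rw [hx]
    rw [map_sum]
    exact Finset.sum_congr rfl fun j _ => by rw [map_smul, smul_eq_mul]
  have h2 : fderiv ℝ (fderiv ℝ f) 0 x = ∑ i, x i • fderiv ℝ (fderiv ℝ f) 0 (Pi.single i 1) := by
    conv_lhs => rw [hx]
    rw [map_sum]
    exact Finset.sum_congr rfl fun j _ => by rw [map_smul]
  rw [h2, dotProduct]
  simp only [_root_.sum_apply, _root_.smul_apply, smul_eq_mul, Matrix.mulVec, dotProduct, hess,
    Matrix.of_apply, iteratedFDeriv_two_apply, Matrix.cons_val_zero, Matrix.cons_val_one]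
  refine Finset.sum_congr rfl fun i _ => ?_
  rw [h1]
  congr 1
  exact Finset.sum_congr rfl fun j _ => mul_comm _ _

theorem ev_two_tay {f : (Fin n → ℝ) → ℝ} (hf : AnalyticAt ℝ f 0) (x : Fin n → ℝ) :
    ev 2 (tay f) x = 1 / 2 * (x ⬝ᵥ hess f *ᵥ x) := by
  rw [ev_tay hf, iteratedFDeriv_two_eq_hess]; norm_num

theorem lowOrd_three_tay_sub {f : (Fin n → ℝ) → ℝ} (hf : AnalyticAt ℝ f 0) (h0 : f 0 = 0)
    (h1 : fderiv ℝ f 0 = 0) :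
    LowOrd 3 (tay f - (1 / 2 : ℝ) • ∑ i, MvPowerSeries.X i * lin (hess f) i) := by
  have h2 : LowOrd 2 (∑ i, MvPowerSeries.X i * lin (hess f) i : PS n) :=
    LowOrd.sum fun i _ => (lowOrd_one_X i).mul (lowOrd_lin _ i)
  have h3 : LowOrd 2 (tay f) := by
    have := lowOrd_two_tay_sub hf h0 (A := (0 : Matrix Unit (Fin n) ℝ)) (i := ())
      (fun j => by rw [h1]; rfl)
    simpa [lin] using this
  intro k hk
  rcases Nat.lt_succ_iff_lt_or_eq.1 hk with hk | rfl
  · rw [hom_sub, h3 k hk, hom_smul, h2 k hk]; simp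
  · refine hom_eq_zero_of_ev fun x => ?_
    rw [ev_sub, ev_smul, ev_two_tay hf, ev_two_quadratic, sub_self]

end LowOrder

/-! ### The formal data of a problem -/

namespace Problem

variable {n m : ℕ} {p : Problem n m}

theorem Assumptions.R1_symm (hp : p.Assumptions) : p.R1ᵀ = p.R1 :=
  isSymm_of_isHermitian hp.R1_pos.1

theorem Assumptions.f_apply_analytic (hp : p.Assumptions) (i : Fin n) :
    AnalyticAt ℝ (fun x => p.f x i) 0 :=
  ((ContinuousLinearMap.proj (R := ℝ) (φ := fun _ : Fin n => ℝ) i).analyticAt _).comp hp.f_analytic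

theorem Assumptions.fderiv_f_apply (hp : p.Assumptions) (i j : Fin n) :
    fderiv ℝ (fun x => p.f x i) 0 (Pi.single j 1) = p.F1 i j := by
  rw [fderiv_apply hp.f_analytic.differentiableAt]; rfl

theorem Assumptions.fderiv_Q (hp : p.Assumptions) : fderiv ℝ p.Q 0 = 0 := by
  refine IsLocalMin.fderiv_eq_zero (Eventually.of_forall fun x => ?_)
  rw [hp.Q_zero]
  rcases eq_or_ne x 0 with rfl | hx
  · rw [hp.Q_zero]
  · exact (hp.Q_pos x hx).le

/-- The Taylor series of the data of a problem. -/
noncomputable def Assumptions.formalData (hp : p.Assumptions) : FormalData n m where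
  F i := tay fun x => p.f x i
  G i j := tay fun x => p.g x i j
  Q := tay p.Q
  t := taylor p.Psi
  F1 := p.F1
  G0 := p.G0
  Q1 := p.Q1
  S := p.R1⁻¹
  Pi1 := p.areSol
  lowOrd_F i := lowOrd_two_tay_sub (hp.f_apply_analytic i)
    (by rw [hp.f_zero]; rfl) fun j => hp.fderiv_f_apply i j
  lowOrd_G i j := by
    intro k hk
    obtain rfl : k = 0 := by omega
    ext a
    rw [hom_sub, hom_smul, Pi.sub_apply, Pi.smul_apply, hom_zero_tay, hom_zero_one, smul_eq_mul,
      mul_one, Problem.G0, sub_self]; rfl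
  lowOrd_Q := lowOrd_three_tay_sub hp.Q_analytic hp.Q_zero hp.fderiv_Q
  S_symm := by rw [Matrix.transpose_nonsing_inv, hp.R1_symm]
  Pi1_symm := isSymm_of_isHermitian hp.isStabilizingARE_areSol.posSemidef.1
  are := hp.isStabilizingARE_areSol.are

end Problem

/-! ### The recursion for the coefficients -/

section Recursion

variable {n m : ℕ}

open NLR.Comp

/-- The linear coefficient matrix, as a coefficient of a series. -/
def linCoeff (A : Matrix (Fin n) (Fin n) ℝ) : Matrix (Fin n) (Sym (Fin n) 1) ℝ :=
  A.submatrix id Sym.oneEquiv.symm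

namespace FormalData

variable (X : FormalData n m)

/-- The coefficient of degree `k` of the solution, from those of lower degree. -/
noncomputable def next (P : Series n (Fin n)) (k : ℕ) : Matrix (Fin n) (Sym (Fin n) k) ℝ :=
  Matrix.of fun i a => ((NLR.redOne n k)ᵀ *ᵥ
    ((Mmat X.Fc k)⁻¹ *ᵥ hom (k + 1) (X.rest (k - 1) (ser P)))) (a, i)

/-- The first coefficients of the solution. -/
noncomputable def table : ℕ → Series n (Fin n)
  | 0 => 0
  | 1 => Function.update 0 1 (linCoeff X.Pi1)
  | k + 2 => Function.update (table (k + 1)) (k + 2) (X.next (table (k + 1)) (k + 2))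

/-- The coefficients of the solution. -/
noncomputable def coeffs : Series n (Fin n) := fun k => X.table k k

theorem table_apply (N k : ℕ) : X.table N k = if k ≤ N then X.coeffs k else 0 := by
  induction N with
  | zero =>
    split_ifs with h
    · obtain rfl : k = 0 := by omega
      rfl
    · rfl
  | succ N ih =>
    rcases eq_or_ne k (N + 1) with rfl | hk
    · rw [if_pos le_rfl]; rfl
    · have h1 : X.table (N + 1) k = X.table N k := by
        rcases N with _ | N
        · exact Function.update_of_ne hk _ _
        · exact Function.update_of_ne hk _ _
      rw [h1, ih]
      exact if_congr (by omega) rfl rfl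

theorem coeffs_zero : X.coeffs 0 = 0 := rfl

theorem coeffs_one : X.coeffs 1 = linCoeff X.Pi1 := by
  show Function.update (0 : Series n (Fin n)) 1 (linCoeff X.Pi1) 1 = _
  exact Function.update_self _ _ _

theorem coeffs_of_two_le {k : ℕ} (hk : 2 ≤ k) : X.coeffs k = X.next (X.table (k - 1)) k := by
  obtain ⟨k, rfl⟩ := Nat.exists_eq_add_of_le' hk
  exact Function.update_self _ _ _

/-- The series `P` solves the HJB equation in every degree. -/
structure IsSolution (P : Series n (Fin n)) : Prop where
  zero : P 0 = 0
  one : P 1 = linCoeff X.Pi1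
  symm : ∀ k, 2 ≤ k → ∃ q : Sym (Fin n) (k + 1) → ℝ,
    (∀ i a, P k i a = ((NLR.redOne n k)ᵀ *ᵥ q) (a, i)) ∧
    Mmat X.Fc k *ᵥ q = hom (k + 1) (X.rest (k - 1) (ser P))

variable {X}

theorem lowOrd_two_ser_sub {P : Series n (Fin n)} (h0 : P 0 = 0) (h1 : P 1 = linCoeff X.Pi1)
    (i : Fin n) : LowOrd 2 (ser P i - lin X.Pi1 i) := by
  intro k hk
  rw [hom_sub, sub_eq_zero]
  ext a
  interval_cases k
  · rw [hom_ser, h0, lowOrd_lin _ i 0 one_pos]; rfl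
  · obtain ⟨j, rfl⟩ := (Sym.oneEquiv (α := Fin n)).surjective a
    rw [hom_ser, h1, hom_one_lin, linCoeff, Matrix.submatrix_apply, Equiv.symm_apply_apply, id]

theorem hom_sum_lin_Fc_mul {P : Series n (Fin n)} {k : ℕ} (hk : 2 ≤ k)
    {q : Sym (Fin n) (k + 1) → ℝ} (hq : ∀ i a, P k i a = ((NLR.redOne n k)ᵀ *ᵥ q) (a, i)) :
    hom (k + 1) (∑ i, lin X.Fc i * (ser P i - lin X.Pi1 i)) = Mmat X.Fc k *ᵥ q := by
  rw [hom_sum_lin_mul, Mmat_mulVec]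
  congr 2
  ext a
  rw [hom_sub, hom_lin_of_ne (by omega), sub_zero, hom_ser, hq]

/-- Terms of `h` of degree `k` or more do not reach degree `k + 1` of `rest`, and `higher (k - 1)`
already contains all degrees up to `k + 1`. -/
theorem hom_rest_congr {k K : ℕ} (hk : 2 ≤ k) (hK : k - 1 ≤ K) {h h' : Fin n → PS n}
    (hh : ∀ i, LowOrd 2 (h i - lin X.Pi1 i)) (hh' : ∀ i, LowOrd 2 (h' i - lin X.Pi1 i))
    (hhh : ∀ i, LowOrd k (h i - h' i)) :
    hom (k + 1) (X.rest K h) = hom (k + 1) (X.rest (k - 1) h') := by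
  have h1 := lowOrd_rest_sub hh hh' hhh K (k + 1) (Nat.lt_succ_self _)
  have h2 := lowOrd_rest_sub_rest (D := X) hK (lowOrd_one_of_sub hh') (k + 1) (by omega)
  rw [hom_sub, sub_eq_zero] at h1 h2
  rw [h1, h2]

theorem lowOrd_ser_sub {P P' : Series n (Fin n)} {k : ℕ} (h : ∀ j < k, P j = P' j) (i : Fin n) :
    LowOrd k (ser P i - ser P' i) := by
  intro j hj
  rw [hom_sub, sub_eq_zero]
  ext a; rw [hom_ser, hom_ser, h j hj]

theorem isSolution_coeffs (hM : ∀ k, 2 ≤ k → IsUnit (Mmat X.Fc k).det) : X.IsSolution X.coeffs where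
  zero := rfl
  one := X.coeffs_one
  symm k hk := by
    refine ⟨(Mmat X.Fc k)⁻¹ *ᵥ hom (k + 1) (X.rest (k - 1) (ser (X.table (k - 1)))), fun i a => ?_, ?_⟩
    · rw [X.coeffs_of_two_le hk]; rfl
    · rw [Matrix.mulVec_mulVec, Matrix.mul_nonsing_inv _ (hM k hk), Matrix.one_mulVec]
      refine hom_rest_congr hk le_rfl (lowOrd_two_ser_sub ?_ ?_)
        (lowOrd_two_ser_sub X.coeffs_zero X.coeffs_one) (lowOrd_ser_sub fun j hj => ?_)
      · rw [table_apply, if_pos (Nat.zero_le _)]; rfl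
      · rw [table_apply, if_pos (by omega), coeffs_one]
      · rw [table_apply, if_pos (by omega)]

/-- Strong induction on the degree: equal lower terms give equal right-hand sides, and `M_k` is
injective. This is what identifies the computed coefficients with those of the value function. -/
theorem IsSolution.eq (hM : ∀ k, 2 ≤ k → IsUnit (Mmat X.Fc k).det) {P P' : Series n (Fin n)}
    (h : X.IsSolution P) (h' : X.IsSolution P') : P = P' := by
  funext k
  induction k using Nat.strong_induction_on with
  | _ k ih =>
    rcases Nat.lt_or_ge k 2 with hk | hk
    · interval_cases k
      · rw [h.zero, h'.zero]
      · rw [h.one, h'.one]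
    · obtain ⟨q, hq, hMq⟩ := h.symm k hk
      obtain ⟨q', hq', hMq'⟩ := h'.symm k hk
      have h1 := hom_rest_congr hk le_rfl (lowOrd_two_ser_sub h.zero h.one)
        (lowOrd_two_ser_sub h'.zero h'.one) (lowOrd_ser_sub ih)
      have h2 : q = q' := by
        rw [← Matrix.one_mulVec q, ← Matrix.one_mulVec q', ← Matrix.nonsing_inv_mul _ (hM k hk),
          ← Matrix.mulVec_mulVec, ← Matrix.mulVec_mulVec, hMq, hMq', h1]
      ext i a
      rw [hq, hq', h2]

/-- A truncation of a solution satisfies the HJB equation in the degrees which determine it. -/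
theorem IsSolution.lowOrd_lhs_of_agree {P P' : Series n (Fin n)} (h : X.IsSolution P) {N K : ℕ}
    (hN : 1 ≤ N) (hP : ∀ k ≤ N, P' k = P k) (hK : N - 1 ≤ K) : LowOrd (N + 2) (X.lhs K (ser P')) := by
  have h0 : P' 0 = 0 := by rw [hP 0 (Nat.zero_le _), h.zero]
  have h1 : P' 1 = linCoeff X.Pi1 := by rw [hP 1 hN, h.one]
  have h2 := lowOrd_two_ser_sub (X := X) h0 h1
  intro l hl
  rw [lhs_eq, hom_sub, sub_eq_zero]
  rcases Nat.lt_or_ge l 3 with hl3 | hl3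
  · rw [lowOrd_rest h2 K l hl3]
    have h3 : LowOrd (1 + 2) (∑ i, lin X.Fc i * (ser P' i - lin X.Pi1 i)) :=
      LowOrd.sum fun i _ => (lowOrd_lin _ i).mul (h2 i)
    exact h3 l hl3
  · obtain ⟨k, rfl⟩ : ∃ k, l = k + 1 := ⟨l - 1, by omega⟩
    have hk : 2 ≤ k := by omega
    obtain ⟨q, hq, hM⟩ := h.symm k hk
    rw [hom_sum_lin_Fc_mul hk (q := q) (fun i a => by rw [hP k (by omega), hq]), hM]
    exact (hom_rest_congr hk (by omega) h2 (lowOrd_two_ser_sub h.zero h.one)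
      (lowOrd_ser_sub fun j hj => hP j (by omega))).symm

theorem isSolution_of_lowOrd_lhs {P : Series n (Fin n)} (h0 : P 0 = 0) (h1 : P 1 = linCoeff X.Pi1)
    (hs : ∀ k, 2 ≤ k → ∃ q : Sym (Fin n) (k + 1) → ℝ,
      ∀ i a, P k i a = ((NLR.redOne n k)ᵀ *ᵥ q) (a, i))
    (h : ∀ K, LowOrd (K + 3) (X.lhs K (ser P))) : X.IsSolution P := by
  refine ⟨h0, h1, fun k hk => ?_⟩
  obtain ⟨q, hq⟩ := hs k hk
  refine ⟨q, hq, ?_⟩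
  have h2 := h (k - 1) (k + 1) (by omega)
  rwa [lhs_eq, hom_sub, sub_eq_zero, hom_sum_lin_Fc_mul hk hq] at h2

end FormalData

/-! ### The values of the algorithms -/

theorem hom_mul_congr_right {l : ℕ} {s t t' : PS n} (hs : LowOrd 1 s)
    (ht : ∀ k < l, hom k t = hom k t') : hom l (s * t) = hom l (s * t') := by
  have h : LowOrd l (t - t') := fun k hk => by rw [hom_sub, ht k hk, sub_self]
  have h1 := hs.mul h l (by omega)
  rwa [mul_sub, hom_sub, sub_eq_zero] at h1

theorem psi_congr {S : Matrix (Fin m) (Fin m) ℝ} {t : ∀ k, Sym (Fin m) k → ℝ} {K l : ℕ}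
    {u v : Fin m → PS n} (hu : ∀ i, LowOrd 1 (u i)) (hv : ∀ i, LowOrd 1 (v i))
    (h : ∀ i, LowOrd l (u i - v i)) :
    hom l ((1 / 2 : ℝ) • bil S u u + higher K t u) =
      hom l ((1 / 2 : ℝ) • bil S v v + higher K t v) := by
  have h1 : LowOrd (l + 1) (((1 / 2 : ℝ) • bil S u u + higher K t u) -
      ((1 / 2 : ℝ) • bil S v v + higher K t v)) := by
    have e : ((1 / 2 : ℝ) • bil S u u + higher K t u) -
      ((1 / 2 : ℝ) • bil S v v + higher K t v) = (1 / 2 : ℝ) • (bil S (u - v) u + bil S v (u - v)) +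
        (higher K t u - higher K t v) := by
      rw [bil_sub_left, bil_sub_right]; module
    rw [e]
    have h2 : LowOrd (l + 1) (bil S (u - v) u) := LowOrd.bil S (fun i => h i) hu
    have h3 : LowOrd (1 + l) (bil S v (u - v)) := LowOrd.bil S hv (fun i => h i)
    exact ((h2.add (h3.mono (by omega))).smul _).add ((lowOrd_higher_sub t hu hv h).mono (by omega))
  have h2 := h1 l (Nat.lt_succ_self l)
  rwa [hom_sub, sub_eq_zero] at h2

namespace Comp

/-- As long as `P k = 0`, the linear term of `lhs_eq` has no part of degree `k + 1`, so in that
degree `rest` is minus the HJB expression of the truncation. That is the right-hand side formed by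
the program. Data of degree at most `k` suffice for `f` and `g` because the truncation has no
constant term. -/
theorem nextP_val (X : FormalData n m) (D : Data n m) (P : Series n (Fin n)) {k : ℕ} (hk : 2 ≤ k)
    (hM : IsUnit (Mmat X.Fc k).det)
    (hF : ∀ i, ∀ j ≤ k, hom j (ser D.F i) = hom j (X.F i))
    (hG : ∀ i i', ∀ j ≤ k, hom j (ser (D.G i) i') = hom j (X.G i' i))
    (hQ : ∀ i a, D.Q k i a = ((NLR.redOne n k)ᵀ *ᵥ hom (k + 1) X.Q) (a, i))
    (hRt : ∀ j, 2 ≤ j → j ≤ k → ∀ i a, D.Rt j i a = ((NLR.redOne m j)ᵀ *ᵥ X.t (j + 1)) (a, i))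
    (hS : D.Rinv = X.S) (h0 : P 0 = 0) (h1 : P 1 = linCoeff X.Pi1) (hP : P k = 0) :
    (nextP D X.Fc P k).val = X.next P k := by
  have h2 := FormalData.lowOrd_two_ser_sub (X := X) h0 h1
  have hl1 := FormalData.lowOrd_one_of_sub h2
  have hpsi : (psiCoef D.Rinv D.Rt (gradProd D.G P (k + 1)).val k (k + 1)).val =
      hom (k + 1) ((1 / 2 : ℝ) • bil X.S (X.v (ser P)) (X.v (ser P)) +
        higher (k - 1) X.t (X.v (ser P))) := by
    have hgp : ∀ i, ∀ d ≤ k + 1, hom d (ser (gradProd D.G P (k + 1)).val i) =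
        hom d (X.v (ser P) i) := by
      intro i d hd
      rw [gradProd_val _ _ _ d hd, FormalData.v, hom_sum, hom_sum]
      exact Finset.sum_congr rfl fun j _ => hom_mul_congr_right (hl1 j) fun l hl => hG i j l (by omega)
    rw [psiCoef_val D.Rinv D.Rt X.t _ k (k + 1) hRt, hS]
    refine psi_congr (fun i => ?_) (FormalData.lowOrd_v hl1) (fun i d hd => ?_)
    · intro d hd
      rw [hgp i d (by omega)]; exact FormalData.lowOrd_v hl1 i d hd
    · rw [hom_sub, sub_eq_zero, hgp i d hd.le]
  have hfh : (dot D.F P (k + 1)).val = hom (k + 1) (∑ i, X.F i * ser P i) := by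
    rw [dot_val, hom_sum, hom_sum]
    refine Finset.sum_congr rfl fun i _ => ?_
    rw [mul_comm, mul_comm (X.F i)]
    exact hom_mul_congr_right (hl1 i) fun l hl => hF i l (by omega)
  have hq : (mulVec (redOne n k).val (D.Q k).vec).val = hom (k + 1) X.Q := by
    rw [mulVec_val, redOne_val]
    have : (D.Q k).vec = (NLR.redOne n k)ᵀ *ᵥ hom (k + 1) X.Q := by
      ext ⟨a, i⟩; exact hQ i a
    rw [this, Matrix.mulVec_mulVec, redOne_mul_transpose, Matrix.one_mulVec]
  obtain ⟨kron, hk'⟩ : ∃ kron : Matrix (Sym (Fin n) k × Fin n) (Sym (Fin n) k × Fin n) ℝ,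
    kron = fun a b => (do
      let t ← sameIndex a.1.1 b.1.1
      pure (if t then X.Fc b.2 a.2 else 0) : Comp ℝ).val := ⟨_, rfl⟩
  have hkron : kron = Matrix.kronecker (1 : Matrix (Sym (Fin n) k) (Sym (Fin n) k) ℝ) X.Fcᵀ := by
    ext a b
    rw [hk']
    show (if decide (a.1.1 = b.1.1) = true then X.Fc b.2 a.2 else 0) = _
    rw [Matrix.kronecker, Matrix.kroneckerMap_apply, Matrix.one_apply, Matrix.transpose_apply]
    simp only [decide_eq_true_eq, ite_mul, one_mul, zero_mul]
    exact if_congr ⟨fun h => Subtype.ext h, fun h => congrArg Subtype.val h⟩ rfl rfl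
  have hrhs : (fun c => (psiCoef D.Rinv D.Rt (gradProd D.G P (k + 1)).val k (k + 1)).val c -
      (dot D.F P (k + 1)).val c - (mulVec (redOne n k).val (D.Q k).vec).val c) =
      hom (k + 1) (X.rest (k - 1) (ser P)) := by
    rw [hpsi, hfh, hq]
    have e1 := congrArg (hom (k + 1)) (X.lhs_eq (k - 1) (ser P))
    rw [FormalData.lhs, hom_sub, hom_sum_lin_mul] at e1
    have e2 : (fun a : Sym (Fin n) k × Fin n => hom k (ser P a.2 - lin X.Pi1 a.2) a.1) = 0 := by
      ext a
      rw [hom_sub, hom_lin_of_ne (by omega), sub_zero, hom_ser, hP]; rfl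
    rw [e2, Matrix.mulVec_zero, Matrix.mulVec_zero, zero_sub, hom_add, hom_sub] at e1
    ext c
    have e3 := congrFun e1 c
    simp only [Pi.add_apply, Pi.sub_apply, Pi.neg_apply] at e3
    linarith
  have hval : (nextP D X.Fc P k).val = Matrix.of fun i a => (((redOne n k).val)ᵀ *ᵥ
      (solve ((redOne n k).val * kron * (redOne n k).valᵀ)
      (fun c => (psiCoef D.Rinv D.Rt (gradProd D.G P (k + 1)).val k (k + 1)).val c -
        (dot D.F P (k + 1)).val c - (mulVec (redOne n k).val (D.Q k).vec).val c)).val) (a, i) := by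
    rw [hk']; rfl
  rw [hval, hkron, hrhs, redOne_val]
  change Matrix.of (fun i a => ((NLR.redOne n k)ᵀ *ᵥ (solve (Mmat X.Fc k) _).val) (a, i)) = _
  rw [solve_val hM]
  rfl

theorem loop_val (X : FormalData n m) (D : Data n m) (N : ℕ)
    (hM : ∀ k, 2 ≤ k → IsUnit (Mmat X.Fc k).det)
    (hF : ∀ i, ∀ j ≤ N, hom j (ser D.F i) = hom j (X.F i))
    (hG : ∀ i i', ∀ j ≤ N, hom j (ser (D.G i) i') = hom j (X.G i' i))
    (hQ : ∀ k ≤ N, ∀ i a, D.Q k i a = ((NLR.redOne n k)ᵀ *ᵥ hom (k + 1) X.Q) (a, i))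
    (hRt : ∀ j ≤ N, ∀ i a, D.Rt j i a = ((NLR.redOne m j)ᵀ *ᵥ X.t (j + 1)) (a, i))
    (hS : D.Rinv = X.S) (k : ℕ) (hk : k ≤ N) : (loop D X.Pi1 X.Fc k).val = X.table k := by
  induction k with
  | zero => rfl
  | succ k ih =>
    rcases k with _ | k
    · rfl
    · have ih' := ih (by omega)
      have h0 : X.table (k + 1) 0 = 0 := by
        rw [FormalData.table_apply, if_pos (Nat.zero_le _)]; rfl
      have h1 : X.table (k + 1) 1 = linCoeff X.Pi1 := by
        rw [FormalData.table_apply, if_pos (by omega), FormalData.coeffs_one]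
      have h2 : X.table (k + 1) (k + 2) = 0 := by
        rw [FormalData.table_apply, if_neg (by omega)]
      have h3 := nextP_val X D (X.table (k + 1)) (k := k + 2) (by omega) (hM _ (by omega))
        (fun i j hj => hF i j (by omega)) (fun i i' j hj => hG i i' j (by omega))
        (hQ _ hk) (fun j _ hj => hRt j (by omega)) hS h0 h1 h2
      show Function.update (loop D X.Pi1 X.Fc (k + 1)).val (k + 2)
        (nextP D X.Fc (loop D X.Pi1 X.Fc (k + 1)).val (k + 2)).val = _
      rw [ih', h3]; rfl

end Comp

theorem algorithm1_val {p : Problem n m} (hp : p.Assumptions)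
    (hM : ∀ k, 2 ≤ k → IsUnit (Mmat p.Fc k).det) (N k : ℕ) (hk : k ≤ N) :
    (algorithm1 p N).val k = hp.formalData.coeffs k := by
  have hF : ∀ i, ∀ j ≤ N, hom j (Comp.ser (Comp.readData p N).val.F i) =
      hom j (hp.formalData.F i) := by
    intro i j hj
    ext a
    rw [Comp.hom_ser]
    show (if j ≤ N then (fun i a => taylor (fun x => p.f x i) j a :
      Matrix (Fin n) (Sym (Fin n) j) ℝ) else 0) i a = hom j (tay _) a
    rw [if_pos hj, hom_tay]
  have hG : ∀ i i', ∀ j ≤ N, hom j (Comp.ser ((Comp.readData p N).val.G i) i') =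
      hom j (hp.formalData.G i' i) := by
    intro i i' j hj
    ext a
    rw [Comp.hom_ser]
    show (if j ≤ N then (fun i' a => taylor (fun x => p.g x i' i) j a :
      Matrix (Fin n) (Sym (Fin n) j) ℝ) else 0) i' a = hom j (tay _) a
    rw [if_pos hj, hom_tay]
  have hQ : ∀ k ≤ N, ∀ i a, (Comp.readData p N).val.Q k i a =
      ((NLR.redOne n k)ᵀ *ᵥ hom (k + 1) hp.formalData.Q) (a, i) := by
    intro k hk i a
    show (if k ≤ N then (fun i a => symTaylor p.Q k i a :
      Matrix (Fin n) (Sym (Fin n) k) ℝ) else 0) i a = (_ *ᵥ hom (k + 1) (tay p.Q)) (a, i)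
    rw [if_pos hk, hom_tay]; rfl
  have hRt : ∀ j ≤ N, ∀ i a, (Comp.readData p N).val.Rt j i a =
      ((NLR.redOne m j)ᵀ *ᵥ hp.formalData.t (j + 1)) (a, i) := by
    intro j hj i a
    show (if j ≤ N then (fun i a => symTaylor p.Psi j i a :
      Matrix (Fin m) (Sym (Fin m) j) ℝ) else 0) i a = _
    rw [if_pos hj]; rfl
  have h := Comp.loop_val hp.formalData (Comp.readData p N).val N hM hF hG hQ hRt rfl N le_rfl
  have h1 : (algorithm1 p N).val = hp.formalData.table N := h
  rw [h1, FormalData.table_apply, if_pos hk]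

end Recursion

end NLR

namespace NLR
open Matrix Asymptotics

/-! ### Bounds for the number of steps -/

namespace Comp

section

variable {B : ℕ}

theorem one_le_pow_of_two_le (hB : 2 ≤ B) (e : ℕ) : 1 ≤ B ^ e := Nat.one_le_pow _ _ (by omega)

theorem const_le_pow (hB : 2 ≤ B) (c : ℕ) : c ≤ B ^ c :=
  Nat.lt_two_pow_self.le.trans (Nat.pow_le_pow_left hB c)

/-- All step counts are bounded by powers of one base `B ≥ 2` that exceeds the degrees in play. A
sum costs one more in the exponent, since `2 * B ^ e ≤ B ^ (e + 1)`; the exponents depend on the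
shape of the program but not on the order. -/
theorem add_le_pow (hB : 2 ≤ B) {a b i j : ℕ} (ha : a ≤ B ^ i) (hb : b ≤ B ^ j) :
    a + b ≤ B ^ (i + j + 1) := by
  have h1 : B ^ i ≤ B ^ (i + j) := Nat.pow_le_pow_right (by omega) (Nat.le_add_right _ _)
  have h2 : B ^ j ≤ B ^ (i + j) := Nat.pow_le_pow_right (by omega) (Nat.le_add_left _ _)
  have h3 : 2 * B ^ (i + j) ≤ B ^ (i + j + 1) := by
    rw [pow_succ, mul_comm]; exact Nat.mul_le_mul_left _ hB
  omega

theorem mul_le_pow {a b i j : ℕ} (ha : a ≤ B ^ i) (hb : b ≤ B ^ j) : a * b ≤ B ^ (i + j) := by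
  rw [pow_add]; exact Nat.mul_le_mul ha hb

theorem sum_le_pow (hB : 2 ≤ B) {ι : Type} {S : Finset ι} {f : ι → ℕ} {d e : ℕ}
    (hS : S.card ≤ B ^ d) (hf : ∀ i ∈ S, f i ≤ B ^ e) : ∑ i ∈ S, (f i + 1) ≤ B ^ (d + (e + 0 + 1)) := by
  refine (Finset.sum_le_card_nsmul S _ (B ^ (e + 0 + 1)) fun i hi => ?_).trans ?_
  · exact add_le_pow hB (hf i hi) (one_le_pow_of_two_le hB 0)
  · rw [smul_eq_mul]; exact mul_le_pow hS le_rfl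

variable {α β : Type} {ι κ τ : Type} [Fintype ι] [Fintype κ] [Fintype τ]

theorem pure_le (_hB : 2 ≤ B) (a : α) : (pure a : Comp α).steps ≤ B ^ 0 := Nat.zero_le _

theorem op_le (hB : 2 ≤ B) (a : α) : (op a).steps ≤ B ^ 0 := one_le_pow_of_two_le hB 0

theorem bind_le (hB : 2 ≤ B) {c : Comp α} {k : α → Comp β} {i j : ℕ} (hc : c.steps ≤ B ^ i)
    (hk : ∀ a, (k a).steps ≤ B ^ j) : (c >>= k).steps ≤ B ^ (i + j + 1) :=
  add_le_pow hB hc (hk c.val)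

/-- Keeps the cost `s` of a recursive call outside the power, so that repeated elimination steps add
up instead of raising the exponent each time. -/
theorem bind_add_le (hB : 2 ≤ B) {c : Comp α} {k : α → Comp β} {i j s : ℕ} (hc : c.steps ≤ B ^ i)
    (hk : ∀ a, (k a).steps ≤ B ^ j + s) : (c >>= k).steps ≤ B ^ (i + j + 1) + s := by
  have h1 := add_le_pow hB hc (le_refl (B ^ j))
  have h2 : (c >>= k).steps = c.steps + (k c.val).steps := rfl
  have h3 := hk c.val
  omega

theorem ite_le (hB : 2 ≤ B) {P : Prop} [Decidable P] {x y : Comp α} {i j : ℕ} (hx : x.steps ≤ B ^ i)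
    (hy : y.steps ≤ B ^ j) : (if P then x else y).steps ≤ B ^ (i + j + 1) := by
  have := add_le_pow hB hx hy
  split_ifs <;> omega

theorem tab_le (hB : 2 ≤ B) {α : ι → Type} {c : ∀ i, Comp (α i)} {d e : ℕ}
    (hι : Fintype.card ι ≤ B ^ d) (hc : ∀ i, (c i).steps ≤ B ^ e) :
    (tab c).steps ≤ B ^ (d + (e + 0 + 1)) :=
  sum_le_pow hB hι fun i _ => hc i

theorem sum_steps_le (hB : 2 ≤ B) {c : ι → Comp ℝ} {d e : ℕ}
    (hι : Fintype.card ι ≤ B ^ d) (hc : ∀ i, (c i).steps ≤ B ^ e) :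
    (sum c).steps ≤ B ^ (d + (e + 0 + 1)) :=
  sum_le_pow hB hι fun i _ => hc i

theorem prod_steps_le (hB : 2 ≤ B) {c : ι → Comp ℝ} {d e : ℕ}
    (hι : Fintype.card ι ≤ B ^ d) (hc : ∀ i, (c i).steps ≤ B ^ e) :
    (prod c).steps ≤ B ^ (d + (e + 0 + 1)) :=
  sum_le_pow hB hι fun i _ => hc i

theorem tabTo_le (hB : 2 ≤ B) {α : ℕ → Type} [∀ d, Zero (α d)] {c : ∀ d, Comp (α d)} {N e : ℕ}
    (hN : N + 1 ≤ B) (hc : ∀ i ≤ N, (c i).steps ≤ B ^ e) :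
    (tabTo N c).steps ≤ B ^ (1 + (e + 0 + 1)) := by
  refine sum_le_pow hB ?_ fun i hi => hc i (Nat.lt_succ_iff.1 (Finset.mem_range.1 hi))
  rw [Finset.card_range, pow_one]; exact hN

theorem mat_le (hB : 2 ≤ B) {c : ι → κ → Comp ℝ} {d d' e : ℕ} (hι : Fintype.card ι ≤ B ^ d)
    (hκ : Fintype.card κ ≤ B ^ d') (hc : ∀ i j, (c i j).steps ≤ B ^ e) :
    (mat c).steps ≤ B ^ (d + (d' + (e + 0 + 1) + 0 + 1)) :=
  tab_le hB hι fun i => tab_le hB hκ fun j => hc i j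

theorem mulMat_le (hB : 2 ≤ B) (A : Matrix ι κ ℝ) (A' : Matrix κ τ ℝ) {d d' d'' : ℕ}
    (hι : Fintype.card ι ≤ B ^ d) (hκ : Fintype.card κ ≤ B ^ d') (hτ : Fintype.card τ ≤ B ^ d'') :
    (mulMat A A').steps ≤ B ^ (d + (d'' + (d' + (0 + 0 + 1) + 0 + 1) + 0 + 1)) :=
  mat_le hB hι hτ fun _ _ => sum_steps_le hB hκ fun _ => op_le hB _

theorem mulVec_le (hB : 2 ≤ B) (A : Matrix ι κ ℝ) (v : κ → ℝ) {d d' : ℕ}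
    (hι : Fintype.card ι ≤ B ^ d) (hκ : Fintype.card κ ≤ B ^ d') :
    (mulVec A v).steps ≤ B ^ (d + (d' + (0 + 0 + 1) + 0 + 1)) :=
  tab_le hB hι fun _ => sum_steps_le hB hκ fun _ => op_le hB _

theorem card_fin_le (hB : 2 ≤ B) (n : ℕ) : Fintype.card (Fin n) ≤ B ^ n := by
  rw [Fintype.card_fin]; exact const_le_pow hB n

theorem card_fin_succ_le {l : ℕ} (hl : l + 1 ≤ B) : Fintype.card (Fin (l + 1)) ≤ B ^ 1 := by
  rw [Fintype.card_fin, pow_one]; exact hl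

/-- A multi-index is determined by its `d` multiplicities, each smaller than `B`. -/
theorem card_sym_le {d k : ℕ} (hk : k + 1 ≤ B) : Fintype.card (Sym (Fin d) k) ≤ B ^ d := by
  have h : Fintype.card (Sym (Fin d) k) ≤ Fintype.card (Fin d → Fin B) := by
    refine Fintype.card_le_of_injective (fun a i => ⟨a.1.count i, ?_⟩) fun a a' h => ?_
    · exact ((Multiset.count_le_card i a.1).trans a.2.le).trans_lt hk
    · refine Subtype.ext (Multiset.ext.2 fun i => ?_)
      have := congrFun h i
      exact congrArg Fin.val this
  simpa using h

theorem card_prod_le {d d' : ℕ} (hι : Fintype.card ι ≤ B ^ d) (hκ : Fintype.card κ ≤ B ^ d') :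
    Fintype.card (ι × κ) ≤ B ^ (d + d') := by
  rw [Fintype.card_prod]; exact mul_le_pow hι hκ

theorem sameIndex_le (hB : 2 ≤ B) {d : ℕ} (s t : Multiset (Fin d)) :
    (sameIndex s t).steps ≤ B ^ (d + 1) := const_le_pow hB (d + 1)

theorem fact_le (hB : 2 ≤ B) {k : ℕ} (hk : k ≤ B) : (fact k).steps ≤ B ^ 3 := by
  have h : ∀ k, (fact k).steps ≤ 2 * k + 1 := by
    intro k
    induction k with
    | zero => exact le_rfl
    | succ k ih =>
      have : (fact (k + 1)).steps = (fact k).steps + (1 + 1) := rfl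
      omega
  have h1 := h k
  have h2 : 2 * B + 1 ≤ B ^ 3 := by nlinarith [Nat.pow_le_pow_left hB 2, Nat.pow_le_pow_left hB 3]
  omega

theorem exists_coef_le (d : ℕ) : ∃ e, ∀ B, 2 ≤ B → ∀ k, k + 1 ≤ B → ∀ s : Sym (Fin d) k,
    (coef s).steps ≤ B ^ e :=
  -- The exponent is found by unification from the cost lemmas applied along the program. Since it
  -- is fixed before `B` and `k` are introduced, it cannot depend on them.
  ⟨_, fun B hB k hk s => bind_le hB (fact_le hB (by omega)) fun _ =>
    bind_le hB (prod_steps_le hB (card_fin_le hB d) fun i => fact_le hB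
      (((Multiset.count_le_card i s.1).trans s.2.le).trans (by omega))) fun _ =>
    bind_le hB (op_le hB _) fun _ => op_le hB _⟩

theorem exists_redOne_le (d : ℕ) : ∃ e, ∀ B, 2 ≤ B → ∀ k, k + 2 ≤ B →
    (redOne d k).steps ≤ B ^ e := by
  obtain ⟨e, he⟩ := exists_coef_le d
  exact ⟨_, fun B hB k hk => mat_le hB (card_sym_le hk)
    (card_prod_le (card_sym_le (by omega)) (card_fin_le hB d)) fun c b =>
    bind_le hB (sameIndex_le hB _ _) fun t => ite_le hB
      (bind_le hB (he B hB _ (by omega) _) fun _ => bind_le hB (he B hB _ (by omega) _) fun _ =>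
        op_le hB _) (pure_le hB _)⟩

theorem exists_red_le (d : ℕ) : ∃ e, ∀ B, 2 ≤ B → ∀ i j l, i + 1 ≤ B → j + 1 ≤ B → l + 1 ≤ B →
    (red d i j l).steps ≤ B ^ e := by
  obtain ⟨e, he⟩ := exists_coef_le d
  exact ⟨_, fun B hB i j l hi hj hl => mat_le hB (card_sym_le hl)
    (card_prod_le (card_sym_le hi) (card_sym_le hj)) fun c b =>
    bind_le hB (sameIndex_le hB _ _) fun t => ite_le hB
      (bind_le hB (he B hB _ hi _) fun _ => bind_le hB (he B hB _ hj _) fun _ =>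
        bind_le hB (op_le hB _) fun _ => bind_le hB (he B hB _ hl _) fun _ => op_le hB _)
      (pure_le hB _)⟩

theorem pivot_le {ι : Type} (A : Matrix ι ι ℝ) (c : ι) (l : List ι) :
    (pivot A c l).steps ≤ l.length := by
  induction l with
  | nil => exact le_rfl
  | cons r rs ih =>
    have h : (pivot A c (r :: rs)).steps =
        1 + (if (isZero (A r c)).val then pivot A c rs else pure r).steps := rfl
    rw [h, List.length_cons]
    split_ifs
    · omega
    · show 1 + 0 ≤ _
      omega

theorem exists_solve_le (d : ℕ) : ∃ e, ∀ B, 2 ≤ B → ∀ (ι : Type) [Fintype ι] [DecidableEq ι],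
    Fintype.card ι ≤ B ^ d → ∀ (A : Matrix ι ι ℝ) (b : ι → ℝ), (solve A b).steps ≤ B ^ e := by
  have hstep : ∃ e, ∀ B, 2 ≤ B → ∀ (ι : Type) [Fintype ι] [DecidableEq ι],
      Fintype.card ι ≤ B ^ d → ∀ (c : ι) (cs : List ι), (c :: cs).length ≤ B ^ d → ∀ s : ℕ,
      (∀ A b, (eliminate cs A b).steps ≤ s) →
      ∀ A b, (eliminate (c :: cs) A b).steps ≤ B ^ e + s :=
    ⟨_, fun B hB ι _ _ hι c cs hl s hs A b =>
      bind_add_le hB ((pivot_le A c (c :: cs)).trans hl) fun _ =>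
      bind_add_le hB (mat_le hB hι hι fun _ _ => pure_le hB _) fun _ =>
      bind_add_le hB (tab_le hB hι fun _ => pure_le hB _) fun _ =>
      bind_add_le hB (tab_le hB hι fun _ => op_le hB _) fun _ =>
      bind_add_le hB (op_le hB _) fun _ =>
      bind_add_le hB (mat_le hB hι hι fun _ _ =>
        ite_le hB (pure_le hB _) (bind_le hB (op_le hB _) fun _ => op_le hB _)) fun _ =>
      bind_add_le hB (tab_le hB hι fun _ =>
        ite_le hB (pure_le hB _) (bind_le hB (op_le hB _) fun _ => op_le hB _)) fun _ =>
      (hs _ _).trans (Nat.le_add_left s (B ^ 0))⟩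
  obtain ⟨e, he⟩ := hstep
  -- There are at most `B ^ d` columns, and eliminating one of them costs at most `B ^ e`.
  refine ⟨d + e, fun B hB ι _ _ hι A b => ?_⟩
  have h : ∀ (l : List ι), l.length ≤ B ^ d → ∀ (A : Matrix ι ι ℝ) (b : ι → ℝ),
      (eliminate l A b).steps ≤ l.length * B ^ e := by
    intro l
    induction l with
    | nil => intro _ A b; exact Nat.zero_le _
    | cons c cs ih =>
      intro hl A b
      have h1 := he B hB ι hι c cs hl _ (ih (by rw [List.length_cons] at hl; omega)) A b
      rw [List.length_cons, add_mul, one_mul]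
      omega
  have hl : (Finset.univ : Finset ι).toList.length ≤ B ^ d := by
    rw [Finset.length_toList]; exact hι
  exact (h _ hl A b).trans (mul_le_pow hl le_rfl)

end

/-! ### Step counts of the series arithmetic and of the two algorithms -/

section

theorem exists_dot_le (n d : ℕ) : ∃ e, ∀ B, 2 ≤ B → ∀ (κ : Type) [Fintype κ],
    Fintype.card κ ≤ B ^ d → ∀ (S T : Series n κ) (l : ℕ), l + 1 ≤ B → (dot S T l).steps ≤ B ^ e := by
  obtain ⟨e, he⟩ := exists_red_le n
  exact ⟨_, fun B hB κ _ hκ S T l hl => bind_le hB (tab_le hB (card_fin_succ_le hl) fun j =>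
    bind_le hB (mulMat_le hB _ _ (card_sym_le (show (j : ℕ) + 1 ≤ B by omega)) hκ
      (card_sym_le (show l - (j : ℕ) + 1 ≤ B by omega))) fun _ =>
    bind_le hB (he B hB _ _ _ (by omega) (by omega) hl) fun _ => mulVec_le hB _ _ (card_sym_le hl)
      (card_prod_le (card_sym_le (by omega)) (card_sym_le (by omega)))) fun _ =>
    tab_le hB (card_sym_le hl) fun _ => sum_steps_le hB (card_fin_succ_le hl) fun _ => pure_le hB _⟩

theorem exists_gradProd_le (n m : ℕ) : ∃ e, ∀ B, 2 ≤ B → ∀ (G : Fin m → Series n (Fin n))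
    (S : Series n (Fin n)) (N : ℕ), N + 1 ≤ B → (gradProd G S N).steps ≤ B ^ e := by
  obtain ⟨e, he⟩ := exists_dot_le n n
  exact ⟨_, fun B hB G S N hN => tabTo_le hB hN fun d hd =>
    bind_le hB (tab_le hB (card_fin_le hB m) fun i =>
      he B hB _ (card_fin_le hB n) _ _ _ (by omega)) fun _ => pure_le hB _⟩

theorem exists_powSeries_le (n m : ℕ) : ∃ e, ∀ B, 2 ≤ B → ∀ (v : Series n (Fin m)) (N j : ℕ),
    N + 1 ≤ B → j + 2 ≤ B → (powSeries v N j).steps ≤ B ^ e := by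
  obtain ⟨e, he⟩ := exists_dot_le n 0
  obtain ⟨e1, he1⟩ := exists_redOne_le m
  have h0 : ∃ e2, ∀ B, 2 ≤ B → ∀ (v : Series n (Fin m)) (N : ℕ), N + 1 ≤ B →
      (powSeries v N 0).steps ≤ B ^ e2 :=
    ⟨_, fun B hB v N hN => tabTo_le hB hN fun d hd => mat_le hB
      (card_sym_le (show 0 + 1 ≤ B by omega)) (card_sym_le (show d + 1 ≤ B by omega))
      fun _ _ => pure_le hB _⟩
  have h1 : ∃ e3, ∀ B, 2 ≤ B → ∀ (v : Series n (Fin m)) (N j : ℕ), N + 1 ≤ B → j + 2 ≤ B →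
      ∀ (W : Series n (Sym (Fin m) j)) (K : Matrix (Sym (Fin m) (j + 1)) (Sym (Fin m) j × Fin m) ℝ),
      (redOne m j).steps + (tabTo N fun d => do
        let rows ← tab fun b : Sym (Fin m) j × Fin m => dot (comp W b.1) (comp v b.2) d
        mulMat K (Matrix.of rows) : Comp (Series n (Sym (Fin m) (j + 1)))).steps ≤ B ^ e3 :=
    ⟨_, fun B hB v N j hN hj W K => add_le_pow hB (he1 B hB j hj) (tabTo_le hB hN fun d hd =>
      bind_le hB (tab_le hB (card_prod_le (card_sym_le (show j + 1 ≤ B by omega)) (card_fin_le hB m))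
        fun b => he B hB _ (by simp) _ _ _ (by omega)) fun _ =>
      mulMat_le hB _ _ (card_sym_le (show j + 1 + 1 ≤ B by omega))
        (card_prod_le (card_sym_le (show j + 1 ≤ B by omega)) (card_fin_le hB m))
        (card_sym_le (show d + 1 ≤ B by omega)))⟩
  obtain ⟨e2, h2⟩ := h0
  obtain ⟨e3, h3⟩ := h1
  refine ⟨e2 + (1 + e3) + 1, fun B hB v N j hN hj => ?_⟩
  have h : (powSeries v N j).steps ≤ B ^ e2 + j * B ^ e3 := by
    induction j with
    | zero => simpa using h2 B hB v N hN
    | succ j ih =>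
      have h4 := ih (by omega)
      have h5 : (powSeries v N (j + 1)).steps ≤ (powSeries v N j).steps + B ^ e3 :=
        Nat.add_le_add_left (h3 B hB v N j hN (by omega) _ _) _
      rw [add_mul, one_mul]
      omega
  exact h.trans (add_le_pow hB le_rfl (mul_le_pow (by rw [pow_one]; omega) le_rfl))

theorem exists_psiCoef_le (n m : ℕ) : ∃ e, ∀ B, 2 ≤ B → ∀ (S : Matrix (Fin m) (Fin m) ℝ)
    (Rt : ∀ j, Matrix (Fin m) (Sym (Fin m) j) ℝ) (v : Series n (Fin m)) (J l : ℕ),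
    J + 4 ≤ B → l + 1 ≤ B → (psiCoef S Rt v J l).steps ≤ B ^ e := by
  obtain ⟨e, he⟩ := exists_dot_le n m
  obtain ⟨e1, he1⟩ := exists_powSeries_le n m
  have hJ : ∀ B, ∀ J, J + 4 ≤ B → Fintype.card (Fin (J - 1)) ≤ B ^ 1 := fun B J hJ => by
    rw [Fintype.card_fin, pow_one]; omega
  exact ⟨_, fun B hB S Rt v J l hJ' hl =>
    bind_le hB (tabTo_le hB hl fun d hd => mulMat_le hB _ _ (card_fin_le hB m) (card_fin_le hB m)
      (card_sym_le (show d + 1 ≤ B by omega))) fun _ =>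
    bind_le hB (he B hB _ (card_fin_le hB m) _ _ _ hl) fun _ =>
    bind_le hB (tab_le hB (hJ B J hJ') fun i => bind_le hB (he1 B hB _ _ _ hl (by omega)) fun _ =>
      bind_le hB (tabTo_le hB hl fun d hd => mulMat_le hB _ _ (card_fin_le hB m)
        (card_sym_le (show (i : ℕ) + 2 + 1 ≤ B by omega)) (card_sym_le (show d + 1 ≤ B by omega)))
      fun _ => he B hB _ (card_fin_le hB m) _ _ _ hl) fun _ =>
    tab_le hB (card_sym_le hl) fun _ => bind_le hB (op_le hB _) fun _ =>
      bind_le hB (sum_steps_le hB (hJ B J hJ') fun _ => pure_le hB _) fun _ => op_le hB _⟩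

theorem exists_nextP_le (n m : ℕ) : ∃ e, ∀ B, 2 ≤ B → ∀ (D : Data n m)
    (Fc : Matrix (Fin n) (Fin n) ℝ) (P : Series n (Fin n)) (k : ℕ), k + 4 ≤ B →
    (nextP D Fc P k).steps ≤ B ^ e := by
  obtain ⟨e1, he1⟩ := exists_gradProd_le n m
  obtain ⟨e2, he2⟩ := exists_psiCoef_le n m
  obtain ⟨e3, he3⟩ := exists_dot_le n n
  obtain ⟨e4, he4⟩ := exists_redOne_le n
  obtain ⟨e5, he5⟩ := exists_solve_le n
  exact ⟨_, fun B hB D Fc P k hk =>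
    have hs : Fintype.card (Sym (Fin n) k) ≤ B ^ n := card_sym_le (by omega)
    have hs1 : Fintype.card (Sym (Fin n) (k + 1)) ≤ B ^ n := card_sym_le (by omega)
    have hp : Fintype.card (Sym (Fin n) k × Fin n) ≤ B ^ (n + n) := card_prod_le hs (card_fin_le hB n)
    bind_le hB (he1 B hB _ _ _ (by omega)) fun _ =>
    bind_le hB (he2 B hB _ _ _ _ _ hk (by omega)) fun _ =>
    bind_le hB (he3 B hB _ (card_fin_le hB n) _ _ _ (by omega)) fun _ =>
    bind_le hB (he4 B hB _ (by omega)) fun _ =>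
    bind_le hB (mulVec_le hB _ _ hs1 hp) fun _ =>
    bind_le hB (tab_le hB hs1 fun _ => bind_le hB (op_le hB _) fun _ => op_le hB _) fun _ =>
    bind_le hB (mat_le hB hp hp fun _ _ => bind_le hB (sameIndex_le hB _ _) fun _ => pure_le hB _)
      fun _ =>
    bind_le hB (mulMat_le hB _ _ hs1 hp hp) fun _ =>
    bind_le hB (mulMat_le hB _ _ hs1 hp hs1) fun _ =>
    bind_le hB (he5 B hB _ hs1 _ _) fun _ =>
    bind_le hB (mulVec_le hB _ _ hp hs1) fun _ => pure_le hB _⟩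

theorem exists_loop_le (n m : ℕ) : ∃ e, ∀ B, 2 ≤ B → ∀ (D : Data n m)
    (P₁ Fc : Matrix (Fin n) (Fin n) ℝ) (N : ℕ), N + 4 ≤ B → (loop D P₁ Fc N).steps ≤ B ^ e := by
  obtain ⟨e, he⟩ := exists_nextP_le n m
  refine ⟨1 + e, fun B hB D P₁ Fc N hN => ?_⟩
  have h : ∀ k, k ≤ N → (loop D P₁ Fc k).steps ≤ k * B ^ e := by
    intro k
    induction k with
    | zero => intro _; exact Nat.zero_le _
    | succ k ih =>
      intro hk
      rcases k with _ | k
      · exact Nat.zero_le _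
      · have h1 : (loop D P₁ Fc (k + 2)).steps ≤ (loop D P₁ Fc (k + 1)).steps + (B ^ e + 0) :=
          Nat.add_le_add_left (Nat.add_le_add_right (he B hB D Fc _ (k + 2) (by omega)) 0) _
        have h2 := ih (by omega)
        have h3 : (k + 1 + 1) * B ^ e = (k + 1) * B ^ e + B ^ e := by ring
        rw [h3]
        exact h1.trans (by omega)
  exact (h N le_rfl).trans (mul_le_pow (by rw [pow_one]; omega) le_rfl)

theorem exists_closedLoop_le (n m : ℕ) : ∃ e, ∀ B, 2 ≤ B → ∀ (p : Problem n m)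
    (P₁ : Matrix (Fin n) (Fin n) ℝ), (closedLoop p P₁).steps ≤ B ^ e :=
  ⟨_, fun _ hB _ _ =>
    have hn := card_fin_le hB n
    have hm := card_fin_le hB m
    bind_le hB (mat_le hB hn hn fun _ _ => op_le hB _) fun _ =>
    bind_le hB (mat_le hB hn hm fun _ _ => op_le hB _) fun _ =>
    bind_le hB (mat_le hB hm hm fun _ _ => op_le hB _) fun _ =>
    bind_le hB (mulMat_le hB _ _ hn hm hm) fun _ =>
    bind_le hB (mulMat_le hB _ _ hn hm hn) fun _ =>
    bind_le hB (mulMat_le hB _ _ hn hn hn) fun _ => mat_le hB hn hn fun _ _ => op_le hB _⟩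

theorem exists_readData_le (n m : ℕ) : ∃ e, ∀ B, 2 ≤ B → ∀ (p : Problem n m) (N : ℕ), N + 4 ≤ B →
    (readData p N).steps ≤ B ^ e :=
  ⟨_, fun B hB p N hN =>
    have hn := card_fin_le hB n
    have hm := card_fin_le hB m
    have hN' : N + 1 ≤ B := by omega
    bind_le hB (tabTo_le hB hN' fun k hk => mat_le hB hn (card_sym_le (show k + 1 ≤ B by omega))
      fun _ _ => op_le hB _) fun _ =>
    bind_le hB (tab_le hB hm fun _ => tabTo_le hB hN' fun k hk => mat_le hB hn
      (card_sym_le (show k + 1 ≤ B by omega)) fun _ _ => op_le hB _) fun _ =>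
    bind_le hB (tabTo_le hB hN' fun k hk => mat_le hB hn (card_sym_le (show k + 1 ≤ B by omega))
      fun _ _ => op_le hB _) fun _ =>
    bind_le hB (tabTo_le hB hN' fun k hk => mat_le hB hm (card_sym_le (show k + 1 ≤ B by omega))
      fun _ _ => op_le hB _) fun _ =>
    bind_le hB (mat_le hB hm hm fun _ _ => op_le hB _) fun _ => pure_le hB _⟩

end

end Comp

open NLR.Comp in
theorem exists_polynomial_steps_le (n m : ℕ) : ∃ c : Polynomial ℕ, ∀ p : Problem n m, ∀ N : ℕ,
    (algorithm1 p N).steps ≤ c.eval N ∧ ∀ θ : ℝ, (algorithm2 p θ N).steps ≤ c.eval N := by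
  obtain ⟨e1, h1⟩ := exists_loop_le n m
  obtain ⟨e2, h2⟩ := exists_closedLoop_le n m
  obtain ⟨e3, h3⟩ := exists_readData_le n m
  have hA : ∃ e, ∀ p : Problem n m, ∀ N, (algorithm1 p N).steps ≤ (N + 4) ^ e :=
    ⟨_, fun p N =>
      have hB : 2 ≤ N + 4 := by omega
      bind_le hB (h3 _ hB p N le_rfl) fun _ => bind_le hB (op_le hB _) fun _ =>
      bind_le hB (h2 _ hB p _) fun _ => h1 _ hB _ _ _ _ le_rfl⟩
  obtain ⟨e, he⟩ := hA
  have hA2 : ∃ e', ∀ p : Problem n m, ∀ θ N, (algorithm2 p θ N).steps ≤ (N + 4) ^ e' :=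
    ⟨_, fun p θ N =>
      have hB : 2 ≤ N + 4 := by omega
      bind_le hB (op_le hB _) fun _ => bind_le hB (h2 _ hB p _) fun _ =>
      bind_le hB (op_le hB _) fun _ => ite_le hB (bind_le hB (he p N) fun _ => pure_le hB _)
        (bind_le hB (op_le hB _) fun _ => bind_le hB (he _ N) fun _ => pure_le hB _)⟩
  obtain ⟨e', he'⟩ := hA2
  -- The base of all powers is taken to be `N + 4`, which exceeds every degree that occurs in the
  -- runs of order `N`.
  refine ⟨(Polynomial.X + Polynomial.C 4) ^ e + (Polynomial.X + Polynomial.C 4) ^ e', fun p N => ?_⟩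
  simp only [Polynomial.eval_add, Polynomial.eval_pow, Polynomial.eval_X, Polynomial.eval_C]
  exact ⟨(he p N).trans (Nat.le_add_right _ _), fun θ => (he' p θ N).trans (Nat.le_add_left _ _)⟩

end NLR

namespace NLR
open Matrix Asymptotics

/-! ### The control cost and its conjugate -/

section

variable {ι : Type*} [Fintype ι]

theorem l2_eq_sqrt (v : ι → ℝ) : l2 v = Real.sqrt (∑ i, v i ^ 2) := by
  rw [← l2_sq, Real.sqrt_sq (l2_nonneg _)]

theorem continuous_l2 : Continuous (l2 : (ι → ℝ) → ℝ) := by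
  have : (l2 : (ι → ℝ) → ℝ) = fun v => Real.sqrt (∑ i, v i ^ 2) := funext l2_eq_sqrt
  rw [this]; fun_prop

theorem norm_le_l2 (v : ι → ℝ) : ‖v‖ ≤ l2 v :=
  (pi_norm_le_iff_of_nonneg (l2_nonneg v)).2 fun i => abs_le_l2 v i

theorem isCompact_l2_le (a : ι → ℝ) (r : ℝ) : IsCompact {w : ι → ℝ | l2 (w - a) ≤ r} := by
  refine Metric.isCompact_of_isClosed_isBounded
    (isClosed_le (continuous_l2.comp (continuous_id.sub continuous_const)) continuous_const) ?_
  refine (Metric.isBounded_closedBall (x := a) (r := r)).subset fun w hw => ?_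
  rw [mem_closedBall_iff_norm]
  exact (norm_le_l2 _).trans hw

end

section

variable {n : ℕ}

theorem fderiv_apply_eq_grad (s : (Fin n → ℝ) → ℝ) (x y : Fin n → ℝ) :
    fderiv ℝ s x y = grad s x ⬝ᵥ y := by
  have hy : y = ∑ i, y i • (Pi.single i 1 : Fin n → ℝ) := by
    ext j; simp [Finset.sum_apply, Pi.single_apply]
  conv_lhs => rw [hy]
  rw [map_sum, dotProduct]
  exact Finset.sum_congr rfl fun i _ => by rw [map_smul, smul_eq_mul, mul_comm]; rfl

theorem grad_eq_of_hasFDerivAt {s : (Fin n → ℝ) → ℝ} {x g : Fin n → ℝ}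
    {L : (Fin n → ℝ) →L[ℝ] ℝ} (h : HasFDerivAt s L x) (hL : ∀ y, L y = g ⬝ᵥ y) : grad s x = g := by
  ext i
  rw [grad, h.fderiv, hL, dotProduct_single, mul_one]

theorem grad_analyticAt {f : (Fin n → ℝ) → ℝ} (hf : AnalyticAt ℝ f 0) : AnalyticAt ℝ (grad f) 0 :=
  analyticAt_pi_iff.2 fun i => AnalyticAt.grad hf i

theorem fderiv_grad {f : (Fin n → ℝ) → ℝ} (hf : AnalyticAt ℝ f 0) (y : Fin n → ℝ) (i : Fin n) :
    fderiv ℝ (grad f) 0 y i = (y ᵥ* hess f) i := by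
  have h0 := (ContinuousLinearMap.apply ℝ ℝ (Pi.single i 1 : Fin n → ℝ)).hasFDerivAt.comp (0 : Fin n → ℝ)
    hf.fderiv.differentiableAt.hasFDerivAt
  have h1 : fderiv ℝ (grad f) 0 y i = fderiv ℝ (fderiv ℝ f) 0 y (Pi.single i 1) := by
    have h2 := (hasFDerivAt_pi'.1 (grad_analyticAt hf).differentiableAt.hasFDerivAt i).unique h0
    have h3 := congrArg (fun L : (Fin n → ℝ) →L[ℝ] ℝ => L y) h2
    exact h3
  have hy : y = ∑ i, y i • (Pi.single i 1 : Fin n → ℝ) := by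
    ext j; simp [Finset.sum_apply, Pi.single_apply]
  rw [h1]
  conv_lhs => rw [hy]
  rw [map_sum, _root_.sum_apply, Matrix.vecMul, dotProduct]
  refine Finset.sum_congr rfl fun j _ => ?_
  rw [map_smul, _root_.smul_apply, smul_eq_mul, hess, Matrix.of_apply, iteratedFDeriv_two_apply]
  rfl

end

namespace Problem

variable {n m : ℕ} {p : Problem n m}

theorem Assumptions.rho_analytic (hp : p.Assumptions) : AnalyticAt ℝ p.rho 0 :=
  grad_analyticAt hp.R_analytic

theorem Assumptions.R_nonneg (hp : p.Assumptions) (u : Fin m → ℝ) : 0 ≤ p.R u := by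
  rcases eq_or_ne u 0 with rfl | hu
  · rw [hp.R_zero]
  · exact (hp.R_pos u hu).le

theorem Assumptions.Q_nonneg (hp : p.Assumptions) (x : Fin n → ℝ) : 0 ≤ p.Q x := by
  rcases eq_or_ne x 0 with rfl | hu
  · rw [hp.Q_zero]
  · exact (hp.Q_pos x hu).le

theorem Assumptions.fderiv_R_zero (hp : p.Assumptions) : fderiv ℝ p.R 0 = 0 := by
  refine IsLocalMin.fderiv_eq_zero (Eventually.of_forall fun x => ?_)
  rw [hp.R_zero]; exact hp.R_nonneg x

theorem Assumptions.rho_zero (hp : p.Assumptions) : p.rho 0 = 0 := by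
  ext i; rw [rho, grad, hp.fderiv_R_zero]; rfl

theorem Assumptions.phi_rho (hp : p.Assumptions) (u : Fin m → ℝ) : p.phi (p.rho u) = u :=
  Function.leftInverse_invFun hp.rho_injective u

theorem Assumptions.phi_zero (hp : p.Assumptions) : p.phi 0 = 0 := by
  have := hp.phi_rho 0
  rwa [hp.rho_zero] at this

theorem Assumptions.isUnit_R1 (hp : p.Assumptions) : IsUnit p.R1.det :=
  (Matrix.isUnit_iff_isUnit_det _).1 hp.R1_pos.isUnit

/-- The derivative of `ρ` at the origin. -/
noncomputable def Assumptions.rhoEquiv (hp : p.Assumptions) : (Fin m → ℝ) ≃L[ℝ] (Fin m → ℝ) :=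
  ContinuousLinearEquiv.equivOfInverse (LinearMap.toContinuousLinearMap (Matrix.toLin' p.R1))
    (LinearMap.toContinuousLinearMap (Matrix.toLin' p.R1⁻¹))
    (fun v => by simp [Matrix.mulVec_mulVec, Matrix.nonsing_inv_mul _ hp.isUnit_R1])
    (fun v => by simp [Matrix.mulVec_mulVec, Matrix.mul_nonsing_inv _ hp.isUnit_R1])

theorem Assumptions.fderiv_rho (hp : p.Assumptions) :
    fderiv ℝ p.rho 0 = (hp.rhoEquiv : (Fin m → ℝ) →L[ℝ] (Fin m → ℝ)) := by
  ext1 y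
  ext i
  rw [rho, fderiv_grad hp.R_analytic]
  have h : y ᵥ* hess p.R = p.R1 *ᵥ y := by
    rw [← Matrix.mulVec_transpose]; exact congrArg (· *ᵥ y) hp.R1_symm
  rw [h]; rfl

theorem Assumptions.rho_strict (hp : p.Assumptions) :
    HasStrictFDerivAt p.rho (hp.rhoEquiv : (Fin m → ℝ) →L[ℝ] (Fin m → ℝ)) 0 := by
  rw [← hp.fderiv_rho]; exact hp.rho_analytic.hasStrictFDerivAt

theorem Assumptions.eventually_rho_phi (hp : p.Assumptions) :
    ∀ᶠ v in 𝓝 (0 : Fin m → ℝ), p.rho (p.phi v) = v := by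
  have h := hp.rho_strict.eventually_right_inverse
  rw [hp.rho_zero] at h
  filter_upwards [h] with v hv
  exact Function.invFun_eq ⟨_, hv⟩

/-- The analytic inverse function theorem gives an analytic local inverse of `ρ`, whose derivative
`R₁` at the origin is invertible. Global injectivity of `ρ` identifies it with `phi`. -/
theorem Assumptions.phi_analytic (hp : p.Assumptions) : AnalyticAt ℝ p.phi 0 := by
  set Φ := hp.rho_strict.toOpenPartialHomeomorph p.rho with hΦ
  have h0 : (0 : Fin m → ℝ) ∈ Φ.source := hp.rho_strict.mem_toOpenPartialHomeomorph_source
  have h1 : AnalyticAt ℝ Φ.symm (Φ 0) := by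
    refine Φ.analyticAt_symm' h0 (i := hp.rhoEquiv) hp.rho_analytic ?_
    exact hp.fderiv_rho
  have h2 : Φ 0 = 0 := hp.rho_zero
  rw [h2] at h1
  refine h1.congr ?_
  have h3 := hp.rho_strict.eventually_right_inverse
  rw [hp.rho_zero] at h3
  filter_upwards [h3] with v hv
  conv_rhs => rw [← hv, hp.phi_rho]
  rfl

theorem Assumptions.R_analytic_phi (hp : p.Assumptions) : AnalyticAt ℝ (fun v => p.R (p.phi v)) 0 := by
  refine AnalyticAt.fun_comp ?_ hp.phi_analytic
  rw [hp.phi_zero]; exact hp.R_analytic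

theorem Assumptions.Psi_analytic (hp : p.Assumptions) : AnalyticAt ℝ p.Psi 0 := by
  refine AnalyticAt.sub ?_ hp.R_analytic_phi
  have h : ∀ i : Fin m, AnalyticAt ℝ (fun v : Fin m → ℝ => v i * p.phi v i) 0 := fun i =>
    ((ContinuousLinearMap.proj (R := ℝ) (φ := fun _ : Fin m => ℝ) i).analyticAt _).mul
      (analyticAt_pi_iff.1 hp.phi_analytic i)
  exact Finset.univ.analyticAt_fun_sum fun i _ => h i

/-- As in the envelope theorem, `ρ(φ(v)) = v` makes the contributions of the derivative of `φ`
cancel. -/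
theorem Assumptions.eventually_hasFDerivAt_Psi (hp : p.Assumptions) :
    ∀ᶠ v in 𝓝 (0 : Fin m → ℝ), DifferentiableAt ℝ p.Psi v ∧ grad p.Psi v = p.phi v := by
  filter_upwards [hp.eventually_rho_phi, hp.phi_analytic.eventually_analyticAt] with v hv ha
  have h1 : ∀ i : Fin m, HasFDerivAt (fun w : Fin m → ℝ => p.phi w i)
      ((ContinuousLinearMap.proj (R := ℝ) (φ := fun _ : Fin m => ℝ) i).comp (fderiv ℝ p.phi v)) v :=
    fun i => hasFDerivAt_pi'.1 ha.differentiableAt.hasFDerivAt i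
  have h2 : HasFDerivAt p.Psi _ v := (HasFDerivAt.fun_sum (u := Finset.univ) fun i _ =>
    ((ContinuousLinearMap.proj (R := ℝ) (φ := fun _ : Fin m => ℝ) i).hasFDerivAt).mul (h1 i)).sub
    ((hp.R_differentiable (p.phi v)).hasFDerivAt.comp v ha.differentiableAt.hasFDerivAt)
  refine ⟨h2.differentiableAt, grad_eq_of_hasFDerivAt h2 fun y => ?_⟩
  have h3 : fderiv ℝ p.R (p.phi v) (fderiv ℝ p.phi v y) = v ⬝ᵥ fderiv ℝ p.phi v y := by
    rw [fderiv_apply_eq_grad]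
    exact congrArg (· ⬝ᵥ _) hv
  simp only [_root_.sub_apply, _root_.sum_apply, ContinuousLinearMap.comp_apply, h3]
  simp [dotProduct, Finset.sum_add_distrib]

theorem Assumptions.Psi_zero (hp : p.Assumptions) : p.Psi 0 = 0 := by
  rw [Psi, hp.phi_zero, hp.R_zero]; simp

theorem Assumptions.fderiv_Psi_zero (hp : p.Assumptions) : fderiv ℝ p.Psi 0 = 0 := by
  ext1 y
  rw [fderiv_apply_eq_grad, hp.eventually_hasFDerivAt_Psi.self_of_nhds.2, hp.phi_zero]
  simp

theorem Assumptions.hess_Psi (hp : p.Assumptions) : hess p.Psi = p.R1⁻¹ := by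
  have h1 : fderiv ℝ (grad p.Psi) 0 = fderiv ℝ p.phi 0 :=
    Filter.EventuallyEq.fderiv_eq (hp.eventually_hasFDerivAt_Psi.mono fun v hv => hv.2)
  have h2 : ∀ y, p.R1 *ᵥ (fderiv ℝ p.phi 0 y) = y := by
    intro y
    have h3 : fderiv ℝ (fun v => p.rho (p.phi v)) 0 = ContinuousLinearMap.id ℝ _ := by
      rw [Filter.EventuallyEq.fderiv_eq (f := fun v => v) hp.eventually_rho_phi]
      exact fderiv_fun_id
    have h4 : HasFDerivAt p.rho (fderiv ℝ p.rho 0) (p.phi 0) := by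
      rw [hp.phi_zero]; exact hp.rho_analytic.differentiableAt.hasFDerivAt
    have h5 := (h4.comp (0 : Fin m → ℝ) hp.phi_analytic.differentiableAt.hasFDerivAt).fderiv
    have h6 := congrArg (fun L : (Fin m → ℝ) →L[ℝ] (Fin m → ℝ) => L y) (h5.symm.trans h3)
    rw [hp.fderiv_rho] at h6
    exact h6
  ext i j
  have h3 := fderiv_grad hp.Psi_analytic (Pi.single i 1) j
  rw [h1, Matrix.single_one_vecMul] at h3
  have h4 : fderiv ℝ p.phi 0 (Pi.single i 1) = p.R1⁻¹ *ᵥ Pi.single i 1 := by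
    rw [← h2 (Pi.single i 1), Matrix.mulVec_mulVec, Matrix.nonsing_inv_mul _ hp.isUnit_R1,
      Matrix.one_mulVec, h2]
  rw [h4, Matrix.mulVec_single_one] at h3
  have h5 : (p.R1⁻¹)ᵀ = p.R1⁻¹ := hp.formalData.S_symm
  calc hess p.Psi i j = (hess p.Psi).row i j := rfl
    _ = p.R1⁻¹ j i := h3.symm
    _ = p.R1⁻¹ i j := congrFun (congrFun h5 i) j

/-- The control cost grows at least linearly. -/
theorem Assumptions.exists_linear_le_R (hp : p.Assumptions) {δ : ℝ} (hδ : 0 < δ) :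
    ∃ c, 0 < c ∧ ∀ u : Fin m → ℝ, δ ≤ l2 u → c * l2 u ≤ p.R u := by
  have h1 : {u : Fin m → ℝ | l2 u < δ / 2} ∈ 𝓝 (0 : Fin m → ℝ) :=
    (isOpen_lt continuous_l2 continuous_const).mem_nhds (by show l2 0 < δ / 2; rw [l2_zero]; positivity)
  -- Each value of `ρ` of norm below some `ε` is taken in the ball of radius `δ / 2`, hence by
  -- injectivity only there. If `R` grew too slowly, a point outside that ball with small gradient
  -- would exist.
  have h2 : p.rho '' {u : Fin m → ℝ | l2 u < δ / 2} ∈ 𝓝 (0 : Fin m → ℝ) := by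
    have := image_mem_map (m := p.rho) h1
    rwa [hp.rho_strict.map_nhds_eq_of_equiv, hp.rho_zero] at this
  obtain ⟨ε, hε, hball⟩ := Metric.mem_nhds_iff.1 h2
  refine ⟨ε / 8, by positivity, fun u hu => ?_⟩
  by_contra! hlt
  have hu0 : 0 < l2 u := hδ.trans_le hu
  -- `R` plus the penalty `K |w - u|²` is minimized over the ball of radius `|u| / 2` about `u`.
  -- This `K` makes the penalty `2 R(u)` on the boundary, so the minimizer is interior; there the
  -- entries of the gradient of `R` are at most `8 R(u) / |u| < ε` in absolute value, while `|w| ≥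
  -- |u| / 2 ≥ δ / 2`.
  set K := 8 * p.R u / l2 u ^ 2 with hK
  have hRu : 0 < p.R u := hp.R_pos u fun h => by rw [h, l2_zero] at hu0; exact lt_irrefl _ hu0
  have hK0 : 0 < K := by positivity
  set H : (Fin m → ℝ) → ℝ := fun w => p.R w + K * ∑ i, (w i - u i) ^ 2 with hH
  have hHd : Differentiable ℝ H := by
    have := hp.R_differentiable
    simp only [hH]; fun_prop
  obtain ⟨w, hw, hmin⟩ := (isCompact_l2_le u (l2 u / 2)).exists_isMinOn
    ⟨u, by show l2 (u - u) ≤ _; rw [sub_self, l2_zero]; positivity⟩ hHd.continuous.continuousOn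
  have hl2 : ∀ v : Fin m → ℝ, ∑ i, (v i - u i) ^ 2 = l2 (v - u) ^ 2 := fun v => by rw [l2_sq]; rfl
  have hHu : H u = p.R u := by simp [hH]
  have hle : H w ≤ p.R u := by
    rw [← hHu]
    exact hmin (by show l2 (u - u) ≤ _; rw [sub_self, l2_zero]; positivity)
  have hint : l2 (w - u) < l2 u / 2 := by
    refine lt_of_le_of_ne hw fun heq => ?_
    have h3 : H w = p.R w + K * (l2 u / 2) ^ 2 := by rw [hH]; simp only [hl2, heq]
    have h4 : K * (l2 u / 2) ^ 2 = 2 * p.R u := by rw [hK]; field_simp; ring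
    have := hp.R_nonneg w
    linarith
  have hloc : IsLocalMin H w := by
    refine hmin.isLocalMin ?_
    refine mem_of_superset ((isOpen_lt (continuous_l2.comp (continuous_id.sub continuous_const))
      continuous_const).mem_nhds hint) fun v hv => ?_
    exact (show l2 (v - u) < l2 u / 2 from hv).le
  have hgrad : ∀ i, p.rho w i = -(2 * K * (w - u) i) := by
    intro i
    have h3 : HasFDerivAt H (fderiv ℝ p.R w + K • ∑ j : Fin m, (2 * (w j - u j)) •
        (ContinuousLinearMap.proj (R := ℝ) (φ := fun _ : Fin m => ℝ) j)) w := by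
      refine (hp.R_differentiable w).hasFDerivAt.add (HasFDerivAt.const_mul ?_ K)
      refine HasFDerivAt.fun_sum fun j _ => ?_
      have h4 := (((ContinuousLinearMap.proj (R := ℝ) (φ := fun _ : Fin m => ℝ) j).hasFDerivAt
        (x := w)).sub_const (u j)).pow 2
      simpa using h4
    have h4 := congrArg (fun L : (Fin m → ℝ) →L[ℝ] ℝ => L (Pi.single i 1))
      (hloc.hasFDerivAt_eq_zero h3)
    simp only [_root_.add_apply, _root_.smul_apply, _root_.sum_apply, smul_eq_mul,
      ContinuousLinearMap.proj_apply, Pi.single_apply, mul_ite, mul_one, mul_zero,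
      Finset.sum_ite_eq', Finset.mem_univ, if_true, _root_.zero_apply] at h4
    rw [rho, grad, Pi.sub_apply]; linarith
  have hsmall : p.rho w ∈ Metric.ball (0 : Fin m → ℝ) ε := by
    rw [mem_ball_zero_iff, pi_norm_lt_iff hε]
    intro i
    rw [hgrad, Real.norm_eq_abs, abs_neg, abs_mul, abs_of_pos (by positivity)]
    calc 2 * K * |(w - u) i| ≤ 2 * K * (l2 u / 2) := by
          gcongr; exact (abs_le_l2 _ i).trans hint.le
      _ = 8 * (p.R u / l2 u) := by rw [hK]; field_simp
      _ < ε := by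
          have : p.R u / l2 u < ε / 8 := by rwa [div_lt_iff₀ hu0]
          linarith
  obtain ⟨u', hu', he⟩ := hball hsmall
  have h3 := hp.rho_injective he
  rw [h3] at hu'
  have h4 : l2 u ≤ l2 w + l2 (w - u) := by
    have := l2_add_le w (-(w - u))
    rwa [l2_neg, neg_sub, add_sub_cancel] at this
  have h5 : l2 w < δ / 2 := hu'
  linarith

theorem Assumptions.exists_quadratic_le_R (hp : p.Assumptions) :
    ∃ c, 0 < c ∧ ∀ᶠ u in 𝓝 (0 : Fin m → ℝ), c * ‖u‖ ^ 2 ≤ p.R u := by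
  obtain ⟨μ, hμ, hpos⟩ := exists_pos_mul_dotProduct_le_of_posDef hp.R1_pos
  have h1 := expands_tay hp.R_analytic 3
  obtain ⟨C, hC⟩ := h1.bound
  have h2 : ∀ᶠ u in 𝓝 (0 : Fin m → ℝ), |C| * ‖u‖ < μ / 4 := by
    have : Tendsto (fun u : Fin m → ℝ => |C| * ‖u‖) (𝓝 0) (𝓝 (|C| * ‖(0 : Fin m → ℝ)‖)) :=
      (continuous_const.mul continuous_norm).tendsto 0
    rw [norm_zero, mul_zero] at this
    exact this.eventually (gt_mem_nhds (by positivity))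
  refine ⟨μ / 4, by positivity, ?_⟩
  filter_upwards [hC, h2] with u hu hu2
  have h3 : ev 0 (tay p.R) u = 0 := by
    rw [ev, lowOrd_one_tay hp.R_zero 0 one_pos, zero_dotProduct]
  have h4 : ev 1 (tay p.R) u = 0 := by
    have := lowOrd_two_tay_sub hp.R_analytic hp.R_zero (A := (0 : Matrix Unit (Fin m) ℝ)) (i := ())
      (fun j => by rw [hp.fderiv_R_zero]; rfl) 1 one_lt_two
    have h5 : lin (0 : Matrix Unit (Fin m) ℝ) () = 0 := by simp [lin]
    rw [h5, sub_zero] at this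
    rw [ev, this, zero_dotProduct]
  simp only [Finset.sum_range_succ, Finset.sum_range_zero, h3, h4, ev_two_tay hp.R_analytic,
    zero_add] at hu
  rw [Real.norm_eq_abs, Real.norm_of_nonneg (by positivity)] at hu
  have h6 : ‖u‖ ^ 2 ≤ u ⬝ᵥ u := by
    rw [← l2_sq_eq_dotProduct]; exact pow_le_pow_left₀ (norm_nonneg _) (norm_le_l2 u) 2
  have h7 := hpos u
  have h8 := (abs_le.1 hu).1
  have h9 : C * ‖u‖ ^ 3 ≤ μ / 4 * ‖u‖ ^ 2 := by
    calc C * ‖u‖ ^ 3 ≤ |C| * ‖u‖ ^ 3 := by gcongr; exact le_abs_self C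
      _ = (|C| * ‖u‖) * ‖u‖ ^ 2 := by ring
      _ ≤ _ := by gcongr
  have h10 : u ⬝ᵥ hess p.R *ᵥ u = u ⬝ᵥ p.R1 *ᵥ u := rfl
  rw [h10] at h8
  nlinarith

/-- A lower bound for the control cost. -/
theorem Assumptions.exists_min_le_R (hp : p.Assumptions) :
    ∃ c, 0 < c ∧ ∀ u : Fin m → ℝ, c * min (‖u‖ ^ 2) ‖u‖ ≤ p.R u := by
  obtain ⟨c, hc, h⟩ := hp.exists_quadratic_le_R
  obtain ⟨δ, hδ, hball⟩ := Metric.eventually_nhds_iff_ball.1 h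
  obtain ⟨c', hc', h'⟩ := hp.exists_linear_le_R hδ
  refine ⟨min c c', lt_min hc hc', fun u => ?_⟩
  have h0 : 0 ≤ min (‖u‖ ^ 2) ‖u‖ := by positivity
  rcases lt_or_ge (l2 u) δ with hu | hu
  · refine le_trans ?_ (hball u (by rw [mem_ball_zero_iff]; exact (norm_le_l2 u).trans_lt hu))
    exact mul_le_mul (min_le_left _ _) (min_le_left _ _) h0 hc.le
  · refine le_trans ?_ (h' u hu)
    exact mul_le_mul (min_le_right _ _) ((min_le_right _ _).trans (norm_le_l2 u)) h0 hc'.le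

/-- The conjugate inequality. -/
theorem Assumptions.eventually_fenchel (hp : p.Assumptions) :
    ∀ᶠ v in 𝓝 (0 : Fin m → ℝ), ∀ u, v ⬝ᵥ u - p.R u ≤ p.Psi v := by
  -- Convexity of `R` is not available. For `|v| < c` the linear growth of `R` dominates `v · w`
  -- outside the unit ball, so `R(w) - v · w` has a global minimizer; at it `ρ(w) = v`, that is, `w
  -- = φ(v)`.
  obtain ⟨c, hc, h⟩ := hp.exists_linear_le_R one_pos
  have h1 : {v : Fin m → ℝ | l2 v < c} ∈ 𝓝 (0 : Fin m → ℝ) :=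
    (isOpen_lt continuous_l2 continuous_const).mem_nhds (by show l2 0 < c; rwa [l2_zero])
  filter_upwards [h1] with v hv u
  have hv' : l2 v < c := hv
  set H : (Fin m → ℝ) → ℝ := fun w => p.R w - v ⬝ᵥ w with hH
  have hHd : Differentiable ℝ H := by
    have := hp.R_differentiable
    simp only [hH, dotProduct]; fun_prop
  obtain ⟨w, hw, hmin⟩ := (isCompact_l2_le (0 : Fin m → ℝ) 1).exists_isMinOn
    ⟨0, by show l2 (0 - 0) ≤ _; rw [sub_self, l2_zero]; positivity⟩ hHd.continuous.continuousOn
  have hH0 : H 0 = 0 := by simp [hH, hp.R_zero]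
  have hw0 : H w ≤ 0 := by
    rw [← hH0]; exact hmin (by show l2 (0 - 0) ≤ _; rw [sub_self, l2_zero]; positivity)
  have hglob : ∀ y, H w ≤ H y := by
    intro y
    rcases le_or_gt (l2 y) 1 with hy | hy
    · exact hmin (by show l2 (y - 0) ≤ 1; rwa [sub_zero])
    · refine hw0.trans ?_
      have h2 := h y hy.le
      have h3 := (le_abs_self _).trans (abs_dotProduct_le v y)
      have h4 : l2 v * l2 y ≤ c * l2 y := mul_le_mul_of_nonneg_right hv'.le (l2_nonneg y)
      simp only [hH]; linarith
  have hrho : p.rho w = v := by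
    have h3 : HasFDerivAt H (fderiv ℝ p.R w - ∑ j : Fin m, v j •
        (ContinuousLinearMap.proj (R := ℝ) (φ := fun _ : Fin m => ℝ) j)) w := by
      refine (hp.R_differentiable w).hasFDerivAt.sub ?_
      exact HasFDerivAt.fun_sum fun j _ =>
        ((ContinuousLinearMap.proj (R := ℝ) (φ := fun _ : Fin m => ℝ) j).hasFDerivAt).const_mul (v j)
    ext i
    have hloc : IsLocalMin H w := Eventually.of_forall hglob
    have h4 := congrArg (fun L : (Fin m → ℝ) →L[ℝ] ℝ => L (Pi.single i 1))
      (hloc.hasFDerivAt_eq_zero h3)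
    simp only [_root_.sub_apply, _root_.smul_apply, _root_.sum_apply, smul_eq_mul,
      ContinuousLinearMap.proj_apply, Pi.single_apply, mul_ite, mul_one, mul_zero,
      Finset.sum_ite_eq', Finset.mem_univ, if_true, _root_.zero_apply] at h4
    rw [rho, grad]; linarith
  have h2 := hglob u
  rw [Psi, ← hrho, hp.phi_rho, hrho]
  simp only [hH] at h2
  linarith

end Problem

end NLR

namespace NLR
open Matrix Asymptotics

/-! ### Exponentially stable equilibria -/

/-- For a bounded field, Picard–Lindelöf applies on any interval, in a ball whose radius is the
bound times the length. Uniqueness glues the solutions on growing intervals. -/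
theorem exists_global_solution {E : Type*} [NormedAddCommGroup E] [NormedSpace ℝ E]
    [CompleteSpace E] {Y : E → E} {K L : NNReal} (hY : LipschitzWith K Y) (hb : ∀ x, ‖Y x‖ ≤ L)
    (x₀ : E) : ∃ x : ℝ → E, x 0 = x₀ ∧ ∀ t, HasDerivAt x (Y (x t)) t := by
  have hloc : ∀ N : ℕ, ∃ α : ℝ → E, α 0 = x₀ ∧
      ∀ t ∈ Ioo (-((N : ℝ) + 1)) (N + 1), HasDerivAt α (Y (α t)) t := by
    intro N
    have h0 : (0 : ℝ) ∈ Icc (-((N : ℝ) + 1)) (N + 1) := by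
      constructor <;> [linarith [N.cast_nonneg (α := ℝ)]; positivity]
    have hp : IsPicardLindelof (fun _ : ℝ => Y) (⟨0, h0⟩ : Icc (-((N : ℝ) + 1)) (N + 1)) x₀
        (L * (N + 1)) 0 L K :=
      .of_time_independent (fun x _ => hb x) hY.lipschitzOnWith (by simp)
    obtain ⟨α, h1, h2⟩ := hp.exists_eq_forall_mem_Icc_hasDerivWithinAt₀
    exact ⟨α, h1, fun t ht => (h2 t (Ioo_subset_Icc_self ht)).hasDerivAt (Icc_mem_nhds ht.1 ht.2)⟩
  choose α hα0 hα using hloc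
  have hagree : ∀ N M : ℕ, N ≤ M → ∀ t ∈ Ioo (-((N : ℝ) + 1)) (N + 1), α N t = α M t := by
    intro N M hNM
    have hc : (N : ℝ) ≤ M := by exact_mod_cast hNM
    have h0 : (0 : ℝ) ∈ Ioo (-((N : ℝ) + 1)) (N + 1) := by
      constructor <;> [linarith [N.cast_nonneg (α := ℝ)]; positivity]
    refine ODE_solution_unique_of_mem_Ioo (v := fun _ => Y) (s := fun _ => univ) (K := K)
      (fun t _ => hY.lipschitzOnWith) h0 (fun t ht => ⟨hα N t ht, mem_univ _⟩)
      (fun t ht => ⟨hα M t ⟨by linarith [ht.1], by linarith [ht.2]⟩, mem_univ _⟩)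
      ((hα0 N).trans (hα0 M).symm)
  have hmem : ∀ t : ℝ, ∀ N : ℕ, |t| ≤ N → t ∈ Ioo (-((N : ℝ) + 1)) (N + 1) := fun t N h =>
    ⟨by linarith [neg_abs_le t], by linarith [le_abs_self t]⟩
  refine ⟨fun t => α ⌈|t|⌉₊ t, by simp [hα0], fun t => ?_⟩
  set N := ⌈|t|⌉₊ + 1 with hN
  have hle : ⌈|t|⌉₊ ≤ N := Nat.le_succ _
  have heq : α ⌈|t|⌉₊ t = α N t := hagree _ _ hle t (hmem t _ (Nat.le_ceil _))
  have htN : |t| < N := lt_of_le_of_lt (Nat.le_ceil _) (by rw [hN]; push_cast; linarith)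
  have hd := hα N t (hmem t N htN.le)
  simp only [heq]
  refine hd.congr_of_eventuallyEq ?_
  have : ∀ᶠ s : ℝ in 𝓝 t, |s| < (N : ℝ) := (continuous_abs.tendsto t).eventually_lt_const htN
  filter_upwards [this] with s hs
  exact hagree _ _ (Nat.ceil_le.2 hs.le) s (hmem s _ (Nat.le_ceil _))

section

variable {n : ℕ}

theorem abs_dotProduct_mulVec_le_norm (A : Matrix (Fin n) (Fin n) ℝ) (x y : Fin n → ℝ) :
    |x ⬝ᵥ A *ᵥ y| ≤ (∑ i, ∑ j, |A i j|) * (‖x‖ * ‖y‖) := by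
  simp only [dotProduct, mulVec, Finset.mul_sum, Finset.sum_mul]
  refine (Finset.abs_sum_le_sum_abs _ _).trans (Finset.sum_le_sum fun i _ => ?_)
  refine (Finset.abs_sum_le_sum_abs _ _).trans (Finset.sum_le_sum fun j _ => ?_)
  rw [abs_mul, abs_mul]
  have h1 := norm_le_pi_norm x i
  have h2 := norm_le_pi_norm y j
  rw [Real.norm_eq_abs] at h1 h2
  calc |x i| * (|A i j| * |y j|) = |A i j| * (|x i| * |y j|) := by ring
    _ ≤ |A i j| * (‖x‖ * ‖y‖) := by gcongr

theorem norm_sq_le_dotProduct (x : Fin n → ℝ) : ‖x‖ ^ 2 ≤ x ⬝ᵥ x := by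
  rw [← l2_sq_eq_dotProduct]
  exact pow_le_pow_left₀ (norm_nonneg _) (norm_le_l2 x) 2

/-- In the sup norm the ball is a cube, and clamping the coordinates is a 1-Lipschitz retraction
onto it. The extension is bounded, as `exists_global_solution` requires. -/
theorem exists_lipschitz_extension_closedBall {X : (Fin n → ℝ) → Fin n → ℝ} {K : NNReal} {r : ℝ}
    (hr : 0 ≤ r) (hX : LipschitzOnWith K X (Metric.closedBall 0 r)) (h0 : X 0 = 0) :
    ∃ Y : (Fin n → ℝ) → Fin n → ℝ, LipschitzWith K Y ∧ (∀ x, ‖Y x‖ ≤ (K * r.toNNReal : NNReal)) ∧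
      ∀ x, ‖x‖ ≤ r → Y x = X x := by
  have hle : -r ≤ r := by linarith
  set c : (Fin n → ℝ) → Fin n → ℝ := fun x i => projIcc (-r) r hle (x i) with hc
  have hcl : LipschitzWith 1 c := by
    refine LipschitzWith.of_dist_le_mul fun x y => ?_
    rw [NNReal.coe_one, one_mul, dist_pi_le_iff dist_nonneg]
    intro i
    refine ((LipschitzWith.projIcc hle).dist_le_mul (x i) (y i)).trans ?_
    rw [NNReal.coe_one, one_mul]
    exact dist_le_pi_dist x y i
  have hcm : ∀ x, ‖c x‖ ≤ r := fun x => (pi_norm_le_iff_of_nonneg hr).2 fun i => by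
    rw [Real.norm_eq_abs, abs_le]
    exact (projIcc (-r) r hle (x i)).2
  have hcb : ∀ x, c x ∈ Metric.closedBall (0 : Fin n → ℝ) r := fun x =>
    mem_closedBall_zero_iff.2 (hcm x)
  refine ⟨X ∘ c, ?_, fun x => ?_, fun x hx => ?_⟩
  · refine LipschitzWith.of_dist_le_mul fun x y => ?_
    refine (hX.dist_le_mul _ (hcb x) _ (hcb y)).trans ?_
    have := hcl.dist_le_mul x y
    rw [NNReal.coe_one, one_mul] at this
    gcongr
  · have := hX.dist_le_mul _ (hcb x) 0 (Metric.mem_closedBall_self hr)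
    rw [h0, dist_zero_right, dist_zero_right] at this
    refine this.trans ?_
    rw [NNReal.coe_mul, Real.coe_toNNReal _ hr]
    gcongr
    exact hcm x
  · have : c x = x := by
      ext i
      have hi := (norm_le_pi_norm x i).trans hx
      rw [Real.norm_eq_abs, abs_le] at hi
      simp only [hc]
      rw [projIcc_of_mem hle hi]
    simp [this]

/-- The Lyapunov function `xᵀ P x` of the linearization still decreases along the nonlinear field
near the origin, so a small sublevel set traps trajectories and the function decays exponentially
there. The trajectory is that of a bounded Lipschitz extension, which agrees with `X` where the
trajectory lives. -/
theorem exists_exp_decay_solution {X : (Fin n → ℝ) → Fin n → ℝ} {A : Matrix (Fin n) (Fin n) ℝ}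
    (hX : ContDiffAt ℝ 1 X 0) (h0 : X 0 = 0) (hA : IsHurwitz A)
    (hXA : ∀ y, fderiv ℝ X 0 y = A *ᵥ y) {U : Set (Fin n → ℝ)} (hU : U ∈ 𝓝 0) :
    ∀ᶠ x₀ in 𝓝 (0 : Fin n → ℝ), ∃ x : ℝ → Fin n → ℝ, x 0 = x₀ ∧
      (∀ t, 0 ≤ t → HasDerivAt x (X (x t)) t) ∧ (∀ t, 0 ≤ t → x t ∈ U) ∧
      ∃ C c : ℝ, 0 < c ∧ ∀ t, 0 ≤ t → ‖x t‖ ≤ C * Real.exp (-c * t) := by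
  obtain ⟨P, hP, hPA⟩ := hA.exists_isLyapunov
  have hPs : Pᵀ = P := (posDef_iff_real.1 hP).1
  obtain ⟨μ, hμ, hμP⟩ := exists_pos_mul_dotProduct_le_of_posDef hP
  set S := ∑ i, ∑ j, |P i j| with hS
  have hS0 : 0 ≤ S := Finset.sum_nonneg fun i _ => Finset.sum_nonneg fun j _ => abs_nonneg _
  -- the Lyapunov inequality near the origin
  have hrem : ∀ᶠ x in 𝓝 (0 : Fin n → ℝ), ‖X x - A *ᵥ x‖ ≤ 1 / (4 * (S + 1)) * ‖x‖ := by
    have hd := (hX.differentiableAt one_ne_zero).hasFDerivAt.isLittleO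
    have := hd.def (show (0 : ℝ) < 1 / (4 * (S + 1)) by positivity)
    simpa [h0, hXA] using this
  have hA2 : ∀ x, x ⬝ᵥ P *ᵥ (A *ᵥ x) = -(1 / 2) * (x ⬝ᵥ x) := by
    intro x
    have h1 : x ⬝ᵥ (Aᵀ * P + P * A + 1) *ᵥ x = 0 := by rw [hPA]; simp
    rw [add_mulVec, add_mulVec, one_mulVec, dotProduct_add, dotProduct_add, ← mulVec_mulVec,
      ← mulVec_mulVec] at h1
    have h2 : x ⬝ᵥ Aᵀ *ᵥ (P *ᵥ x) = x ⬝ᵥ P *ᵥ (A *ᵥ x) := by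
      rw [dotProduct_mulVec, vecMul_transpose, dotProduct_mulVec, ← mulVec_transpose, hPs,
        dotProduct_comm, dotProduct_comm]
    rw [h2] at h1
    linarith
  have hdec : ∀ᶠ x in 𝓝 (0 : Fin n → ℝ), 2 * (x ⬝ᵥ P *ᵥ X x) ≤ -(1 / 2) * (x ⬝ᵥ x) := by
    filter_upwards [hrem] with x hx
    have h1 : x ⬝ᵥ P *ᵥ X x = -(1 / 2) * (x ⬝ᵥ x) + x ⬝ᵥ P *ᵥ (X x - A *ᵥ x) := by
      rw [← hA2, ← dotProduct_add, ← mulVec_add, add_sub_cancel]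
    have h2 := (le_abs_self _).trans (abs_dotProduct_mulVec_le_norm P x (X x - A *ᵥ x))
    rw [← hS] at h2
    have h3 : S * (‖x‖ * ‖X x - A *ᵥ x‖) ≤ 1 / 4 * ‖x‖ ^ 2 := by
      calc S * (‖x‖ * ‖X x - A *ᵥ x‖) ≤ S * (‖x‖ * (1 / (4 * (S + 1)) * ‖x‖)) := by gcongr
        _ = S / (S + 1) * (1 / 4 * ‖x‖ ^ 2) := by field_simp
        _ ≤ 1 * (1 / 4 * ‖x‖ ^ 2) := by
          gcongr
          rw [div_le_one (by positivity)]; linarith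
        _ = _ := one_mul _
    have h4 := norm_sq_le_dotProduct x
    linarith
  obtain ⟨K, s, hs, hKs⟩ := hX.exists_lipschitzOnWith
  obtain ⟨r, hr, hball⟩ := Metric.nhds_basis_closedBall.mem_iff.1
    (Filter.inter_mem (Filter.inter_mem hU hs) hdec)
  have hin : ∀ x : Fin n → ℝ, ‖x‖ ≤ r → x ∈ U ∧ 2 * (x ⬝ᵥ P *ᵥ X x) ≤ -(1 / 2) * (x ⬝ᵥ x) :=
    fun x hx => by
      have := hball (mem_closedBall_zero_iff.2 hx)
      exact ⟨this.1.1, this.2⟩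
  obtain ⟨Y, hY, hYb, hYX⟩ := exists_lipschitz_extension_closedBall hr.le
    (hKs.mono fun x hx => (hball hx).1.2) h0
  have hlev : ∀ x, x ⬝ᵥ P *ᵥ x ≤ μ * r ^ 2 → ‖x‖ ≤ r := by
    intro x hx
    have h1 := (mul_le_mul_of_nonneg_left (norm_sq_le_dotProduct x) hμ.le).trans ((hμP x).trans hx)
    exact le_of_sq_le_sq (le_of_mul_le_mul_left h1 hμ) hr.le
  have hcont : Continuous fun x : Fin n → ℝ => x ⬝ᵥ P *ᵥ x := by fun_prop
  have hev : ∀ᶠ x in 𝓝 (0 : Fin n → ℝ), x ⬝ᵥ P *ᵥ x < μ * r ^ 2 := by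
    refine (hcont.tendsto 0).eventually_lt_const ?_
    simp only [zero_dotProduct]
    positivity
  filter_upwards [hev] with x₀ hx₀
  obtain ⟨x, hx0, hx⟩ := exists_global_solution hY hYb x₀
  have hLd : ∀ t, HasDerivAt (fun t => x t ⬝ᵥ P *ᵥ x t) (2 * (x t ⬝ᵥ P *ᵥ Y (x t))) t := by
    intro t
    have hc : ∀ i, HasDerivAt (fun t => x t i) (Y (x t) i) t := fun i => hasDerivAt_pi.1 (hx t) i
    have h1 : HasDerivAt (fun t => x t ⬝ᵥ P *ᵥ x t)
        (∑ i, (Y (x t) i * (P *ᵥ x t) i + x t i * ∑ j, P i j * Y (x t) j)) t :=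
      HasDerivAt.fun_sum fun i _ => by
        have hm : HasDerivAt (fun t => (P *ᵥ x t) i) (∑ j, P i j * Y (x t) j) t := by
          simp only [mulVec, dotProduct]
          exact HasDerivAt.fun_sum fun j _ => (hc j).const_mul (P i j)
        exact (hc i).mul hm
    have h2 : Y (x t) ⬝ᵥ P *ᵥ x t = x t ⬝ᵥ P *ᵥ Y (x t) := by
      rw [dotProduct_mulVec, ← mulVec_transpose, hPs, dotProduct_comm]
    have h3 : ∑ i, (Y (x t) i * (P *ᵥ x t) i + x t i * ∑ j, P i j * Y (x t) j) =
        Y (x t) ⬝ᵥ P *ᵥ x t + x t ⬝ᵥ P *ᵥ Y (x t) := Finset.sum_add_distrib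
    rw [h3, h2, ← two_mul] at h1
    exact h1
  have htrap : ∀ t, 0 ≤ t → x t ⬝ᵥ P *ᵥ x t ≤ μ * r ^ 2 := by
    intro t ht
    -- The derivative has to be negative only at times when the level `μ r²` is attained; there `x`
    -- is nonzero and still in the ball, so the Lyapunov inequality is strict.
    refine image_le_of_deriv_right_lt_deriv_boundary' (a := 0) (b := t) (B' := fun _ => 0)
      (fun s _ => (hLd s).continuousAt.continuousWithinAt)
      (fun s _ => (hLd s).hasDerivWithinAt) (by rw [hx0]; exact hx₀.le) continuousOn_const
      (fun s _ => hasDerivWithinAt_const _ _ _) (fun s _ hsb => ?_) (right_mem_Icc.2 ht)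
    have hb := hlev (x s) hsb.le
    rw [hYX _ hb]
    have h1 := (hin _ hb).2
    have hxs : x s ≠ 0 := by
      intro h
      rw [h] at hsb
      simp only [zero_dotProduct] at hsb
      have : 0 < μ * r ^ 2 := by positivity
      linarith
    have h2 : 0 < x s ⬝ᵥ x s := lt_of_lt_of_le (by positivity) (norm_sq_le_dotProduct _)
    linarith
  have hxr : ∀ t, 0 ≤ t → ‖x t‖ ≤ r := fun t ht => hlev _ (htrap t ht)
  refine ⟨x, hx0, fun t ht => ?_, fun t ht => (hin _ (hxr t ht)).1, r, 1 / (4 * (n * S + 1)),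
    by positivity, fun t ht => ?_⟩
  · rw [← hYX _ (hxr t ht)]; exact hx t
  -- With this rate `k P` is at most half the identity as a form, so `exp (k t)` times the Lyapunov
  -- function does not increase. Passing to the norm takes a square root, which halves the rate.
  · set k : ℝ := 1 / (2 * (n * S + 1)) with hk
    have hk0 : 0 < k := by positivity
    have hanti : AntitoneOn (fun t => (x t ⬝ᵥ P *ᵥ x t) * Real.exp (k * t)) (Ici 0) := by
      have hd : ∀ s, HasDerivAt (fun t => (x t ⬝ᵥ P *ᵥ x t) * Real.exp (k * t))
          (2 * (x s ⬝ᵥ P *ᵥ Y (x s)) * Real.exp (k * s) +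
            (x s ⬝ᵥ P *ᵥ x s) * (Real.exp (k * s) * (k * 1))) s := fun s =>
        (hLd s).mul (((hasDerivAt_id s).const_mul k).exp)
      refine antitoneOn_of_deriv_nonpos (convex_Ici 0)
        (fun s _ => (hd s).continuousAt.continuousWithinAt)
        (fun s _ => (hd s).differentiableAt.differentiableWithinAt) fun s hs => ?_
      rw [interior_Ici] at hs
      have hb := hxr s (le_of_lt hs)
      rw [(hd s).deriv, hYX _ hb]
      have h1 := (hin _ hb).2
      have h2 : x s ⬝ᵥ P *ᵥ x s ≤ (n * S + 1) * (x s ⬝ᵥ x s) := by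
        rcases Nat.eq_zero_or_pos n with hn | hn
        · subst hn; simp [dotProduct]
        · have h3 := (le_abs_self _).trans (abs_dotProduct_mulVec_le_norm P (x s) (x s))
          rw [← hS, ← sq] at h3
          have h4 := norm_sq_le_dotProduct (x s)
          have h5 : (1 : ℝ) ≤ n := by exact_mod_cast hn
          have h6 : S * ‖x s‖ ^ 2 ≤ S * (x s ⬝ᵥ x s) := by gcongr
          have h7 : S * (x s ⬝ᵥ x s) ≤ n * (S * (x s ⬝ᵥ x s)) := le_mul_of_one_le_left
            (mul_nonneg hS0 (le_trans (by positivity) h4)) h5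
          have h8 : 0 ≤ x s ⬝ᵥ x s := le_trans (by positivity) h4
          linarith
      have h3 : k * (x s ⬝ᵥ P *ᵥ x s) ≤ 1 / 2 * (x s ⬝ᵥ x s) := by
        calc k * (x s ⬝ᵥ P *ᵥ x s) ≤ k * ((n * S + 1) * (x s ⬝ᵥ x s)) := by gcongr
          _ = _ := by rw [hk]; field_simp
      have h4 : 2 * (x s ⬝ᵥ P *ᵥ X (x s)) + k * (x s ⬝ᵥ P *ᵥ x s) ≤ 0 := by linarith
      have h5 := mul_nonpos_of_nonpos_of_nonneg h4 (Real.exp_pos (k * s)).le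
      linarith
    have h1 := hanti (mem_Ici.2 le_rfl) (mem_Ici.2 ht) ht
    simp only [mul_zero, Real.exp_zero, mul_one] at h1
    have h2 : μ * ‖x t‖ ^ 2 ≤ μ * r ^ 2 * Real.exp (-k * t) := by
      have h3 := (mul_le_mul_of_nonneg_left (norm_sq_le_dotProduct (x t)) hμ.le).trans (hμP (x t))
      have h4 : x t ⬝ᵥ P *ᵥ x t = (x t ⬝ᵥ P *ᵥ x t) * Real.exp (k * t) * Real.exp (-k * t) := by
        rw [mul_assoc, ← Real.exp_add]; simp
      rw [h4] at h3
      refine h3.trans (mul_le_mul_of_nonneg_right (h1.trans ?_) (Real.exp_pos _).le)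
      exact htrap 0 le_rfl
    refine le_of_sq_le_sq (?_ : ‖x t‖ ^ 2 ≤ _) (by positivity)
    rw [mul_pow, ← Real.exp_nat_mul]
    refine le_of_mul_le_mul_left (h2.trans_eq ?_) hμ
    rw [mul_assoc]
    congr 3
    rw [hk]; push_cast; field_simp; ring

end

/-! ### The chain rule along absolutely continuous curves -/

section

variable {n : ℕ}

/-- For a merely integrable velocity the curve is only absolutely continuous. Since `V` is Lipschitz
on `B`, the composition is absolutely continuous too, and the fundamental theorem of calculus
applies with the chain rule almost everywhere. -/
theorem sub_le_integral_of_ae_deriv {V : (Fin n → ℝ) → ℝ} {B : Set (Fin n → ℝ)} {K : NNReal}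
    (hV : ∀ y ∈ B, DifferentiableAt ℝ V y) (hK : LipschitzOnWith K V B)
    {x : ℝ → Fin n → ℝ} {w : ℝ → Fin n → ℝ} {ℓ : ℝ → ℝ} {a b : ℝ} (hab : a ≤ b)
    (hw : IntervalIntegrable w volume a b)
    (hx : ∀ t ∈ Icc a b, x t = x a + ∫ s in a..t, w s)
    (hxB : ∀ t ∈ Icc a b, x t ∈ B) (hℓ : IntervalIntegrable ℓ volume a b)
    (h : ∀ᵐ t, t ∈ Ioc a b → -(fderiv ℝ V (x t) (w t)) ≤ ℓ t) :
    V (x a) - V (x b) ≤ ∫ t in a..b, ℓ t := by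
  set y : ℝ → Fin n → ℝ := fun t => x a + ∫ s in a..t, w s with hy
  have huI : uIcc a b = Icc a b := uIcc_of_le hab
  have hac : AbsolutelyContinuousOnInterval (fun t => V (x t)) a b := by
    have hN := hw.norm.absolutelyContinuousOnInterval_intervalIntegral (c := a) left_mem_uIcc
    rw [absolutelyContinuousOnInterval_iff] at hN ⊢
    intro ε hε
    obtain ⟨δ, hδ, H⟩ := hN (ε / (K + 1)) (by positivity)
    refine ⟨δ, hδ, fun E hE hEδ => ?_⟩
    have h1 := H E hE hEδ
    rw [lt_div_iff₀ (by positivity)] at h1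
    refine lt_of_le_of_lt ?_ h1
    rw [Finset.sum_mul]
    refine Finset.sum_le_sum fun i hi => ?_
    obtain ⟨hs, ht⟩ := hE.1 i hi
    have hsub : ∀ {s t}, s ∈ uIcc a b → t ∈ uIcc a b → IntervalIntegrable w volume s t :=
      fun hs ht => hw.mono_set (uIcc_subset_uIcc hs ht)
    have hsi := hsub left_mem_uIcc hs
    have hti := hsub left_mem_uIcc ht
    have h2 : dist (x (E.2 i).1) (x (E.2 i).2) ≤
        dist (∫ s in a..(E.2 i).1, ‖w s‖) (∫ s in a..(E.2 i).2, ‖w s‖) := by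
      rw [hx (E.2 i).1 (huI ▸ hs), hx (E.2 i).2 (huI ▸ ht), dist_add_left, dist_eq_norm, dist_eq_norm,
        intervalIntegral.integral_interval_sub_left hsi hti,
        intervalIntegral.integral_interval_sub_left hsi.norm hti.norm]
      exact intervalIntegral.norm_integral_le_abs_integral_norm.trans_eq (Real.norm_eq_abs _).symm
    calc dist (V (x (E.2 i).1)) (V (x (E.2 i).2)) ≤ K * dist (x (E.2 i).1) (x (E.2 i).2) :=
          hK.dist_le_mul _ (hxB _ (huI ▸ hs)) _ (hxB _ (huI ▸ ht))
      _ ≤ (K + 1) * dist (∫ s in a..(E.2 i).1, ‖w s‖) (∫ s in a..(E.2 i).2, ‖w s‖) := by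
          gcongr; linarith
      _ = _ := mul_comm _ _
  have hd : ∀ᵐ t, t ∈ Ioo a b → HasDerivAt (fun t => V (x t)) (fderiv ℝ V (x t) (w t)) t := by
    filter_upwards [hw.ae_hasDerivAt_integral] with t ht htI
    have htc := Ioo_subset_Icc_self htI
    have h1 : HasDerivAt y (w t) t := (ht (huI ▸ htc) a left_mem_uIcc).const_add _
    have h2 : HasDerivAt x (w t) t := by
      refine h1.congr_of_eventuallyEq ?_
      filter_upwards [Ioo_mem_nhds htI.1 htI.2] with s hs
      exact hx s (Ioo_subset_Icc_self hs)
    exact (hV _ (hxB t htc)).hasFDerivAt.comp_hasDerivAt t h2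
  have hne : ∀ᵐ t : ℝ, t ≠ b := by simp [ae_iff]
  have hint := hac.integral_deriv_eq_sub
  have h1 : V (x a) - V (x b) = ∫ t in a..b, -deriv (fun t => V (x t)) t := by
    rw [intervalIntegral.integral_neg, hint]; ring
  rw [h1]
  refine intervalIntegral.integral_mono_ae_restrict hab hac.intervalIntegrable_deriv.neg hℓ ?_
  rw [Filter.EventuallyLE, ae_restrict_iff' measurableSet_Icc]
  have hna : ∀ᵐ t : ℝ, t ≠ a := by simp [ae_iff]
  filter_upwards [hd, h, hne, hna] with t h1 h2 h3 h4 htI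
  have h5 : t ∈ Ioo a b := ⟨lt_of_le_of_ne htI.1 (Ne.symm h4), lt_of_le_of_ne htI.2 h3⟩
  rw [(h1 h5).deriv]
  exact h2 (Ioo_subset_Ioc_self h5)

end

end NLR

namespace NLR
open Matrix Asymptotics

/-! ### The value function is bounded below by solutions of the HJB equation -/

/-- `τ` is the first time at which the upper level is reached, and `s` the last time before `τ` at
or below the lower level. -/
theorem exists_annulus_crossing {φ : ℝ → ℝ} {T a b : ℝ} (hT : 0 ≤ T) (hφ : ContinuousOn φ (Icc 0 T))
    (h0 : φ 0 ≤ a) (hb : b ≤ φ T) :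
    ∃ s τ, 0 ≤ s ∧ s ≤ τ ∧ φ s ≤ a ∧ b ≤ φ τ ∧ ∀ t ∈ Ioo s τ, a < φ t ∧ φ t < b := by
  have hc1 : IsCompact (Icc 0 T ∩ φ ⁻¹' Ici b) :=
    isCompact_Icc.of_isClosed_subset (hφ.preimage_isClosed_of_isClosed isClosed_Icc isClosed_Ici)
      inter_subset_left
  obtain ⟨τ, ⟨hτI, hτb⟩, hτ⟩ := hc1.exists_isLeast ⟨T, ⟨hT, le_rfl⟩, hb⟩
  have hφτ : ContinuousOn φ (Icc 0 τ) := hφ.mono (Icc_subset_Icc_right hτI.2)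
  have hc2 : IsCompact (Icc 0 τ ∩ φ ⁻¹' Iic a) :=
    isCompact_Icc.of_isClosed_subset (hφτ.preimage_isClosed_of_isClosed isClosed_Icc isClosed_Iic)
      inter_subset_left
  obtain ⟨s, ⟨hsI, hsa⟩, hs⟩ := hc2.exists_isGreatest ⟨0, ⟨le_rfl, hτI.1⟩, h0⟩
  refine ⟨s, τ, hsI.1, hsI.2, hsa, hτb, fun t ht => ⟨?_, ?_⟩⟩
  · by_contra h
    exact absurd (hs ⟨⟨hsI.1.trans ht.1.le, ht.2.le⟩, not_lt.1 h⟩) (not_le.2 ht.1)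
  · by_contra h
    exact absurd (hτ ⟨⟨hsI.1.trans ht.1.le, ht.2.le.trans hτI.2⟩, not_lt.1 h⟩) (not_le.2 ht.2)

namespace Problem

variable {n m : ℕ} {p : Problem n m}

theorem Assumptions.exists_cost_bound (hp : p.Assumptions) :
    ∃ C, 0 ≤ C ∧ ∀ᶠ y in 𝓝 (0 : Fin n → ℝ), ∀ u : Fin m → ℝ,
      ‖p.f y + p.g y *ᵥ u‖ ≤ C * (1 + ‖u‖) := by
  have hf := hp.f_analytic.continuousAt.norm.eventually_le_const (lt_add_one ‖p.f 0‖)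
  have hg : ∀ᶠ y in 𝓝 (0 : Fin n → ℝ), ∀ i j, |p.g y i j| ≤ |p.g 0 i j| + 1 :=
    eventually_all.2 fun i => eventually_all.2 fun j =>
      (hp.g_analytic i j).continuousAt.norm.eventually_le_const (lt_add_one _)
  set A := ‖p.f 0‖ + 1
  set B := ∑ i, ∑ j, (|p.g 0 i j| + 1)
  have hB : 0 ≤ B := Finset.sum_nonneg fun i _ => Finset.sum_nonneg fun j _ => by positivity
  have hA : 0 ≤ A := by positivity
  refine ⟨A + B, by positivity, ?_⟩
  filter_upwards [hf, hg] with y h1 h2 u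
  have h3 : ‖p.g y *ᵥ u‖ ≤ B * ‖u‖ := by
    refine (pi_norm_le_iff_of_nonneg (by positivity)).2 fun i => ?_
    rw [Real.norm_eq_abs, mulVec, dotProduct]
    refine (Finset.abs_sum_le_sum_abs _ _).trans ?_
    calc ∑ j, |p.g y i j * u j| ≤ ∑ j, (|p.g 0 i j| + 1) * ‖u‖ := by
          refine Finset.sum_le_sum fun j _ => ?_
          rw [abs_mul]
          have := norm_le_pi_norm u j
          rw [Real.norm_eq_abs] at this
          gcongr
          exact h2 i j
      _ = (∑ j, (|p.g 0 i j| + 1)) * ‖u‖ := by rw [Finset.sum_mul]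
      _ ≤ B * ‖u‖ := by
          gcongr
          exact Finset.single_le_sum (f := fun i => ∑ j, (|p.g 0 i j| + 1))
            (fun i _ => Finset.sum_nonneg fun j _ => by positivity) (Finset.mem_univ i)
  refine (norm_add_le _ _).trans ?_
  have h4 := norm_nonneg u
  nlinarith

theorem exists_pos_le_of_compact {s : Set (Fin n → ℝ)} (hs : IsCompact s) {q : (Fin n → ℝ) → ℝ}
    (hq : ContinuousOn q s) (h : ∀ y ∈ s, 0 < q y) : ∃ ε, 0 < ε ∧ ∀ y ∈ s, ε ≤ q y := by
  rcases s.eq_empty_or_nonempty with rfl | hne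
  · exact ⟨1, one_pos, by simp⟩
  · obtain ⟨y, hy, hmin⟩ := hs.exists_isMinOn hne hq
    exact ⟨q y, h y hy, fun z hz => hmin hz⟩

theorem isCompact_annulus (a r : ℝ) : IsCompact {y : Fin n → ℝ | a ≤ ‖y‖ ∧ ‖y‖ ≤ r} := by
  refine (isCompact_closedBall (0 : Fin n → ℝ) r).of_isClosed_subset ?_
    fun y hy => mem_closedBall_zero_iff.2 hy.2
  exact (isClosed_le continuous_const continuous_norm).inter
    (isClosed_le continuous_norm continuous_const)

/-- Away from the origin `Q` is bounded below and `R` grows at least linearly, so the running cost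
dominates the speed however large the control is. The length travelled in the annulus is then
bounded by the cost. -/
theorem Assumptions.exists_norm_le_mul_cost (hp : p.Assumptions) {r C : ℝ} (hr : 0 < r)
    (hC : 0 ≤ C) (hQ : ContinuousOn p.Q (Metric.closedBall 0 r))
    (hb : ∀ y, ‖y‖ ≤ r → ∀ u : Fin m → ℝ, ‖p.f y + p.g y *ᵥ u‖ ≤ C * (1 + ‖u‖)) :
    ∃ D, 0 < D ∧ ∀ y, r / 2 ≤ ‖y‖ → ‖y‖ ≤ r → ∀ u, ‖p.f y + p.g y *ᵥ u‖ ≤ D * (p.Q y + p.R u) := by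
  obtain ⟨q, hq, hqQ⟩ := exists_pos_le_of_compact (isCompact_annulus (n := n) (r / 2) r)
    (hQ.mono fun y hy => mem_closedBall_zero_iff.2 hy.2) fun y hy => hp.Q_pos y (by
      rintro rfl
      have := hy.1
      rw [norm_zero] at this
      linarith)
  obtain ⟨c, hc, hcR⟩ := hp.exists_min_le_R
  -- The third is used at `‖u‖ = 2`: below that `Q` alone pays for `1 + ‖u‖ ≤ 3`, above it the
  -- linear part of `R` does.
  set κ := min q c / 3 with hκ
  have hκ0 : 0 < κ := by positivity
  have h1 : 3 * κ ≤ q := by rw [hκ]; linarith [min_le_left q c]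
  have h2 : 3 * κ ≤ c := by rw [hκ]; linarith [min_le_right q c]
  refine ⟨(C + 1) / κ, by positivity, fun y hy1 hy2 u => (hb y hy2 u).trans ?_⟩
  have h3 : κ * (1 + ‖u‖) ≤ p.Q y + p.R u := by
    have h4 := hqQ y ⟨hy1, hy2⟩
    have h5 := hcR u
    have h6 := norm_nonneg u
    rcases le_total ‖u‖ 2 with h | h
    · have := hp.R_nonneg u
      nlinarith
    · rw [min_eq_right (by nlinarith)] at h5
      nlinarith
  calc C * (1 + ‖u‖) ≤ (C + 1) * (1 + ‖u‖) := by gcongr; linarith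
    _ = (C + 1) / κ * (κ * (1 + ‖u‖)) := by field_simp
    _ ≤ _ := by gcongr

theorem IsTrajectory.intervalIntegrable {x₀ : Fin n → ℝ} {x : ℝ → Fin n → ℝ} {u : ℝ → Fin m → ℝ}
    (h : p.IsTrajectory x₀ x u) {a b : ℝ} (ha : 0 ≤ a) (hb : 0 ≤ b) :
    IntervalIntegrable (fun s => p.f (x s) + p.g (x s) *ᵥ u s) volume a b :=
  (h.integrable a ha).symm.trans (h.integrable b hb)

theorem IsTrajectory.eq_add_integral {x₀ : Fin n → ℝ} {x : ℝ → Fin n → ℝ} {u : ℝ → Fin m → ℝ}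
    (h : p.IsTrajectory x₀ x u) {a b : ℝ} (ha : 0 ≤ a) (hb : 0 ≤ b) :
    x b = x a + ∫ s in a..b, (p.f (x s) + p.g (x s) *ᵥ u s) := by
  rw [h.eq_integral b hb, h.eq_integral a ha, add_assoc,
    intervalIntegral.integral_add_adjacent_intervals (h.integrable a ha) (h.intervalIntegrable ha hb)]

theorem lintegral_Ioc_le_cost (x : ℝ → Fin n → ℝ) (u : ℝ → Fin m → ℝ) {a b : ℝ} (ha : 0 ≤ a) :
    ∫⁻ t in Ioc a b, ENNReal.ofReal (p.Q (x t) + p.R (u t)) ≤ p.cost x u :=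
  lintegral_mono_set fun _ ht => lt_of_le_of_lt ha ht.1

/-- Leaving a small ball is expensive. -/
theorem IsTrajectory.ofReal_le_cost_of_exit {x₀ : Fin n → ℝ} {x : ℝ → Fin n → ℝ}
    {u : ℝ → Fin m → ℝ} (h : p.IsTrajectory x₀ x u) {r D : ℝ} (hr : 0 < r) (hD : 0 < D)
    (hb : ∀ y, r / 2 ≤ ‖y‖ → ‖y‖ ≤ r → ∀ u, ‖p.f y + p.g y *ᵥ u‖ ≤ D * (p.Q y + p.R u))
    (h0 : ‖x₀‖ ≤ r / 2) {T : ℝ} (hT : 0 ≤ T) (hxT : r ≤ ‖x T‖) :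
    ENNReal.ofReal (r / (2 * D)) ≤ p.cost x u := by
  have hx0 : x 0 = x₀ := by
    have := h.eq_integral 0 le_rfl
    simpa using this
  obtain ⟨s, τ, hs, hsτ, hxs, hxτ, hin⟩ := exists_annulus_crossing (φ := fun t => ‖x t‖) (a := r / 2) hT
    (h.continuousOn.norm.mono Icc_subset_Ici_self) (by rw [hx0]; exact h0) hxT
  have h1 : r / 2 ≤ ‖x τ - x s‖ := by
    have := norm_sub_norm_le (x τ) (x s)
    linarith
  rw [h.eq_add_integral hs (hs.trans hsτ), add_sub_cancel_left,
    intervalIntegral.integral_of_le hsτ] at h1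
  have h2 : ENNReal.ofReal (r / 2) ≤
      ∫⁻ t in Ioc s τ, ENNReal.ofReal (D * (p.Q (x t) + p.R (u t))) := by
    calc ENNReal.ofReal (r / 2) ≤ ENNReal.ofReal _ := ENNReal.ofReal_le_ofReal h1
      _ = ‖∫ t in Ioc s τ, (p.f (x t) + p.g (x t) *ᵥ u t)‖ₑ := ofReal_norm _
      _ ≤ ∫⁻ t in Ioc s τ, ‖p.f (x t) + p.g (x t) *ᵥ u t‖ₑ := enorm_integral_le_lintegral_enorm _
      _ ≤ _ := by
        refine lintegral_mono_ae ?_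
        rw [ae_restrict_iff' measurableSet_Ioc]
        have hne : ∀ᵐ t : ℝ, t ≠ τ := by simp [ae_iff]
        filter_upwards [hne] with t ht htI
        have h3 := hin t ⟨htI.1, lt_of_le_of_ne htI.2 ht⟩
        rw [← ofReal_norm]
        exact ENNReal.ofReal_le_ofReal (hb _ h3.1.le h3.2.le _)
  have h3 : r / (2 * D) = D⁻¹ * (r / 2) := by field_simp
  rw [h3, ENNReal.ofReal_mul (by positivity)]
  have h4 : ∫⁻ t in Ioc s τ, ENNReal.ofReal (D * (p.Q (x t) + p.R (u t))) ≤
      ENNReal.ofReal D * p.cost x u := by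
    simp only [ENNReal.ofReal_mul hD.le]
    rw [lintegral_const_mul' _ _ ENNReal.ofReal_ne_top]
    gcongr
    exact lintegral_Ioc_le_cost x u hs
  calc ENNReal.ofReal D⁻¹ * ENNReal.ofReal (r / 2)
      ≤ ENNReal.ofReal D⁻¹ * (ENNReal.ofReal D * p.cost x u) := by gcongr; exact h2.trans h4
    _ = p.cost x u := by
      rw [← mul_assoc, ← ENNReal.ofReal_mul (by positivity), inv_mul_cancel₀ hD.ne']
      simp

theorem Assumptions.integral_le_cost (hp : p.Assumptions) {x₀ : Fin n → ℝ} {x : ℝ → Fin n → ℝ}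
    {u : ℝ → Fin m → ℝ} (h : p.IsTrajectory x₀ x u) {r : ℝ}
    (hQ : ContinuousOn p.Q (Metric.closedBall 0 r)) {T : ℝ} (hT : 0 ≤ T)
    (hx : ∀ t ∈ Icc 0 T, ‖x t‖ ≤ r) (hc : p.cost x u ≠ ⊤) :
    IntervalIntegrable (fun t => p.Q (x t) + p.R (u t)) volume 0 T ∧
      ENNReal.ofReal (∫ t in (0 : ℝ)..T, (p.Q (x t) + p.R (u t))) ≤ p.cost x u := by
  have hm1 : AEStronglyMeasurable (fun t => p.Q (x t)) (volume.restrict (Ioc 0 T)) := by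
    have : ContinuousOn (fun t => p.Q (x t)) (Icc 0 T) :=
      hQ.comp (h.continuousOn.mono Icc_subset_Ici_self)
        fun t ht => mem_closedBall_zero_iff.2 (hx t ht)
    exact (this.mono Ioc_subset_Icc_self).aestronglyMeasurable measurableSet_Ioc
  have hm2 : AEStronglyMeasurable (fun t => p.R (u t)) (volume.restrict (Ioc 0 T)) :=
    hp.R_differentiable.continuous.comp_aestronglyMeasurable
      (h.memLp.aestronglyMeasurable.mono_measure (Measure.restrict_mono Ioc_subset_Ioi_self le_rfl))
  have hnn : 0 ≤ᵐ[volume.restrict (Ioc 0 T)] fun t => p.Q (x t) + p.R (u t) :=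
    Filter.Eventually.of_forall fun t => add_nonneg (hp.Q_nonneg _) (hp.R_nonneg _)
  have hle := lintegral_Ioc_le_cost (p := p) x u (a := 0) (b := T) le_rfl
  have hint : Integrable (fun t => p.Q (x t) + p.R (u t)) (volume.restrict (Ioc 0 T)) :=
    (lintegral_ofReal_ne_top_iff_integrable (hm1.add hm2) hnn).1 (ne_top_of_le_ne_top hc hle)
  refine ⟨(intervalIntegrable_iff_integrableOn_Ioc_of_le hT).2 hint, ?_⟩
  rw [intervalIntegral.integral_of_le hT, ofReal_integral_eq_lintegral_ofReal hint hnn]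
  exact hle

theorem fderiv_eq_neg_cost_of_hjb (p : Problem n m) {V : (Fin n → ℝ) → ℝ} {y : Fin n → ℝ}
    (h : p.hjb (grad V y) y = 0) (u : Fin m → ℝ) :
    fderiv ℝ V y (p.f y + p.g y *ᵥ u) =
      p.Psi ((p.g y)ᵀ *ᵥ grad V y) - p.Q y + ((p.g y)ᵀ *ᵥ grad V y) ⬝ᵥ u := by
  rw [fderiv_apply_eq_grad, dotProduct_add, dotProduct_mulVec, ← mulVec_transpose]
  unfold hjb at h
  linarith

theorem Assumptions.continuousAt_gradProd (hp : p.Assumptions) {V : (Fin n → ℝ) → ℝ}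
    (hV : AnalyticAt ℝ V 0) : ContinuousAt (fun y => (p.g y)ᵀ *ᵥ grad V y) 0 := by
  refine continuousAt_pi.2 fun j => ?_
  simp only [mulVec, dotProduct, transpose_apply]
  exact tendsto_finsetSum _ fun i _ =>
    (hp.g_analytic i j).continuousAt.mul (AnalyticAt.grad hV i).continuousAt

/-- A trajectory that leaves a fixed small ball costs at least `r / (2 D)`, which exceeds `V x₀` for
small `x₀`. If it stays, the HJB equation and the Fenchel inequality make `V` decrease no faster
than cost accrues. If moreover the cost is finite, the trajectory comes arbitrarily close to the
origin, since `Q` is bounded below on every annulus, so all of `V x₀` has to be paid for. -/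
theorem Assumptions.eventually_le_cost (hp : p.Assumptions) {V : (Fin n → ℝ) → ℝ}
    (hV : AnalyticAt ℝ V 0) (h0 : V 0 = 0) (h1 : grad V 0 = 0)
    (hjb : ∀ᶠ x in 𝓝 (0 : Fin n → ℝ), p.hjb (grad V x) x = 0) :
    ∀ᶠ x₀ in 𝓝 (0 : Fin n → ℝ), ∀ x u, p.IsTrajectory x₀ x u →
      ENNReal.ofReal (V x₀) ≤ p.cost x u := by
  obtain ⟨C, hC, hCb⟩ := hp.exists_cost_bound
  obtain ⟨K, s, hs, hKs⟩ := (hV.contDiffAt (n := 1)).exists_lipschitzOnWith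
  have hgp := hp.continuousAt_gradProd hV
  have hfen : ∀ᶠ y in 𝓝 (0 : Fin n → ℝ), ∀ u,
      ((p.g y)ᵀ *ᵥ grad V y) ⬝ᵥ u - p.R u ≤ p.Psi ((p.g y)ᵀ *ᵥ grad V y) := by
    refine hgp.eventually (p := fun v => ∀ u, v ⬝ᵥ u - p.R u ≤ p.Psi v) ?_
    simp only [h1, mulVec_zero]
    exact hp.eventually_fenchel
  obtain ⟨r, hr, hball⟩ := Metric.nhds_basis_closedBall.mem_iff.1
    (hs |> Filter.inter_mem (Filter.inter_mem hCb (Filter.inter_mem hjb (Filter.inter_mem hfen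
      (Filter.inter_mem hp.Q_analytic.eventually_analyticAt hV.eventually_analyticAt)))))
  have hin : ∀ y : Fin n → ℝ, ‖y‖ ≤ r → y ∈ Metric.closedBall (0 : Fin n → ℝ) r := fun y hy =>
    mem_closedBall_zero_iff.2 hy
  have hQc : ContinuousOn p.Q (Metric.closedBall 0 r) := fun y hy =>
    (hball hy).1.2.2.2.1.continuousAt.continuousWithinAt
  obtain ⟨D, hD, hDb⟩ := hp.exists_norm_le_mul_cost hr hC hQc fun y hy => (hball (hin y hy)).1.1
  have hsmall : ∀ᶠ x₀ in 𝓝 (0 : Fin n → ℝ), V x₀ < r / (2 * D) := by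
    refine hV.continuousAt.eventually_lt_const ?_
    rw [h0]; positivity
  have hsmall2 : ∀ᶠ x₀ in 𝓝 (0 : Fin n → ℝ), ‖x₀‖ ≤ r / 2 := by
    refine continuous_norm.continuousAt.eventually_le_const ?_
    simp only [norm_zero]; positivity
  filter_upwards [hsmall, hsmall2] with x₀ hx1 hx2 x u h
  by_cases hexit : ∃ T, 0 ≤ T ∧ r ≤ ‖x T‖
  · obtain ⟨T, hT, hxT⟩ := hexit
    exact (ENNReal.ofReal_le_ofReal hx1.le).trans
      (h.ofReal_le_cost_of_exit hr hD hDb hx2 hT hxT)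
  push Not at hexit
  by_cases hc : p.cost x u = ⊤
  · rw [hc]; exact le_top
  have hx0 : x 0 = x₀ := by
    have := h.eq_integral 0 le_rfl
    simpa using this
  -- the decrease of `V` along the trajectory
  have hdec : ∀ T, 0 ≤ T → V x₀ - V (x T) ≤ (p.cost x u).toReal := by
    intro T hT
    have hxr : ∀ t ∈ Icc 0 T, ‖x t‖ ≤ r := fun t ht => (hexit t ht.1).le
    obtain ⟨hi, hle⟩ := hp.integral_le_cost h hQc hT hxr hc
    have h2 := sub_le_integral_of_ae_deriv (V := V) (B := Metric.closedBall 0 r) (K := K)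
      (fun y hy => (hball hy).1.2.2.2.2.differentiableAt) (hKs.mono fun y hy => (hball hy).2)
      hT (h.integrable T hT) (fun t ht => h.eq_add_integral le_rfl ht.1)
      (fun t ht => hin _ (hxr t ht)) hi (Filter.Eventually.of_forall fun t ht => by
        have hb := hball (hin _ (hxr t (Ioc_subset_Icc_self ht)))
        rw [fderiv_eq_neg_cost_of_hjb p hb.1.2.1]
        -- The minimizing control carries a minus sign, so the Fenchel inequality is used at `-u`;
        -- evenness of `R` restores the cost of `u`.
        have h3 := hb.1.2.2.1 (-u t)
        rw [hp.R_even, dotProduct_neg] at h3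
        linarith)
    rw [hx0] at h2
    exact h2.trans ((ENNReal.ofReal_le_iff_le_toReal hc).1 hle)
  -- `V` gets small along the trajectory
  have hsm : ∀ ε > 0, ∃ T, 0 ≤ T ∧ V (x T) < ε := by
    intro ε hε
    by_contra hcon
    push Not at hcon
    have hev : ∀ᶠ y in 𝓝 (0 : Fin n → ℝ), V y < ε :=
      hV.continuousAt.eventually_lt_const (by rwa [h0])
    obtain ⟨δ, hδ, hδV⟩ := Metric.eventually_nhds_iff_ball.1 hev
    have hfar : ∀ t, 0 ≤ t → δ ≤ ‖x t‖ := by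
      intro t ht
      by_contra hlt
      have := hδV (x t) (mem_ball_zero_iff.2 (not_le.1 hlt))
      linarith [hcon t ht]
    obtain ⟨q, hq, hqQ⟩ := exists_pos_le_of_compact (isCompact_annulus (n := n) δ r)
      (hQc.mono fun y hy => mem_closedBall_zero_iff.2 hy.2) fun y hy => hp.Q_pos y (by
        rintro rfl
        have := hy.1
        rw [norm_zero] at this
        linarith)
    refine hc (top_unique ?_)
    have h3 : ∫⁻ _ in Ioi (0 : ℝ), ENNReal.ofReal q ≤ p.cost x u := by
      refine setLIntegral_mono' measurableSet_Ioi fun t ht => ENNReal.ofReal_le_ofReal ?_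
      have := hqQ (x t) ⟨hfar t (le_of_lt ht), (hexit t (le_of_lt ht)).le⟩
      have := hp.R_nonneg (u t)
      linarith
    refine le_trans (le_of_eq ?_) h3
    rw [setLIntegral_const, Real.volume_Ioi, ENNReal.mul_top]
    simpa using hq
  refine (ENNReal.ofReal_le_iff_le_toReal hc).2 (le_of_forall_pos_le_add fun ε hε => ?_)
  obtain ⟨T, hT, hxT⟩ := hsm ε hε
  linarith [hdec T hT]

end Problem

end NLR

namespace NLR
open Matrix Asymptotics

/-! ### The optimal feedback -/

namespace Problem

variable {n m : ℕ} {p : Problem n m}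

/-- The feedback `-φ(gᵀ V_x)`. -/
noncomputable def feedback (p : Problem n m) (V : (Fin n → ℝ) → ℝ) (y : Fin n → ℝ) : Fin m → ℝ :=
  -p.phi ((p.g y)ᵀ *ᵥ grad V y)

theorem Assumptions.fderiv_phi (hp : p.Assumptions) (v : Fin m → ℝ) :
    fderiv ℝ p.phi 0 v = v ᵥ* p.R1⁻¹ := by
  have h : fderiv ℝ p.phi 0 = fderiv ℝ (grad p.Psi) 0 :=
    Filter.EventuallyEq.fderiv_eq (hp.eventually_hasFDerivAt_Psi.mono fun v hv => hv.2.symm)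
  ext i
  rw [h, fderiv_grad hp.Psi_analytic, hp.hess_Psi]

section

variable {V : (Fin n → ℝ) → ℝ}

theorem Assumptions.gradProd_analytic (hp : p.Assumptions) (hV : AnalyticAt ℝ V 0) :
    AnalyticAt ℝ (fun y => (p.g y)ᵀ *ᵥ grad V y) 0 := by
  refine analyticAt_pi_iff.2 fun j => ?_
  simp only [mulVec, dotProduct, transpose_apply]
  exact Finset.univ.analyticAt_fun_sum fun i _ => (hp.g_analytic i j).mul (AnalyticAt.grad hV i)

theorem Assumptions.fderiv_gradProd (hp : p.Assumptions) (hV : AnalyticAt ℝ V 0)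
    (h1 : grad V 0 = 0) (y : Fin n → ℝ) :
    fderiv ℝ (fun y => (p.g y)ᵀ *ᵥ grad V y) 0 y = p.G0ᵀ *ᵥ (y ᵥ* hess V) := by
  ext j
  have hd : HasFDerivAt (fun y => ((p.g y)ᵀ *ᵥ grad V y) j)
      (∑ i, (p.g 0 i j • fderiv ℝ (fun y => grad V y i) 0 +
        grad V 0 i • fderiv ℝ (fun y => p.g y i j) 0)) 0 := by
    simp only [mulVec, dotProduct, transpose_apply]
    exact HasFDerivAt.fun_sum fun i _ =>
      (hp.g_analytic i j).differentiableAt.hasFDerivAt.mul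
        (AnalyticAt.grad hV i).differentiableAt.hasFDerivAt
  have h2 := hasFDerivAt_pi'.1 (hp.gradProd_analytic hV).differentiableAt.hasFDerivAt j
  have h3 := congrArg (fun L : (Fin n → ℝ) →L[ℝ] ℝ => L y) (h2.unique hd)
  refine Eq.trans (b := _) h3 ?_
  have h4 : ∀ i, fderiv ℝ (fun y => grad V y i) 0 y = (y ᵥ* hess V) i := by
    intro i
    rw [← fderiv_grad hV]
    have h5 := hasFDerivAt_pi'.1 (grad_analyticAt hV).differentiableAt.hasFDerivAt i
    rw [h5.fderiv]
    rfl
  simp only [_root_.sum_apply, _root_.smul_apply, h1, Pi.zero_apply, zero_smul,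
    add_zero, smul_eq_mul, h4]
  rfl

theorem Assumptions.feedback_zero (hp : p.Assumptions) (h1 : grad V 0 = 0) :
    p.feedback V 0 = 0 := by
  rw [feedback, h1, mulVec_zero, hp.phi_zero, neg_zero]

theorem Assumptions.feedback_analytic (hp : p.Assumptions) (hV : AnalyticAt ℝ V 0)
    (h1 : grad V 0 = 0) : AnalyticAt ℝ (p.feedback V) 0 := by
  refine AnalyticAt.neg (AnalyticAt.fun_comp (g := p.phi) ?_ (hp.gradProd_analytic hV))
  rw [h1, mulVec_zero]
  exact hp.phi_analytic

theorem Assumptions.fderiv_feedback (hp : p.Assumptions) (hV : AnalyticAt ℝ V 0)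
    (h1 : grad V 0 = 0) (y : Fin n → ℝ) :
    fderiv ℝ (p.feedback V) 0 y = -((p.G0ᵀ *ᵥ (y ᵥ* hess V)) ᵥ* p.R1⁻¹) := by
  have hz : (p.g 0)ᵀ *ᵥ grad V 0 = 0 := by rw [h1, mulVec_zero]
  have hphi : HasFDerivAt p.phi (fderiv ℝ p.phi 0) ((p.g 0)ᵀ *ᵥ grad V 0) := by
    rw [hz]; exact hp.phi_analytic.differentiableAt.hasFDerivAt
  have h2 := (hphi.comp (0 : Fin n → ℝ)
    (hp.gradProd_analytic hV).differentiableAt.hasFDerivAt).neg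
  have h3 : fderiv ℝ (p.feedback V) 0 = _ := h2.fderiv
  rw [h3]
  simp only [_root_.neg_apply, ContinuousLinearMap.comp_apply, hp.fderiv_gradProd hV h1,
    hp.fderiv_phi]

/-- The closed-loop vector field. -/
noncomputable def closedLoopField (p : Problem n m) (V : (Fin n → ℝ) → ℝ) (y : Fin n → ℝ) :
    Fin n → ℝ :=
  p.f y + p.g y *ᵥ p.feedback V y

theorem Assumptions.closedLoopField_analytic (hp : p.Assumptions) (hV : AnalyticAt ℝ V 0)
    (h1 : grad V 0 = 0) : AnalyticAt ℝ (p.closedLoopField V) 0 := by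
  refine hp.f_analytic.add (analyticAt_pi_iff.2 fun i => ?_)
  simp only [mulVec, dotProduct]
  exact Finset.univ.analyticAt_fun_sum fun j _ => (hp.g_analytic i j).mul
    (analyticAt_pi_iff.1 (hp.feedback_analytic hV h1) j)

/-- The feedback vanishes at the origin and `φ` has derivative `R₁⁻¹` there, so a Hessian equal to
`P₁` gives the linear gain `-R₁⁻¹ G₀ᵀ P₁`. Variations of `g` are multiplied by the zero feedback and
drop out. -/
theorem Assumptions.fderiv_closedLoopField (hp : p.Assumptions) (hV : AnalyticAt ℝ V 0)
    (h1 : grad V 0 = 0) (h2 : hess V = p.areSol) (y : Fin n → ℝ) :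
    fderiv ℝ (p.closedLoopField V) 0 y = p.Fc *ᵥ y := by
  have hφ := hp.feedback_analytic hV h1
  ext i
  have hd : HasFDerivAt (fun y => p.closedLoopField V y i)
      (fderiv ℝ (fun y => p.f y i) 0 + ∑ j, (p.g 0 i j • fderiv ℝ (fun y => p.feedback V y j) 0 +
        p.feedback V 0 j • fderiv ℝ (fun y => p.g y i j) 0)) 0 := by
    simp only [closedLoopField, Pi.add_apply, mulVec, dotProduct]
    exact (hp.f_apply_analytic i).differentiableAt.hasFDerivAt.add
      (HasFDerivAt.fun_sum fun j _ => (hp.g_analytic i j).differentiableAt.hasFDerivAt.mul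
        (analyticAt_pi_iff.1 hφ j).differentiableAt.hasFDerivAt)
  have h3 := hasFDerivAt_pi'.1 (hp.closedLoopField_analytic hV h1).differentiableAt.hasFDerivAt i
  have h4 := congrArg (fun L : (Fin n → ℝ) →L[ℝ] ℝ => L y) (h3.unique hd)
  refine Eq.trans (b := _) h4 ?_
  have h5 : ∀ j, fderiv ℝ (fun y => p.feedback V y j) 0 y =
      -((p.G0ᵀ *ᵥ (y ᵥ* hess V)) ᵥ* p.R1⁻¹) j := by
    intro j
    have h6 := hasFDerivAt_pi'.1 hφ.differentiableAt.hasFDerivAt j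
    rw [h6.fderiv, ContinuousLinearMap.comp_apply, hp.fderiv_feedback hV h1]
    rfl
  have h7 : p.R1⁻¹ᵀ = p.R1⁻¹ := by rw [transpose_nonsing_inv, hp.R1_symm]
  have h8 : p.areSolᵀ = p.areSol := isSymm_of_isHermitian hp.isStabilizingARE_areSol.posSemidef.1
  simp only [_root_.sum_apply, _root_.add_apply, _root_.smul_apply, hp.feedback_zero h1,
    Pi.zero_apply, zero_smul, add_zero, smul_eq_mul, h5]
  have h9 : fderiv ℝ (fun y => p.f y i) 0 y = (p.F1 *ᵥ y) i := by
    rw [fderiv_apply_eq_grad]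
    exact Finset.sum_congr rfl fun j _ => congrArg (· * y j) (hp.fderiv_f_apply i j)
  rw [h9, Fc, closedLoop, sub_mulVec, Pi.sub_apply, sub_eq_add_neg]
  congr 1
  rw [h2, ← mulVec_transpose, ← mulVec_transpose _ y, h7, h8, ← mulVec_mulVec, ← mulVec_mulVec,
    ← mulVec_mulVec]
  simp only [mul_neg, Finset.sum_neg_distrib]
  rfl

theorem memLp_two_of_exp_decay {u : ℝ → Fin m → ℝ} {C c : ℝ} (hc : 0 < c)
    (hu : ContinuousOn u (Ioi 0)) (h : ∀ t, 0 < t → ‖u t‖ ≤ C * Real.exp (-c * t)) :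
    MemLp u 2 (volume.restrict (Ioi 0)) := by
  have hm := hu.aestronglyMeasurable (μ := volume) measurableSet_Ioi
  rw [memLp_two_iff_integrable_sq_norm hm]
  have hi : Integrable (fun t => C ^ 2 * Real.exp (-(2 * c) * t)) (volume.restrict (Ioi 0)) :=
    (exp_neg_integrableOn_Ioi 0 (by positivity)).const_mul _
  refine hi.mono' (hm.norm.pow 2) ?_
  rw [ae_restrict_iff' measurableSet_Ioi]
  refine Filter.Eventually.of_forall fun t ht => ?_
  rw [Real.norm_of_nonneg (by positivity)]
  calc ‖u t‖ ^ 2 ≤ (C * Real.exp (-c * t)) ^ 2 := pow_le_pow_left₀ (norm_nonneg _) (h t ht) 2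
    _ = _ := by
      rw [mul_pow, ← Real.exp_nat_mul]
      congr 2
      push_cast
      ring

/-- Exponential decay of the closed loop puts the control in `L²`. With `u = -φ(gᵀ V_x)` the
definition of `Ψ` gives equality in the Fenchel inequality, so `-V` along the trajectory is an
antiderivative of the running cost, and it tends to zero. -/
theorem Assumptions.eventually_optimal (hp : p.Assumptions) (hV : AnalyticAt ℝ V 0) (h0 : V 0 = 0)
    (h1 : grad V 0 = 0) (h2 : hess V = p.areSol)
    (hjb : ∀ᶠ x in 𝓝 (0 : Fin n → ℝ), p.hjb (grad V x) x = 0) {U : Set (Fin n → ℝ)}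
    (hU : U ∈ 𝓝 0) :
    ∀ᶠ x₀ in 𝓝 (0 : Fin n → ℝ), ∃ x u, p.IsTrajectory x₀ x u ∧
      p.cost x u = ENNReal.ofReal (V x₀) ∧ 0 ≤ V x₀ ∧
      ∀ t, 0 ≤ t → x t ∈ U ∧ u t = -p.phi ((p.g (x t))ᵀ *ᵥ grad V (x t)) := by
  have hX := hp.closedLoopField_analytic hV h1
  have hφ := hp.feedback_analytic hV h1
  have hX0 : p.closedLoopField V 0 = 0 := by
    rw [closedLoopField, hp.feedback_zero h1, hp.f_zero, mulVec_zero, add_zero]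
  obtain ⟨K, s, hs, hKs⟩ := (hφ.contDiffAt (n := 1)).exists_lipschitzOnWith
  have hgood := Filter.inter_mem hU (Filter.inter_mem hs (Filter.inter_mem hjb
    (Filter.inter_mem hX.eventually_analyticAt (Filter.inter_mem hφ.eventually_analyticAt
      hV.eventually_analyticAt))))
  filter_upwards [exists_exp_decay_solution hX.contDiffAt hX0 hp.isHurwitz_Fc
    (hp.fderiv_closedLoopField hV h1 h2) hgood] with x₀ hsol
  obtain ⟨x, hx0, hxd, hxU, C, c, hc, hdecay⟩ := hsol
  set u : ℝ → Fin m → ℝ := fun t => p.feedback V (x t) with hu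
  have hxc : ContinuousOn x (Ici 0) := fun t ht => (hxd t ht).continuousAt.continuousWithinAt
  have huc : ContinuousOn u (Ici 0) := fun t ht =>
    (((hxU t ht).2.2.2.2.1.continuousAt).comp (hxd t ht).continuousAt).continuousWithinAt
  have hwc : ContinuousOn (fun t => p.f (x t) + p.g (x t) *ᵥ u t) (Ici 0) := fun t ht =>
    (((hxU t ht).2.2.2.1.continuousAt).comp (hxd t ht).continuousAt).continuousWithinAt
  have hint : ∀ t, 0 ≤ t → IntervalIntegrable (fun t => p.f (x t) + p.g (x t) *ᵥ u t)
      volume 0 t := fun t ht =>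
    (hwc.mono (by rw [uIcc_of_le ht]; exact Icc_subset_Ici_self)).intervalIntegrable
  have hub : ∀ t, 0 < t → ‖u t‖ ≤ K * C * Real.exp (-c * t) := by
    intro t ht
    have h3 := hKs.dist_le_mul (x t) (hxU t ht.le).2.1 0 (mem_of_mem_nhds hs)
    rw [hp.feedback_zero h1, dist_zero_right, dist_zero_right] at h3
    refine h3.trans ?_
    rw [mul_assoc]
    exact mul_le_mul_of_nonneg_left (hdecay t ht.le) K.2
  have htraj : p.IsTrajectory x₀ x u := by
    refine ⟨hxc, memLp_two_of_exp_decay hc (huc.mono Ioi_subset_Ici_self) hub, hint,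
      fun t ht => ?_⟩
    have h3 : ∀ s ∈ uIcc 0 t, HasDerivAt x (p.f (x s) + p.g (x s) *ᵥ u s) s := fun s hs => by
      rw [uIcc_of_le ht] at hs
      exact hxd s hs.1
    rw [intervalIntegral.integral_eq_sub_of_hasDerivAt h3 (hint t ht), hx0, add_sub_cancel]
  have hVd : ∀ t ∈ Ici (0 : ℝ), HasDerivAt (fun t => -V (x t)) (p.Q (x t) + p.R (u t)) t := by
    intro t ht
    have hg := hxU t ht
    have h3 := (hg.2.2.2.2.2.differentiableAt.hasFDerivAt.comp_hasDerivAt t (hxd t ht)).neg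
    have h4 : -(fderiv ℝ V (x t) (p.closedLoopField V (x t))) = p.Q (x t) + p.R (u t) := by
      rw [closedLoopField, fderiv_eq_neg_cost_of_hjb p hg.2.2.1]
      have hut : u t = -p.phi ((p.g (x t))ᵀ *ᵥ grad V (x t)) := rfl
      have hfb : p.feedback V (x t) = u t := rfl
      rw [hfb, hut, hp.R_even, dotProduct_neg, Psi]
      ring
    rw [h4] at h3
    exact h3
  have hnn : ∀ t ∈ Ioi (0 : ℝ), 0 ≤ p.Q (x t) + p.R (u t) := fun t _ =>
    add_nonneg (hp.Q_nonneg _) (hp.R_nonneg _)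
  have hxlim : Tendsto x atTop (𝓝 0) := by
    have h3 : Tendsto (fun t : ℝ => C * Real.exp (-c * t)) atTop (𝓝 (C * 0)) := by
      refine Tendsto.const_mul C (Real.tendsto_exp_atBot.comp ?_)
      exact tendsto_id.const_mul_atTop_of_neg (neg_lt_zero.2 hc)
    rw [mul_zero] at h3
    refine squeeze_zero_norm' ?_ h3
    filter_upwards [eventually_ge_atTop 0] with t ht using hdecay t ht
  have hVlim : Tendsto (fun t => -V (x t)) atTop (𝓝 0) := by
    have h3 := (hV.continuousAt.tendsto.comp hxlim).neg
    rw [h0, neg_zero] at h3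
    exact h3
  have hI := integral_Ioi_of_hasDerivAt_of_nonneg' hVd hnn hVlim
  have hIi := integrableOn_Ioi_deriv_of_nonneg' hVd hnn hVlim
  rw [hx0, zero_sub, neg_neg] at hI
  have hnn' : 0 ≤ᵐ[volume.restrict (Ioi 0)] fun t => p.Q (x t) + p.R (u t) :=
    Filter.Eventually.of_forall fun t => add_nonneg (hp.Q_nonneg _) (hp.R_nonneg _)
  refine ⟨x, u, htraj, ?_, ?_, fun t ht => ⟨(hxU t ht).1, rfl⟩⟩
  · rw [cost, ← ofReal_integral_eq_lintegral_ofReal hIi hnn', hI]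
  · rw [← hI]; exact setIntegral_nonneg measurableSet_Ioi hnn

theorem Assumptions.eventually_value_eq (hp : p.Assumptions) (hV : AnalyticAt ℝ V 0) (h0 : V 0 = 0)
    (h1 : grad V 0 = 0) (h2 : hess V = p.areSol)
    (hjb : ∀ᶠ x in 𝓝 (0 : Fin n → ℝ), p.hjb (grad V x) x = 0) :
    ∀ᶠ x₀ in 𝓝 (0 : Fin n → ℝ), p.value x₀ = ENNReal.ofReal (V x₀) ∧ p.valueR x₀ = V x₀ := by
  filter_upwards [hp.eventually_le_cost hV h0 h1 hjb,
    hp.eventually_optimal hV h0 h1 h2 hjb Filter.univ_mem] with x₀ hle hopt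
  obtain ⟨x, u, htr, hcost, hnn, -⟩ := hopt
  have h3 : p.value x₀ = ENNReal.ofReal (V x₀) := by
    refine le_antisymm ?_ (le_iInf fun x => le_iInf fun u => le_iInf fun h => hle x u h)
    rw [← hcost]
    exact iInf_le_of_le x (iInf_le_of_le u (iInf_le_of_le htr le_rfl))
  exact ⟨h3, by rw [valueR, h3, ENNReal.toReal_ofReal hnn]⟩

end

end Problem

end NLR

namespace NLR
open Matrix Asymptotics

/-! ### Homogeneous polynomials -/

section

variable {n : ℕ} {k : ℕ}

theorem analyticAt_multiset_prod (s : Multiset (Fin n)) (x : Fin n → ℝ) :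
    AnalyticAt ℝ (fun y : Fin n → ℝ => (s.map y).prod) x := by
  induction s using Multiset.induction_on with
  | empty => simpa using analyticAt_const
  | cons i s ih =>
    simp only [Multiset.map_cons, Multiset.prod_cons]
    exact ((ContinuousLinearMap.proj (R := ℝ) (φ := fun _ : Fin n => ℝ) i).analyticAt x).mul ih

theorem analyticAt_dotProduct_powVec (q : Sym (Fin n) k → ℝ) (x : Fin n → ℝ) :
    AnalyticAt ℝ (fun y : Fin n → ℝ => q ⬝ᵥ powVec y k) x := by
  simp only [dotProduct, powVec]
  exact Finset.univ.analyticAt_fun_sum fun c _ =>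
    analyticAt_const.mul (analyticAt_const.mul (analyticAt_multiset_prod c.1 x))

/-- The homogeneous polynomial with coefficient vector `q`, as a power series. -/
noncomputable def homPart (k : ℕ) (q : Sym (Fin n) k → ℝ) : PS n := ofHom (Pi.single k q)

theorem hom_homPart (q : Sym (Fin n) k → ℝ) : hom k (homPart k q) = q := by
  rw [homPart, hom_ofHom, Pi.single_eq_same]

theorem hom_homPart_of_ne {j : ℕ} (h : j ≠ k) (q : Sym (Fin n) k → ℝ) :
    hom j (homPart k q) = 0 := by
  rw [homPart, hom_ofHom, Pi.single_eq_of_ne h]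

theorem ev_homPart (q : Sym (Fin n) k → ℝ) (x : Fin n → ℝ) :
    ev k (homPart k q) x = q ⬝ᵥ powVec x k := by rw [ev, hom_homPart]

theorem ev_homPart_of_ne {j : ℕ} (h : j ≠ k) (q : Sym (Fin n) k → ℝ) (x : Fin n → ℝ) :
    ev j (homPart k q) x = 0 := by rw [ev, hom_homPart_of_ne h, zero_dotProduct]

theorem expands_homPart (N : ℕ) (q : Sym (Fin n) k → ℝ) :
    Expands N (fun y => q ⬝ᵥ powVec y k) (homPart k q) := by
  rw [Expands]
  rcases lt_or_ge k N with h | h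
  · have : ∀ x, q ⬝ᵥ powVec x k - ∑ j ∈ Finset.range N, ev j (homPart k q) x = 0 := fun x => by
      rw [Finset.sum_eq_single_of_mem k (Finset.mem_range.2 h) fun j _ hj =>
        ev_homPart_of_ne hj q x, ev_homPart, sub_self]
    simp only [this]
    exact isBigO_zero _ _
  · have : ∀ x, q ⬝ᵥ powVec x k - ∑ j ∈ Finset.range N, ev j (homPart k q) x =
        ev k (homPart k q) x := fun x => by
      rw [Finset.sum_eq_zero fun j hj =>
        ev_homPart_of_ne (ne_of_lt ((Finset.mem_range.1 hj).trans_le h)) q x, ev_homPart, sub_zero]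
    simp only [this]
    exact IsBigO.trans (ev_isBigO k _) (norm_pow_isBigO h)

theorem tay_dotProduct_powVec (q : Sym (Fin n) k → ℝ) :
    tay (fun y => q ⬝ᵥ powVec y k) = homPart k q := ps_ext fun j => by
  rw [hom_tay, ← (expands_homPart (j + 1) q).hom_tay_eq (analyticAt_dotProduct_powVec q 0)
    (Nat.lt_succ_self j)]

/-- Near the origin the formula is read off from the Taylor coefficients of the gradient. Both sides
are homogeneous of degree `k`, so scaling extends it to every `x`. -/
theorem grad_dotProduct_powVec (q : Sym (Fin n) (k + 1) → ℝ) (x : Fin n → ℝ) (i : Fin n) :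
    grad (fun y => q ⬝ᵥ powVec y (k + 1)) x i =
      (k + 1) * ((fun b => ((redOne n k)ᵀ *ᵥ q) (b, i)) ⬝ᵥ powVec x k) := by
  set f : (Fin n → ℝ) → ℝ := fun y => q ⬝ᵥ powVec y (k + 1) with hf
  have hfa : ∀ x, AnalyticAt ℝ f x := analyticAt_dotProduct_powVec q
  have hloc : ∀ᶠ y in 𝓝 (0 : Fin n → ℝ), grad f y i =
      (k + 1) * ((fun b => ((redOne n k)ᵀ *ᵥ q) (b, i)) ⬝ᵥ powVec y k) := by
    filter_upwards [hasSum_ev_tay (AnalyticAt.grad (hfa 0) i)] with y hy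
    have h1 : ∀ j b, taylor (fun x => grad f x i) j b =
        (j + 1) * ((redOne n j)ᵀ *ᵥ hom (j + 1) (homPart (k + 1) q)) (b, i) := fun j b => by
      rw [taylor_grad (hfa 0), ← hom_tay f, hf, tay_dotProduct_powVec]
    have h2 : HasSum (fun j => ev j (tay fun x => grad f x i) y)
        (ev k (tay fun x => grad f x i) y) := by
      refine hasSum_single k fun j hj => ?_
      have : hom j (tay fun x => grad f x i) = 0 := by
        ext b
        rw [hom_tay, h1, hom_homPart_of_ne (by omega), mulVec_zero]
        simp
      rw [ev, this, zero_dotProduct]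
    rw [hy.unique h2, ev, hom_tay]
    have h3 : taylor (fun x => grad f x i) k =
        ((k : ℝ) + 1) • fun b => ((redOne n k)ᵀ *ᵥ q) (b, i) := by
      ext b
      rw [h1, hom_homPart]; rfl
    rw [h3, smul_dotProduct, smul_eq_mul]
  have hscale : ∀ t : ℝ, t ≠ 0 → grad f (t • x) i = t ^ k * grad f x i := by
    intro t ht
    have h1 : HasFDerivAt (fun y => f (t • y)) _ x :=
      (hfa (t • x)).differentiableAt.hasFDerivAt.comp x ((hasFDerivAt_id x).const_smul t)
    have h2 : (fun y => f (t • y)) = fun y => t ^ (k + 1) * f y := by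
      ext y
      show f (t • y) = _
      simp only [hf, powVec_smul, dotProduct_smul, smul_eq_mul]
    rw [h2] at h1
    have h3 := congrArg (fun L : (Fin n → ℝ) →L[ℝ] ℝ => L (Pi.single i 1))
      (h1.unique ((hfa x).differentiableAt.hasFDerivAt.const_mul (t ^ (k + 1))))
    have h4 : t * grad f (t • x) i = t ^ (k + 1) * grad f x i := by
      simp only [ContinuousLinearMap.comp_apply, _root_.smul_apply, ContinuousLinearMap.id_apply,
        map_smul, smul_eq_mul] at h3
      exact h3
    rw [pow_succ', mul_assoc] at h4
    exact mul_left_cancel₀ ht h4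
  have htend : Tendsto (fun t : ℝ => t • x) (𝓝[≠] 0) (𝓝 0) := by
    have : Tendsto (fun t : ℝ => t • x) (𝓝 0) (𝓝 ((0 : ℝ) • x)) :=
      (continuous_id.smul continuous_const).tendsto 0
    rw [zero_smul] at this
    exact this.mono_left nhdsWithin_le_nhds
  obtain ⟨t, ht, ht0⟩ := ((htend.eventually hloc).and self_mem_nhdsWithin).exists
  rw [hscale t ht0, powVec_smul, dotProduct_smul, smul_eq_mul] at ht
  refine mul_left_cancel₀ (pow_ne_zero k ht0) (ht.trans ?_)
  ring

theorem ev_lin_mul (A : Matrix (Fin n) (Fin n) ℝ) (w : PS n) (i : Fin n) (x : Fin n → ℝ) :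
    ev (k + 1) (lin A i * w) x = (A *ᵥ x) i * ev k w x := by
  rw [ev_mul, Finset.sum_eq_single_of_mem 1 (by simp) fun j _ hj => by
    rw [ev, hom_lin_of_ne hj, zero_dotProduct, zero_mul], ev_one_lin, Nat.add_sub_cancel]

/-- A kernel vector `q` gives the homogeneous polynomial `W = q · x^{k+1}`, whose derivative along
`ẋ = A x` is `k + 1` times the polynomial with coefficients `M_k q`, hence zero. So `W` is constant
along solutions that tend to the origin, where it vanishes; thus `W = 0` and `q = 0`. -/
theorem isUnit_det_Mmat_of_isHurwitz {A : Matrix (Fin n) (Fin n) ℝ} (hA : IsHurwitz A) (k : ℕ) :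
    IsUnit (Mmat A k).det := by
  rw [isUnit_iff_ne_zero]
  intro hdet
  obtain ⟨q, hq0, hq⟩ := Matrix.exists_mulVec_eq_zero_iff.2 hdet
  set W : (Fin n → ℝ) → ℝ := fun x => q ⬝ᵥ powVec x (k + 1) with hW
  set w : Fin n → PS n := fun i => homPart k fun b => ((redOne n k)ᵀ *ᵥ q) (b, i) with hw
  have hsum : hom (k + 1) (∑ i, lin A i * w i) = 0 := by
    rw [hom_sum_lin_mul, ← hq, Mmat_mulVec]
    simp only [hw, hom_homPart]
  have hder : ∀ x, fderiv ℝ W x (A *ᵥ x) = 0 := by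
    intro x
    have h1 : ev (k + 1) (∑ i, lin A i * w i) x = 0 := by rw [ev, hsum, zero_dotProduct]
    rw [ev_finset_sum] at h1
    simp only [ev_lin_mul, hw, ev_homPart] at h1
    rw [fderiv_apply_eq_grad, dotProduct]
    simp only [hW, grad_dotProduct_powVec]
    rw [← mul_zero ((k : ℝ) + 1), ← h1, Finset.mul_sum]
    exact Finset.sum_congr rfl fun i _ => by ring
  have hlin : ∀ x, HasFDerivAt (fun y => A *ᵥ y)
      (LinearMap.toContinuousLinearMap (Matrix.mulVecLin A)) x := fun x =>
    (LinearMap.toContinuousLinearMap (Matrix.mulVecLin A)).hasFDerivAt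
  have hloc : ∀ᶠ x in 𝓝 (0 : Fin n → ℝ), W x = 0 := by
    have hcd : ContDiffAt ℝ 1 (fun y : Fin n → ℝ => A *ᵥ y) 0 :=
      (LinearMap.toContinuousLinearMap (Matrix.mulVecLin A)).contDiff.contDiffAt
    filter_upwards [exists_exp_decay_solution hcd (mulVec_zero A) hA
      (fun y => by rw [(hlin 0).fderiv]; rfl) Filter.univ_mem] with x₀ hsol
    obtain ⟨x, hx0, hxd, -, C, c, hc, hdecay⟩ := hsol
    have hd : ∀ t, 0 ≤ t → HasDerivAt (fun t => W (x t)) 0 t := fun t ht => by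
      have := (analyticAt_dotProduct_powVec q (x t)).differentiableAt.hasFDerivAt.comp_hasDerivAt t
        (hxd t ht)
      rw [hder] at this
      exact this
    have hconst : ∀ t, 0 ≤ t → W (x t) = W x₀ := fun t ht => by
      rw [← hx0]
      exact constant_of_has_deriv_right_zero (a := 0) (b := t)
        (fun s hs => (hd s hs.1).continuousAt.continuousWithinAt)
        (fun s hs => (hd s hs.1).hasDerivWithinAt) t (right_mem_Icc.2 ht)
    have hxlim : Tendsto x atTop (𝓝 0) := by
      have h3 : Tendsto (fun t : ℝ => C * Real.exp (-c * t)) atTop (𝓝 (C * 0)) :=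
        Tendsto.const_mul C (Real.tendsto_exp_atBot.comp
          (tendsto_id.const_mul_atTop_of_neg (neg_lt_zero.2 hc)))
      rw [mul_zero] at h3
      refine squeeze_zero_norm' ?_ h3
      filter_upwards [eventually_ge_atTop 0] with t ht using hdecay t ht
    have h4 : Tendsto (fun t => W (x t)) atTop (𝓝 (W 0)) :=
      (analyticAt_dotProduct_powVec q 0).continuousAt.tendsto.comp hxlim
    have h5 : Tendsto (fun t => W (x t)) atTop (𝓝 (W x₀)) :=
      tendsto_const_nhds.congr' (by
        filter_upwards [eventually_ge_atTop 0] with t ht using (hconst t ht).symm)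
    rw [tendsto_nhds_unique h5 h4]
    have := ev_smul_point (k + 1) (homPart (k + 1) q) 0 0
    rw [zero_smul, zero_pow (Nat.succ_ne_zero k), zero_mul, ev_homPart] at this
    exact this
  refine hq0 ?_
  rw [← hom_homPart q]
  have h6 := eventually_eq_zero_of_tay (analyticAt_dotProduct_powVec q 0)
  rw [← tay_dotProduct_powVec, hom_tay]
  have h7 : Expands (k + 2) W (0 : PS n) := expands_zero.congr' (hloc.mono fun x hx => hx.symm)
  rw [← h7.hom_tay_eq (analyticAt_dotProduct_powVec q 0) (Nat.lt_succ_self _), hom_zero]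

end

/-! ### The expansion of the HJB equation -/

section

variable {n m : ℕ} {p : Problem n m}

theorem Problem.Assumptions.ev_Psi (hp : p.Assumptions) (v : Fin m → ℝ) :
    ev 0 (tay p.Psi) v = 0 ∧ ev 1 (tay p.Psi) v = 0 ∧
      ev 2 (tay p.Psi) v = 1 / 2 * ∑ i, ∑ j, p.R1⁻¹ i j * (v i * v j) := by
  have hlow : LowOrd 2 (tay p.Psi) := by
    have h := lowOrd_two_tay_sub hp.Psi_analytic hp.Psi_zero (A := (0 : Matrix Unit (Fin m) ℝ))
      (i := ()) fun j => by rw [hp.fderiv_Psi_zero]; rfl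
    have h0 : lin (0 : Matrix Unit (Fin m) ℝ) () = 0 := by simp [lin]
    rwa [h0, sub_zero] at h
  refine ⟨by rw [ev, hlow 0 two_pos, zero_dotProduct],
    by rw [ev, hlow 1 one_lt_two, zero_dotProduct], ?_⟩
  rw [ev_two_tay hp.Psi_analytic, hp.hess_Psi]
  simp only [dotProduct, mulVec, Finset.mul_sum]
  exact Finset.sum_congr rfl fun i _ => Finset.sum_congr rfl fun j _ => by ring

/-- The Taylor series of `Ψ` begins with `½ vᵀ R₁⁻¹ v`. Because `v = O(‖x‖)`, its remainder of order
`K + 3` in `v` is one of the same order in `x`. -/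
theorem Problem.Assumptions.expands_Psi (hp : p.Assumptions) {K : ℕ}
    {v : (Fin n → ℝ) → Fin m → ℝ} {s : Fin m → PS n}
    (hv : ∀ i, Expands (K + 3) (fun x => v x i) (s i)) (hs : ∀ i, LowOrd 1 (s i)) :
    Expands (K + 3) (fun x => p.Psi (v x))
      ((1 / 2 : ℝ) • bil p.R1⁻¹ s s + higher K (taylor p.Psi) s) := by
  have hv1 : v =O[𝓝 0] fun x : Fin n → ℝ => ‖x‖ := by
    refine isBigO_pi.2 fun i => ?_
    simpa using (hv i).isBigO_of_lowOrd (N' := 1) (by omega) (hs i)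
  have hvt : Tendsto v (𝓝 0) (𝓝 0) := by
    refine hv1.trans_tendsto ?_
    simpa using (continuous_norm (E := Fin n → ℝ)).tendsto 0
  have hrem : (fun x => p.Psi (v x) - ∑ k ∈ Finset.range (K + 3), ev k (tay p.Psi) (v x))
      =O[𝓝 0] fun x => ‖x‖ ^ (K + 3) := by
    have h1 : (fun y => p.Psi y - ∑ k ∈ Finset.range (K + 3), ev k (tay p.Psi) y)
      =O[𝓝 0] fun y => ‖y‖ ^ (K + 3) := expands_tay hp.Psi_analytic (K + 3)
    exact IsBigO.trans (h1.comp_tendsto hvt) (hv1.norm_left.pow (K + 3))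
  have hsplit : ∀ y, ∑ k ∈ Finset.range (K + 3), ev k (tay p.Psi) y =
      1 / 2 * ∑ i, ∑ j, p.R1⁻¹ i j * (y i * y j) +
        ∑ j ∈ Finset.range K, ∑ c : Sym (Fin m) (j + 3),
          taylor p.Psi (j + 3) c * mcoef c * (c.1.map y).prod := by
    intro y
    obtain ⟨e0, e1, e2⟩ := hp.ev_Psi y
    rw [Finset.sum_range_succ', Finset.sum_range_succ', Finset.sum_range_succ', e0, e1, e2]
    rw [add_zero, add_zero, add_comm]
    congr 1
    refine Finset.sum_congr rfl fun j _ => ?_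
    rw [ev, hom_tay, dotProduct]
    exact Finset.sum_congr rfl fun c _ => by rw [powVec, mul_assoc]
  have hexp : Expands (K + 3) (fun x => ∑ k ∈ Finset.range (K + 3), ev k (tay p.Psi) (v x))
      ((1 / 2 : ℝ) • bil p.R1⁻¹ s s + higher K (taylor p.Psi) s) := by
    simp only [hsplit]
    refine (Expands.smul _ (Expands.sum fun i _ => Expands.sum fun j _ =>
      Expands.smul _ ((hv i).mul (hv j)))).add ?_
    exact Expands.sum fun j _ => Expands.sum fun c _ =>
      Expands.smul _ (Expands.multiset_prod hv c.1)
  exact hexp.of_isBigO_sub hrem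

theorem Problem.Assumptions.expands_hjb (hp : p.Assumptions) {K : ℕ}
    {h : (Fin n → ℝ) → Fin n → ℝ} {s : Fin n → PS n}
    (hh : ∀ i, Expands (K + 3) (fun x => h x i) (s i)) (hs : ∀ i, LowOrd 1 (s i)) :
    Expands (K + 3) (fun x => p.hjb (h x) x) (hp.formalData.lhs K s) := by
  have hv : ∀ j, Expands (K + 3) (fun x => ((p.g x)ᵀ *ᵥ h x) j) (hp.formalData.v s j) := by
    intro j
    have h1 : Expands (K + 3) (fun x => ∑ i, h x i * p.g x i j) (hp.formalData.v s j) :=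
      Expands.sum fun i _ => (hh i).mul (expands_tay (hp.g_analytic i j) _)
    refine h1.congr' (Filter.Eventually.of_forall fun x => ?_)
    exact Finset.sum_congr rfl fun i _ => mul_comm _ _
  have hPsi := hp.expands_Psi hv fun j => FormalData.lowOrd_v hs j
  have hf : Expands (K + 3) (fun x => ∑ i, p.f x i * h x i) (∑ i, hp.formalData.F i * s i) :=
    Expands.sum fun i _ => (expands_tay (hp.f_apply_analytic i) _).mul (hh i)
  have hfin := (hf.sub hPsi).add (expands_tay hp.Q_analytic (K + 3))
  refine hfin.congr' (Filter.Eventually.of_forall fun x => ?_)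
  show _ = h x ⬝ᵥ p.f x - _ + _
  rw [dotProduct_comm]
  rfl

end

end NLR

namespace NLR
open Matrix Asymptotics

/-! ### Analytic solutions of the HJB equation -/

section

variable {n m k : ℕ}

theorem redOne_transpose_mulVec_powVec (x : Fin n → ℝ) (b : Sym (Fin n) k) (i : Fin n) :
    ((redOne n k)ᵀ *ᵥ powVec x (k + 1)) (b, i) = powVec x k b * x i := by
  rw [redOne_transpose_mulVec_apply, powVec, powVec, ← mul_assoc,
    div_mul_cancel₀ _ (mcoef_ne_zero _)]
  have : ((i ::ₛ b).1.map x).prod = x i * (b.1.map x).prod := by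
    show ((i ::ₘ b.1).map x).prod = _
    rw [Multiset.map_cons, Multiset.prod_cons]
  rw [this]; ring

theorem dotProduct_mulVec_powVec {P : Matrix (Fin n) (Sym (Fin n) k) ℝ} {c : ℝ}
    {q : Sym (Fin n) (k + 1) → ℝ} (hP : ∀ i a, P i a = c * ((redOne n k)ᵀ *ᵥ q) (a, i))
    (x : Fin n → ℝ) : x ⬝ᵥ P *ᵥ powVec x k = c * (q ⬝ᵥ powVec x (k + 1)) := by
  have h1 : q ⬝ᵥ powVec x (k + 1) =
      ((redOne n k)ᵀ *ᵥ q) ⬝ᵥ ((redOne n k)ᵀ *ᵥ powVec x (k + 1)) := by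
    conv_lhs => rw [← redOne_mulVec_transpose (powVec x (k + 1)), dotProduct_mulVec]
    rw [← mulVec_transpose]
  rw [h1, dotProduct, dotProduct, Fintype.sum_prod_type, Finset.mul_sum]
  simp only [Finset.mul_sum]
  rw [Finset.sum_comm]
  refine Finset.sum_congr rfl fun i _ => ?_
  rw [mulVec, dotProduct, Finset.mul_sum]
  refine Finset.sum_congr rfl fun a _ => ?_
  rw [redOne_transpose_mulVec_powVec, hP]
  ring

/-- `V` is an analytic solution of the HJB equation near the origin, whose Hessian is the
stabilizing solution of the Riccati equation. -/
structure IsLocalSolution (p : Problem n m) (V : (Fin n → ℝ) → ℝ) : Prop where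
  analytic : AnalyticAt ℝ V 0
  zero : V 0 = 0
  grad_zero : grad V 0 = 0
  hess : hess V = p.areSol
  hjb : ∀ᶠ x in 𝓝 (0 : Fin n → ℝ), p.hjb (grad V x) x = 0

/-- The Taylor coefficients of the gradient. -/
noncomputable def gradCoeffs (V : (Fin n → ℝ) → ℝ) : Comp.Series n (Fin n) :=
  fun k => Matrix.of fun i a => taylor (fun x => grad V x i) k a

theorem ser_gradCoeffs (V : (Fin n → ℝ) → ℝ) (i : Fin n) :
    Comp.ser (gradCoeffs V) i = tay fun x => grad V x i := ps_ext fun k => by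
  ext a
  rw [Comp.hom_ser, hom_tay]; rfl

theorem gradCoeffs_apply {V : (Fin n → ℝ) → ℝ} (hV : AnalyticAt ℝ V 0) (i : Fin n)
    (a : Sym (Fin n) k) :
    gradCoeffs V k i a = (k + 1) * ((redOne n k)ᵀ *ᵥ taylor V (k + 1)) (a, i) :=
  taylor_grad hV i k a

theorem gradCoeffs_mulVec_powVec (V : (Fin n → ℝ) → ℝ) (x : Fin n → ℝ) (i : Fin n) :
    (gradCoeffs V k *ᵥ powVec x k) i = ev k (tay fun x => grad V x i) x := by
  rw [ev, hom_tay]; rfl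

variable {p : Problem n m} {V : (Fin n → ℝ) → ℝ}

namespace IsLocalSolution

theorem gradCoeffs_zero (h : IsLocalSolution p V) : gradCoeffs V 0 = 0 := by
  ext i a
  refine Eq.trans (b := hom 0 (tay fun x => grad V x i) a) (by rw [hom_tay]; rfl) ?_
  rw [hom_zero_tay, h.grad_zero]; rfl

theorem gradCoeffs_one (h : IsLocalSolution p V) (hp : p.Assumptions) :
    gradCoeffs V 1 = linCoeff p.areSol := by
  ext i a
  obtain ⟨j, rfl⟩ := (Sym.oneEquiv (α := Fin n)).surjective a
  refine Eq.trans (b := taylor (fun x => grad V x i) 1 (Sym.oneEquiv j)) rfl ?_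
  have h8 : p.areSolᵀ = p.areSol := isSymm_of_isHermitian hp.isStabilizingARE_areSol.posSemidef.1
  have h6 := hasFDerivAt_pi'.1 (grad_analyticAt h.analytic).differentiableAt.hasFDerivAt i
  rw [taylor_one (AnalyticAt.grad h.analytic i), h6.fderiv, ContinuousLinearMap.comp_apply]
  refine (fderiv_grad h.analytic (Pi.single j 1) i).trans ?_
  rw [h.hess, single_one_vecMul]
  show p.areSol j i = p.areSol i (Sym.oneEquiv.symm (Sym.oneEquiv j))
  rw [Equiv.symm_apply_apply, ← transpose_apply p.areSol, h8]

theorem lowOrd_one (h : IsLocalSolution p V) (i : Fin n) :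
    LowOrd 1 (tay fun x => grad V x i) := lowOrd_one_tay (by rw [h.grad_zero]; rfl)

theorem isSolution (h : IsLocalSolution p V) (hp : p.Assumptions) :
    hp.formalData.IsSolution (gradCoeffs V) := by
  refine FormalData.isSolution_of_lowOrd_lhs h.gradCoeffs_zero (h.gradCoeffs_one hp)
    (fun k _ => ⟨((k : ℝ) + 1) • taylor V (k + 1), fun i a => ?_⟩) fun K => ?_
  · rw [gradCoeffs_apply h.analytic, mulVec_smul]; rfl
  · have h1 : Comp.ser (gradCoeffs V) = fun i => tay fun x => grad V x i :=
      funext (ser_gradCoeffs V)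
    rw [h1]
    have h2 := hp.expands_hjb (K := K) (h := grad V)
      (fun i => expands_tay (AnalyticAt.grad h.analytic i) _) h.lowOrd_one
    refine h2.lowOrd_of_isBigO ?_
    exact (isBigO_zero _ _).congr' (h.hjb.mono fun x hx => hx.symm) EventuallyEq.rfl

theorem eventually_valueR (h : IsLocalSolution p V) (hp : p.Assumptions) :
    p.valueR =ᶠ[𝓝 0] V :=
  (hp.eventually_value_eq h.analytic h.zero h.grad_zero h.hess h.hjb).mono fun _ hx => hx.2

theorem eventually_grad_valueR (h : IsLocalSolution p V) (hp : p.Assumptions) :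
    ∀ᶠ x in 𝓝 (0 : Fin n → ℝ), grad p.valueR x = grad V x := by
  filter_upwards [(h.eventually_valueR hp).fderiv (𝕜 := ℝ)] with x hx
  ext i
  rw [grad, hx]; rfl

theorem eventually_hasSum_grad (h : IsLocalSolution p V) :
    ∀ᶠ x in 𝓝 (0 : Fin n → ℝ),
      HasSum (fun k : ℕ => gradCoeffs V (k + 1) *ᵥ powVec x (k + 1)) (grad V x) := by
  have h1 : ∀ i : Fin n, ∀ᶠ x in 𝓝 (0 : Fin n → ℝ),
      HasSum (fun k => ev k (tay fun x => grad V x i) x) (grad V x i) := fun i =>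
    hasSum_ev_tay (AnalyticAt.grad h.analytic i)
  filter_upwards [eventually_all.2 h1] with x hx
  refine Pi.hasSum.2 fun i => ?_
  simp only [gradCoeffs_mulVec_powVec]
  have h2 := (hasSum_nat_add_iff' 1).2 (hx i)
  rw [Finset.sum_range_one, ev, h.lowOrd_one i 0 one_pos, zero_dotProduct, sub_zero] at h2
  exact h2

theorem hom_tay_eq_zero (h : IsLocalSolution p V) : LowOrd 2 (tay V) := by
  have h1 := lowOrd_two_tay_sub h.analytic h.zero (A := (0 : Matrix Unit (Fin n) ℝ))
    (i := ()) fun j => congrFun h.grad_zero j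
  have h0 : lin (0 : Matrix Unit (Fin n) ℝ) () = 0 := by simp [lin]
  rwa [h0, sub_zero] at h1

theorem dotProduct_gradCoeffs (h : IsLocalSolution p V) (x : Fin n → ℝ) (k : ℕ) :
    x ⬝ᵥ gradCoeffs V k *ᵥ powVec x k / ((k : ℝ) + 1) = taylor V (k + 1) ⬝ᵥ powVec x (k + 1) := by
  rw [dotProduct_mulVec_powVec fun i a => gradCoeffs_apply h.analytic i a]
  rw [mul_div_cancel_left₀]
  positivity

theorem expands_gradTrunc (P : Comp.Series n (Fin n)) (h0 : P 0 = 0) (N M : ℕ) (i : Fin n) :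
    Expands M (fun x => gradTrunc P N x i)
      (Comp.ser (fun k => if k ≤ N then P k else 0 : Comp.Series n (Fin n)) i) := by
  have h1 : Expands M (fun x => ∑ k ∈ Finset.Icc 1 N, (P k i) ⬝ᵥ powVec x k)
      (∑ k ∈ Finset.Icc 1 N, homPart k (P k i)) := Expands.sum fun k _ => expands_homPart M _
  have h2 : ∑ k ∈ Finset.Icc 1 N, homPart k (P k i) =
      Comp.ser (fun k => if k ≤ N then P k else 0 : Comp.Series n (Fin n)) i := ps_ext fun j => by
    ext a
    rw [Comp.hom_ser, hom_sum]
    by_cases hj : j ∈ Finset.Icc 1 N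
    · rw [Finset.sum_eq_single_of_mem j hj fun k _ hk => hom_homPart_of_ne (Ne.symm hk) _,
        hom_homPart, if_pos (Finset.mem_Icc.1 hj).2]
    · rw [Finset.sum_eq_zero fun k hk => hom_homPart_of_ne (fun e : j = k => hj (by rw [e]; exact hk)) _]
      by_cases hjN : j ≤ N
      · have : j = 0 := by
          by_contra hne
          exact hj (Finset.mem_Icc.2 ⟨Nat.one_le_iff_ne_zero.2 hne, hjN⟩)
        subst this
        rw [if_pos hjN, h0]; rfl
      · rw [if_neg hjN]; rfl
  rw [← h2]
  refine h1.congr' (Filter.Eventually.of_forall fun x => ?_)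
  simp only [gradTrunc, Finset.sum_apply]
  rfl

theorem hjb_gradTrunc_isBigO (h : IsLocalSolution p V) (hp : p.Assumptions) (N : ℕ) :
    (fun x : Fin n → ℝ => p.hjb (gradTrunc (gradCoeffs V) N x) x) =O[𝓝 0]
      fun x => ‖x‖ ^ (N + 2) := by
  -- For `N = 0` the truncation is zero and the HJB expression reduces to `Q`, which starts in
  -- degree two.
  rcases Nat.eq_zero_or_pos N with rfl | hN
  · have h1 : ∀ x, p.hjb (gradTrunc (gradCoeffs V) 0 x) x = p.Q x := fun x => by
      have : gradTrunc (gradCoeffs V) 0 x = 0 := by simp [gradTrunc]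
      rw [this, Problem.hjb, mulVec_zero, hp.Psi_zero, zero_dotProduct]; ring
    simp only [h1]
    have h2 := lowOrd_two_tay_sub hp.Q_analytic hp.Q_zero (A := (0 : Matrix Unit (Fin n) ℝ))
      (i := ()) fun j => by rw [hp.fderiv_Q]; rfl
    have h0 : lin (0 : Matrix Unit (Fin n) ℝ) () = 0 := by simp [lin]
    rw [h0, sub_zero] at h2
    exact (expands_tay hp.Q_analytic 2).isBigO_of_lowOrd le_rfl h2
  · set P' : Comp.Series n (Fin n) := fun k => if k ≤ N then gradCoeffs V k else 0 with hP'
    have h1 := hp.expands_hjb (K := N) (h := gradTrunc (gradCoeffs V) N) (s := Comp.ser P')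
      (fun i => expands_gradTrunc _ h.gradCoeffs_zero N _ i) fun i j hj => by
        ext a
        obtain rfl : j = 0 := by omega
        rw [Comp.hom_ser, hP']
        simp only [Nat.zero_le, if_true]
        rw [h.gradCoeffs_zero]; rfl
    exact h1.isBigO_of_lowOrd (by omega)
      ((h.isSolution hp).lowOrd_lhs_of_agree hN (fun k hk => if_pos hk) (Nat.sub_le N 1))

theorem solvesExactly (h : IsLocalSolution p V) (hp : p.Assumptions) :
    SolvesExactly p (gradCoeffs V) where
  finite := (hp.eventually_value_eq h.analytic h.zero h.grad_zero h.hess h.hjb).mono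
    fun x hx => by rw [hx.1]; exact ENNReal.ofReal_ne_top
  analytic := h.analytic.congr (h.eventually_valueR hp).symm
  value_series := by
    filter_upwards [h.eventually_valueR hp, hasSum_ev_tay h.analytic] with x hx hs
    rw [hx]
    have h2 := (hasSum_nat_add_iff' 2).2 hs
    rw [Finset.sum_range_succ, Finset.sum_range_one, ev, ev, h.hom_tay_eq_zero 0 two_pos,
      h.hom_tay_eq_zero 1 one_lt_two, zero_dotProduct, zero_dotProduct, add_zero, sub_zero] at h2
    refine (congrArg (fun F => HasSum F (V x)) (funext fun k => ?_)).mpr h2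
    have h3 := h.dotProduct_gradCoeffs x (k + 1)
    rw [ev, hom_tay, ← h3]
    push_cast
    congr 1
    ring
  symmetric k _ := ⟨((k : ℝ) + 1) • taylor V (k + 1), by
    ext ⟨a, i⟩
    rw [mulVec_smul]
    exact gradCoeffs_apply h.analytic i a⟩
  grad_term k _ x := by
    simp only [h.dotProduct_gradCoeffs]
    ext i
    rw [grad_dotProduct_powVec, mulVec, dotProduct, dotProduct, Finset.mul_sum]
    refine Finset.sum_congr rfl fun a _ => ?_
    rw [gradCoeffs_apply h.analytic, mul_assoc]
  grad_series := by
    filter_upwards [h.eventually_grad_valueR hp, h.eventually_hasSum_grad] with x hx hs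
    rw [hx]; exact hs
  hjb := by
    filter_upwards [h.eventually_grad_valueR hp, h.hjb] with x hx hj
    rw [hx]; exact hj
  hjb_trunc := h.hjb_gradTrunc_isBigO hp
  optimal := by
    -- The whole optimal trajectory is kept in the neighbourhood where the gradient series
    -- converges, so that the feedback is given by the series at all times.
    filter_upwards [hp.eventually_optimal h.analytic h.zero h.grad_zero h.hess h.hjb
      h.eventually_hasSum_grad, hp.eventually_value_eq h.analytic h.zero h.grad_zero h.hess h.hjb]
      with x₀ hopt hval
    obtain ⟨x, u, htr, hcost, -, hxu⟩ := hopt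
    refine ⟨x, u, htr, hcost.trans hval.1.symm, fun t ht => ?_⟩
    exact ⟨_, (hxu t ht).1.map (Matrix.mulVecLin (p.g (x t))ᵀ)
      (LinearMap.continuous_of_finiteDimensional _), (hxu t ht).2⟩

end IsLocalSolution

end

end NLR

namespace NLR
open Matrix Asymptotics

/-! ### Convergence of the formal solution -/

section

variable {n m : ℕ}

/-- The weighted norms of `s` are `O(r ^ j)`, uniformly in the order of truncation. -/
def SmallOrd (j : ℕ) (s : PS n) : Prop :=
  ∃ C, 0 ≤ C ∧ ∀ᶠ r in 𝓝[>] (0 : ℝ), ∀ M, wn M r s ≤ C * r ^ j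

theorem smallOrd_tay {f : (Fin n → ℝ) → ℝ} (hf : AnalyticAt ℝ f 0) : SmallOrd 0 (tay f) := by
  obtain ⟨C, ρ, hC, hρ, h⟩ := exists_bn_tay_le hf
  refine ⟨C * 2, by positivity, ?_⟩
  filter_upwards [Ioo_mem_nhdsGT (show (0 : ℝ) < 1 / (2 * ρ) by positivity)] with r hr M
  have hr0 := hr.1
  have h1 : ρ * r ≤ 1 / 2 := by
    have := (mul_le_mul_of_nonneg_left hr.2.le hρ.le)
    refine this.trans_eq ?_
    field_simp
  calc wn M r (tay f) ≤ ∑ k ∈ Finset.range M, C * (1 / 2) ^ k := by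
        refine Finset.sum_le_sum fun k _ => ?_
        calc bn k (tay f) * r ^ k ≤ C * ρ ^ k * r ^ k := by gcongr; exact h k
          _ = C * (ρ * r) ^ k := by rw [mul_pow, mul_assoc]
          _ ≤ C * (1 / 2) ^ k := by gcongr
    _ ≤ C * 2 := by
        rw [← Finset.mul_sum]
        gcongr
        exact sum_geometric_two_le M
    _ = _ := by simp

theorem smallOrd_lin {ι : Type*} (A : Matrix ι (Fin n) ℝ) (i : ι) : SmallOrd 0 (lin A i) := by
  refine ⟨∑ j, |A i j|, Finset.sum_nonneg fun j _ => abs_nonneg _, ?_⟩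
  filter_upwards [Ioo_mem_nhdsGT (show (0 : ℝ) < 1 by norm_num)] with r hr M
  refine (wn_lin_le M hr.1.le A i).trans ?_
  rw [pow_zero]
  exact mul_le_mul_of_nonneg_left hr.2.le (Finset.sum_nonneg fun j _ => abs_nonneg _)

theorem smallOrd_X (i : Fin n) : SmallOrd 0 (MvPowerSeries.X i : PS n) := by
  refine ⟨1, zero_le_one, ?_⟩
  filter_upwards [Ioo_mem_nhdsGT (show (0 : ℝ) < 1 by norm_num)] with r hr M
  refine (wn_X_le M hr.1.le i).trans ?_
  rw [pow_zero, mul_one]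
  exact hr.2.le

theorem smallOrd_one : SmallOrd 0 (1 : PS n) :=
  ⟨1, zero_le_one, Filter.Eventually.of_forall fun r M => by simpa using wn_one_le⟩

theorem SmallOrd.sub {s t : PS n} (hs : SmallOrd 0 s) (ht : SmallOrd 0 t) :
    SmallOrd 0 (s - t) := by
  obtain ⟨C, hC, h⟩ := hs
  obtain ⟨C', hC', h'⟩ := ht
  refine ⟨C + C', by positivity, ?_⟩
  filter_upwards [h, h', self_mem_nhdsWithin] with r h1 h2 hr M
  rw [add_mul]
  exact (wn_sub_le (le_of_lt hr) s t).trans (add_le_add (h1 M) (h2 M))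

theorem SmallOrd.smul {s : PS n} (c : ℝ) (hs : SmallOrd 0 s) : SmallOrd 0 (c • s) := by
  obtain ⟨C, hC, h⟩ := hs
  refine ⟨|c| * C, by positivity, ?_⟩
  filter_upwards [h] with r h1 M
  rw [wn_smul, mul_assoc]
  exact mul_le_mul_of_nonneg_left (h1 M) (abs_nonneg c)

theorem SmallOrd.mul {s t : PS n} (hs : SmallOrd 0 s) (ht : SmallOrd 0 t) :
    SmallOrd 0 (s * t) := by
  obtain ⟨C, hC, h⟩ := hs
  obtain ⟨C', hC', h'⟩ := ht
  refine ⟨C * C', by positivity, ?_⟩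
  filter_upwards [h, h', self_mem_nhdsWithin] with r h1 h2 hr M
  have h3 := h1 M
  have h4 := h2 M
  rw [pow_zero, mul_one] at h3 h4 ⊢
  exact (wn_mul_le (le_of_lt hr) s t).trans (mul_le_mul h3 h4 (wn_nonneg (le_of_lt hr) _) hC)

theorem SmallOrd.family {ι : Type*} [Fintype ι] {j : ℕ} {s : ι → PS n}
    (h : ∀ i, SmallOrd j (s i)) :
    ∃ C, 0 ≤ C ∧ ∀ᶠ r in 𝓝[>] (0 : ℝ), ∀ i M, wn M r (s i) ≤ C * r ^ j := by
  choose C hC h using h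
  refine ⟨∑ i, C i, Finset.sum_nonneg fun i _ => hC i, ?_⟩
  filter_upwards [eventually_all.2 h, self_mem_nhdsWithin] with r h1 hr i M
  have hr0 : 0 < r := hr
  refine (h1 i M).trans ?_
  gcongr
  exact Finset.single_le_sum (fun i _ => hC i) (Finset.mem_univ i)

theorem SmallOrd.sum {ι : Type*} [Fintype ι] {s : ι → PS n} (h : ∀ i, SmallOrd 0 (s i)) :
    SmallOrd 0 (∑ i, s i) := by
  obtain ⟨C, hC, h⟩ := SmallOrd.family h
  refine ⟨Fintype.card ι * C, by positivity, ?_⟩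
  filter_upwards [h, self_mem_nhdsWithin] with r h1 hr M
  refine (wn_sum_le (le_of_lt hr) _ _).trans ?_
  refine (Finset.sum_le_sum fun i _ => h1 i M).trans ?_
  rw [Finset.sum_const, nsmul_eq_mul, Finset.card_univ, mul_assoc]

/-- No terms below degree `j` occur, so shrinking the radius from `R` to `r` gains the factor `(r /
R) ^ j`. -/
theorem SmallOrd.of_lowOrd {j : ℕ} {s : PS n} (hs : SmallOrd 0 s) (h : LowOrd j s) :
    SmallOrd j s := by
  obtain ⟨C, hC, hb⟩ := hs
  obtain ⟨R, hR, hR0⟩ := (hb.and self_mem_nhdsWithin).exists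
  have hR0' : 0 < R := hR0
  refine ⟨C / R ^ j, by positivity, ?_⟩
  filter_upwards [Ioo_mem_nhdsGT hR0'] with r hr M
  have hr0 := hr.1
  calc wn M r s ≤ ∑ k ∈ Finset.range M, (r / R) ^ j * (bn k s * R ^ k) := by
        refine Finset.sum_le_sum fun k _ => ?_
        rcases lt_or_ge k j with hk | hk
        · rw [bn, h k hk, l2_zero]; simp
        · have h1 : r ^ k = (r / R) ^ k * R ^ k := by
            rw [← mul_pow, div_mul_cancel₀ _ hR0'.ne']
          rw [h1, mul_left_comm]
          refine mul_le_mul_of_nonneg_right ?_ (mul_nonneg (bn_nonneg _ _) (by positivity))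
          exact pow_le_pow_of_le_one (by positivity) ((div_le_one hR0').2 hr.2.le) hk
    _ = (r / R) ^ j * wn M R s := by rw [wn, Finset.mul_sum]
    _ ≤ (r / R) ^ j * C := by
        gcongr
        simpa using hR M
    _ = _ := by rw [div_pow]; ring

theorem wn_bil_le {M : ℕ} {r A B : ℝ} (hr : 0 ≤ r) (S : Matrix (Fin m) (Fin m) ℝ)
    {u v : Fin m → PS n} (hA : 0 ≤ A) (hu : ∀ i, wn M r (u i) ≤ A) (hv : ∀ i, wn M r (v i) ≤ B) :
    wn M r (bil S u v) ≤ (∑ i, ∑ j, |S i j|) * (A * B) := by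
  rw [bil, Finset.sum_mul]
  refine (wn_sum_le hr _ _).trans (Finset.sum_le_sum fun i _ => ?_)
  rw [Finset.sum_mul]
  refine (wn_sum_le hr _ _).trans (Finset.sum_le_sum fun j _ => ?_)
  rw [wn_smul]
  exact mul_le_mul_of_nonneg_left ((wn_mul_le hr _ _).trans
    (mul_le_mul (hu i) (hv j) (wn_nonneg hr _) hA)) (abs_nonneg _)

theorem sum_abs_mul_mcoef_le {k : ℕ} (t : Sym (Fin m) k → ℝ) :
    ∑ c, |t c * mcoef c| ≤ l2 t * Real.sqrt m ^ k := by
  have h1 : l2 (fun c => |t c|) = l2 t := by rw [l2_eq_sqrt, l2_eq_sqrt]; simp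
  have h2 : l2 (mcoef : Sym (Fin m) k → ℝ) ≤ Real.sqrt m ^ k := by
    refine l2_le_of_sq_le (by positivity) ?_
    rw [sum_mcoef_sq, ← pow_mul, mul_comm k, pow_mul, Real.sq_sqrt (Nat.cast_nonneg m)]
  have h3 : ∑ c, |t c * mcoef c| = (fun c => |t c|) ⬝ᵥ mcoef := by
    refine Finset.sum_congr rfl fun c _ => ?_
    rw [abs_mul, abs_of_pos (mcoef_pos c)]
  rw [h3]
  refine (le_abs_self _).trans ((abs_dotProduct_le _ _).trans ?_)
  rw [h1]
  exact mul_le_mul_of_nonneg_left h2 (l2_nonneg _)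

/-- Geometric growth of the coefficients: three powers of the small quantity are factored out, and a
geometric series of ratio at most one half remains. -/
theorem wn_higher_le {M K : ℕ} {r s C ρ : ℝ} (hr : 0 ≤ r) (hC : 0 ≤ C) (hρ : 0 ≤ ρ) (hs : 0 ≤ s)
    {t : ∀ k, Sym (Fin m) k → ℝ} (ht : ∀ k, l2 (t k) ≤ C * ρ ^ k)
    (hρs : ρ * Real.sqrt m * s ≤ 1 / 2) {v : Fin m → PS n} (hv : ∀ i, wn M r (v i) ≤ s) :
    wn M r (higher K t v) ≤ 2 * C * (ρ * Real.sqrt m) ^ 3 * s ^ 3 := by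
  set κ := ρ * Real.sqrt m with hκ
  have hκ0 : 0 ≤ κ := by positivity
  calc wn M r (higher K t v) ≤ ∑ j ∈ Finset.range K, C * (κ * s) ^ 3 * (1 / 2) ^ j := by
        refine (wn_sum_le hr _ _).trans (Finset.sum_le_sum fun j _ => ?_)
        calc wn M r (∑ c : Sym (Fin m) (j + 3), (t (j + 3) c * mcoef c) • (c.1.map v).prod)
            ≤ ∑ c : Sym (Fin m) (j + 3), |t (j + 3) c * mcoef c| * s ^ (j + 3) := by
              refine (wn_sum_le hr _ _).trans (Finset.sum_le_sum fun c _ => ?_)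
              rw [wn_smul]
              refine mul_le_mul_of_nonneg_left ?_ (abs_nonneg _)
              have h1 := wn_multiset_prod_le hr hv c.1
              have h2 : Multiset.card c.1 = j + 3 := c.2
              rwa [h2] at h1
          _ ≤ C * ρ ^ (j + 3) * Real.sqrt m ^ (j + 3) * s ^ (j + 3) := by
              rw [← Finset.sum_mul]
              refine mul_le_mul_of_nonneg_right ((sum_abs_mul_mcoef_le _).trans ?_) (by positivity)
              exact mul_le_mul_of_nonneg_right (ht _) (by positivity)
          _ = C * (κ * s) ^ 3 * (κ * s) ^ j := by rw [hκ]; ring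
          _ ≤ C * (κ * s) ^ 3 * (1 / 2) ^ j := by gcongr
    _ ≤ C * (κ * s) ^ 3 * 2 := by
        rw [← Finset.mul_sum]
        gcongr
        exact sum_geometric_two_le K
    _ = _ := by ring

namespace FormalData

/-- The convergence of the data. -/
structure Converges (X : FormalData n m) : Prop where
  F : ∀ i, SmallOrd 2 (X.F i - lin X.F1 i)
  G : ∀ i j, SmallOrd 1 (X.G i j - X.G0 i j • 1)
  Q : SmallOrd 3 (X.Q - (1 / 2 : ℝ) • ∑ i, MvPowerSeries.X i * lin X.Q1 i)
  t : ∃ C ρ, 0 ≤ C ∧ 0 ≤ ρ ∧ ∀ k, l2 (X.t k) ≤ C * ρ ^ k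

-- Every term of `rest` is either of total order three in `r` or quadratic in the deviation `h - Π
-- x`, apart from terms of still higher order. The constant `B` depends neither on `h` nor on the
-- truncation orders, as the induction on the order requires.
set_option maxHeartbeats 1000000 in
theorem Converges.exists_wn_rest_le {X : FormalData n m} (hX : X.Converges) :
    ∃ B, 0 ≤ B ∧ ∀ᶠ r in 𝓝[>] (0 : ℝ), ∀ M K (h : Fin n → PS n) δ, 0 ≤ δ → δ ≤ 1 →
      (∀ i, wn M r (h i - lin X.Pi1 i) ≤ δ * r) →
      wn M r (X.rest K h) ≤ B * (r ^ 3 + δ ^ 2 * r ^ 2) := by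
  obtain ⟨CF, hCF, hF⟩ := SmallOrd.family hX.F
  obtain ⟨CG, hCG, hG⟩ := SmallOrd.family (s := fun a : Fin n × Fin m =>
    X.G a.1 a.2 - X.G0 a.1 a.2 • 1) fun a => hX.G a.1 a.2
  obtain ⟨CQ, hCQ, hQ⟩ := hX.Q
  obtain ⟨Ct, ρ, hCt, hρ, ht⟩ := hX.t
  set c1 := ∑ i, ∑ j, |X.Pi1 i j| with hc1
  set ca := ∑ i, ∑ j, |(X.G0ᵀ * X.Pi1) i j| with hca
  set cb := ∑ i, ∑ k, |X.G0 k i| with hcb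
  set cS := ∑ i, ∑ j, |X.S i j| with hcS
  have hc10 : 0 ≤ c1 := Finset.sum_nonneg fun i _ => Finset.sum_nonneg fun j _ => abs_nonneg _
  have hca0 : 0 ≤ ca := Finset.sum_nonneg fun i _ => Finset.sum_nonneg fun j _ => abs_nonneg _
  have hcb0 : 0 ≤ cb := Finset.sum_nonneg fun i _ => Finset.sum_nonneg fun j _ => abs_nonneg _
  have hcS0 : 0 ≤ cS := Finset.sum_nonneg fun i _ => Finset.sum_nonneg fun j _ => abs_nonneg _
  set ce := n * ((c1 + 1) * CG) with hce
  have hce0 : 0 ≤ ce := by positivity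
  set cv := ca + cb + ce with hcv
  have hcv0 : 0 ≤ cv := by positivity
  set κ := ρ * Real.sqrt m with hκ
  have hκ0 : 0 ≤ κ := by positivity
  refine ⟨cS * (ca * ce) + cS * (cb ^ 2 + ce ^ 2) + 2 * Ct * κ ^ 3 * cv ^ 3 +
    n * (CF * (c1 + 1)) + CQ, by positivity, ?_⟩
  have hsmall : ∀ᶠ r in 𝓝[>] (0 : ℝ), κ * (cv * r) < 1 / 2 := by
    have : Tendsto (fun r : ℝ => κ * (cv * r)) (𝓝 0) (𝓝 (κ * (cv * 0))) :=
      (tendsto_id.const_mul cv).const_mul κ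
    refine (this.mono_left nhdsWithin_le_nhds).eventually_lt_const ?_
    norm_num
  filter_upwards [hF, hG, hQ, hsmall, Ioo_mem_nhdsGT (show (0 : ℝ) < 1 by norm_num)]
    with r hF hG hQ hsm hr M K h δ hδ0 hδ1 hh
  have hr0 : 0 ≤ r := hr.1.le
  have hr1 : r ≤ 1 := hr.2.le
  have hlin : ∀ i, wn M r (lin X.Pi1 i) ≤ c1 * r := fun i =>
    (wn_lin_le M hr0 _ i).trans (mul_le_mul_of_nonneg_right (Finset.single_le_sum
      (f := fun i => ∑ j, |X.Pi1 i j|) (fun i _ => Finset.sum_nonneg fun j _ => abs_nonneg _)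
      (Finset.mem_univ i)) hr0)
  have hhb : ∀ i, wn M r (h i) ≤ (c1 + 1) * r := fun i => by
    have h1 := wn_add_le (N := M) hr0 (h i - lin X.Pi1 i) (lin X.Pi1 i)
    rw [sub_add_cancel] at h1
    have h2 : δ * r ≤ 1 * r := by gcongr
    linarith [hh i, hlin i]
  have ha : ∀ i, wn M r (X.a i) ≤ ca * r := fun i =>
    (wn_lin_le M hr0 _ i).trans (mul_le_mul_of_nonneg_right (Finset.single_le_sum
      (f := fun i => ∑ j, |(X.G0ᵀ * X.Pi1) i j|)
      (fun i _ => Finset.sum_nonneg fun j _ => abs_nonneg _) (Finset.mem_univ i)) hr0)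
  have he : ∀ i, wn M r (X.e h i) ≤ ce * r ^ 2 := fun i => by
    refine (wn_sum_le hr0 _ _).trans ?_
    calc ∑ k, wn M r (h k * (X.G k i - X.G0 k i • 1)) ≤ ∑ _k : Fin n, ((c1 + 1) * r) * (CG * r ^ 1) :=
          Finset.sum_le_sum fun k _ => (wn_mul_le hr0 _ _).trans
            (mul_le_mul (hhb k) (hG (k, i) M) (wn_nonneg hr0 _) (by positivity))
      _ = ce * r ^ 2 := by
          rw [Finset.sum_const, Finset.card_univ, Fintype.card_fin, nsmul_eq_mul, hce]; ring
  have hb : ∀ i, wn M r (X.b h i) ≤ cb * (δ * r) := fun i => by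
    refine (wn_sum_le hr0 _ _).trans ?_
    calc ∑ k, wn M r (X.G0 k i • (h k - lin X.Pi1 k)) ≤ ∑ k, |X.G0 k i| * (δ * r) :=
          Finset.sum_le_sum fun k _ => by
            rw [wn_smul]; exact mul_le_mul_of_nonneg_left (hh k) (abs_nonneg _)
      _ = (∑ k, |X.G0 k i|) * (δ * r) := by rw [Finset.sum_mul]
      _ ≤ cb * (δ * r) := by
          refine mul_le_mul_of_nonneg_right (Finset.single_le_sum (f := fun i => ∑ k, |X.G0 k i|)
            (fun i _ => Finset.sum_nonneg fun j _ => abs_nonneg _) (Finset.mem_univ i)) ?_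
          positivity
  have hbe : ∀ i, wn M r ((X.b h + X.e h) i) ≤ cb * (δ * r) + ce * r ^ 2 := fun i =>
    (wn_add_le hr0 _ _).trans (add_le_add (hb i) (he i))
  have hv : ∀ i, wn M r (X.v h i) ≤ cv * r := fun i => by
    rw [X.v_eq h]
    refine ((wn_add_le hr0 _ _).trans (add_le_add (ha i) (hbe i))).trans ?_
    have h1 : cb * (δ * r) ≤ cb * (1 * r) := by gcongr
    have h2 : ce * r ^ 2 ≤ ce * r := by
      gcongr
      exact pow_le_of_le_one hr0 hr1 two_ne_zero
    rw [hcv]; linarith only [h1, h2]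
  set E := r ^ 3 + δ ^ 2 * r ^ 2 with hE
  have hE1 : r ^ 3 ≤ E := by rw [hE]; linarith [show 0 ≤ δ ^ 2 * r ^ 2 by positivity]
  have hE2 : δ ^ 2 * r ^ 2 ≤ E := by rw [hE]; linarith [show 0 ≤ r ^ 3 by positivity]
  have t1 : wn M r (bil X.S X.a (X.e h)) ≤ cS * (ca * ce) * E := by
    refine (wn_bil_le hr0 X.S (by positivity) ha he).trans ?_
    calc cS * (ca * r * (ce * r ^ 2)) = cS * (ca * ce) * r ^ 3 := by ring
      _ ≤ _ := by gcongr
  have t2 : wn M r ((1 / 2 : ℝ) • bil X.S (X.b h + X.e h) (X.b h + X.e h)) ≤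
      cS * (cb ^ 2 + ce ^ 2) * E := by
    rw [wn_smul, abs_of_pos (by norm_num : (0 : ℝ) < 1 / 2)]
    have h1 := wn_bil_le hr0 X.S (by positivity) hbe hbe
    have h2 : r ^ 4 ≤ r ^ 3 := pow_le_pow_of_le_one hr0 hr1 (by norm_num)
    have h3 : (cb * (δ * r) + ce * r ^ 2) * (cb * (δ * r) + ce * r ^ 2) ≤
        2 * ((cb ^ 2 + ce ^ 2) * E) := by
      have h4 : (cb * (δ * r) + ce * r ^ 2) * (cb * (δ * r) + ce * r ^ 2) ≤
          2 * (cb ^ 2 * (δ ^ 2 * r ^ 2) + ce ^ 2 * r ^ 4) := by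
        have hAB : ∀ A B : ℝ, (A + B) * (A + B) ≤ 2 * (A ^ 2 + B ^ 2) := fun A B => by
          nlinarith only [sq_nonneg (A - B)]
        refine (hAB _ _).trans_eq ?_
        ring
      have h5 : cb ^ 2 * (δ ^ 2 * r ^ 2) ≤ cb ^ 2 * E := by gcongr
      have h6 : ce ^ 2 * r ^ 4 ≤ ce ^ 2 * E := by gcongr; exact h2.trans hE1
      linarith only [h4, h5, h6]
    have h7 := mul_le_mul_of_nonneg_left h3 hcS0
    linarith only [h1, h7]
  have t3 : wn M r (higher K X.t (X.v h)) ≤ 2 * Ct * κ ^ 3 * cv ^ 3 * E := by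
    refine (wn_higher_le hr0 hCt hρ (by positivity) ht hsm.le hv).trans ?_
    calc 2 * Ct * κ ^ 3 * (cv * r) ^ 3 = 2 * Ct * κ ^ 3 * cv ^ 3 * r ^ 3 := by ring
      _ ≤ _ := by gcongr
  have t4 : wn M r (∑ i, (X.F i - lin X.F1 i) * h i) ≤ n * (CF * (c1 + 1)) * E := by
    refine (wn_sum_le hr0 _ _).trans ?_
    calc ∑ i, wn M r ((X.F i - lin X.F1 i) * h i) ≤ ∑ _i : Fin n, (CF * r ^ 2) * ((c1 + 1) * r) :=
          Finset.sum_le_sum fun i _ => (wn_mul_le hr0 _ _).trans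
            (mul_le_mul (hF i M) (hhb i) (wn_nonneg hr0 _) (by positivity))
      _ = n * (CF * (c1 + 1)) * r ^ 3 := by
          rw [Finset.sum_const, Finset.card_univ, Fintype.card_fin, nsmul_eq_mul]; ring
      _ ≤ _ := by gcongr
  have t5 : wn M r (X.Q - (1 / 2 : ℝ) • ∑ i, MvPowerSeries.X i * lin X.Q1 i) ≤ CQ * E :=
    (hQ M).trans (by gcongr)
  rw [rest]
  refine (wn_sub_le hr0 _ _).trans ?_
  refine (add_le_add_left (wn_sub_le hr0 _ _) _).trans ?_
  refine (add_le_add_left (add_le_add_left (wn_add_le hr0 _ _) _) _).trans ?_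
  refine (add_le_add_left (add_le_add_left (add_le_add_left (wn_add_le hr0 _ _) _) _) _).trans ?_
  rw [add_mul, add_mul, add_mul, add_mul]
  exact add_le_add (add_le_add (add_le_add (add_le_add t1 t2) t3) t4) t5

open NLR.Comp in
-- If the sum of `|q_k| r ^ k` over `2 ≤ k < N` is at most `δ r`, then `rest` of the truncation has
-- weighted norm at most `2 B δ² r²`. Dissipativity bounds `μ |q_k|` by the part of `rest` of degree
-- `k + 1`, so the sum up to `k = N` is at most `(2 B δ / μ) δ r ≤ δ r`. The bound reproduces
-- itself, and each single term gives geometric growth.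
theorem IsSolution.exists_l2_le {X : FormalData n m} (hX : X.Converges) {μ : ℝ} (hμ : 0 < μ)
    (hF : ∀ x : Fin n → ℝ, x ⬝ᵥ X.Fc *ᵥ x ≤ -(μ * (x ⬝ᵥ x))) {P : Series n (Fin n)}
    (hP : X.IsSolution P) {q : ∀ k, Sym (Fin n) (k + 1) → ℝ}
    (hq : ∀ k, 2 ≤ k → (∀ i a, P k i a = ((NLR.redOne n k)ᵀ *ᵥ q k) (a, i)) ∧
      Mmat X.Fc k *ᵥ q k = hom (k + 1) (X.rest (k - 1) (ser P))) :
    ∃ C ρ : ℝ, 0 < C ∧ 0 < ρ ∧ ∀ k, 2 ≤ k → l2 (q k) ≤ C * ρ ^ k := by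
  obtain ⟨B, hB, hev⟩ := hX.exists_wn_rest_le
  -- Small enough that `2 B δ ≤ μ`, which closes the induction.
  set δ := min 1 (μ / (2 * (B + 1))) with hδ
  have hδ0 : 0 < δ := by positivity
  have hδ1 : δ ≤ 1 := min_le_left _ _
  have hδB : 2 * B * δ ≤ μ := by
    have h1 : δ ≤ μ / (2 * (B + 1)) := min_le_right _ _
    rw [le_div_iff₀ (by positivity)] at h1
    nlinarith
  -- Taking `r < δ²` lets `r ^ 3` be absorbed into `δ² r²`.
  obtain ⟨r, hr, hrI⟩ := (hev.and (Ioo_mem_nhdsGT (show (0 : ℝ) < δ ^ 2 by positivity))).exists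
  have hr0 := hrI.1
  have hcomp : ∀ k, 2 ≤ k → ∀ i, l2 (P k i) ≤ l2 (q k) := by
    intro k hk i
    rw [← l2_transpose_mulVec_of_coisometry (redOne_mul_transpose n k) (q k)]
    refine l2_le_of_sq_le (l2_nonneg _) ?_
    rw [l2_sq, Fintype.sum_prod_type]
    refine Finset.sum_le_sum fun a _ => ?_
    rw [(hq k hk).1 i a]
    exact Finset.single_le_sum (f := fun i => ((NLR.redOne n k)ᵀ *ᵥ q k) (a, i) ^ 2)
      (fun i _ => sq_nonneg _) (Finset.mem_univ i)
  have key : ∀ N, 2 ≤ N → ∑ k ∈ Finset.Ico 2 N, l2 (q k) * r ^ k ≤ δ * r := by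
    intro N hN
    induction N, hN using Nat.le_induction with
    | base => simp; positivity
    | succ N hN ih =>
      -- The truncation below degree `N` obeys the inductive bound and still determines `rest` up to
      -- degree `N + 1`, which is the degree that fixes `q N`.
      set P' : Series n (Fin n) := fun k => if k < N then P k else 0 with hP'
      have h0 : P' 0 = 0 := by rw [hP']; simp [hP.zero]
      have h1 : P' 1 = linCoeff X.Pi1 := by
        rw [hP']; simp only; rw [if_pos (by omega), hP.one]
      have hlow := lowOrd_two_ser_sub (X := X) h0 h1
      have hlow' := lowOrd_two_ser_sub (X := X) hP.zero hP.one
      have hw : ∀ M i, wn M r (ser P' i - lin X.Pi1 i) ≤ δ * r := by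
        intro M i
        refine le_trans ?_ ih
        have hterm : ∀ k, bn k (ser P' i - lin X.Pi1 i) * r ^ k ≤
            if k ∈ Finset.Ico 2 N then l2 (q k) * r ^ k else 0 := by
          intro k
          rcases lt_or_ge k 2 with hk | hk
          · rw [bn, hlow i k hk, l2_zero, if_neg (by simp; omega), zero_mul]
          · have h2 : hom k (ser P' i - lin X.Pi1 i) = P' k i := by
              rw [hom_sub, hom_lin_of_ne (by omega), sub_zero]
              ext a; exact hom_ser _ _ _ _
            rw [bn, h2]
            by_cases hkN : k < N
            · rw [if_pos (Finset.mem_Ico.2 ⟨hk, hkN⟩), hP']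
              simp only [if_pos hkN]
              exact mul_le_mul_of_nonneg_right (hcomp k hk i) (by positivity)
            · rw [if_neg (by simp; omega), hP']
              simp only [if_neg hkN]
              have : l2 ((0 : Matrix (Fin n) (Sym (Fin n) k) ℝ) i) = 0 := l2_zero
              rw [this, zero_mul]
        refine (Finset.sum_le_sum fun k _ => hterm k).trans ?_
        rw [← Finset.sum_filter]
        exact Finset.sum_le_sum_of_subset_of_nonneg (fun k hk => (Finset.mem_filter.1 hk).2)
          fun k _ _ => mul_nonneg (l2_nonneg _) (by positivity)
      have hrest := hr (N + 2) (N - 1) (ser P') δ hδ0.le hδ1 (hw _)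
      have hsum : ∑ k ∈ Finset.Ico 2 (N + 1), μ * l2 (q k) * r ^ (k + 1) ≤
          wn (N + 2) r (X.rest (N - 1) (ser P')) := by
        calc ∑ k ∈ Finset.Ico 2 (N + 1), μ * l2 (q k) * r ^ (k + 1)
            ≤ ∑ k ∈ Finset.Ico 2 (N + 1), bn (k + 1) (X.rest (N - 1) (ser P')) * r ^ (k + 1) := by
              refine Finset.sum_le_sum fun k hk => ?_
              obtain ⟨hk1, hk2⟩ := Finset.mem_Ico.1 hk
              refine mul_le_mul_of_nonneg_right ?_ (by positivity)
              refine (mul_l2_le_l2_Mmat_mulVec hF (q k)).trans_eq ?_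
              rw [(hq k hk1).2, bn, hom_rest_congr hk1 (by omega) hlow hlow' fun i =>
                lowOrd_ser_sub (fun j hj => if_pos (by omega)) i]
          _ = ∑ k ∈ Finset.Ico (2 + 1) (N + 1 + 1), bn k (X.rest (N - 1) (ser P')) * r ^ k :=
              Finset.sum_Ico_add' (fun k => bn k (X.rest (N - 1) (ser P')) * r ^ k) 2 (N + 1) 1
          _ ≤ _ := Finset.sum_le_sum_of_subset_of_nonneg
              (fun k hk => Finset.mem_range.2 (Finset.mem_Ico.1 hk).2)
              fun k _ _ => mul_nonneg (bn_nonneg _ _) (by positivity)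
      have h3 : μ * r * ∑ k ∈ Finset.Ico 2 (N + 1), l2 (q k) * r ^ k ≤ μ * r * (δ * r) := by
        calc μ * r * ∑ k ∈ Finset.Ico 2 (N + 1), l2 (q k) * r ^ k
            = ∑ k ∈ Finset.Ico 2 (N + 1), μ * l2 (q k) * r ^ (k + 1) := by
              rw [Finset.mul_sum]
              exact Finset.sum_congr rfl fun k _ => by ring
          _ ≤ B * (r ^ 3 + δ ^ 2 * r ^ 2) := hsum.trans hrest
          _ ≤ B * (δ ^ 2 * r ^ 2 + δ ^ 2 * r ^ 2) := by
              have : r ^ 3 ≤ δ ^ 2 * r ^ 2 := by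
                calc r ^ 3 = r * r ^ 2 := by ring
                  _ ≤ δ ^ 2 * r ^ 2 := by gcongr; exact hrI.2.le
              gcongr
          _ = 2 * B * δ * (δ * r ^ 2) := by ring
          _ ≤ μ * (δ * r ^ 2) := by gcongr
          _ = _ := by ring
      exact le_of_mul_le_mul_left h3 (by positivity)
  refine ⟨δ * r, 1 / r, by positivity, by positivity, fun k hk => ?_⟩
  have h1 := key (k + 1) (by omega)
  have h2 : l2 (q k) * r ^ k ≤ δ * r := le_trans (Finset.single_le_sum
    (f := fun k => l2 (q k) * r ^ k) (fun k _ => mul_nonneg (l2_nonneg _) (by positivity))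
    (Finset.mem_Ico.2 ⟨hk, Nat.lt_succ_self k⟩)) h1
  rw [div_pow, one_pow, mul_one_div, le_div_iff₀ (by positivity)]
  exact h2

end FormalData

end

end NLR

namespace NLR
open Matrix Asymptotics

/-! ### Existence of a local solution in good coordinates -/

section

variable {n m : ℕ} {p : Problem n m}

theorem smallOrd_quadratic (A : Matrix (Fin n) (Fin n) ℝ) :
    SmallOrd 0 ((1 / 2 : ℝ) • ∑ i, MvPowerSeries.X i * lin A i) :=
  (SmallOrd.sum fun i => (smallOrd_X i).mul (smallOrd_lin A i)).smul _

theorem Problem.Assumptions.converges (hp : p.Assumptions) : hp.formalData.Converges where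
  F i := ((smallOrd_tay (hp.f_apply_analytic i)).sub (smallOrd_lin _ i)).of_lowOrd
    (hp.formalData.lowOrd_F i)
  G i j := ((smallOrd_tay (hp.g_analytic i j)).sub (smallOrd_one.smul _)).of_lowOrd
    (hp.formalData.lowOrd_G i j)
  Q := ((smallOrd_tay hp.Q_analytic).sub (smallOrd_quadratic _)).of_lowOrd hp.formalData.lowOrd_Q
  t := by
    obtain ⟨C, ρ, hC, hρ, h⟩ := exists_bn_tay_le hp.Psi_analytic
    refine ⟨C, ρ, hC.le, hρ.le, fun k => ?_⟩
    have := h k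
    rwa [bn, hom_tay] at this

/-- For symmetric `A` the field `A x` is the gradient of `½ xᵀ A x`, and `taylor_grad` supplies the
vector `q`. -/
theorem exists_linCoeff_eq {A : Matrix (Fin n) (Fin n) ℝ} (hA : Aᵀ = A) :
    ∃ q : Sym (Fin n) (1 + 1) → ℝ, ∀ i a, linCoeff A i a = ((redOne n 1)ᵀ *ᵥ q) (a, i) := by
  set W : (Fin n → ℝ) → ℝ := fun x => 1 / 2 * (x ⬝ᵥ A *ᵥ x) with hW
  have hproj : ∀ (i : Fin n) (x : Fin n → ℝ), HasFDerivAt (fun x : Fin n → ℝ => x i)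
      (ContinuousLinearMap.proj (R := ℝ) (φ := fun _ : Fin n => ℝ) i) x := fun i x =>
    (ContinuousLinearMap.proj (R := ℝ) (φ := fun _ : Fin n => ℝ) i).hasFDerivAt
  have hWa : AnalyticAt ℝ W 0 := by
    have hpa : ∀ i : Fin n, AnalyticAt ℝ (fun x : Fin n → ℝ => x i) 0 := fun i =>
      (ContinuousLinearMap.proj (R := ℝ) (φ := fun _ : Fin n => ℝ) i).analyticAt 0
    refine analyticAt_const.mul (Finset.univ.analyticAt_fun_sum fun i _ => (hpa i).mul ?_)
    simp only [mulVec, dotProduct]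
    exact Finset.univ.analyticAt_fun_sum fun j _ => analyticAt_const.mul (hpa j)
  have hgrad : ∀ x, grad W x = A *ᵥ x := by
    intro x
    have hmv : ∀ i, HasFDerivAt (fun x : Fin n → ℝ => (A *ᵥ x) i)
        (∑ j, A i j • ContinuousLinearMap.proj (R := ℝ) (φ := fun _ : Fin n => ℝ) j) x := by
      intro i
      simp only [mulVec, dotProduct]
      exact HasFDerivAt.fun_sum fun j _ => (hproj j x).const_mul (A i j)
    have hd : HasFDerivAt W ((1 / 2 : ℝ) • ∑ i, (x i •
        (∑ j, A i j • ContinuousLinearMap.proj (R := ℝ) (φ := fun _ : Fin n => ℝ) j) +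
        (A *ᵥ x) i • ContinuousLinearMap.proj (R := ℝ) (φ := fun _ : Fin n => ℝ) i)) x :=
      (HasFDerivAt.fun_sum fun i _ => (hproj i x).mul (hmv i)).const_mul _
    refine grad_eq_of_hasFDerivAt hd fun y => ?_
    simp only [_root_.smul_apply, _root_.sum_apply, _root_.add_apply, smul_eq_mul,
      ContinuousLinearMap.proj_apply, Finset.sum_add_distrib]
    have h1 : ∑ i, x i * ∑ j, A i j * y j = (A *ᵥ x) ⬝ᵥ y := by
      have : x ⬝ᵥ A *ᵥ y = (A *ᵥ x) ⬝ᵥ y := by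
        rw [dotProduct_mulVec, ← mulVec_transpose, hA]
      exact this
    rw [h1]
    show 1 / 2 * ((A *ᵥ x) ⬝ᵥ y + (A *ᵥ x) ⬝ᵥ y) = _
    ring
  refine ⟨(2 : ℝ) • taylor W 2, fun i a => ?_⟩
  have h1 := taylor_grad hWa i 1 a
  have h2 : Expands 2 (fun x => grad W x i) (lin A i) :=
    (expands_lin 2 A i).congr' (Filter.Eventually.of_forall fun x => by
      show (A *ᵥ x) i = grad W x i
      rw [hgrad])
  rw [← h2.hom_tay_eq (AnalyticAt.grad hWa i) one_lt_two] at h1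
  obtain ⟨j, rfl⟩ := (Sym.oneEquiv (α := Fin n)).surjective a
  rw [hom_one_lin] at h1
  rw [mulVec_smul, linCoeff, submatrix_apply, Equiv.symm_apply_apply, id, h1]
  show _ = (2 : ℝ) * _
  norm_num

theorem hess_eq_of_gradCoeffs_one {V : (Fin n → ℝ) → ℝ} (hV : AnalyticAt ℝ V 0)
    {A : Matrix (Fin n) (Fin n) ℝ} (hA : Aᵀ = A) (h : gradCoeffs V 1 = linCoeff A) :
    hess V = A := by
  ext j i
  have h6 := hasFDerivAt_pi'.1 (grad_analyticAt hV).differentiableAt.hasFDerivAt i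
  have h1 := fderiv_grad hV (Pi.single j 1) i
  rw [single_one_vecMul] at h1
  have h2 : taylor (fun x => grad V x i) 1 (Sym.oneEquiv j) = linCoeff A i (Sym.oneEquiv j) := by
    rw [← h]; rfl
  rw [taylor_one (AnalyticAt.grad hV i), h6.fderiv, ContinuousLinearMap.comp_apply] at h2
  refine h1.symm.trans (Eq.trans (b := linCoeff A i (Sym.oneEquiv j)) h2 ?_)
  rw [linCoeff, submatrix_apply, Equiv.symm_apply_apply, id, ← transpose_apply A, hA]

theorem Problem.Assumptions.hjb_grad_analytic (hp : p.Assumptions) {V : (Fin n → ℝ) → ℝ}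
    (hV : AnalyticAt ℝ V 0) (h1 : grad V 0 = 0) :
    AnalyticAt ℝ (fun x => p.hjb (grad V x) x) 0 := by
  unfold Problem.hjb
  refine (AnalyticAt.sub ?_ (AnalyticAt.fun_comp (g := p.Psi) ?_ (hp.gradProd_analytic hV))).add
    hp.Q_analytic
  · exact Finset.univ.analyticAt_fun_sum fun i _ =>
      (AnalyticAt.grad hV i).mul (hp.f_apply_analytic i)
  · rw [h1, mulVec_zero]
    exact hp.Psi_analytic

/-- Integrate the formal gradient term by term; the geometric bound makes the sum an analytic `V`.
Its HJB residual is analytic and all its Taylor coefficients vanish. -/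
theorem Problem.Assumptions.exists_isLocalSolution (hp : p.Assumptions)
    (hF : (-(p.Fc + p.Fcᵀ)).PosDef) : ∃ V, IsLocalSolution p V := by
  obtain ⟨μ, hμ, hdis⟩ := exists_dissipative_of_posDef hF
  have hM : ∀ k, 2 ≤ k → IsUnit (Mmat hp.formalData.Fc k).det := fun k _ =>
    isUnit_det_Mmat_of_dissipative hμ hdis k
  have h8 : p.areSolᵀ = p.areSol := isSymm_of_isHermitian hp.isStabilizingARE_areSol.posSemidef.1
  set P := hp.formalData.coeffs with hPdef
  have hP := FormalData.isSolution_coeffs (X := hp.formalData) hM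
  obtain ⟨q1, hq1⟩ := exists_linCoeff_eq h8
  have hex : ∀ k, ∃ q : Sym (Fin n) (k + 1) → ℝ,
      (1 ≤ k → ∀ i a, P k i a = ((redOne n k)ᵀ *ᵥ q) (a, i)) ∧
      (2 ≤ k → Mmat hp.formalData.Fc k *ᵥ q =
        hom (k + 1) (hp.formalData.rest (k - 1) (Comp.ser P))) := by
    intro k
    rcases k with _ | _ | k
    · exact ⟨0, fun h => absurd h (by omega), fun h => absurd h (by omega)⟩
    · refine ⟨q1, fun _ i a => ?_, fun h => absurd h (by omega)⟩
      rw [← hq1, hPdef, hP.one]; rfl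
    · obtain ⟨q, h1, h2⟩ := (hP.symm (k + 2) (by omega))
      exact ⟨q, fun _ => h1, fun _ => h2⟩
  choose q hq1 hq2 using hex
  obtain ⟨C, ρ, hC, hρ, hbound⟩ := FormalData.IsSolution.exists_l2_le hp.converges hμ hdis hP
    (q := q) fun k hk => ⟨hq1 k (by omega), hq2 k hk⟩
  -- A gradient coefficient `K_{k+1}ᵀ q (k + 1)` of degree `k + 1` comes from a potential of degree
  -- `k + 2`, and differentiation multiplies by `k + 2`.
  set s : PS n := ofHom fun
    | 0 => 0
    | 1 => 0
    | k + 2 => ((k : ℝ) + 2)⁻¹ • q (k + 1) with hs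
  have hs0 : hom 0 s = 0 := by rw [hs, hom_ofHom]
  have hs1 : hom 1 s = 0 := by rw [hs, hom_ofHom]
  have hs2 : ∀ k, hom (k + 2) s = ((k : ℝ) + 2)⁻¹ • q (k + 1) := fun k => by rw [hs, hom_ofHom]
  -- The geometric bound starts at `k = 2`; the added term covers the quadratic part `q 1`.
  set C' := C + l2 (q 1) * ρ⁻¹ with hC'
  have hC'0 : 0 < C' := by
    have := l2_nonneg (q 1)
    positivity
  have hbn : ∀ k, bn k s ≤ C' / ρ * ρ ^ k := by
    intro k
    rcases k with _ | _ | k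
    · rw [bn, hs0, l2_zero]; positivity
    · rw [bn, hs1, l2_zero]; positivity
    · have h1 : l2 (q (k + 1)) ≤ C' * ρ ^ (k + 1) := by
        rcases k with _ | k
        · rw [hC', add_mul]
          have h2 : l2 (q 1) * ρ⁻¹ * ρ ^ (0 + 1) = l2 (q 1) := by
            rw [zero_add, pow_one, mul_assoc, inv_mul_cancel₀ hρ.ne', mul_one]
          rw [h2]
          exact le_add_of_nonneg_left (by positivity)
        · refine (hbound _ (by omega)).trans ?_
          gcongr
          rw [hC']
          exact le_add_of_nonneg_right (mul_nonneg (l2_nonneg _) (by positivity))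
      rw [bn, hs2, l2_smul, abs_of_pos (by positivity)]
      have h3 : C' / ρ * ρ ^ (k + 2) = C' * ρ ^ (k + 1) := by
        field_simp
        ring
      rw [h3]
      refine le_trans ?_ h1
      refine mul_le_of_le_one_left (l2_nonneg _) (inv_le_one_of_one_le₀ ?_)
      have : (0 : ℝ) ≤ k := k.cast_nonneg
      linarith
  obtain ⟨V, hV, hVs⟩ := exists_analytic_of_bn_le hρ hbn
  have hzero : V 0 = 0 := by
    rw [← hom_zero_tay V Sym.nil, hVs, hs0]; rfl
  have hcoef : gradCoeffs V = P := by
    funext k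
    ext i a
    rw [gradCoeffs_apply hV, ← hom_tay, hVs]
    rcases k with _ | k
    · have h1 : P 0 = 0 := hP.zero
      rw [hs1, h1, mulVec_zero]; simp
    · rw [hs2, mulVec_smul, hq1 (k + 1) (by omega) i a]
      show _ * (((k : ℝ) + 2)⁻¹ * _) = _
      push_cast
      field_simp
      ring
  have hgrad : grad V 0 = 0 := by
    ext i
    have h1 := hom_zero_tay (fun x => grad V x i) Sym.nil
    have h2 : gradCoeffs V 0 i Sym.nil = grad V 0 i := by rw [← h1, hom_tay]; rfl
    rw [← h2, hcoef, hPdef, hP.zero]; rfl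
  refine ⟨V, hV, hzero, hgrad, hess_eq_of_gradCoeffs_one hV h8 ((congrFun hcoef 1).trans hP.one), ?_⟩
  have hana := hp.hjb_grad_analytic hV hgrad
  refine eventually_eq_zero_of_tay hana fun k => ?_
  have hser : Comp.ser P = fun i => tay fun x => grad V x i := by
    rw [← hcoef]; exact funext (ser_gradCoeffs V)
  have h2 := hp.expands_hjb (K := k) (h := grad V)
    (fun i => expands_tay (AnalyticAt.grad hV i) _)
    fun i => lowOrd_one_tay (by rw [hgrad]; rfl)
  rw [hom_tay, ← h2.hom_tay_eq hana (by omega), ← hser]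
  exact hP.lowOrd_lhs_of_agree (N := k + 1) (by omega) (fun _ _ => rfl) (by omega) k (by omega)

end

end NLR

namespace NLR
open Matrix Asymptotics

/-! ### Linear changes of coordinates -/

section

variable {n m : ℕ} {T : Matrix (Fin n) (Fin n) ℝ}

/-- The change of coordinates `z = T x`. -/
noncomputable def mulVecEquiv (hT : IsUnit T.det) : (Fin n → ℝ) ≃L[ℝ] (Fin n → ℝ) :=
  ContinuousLinearEquiv.equivOfInverse (LinearMap.toContinuousLinearMap (Matrix.toLin' T))
    (LinearMap.toContinuousLinearMap (Matrix.toLin' T⁻¹))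
    (fun v => by simp [Matrix.mulVec_mulVec, Matrix.nonsing_inv_mul _ hT])
    (fun v => by simp [Matrix.mulVec_mulVec, Matrix.mul_nonsing_inv _ hT])

theorem tendsto_mulVec_zero (T : Matrix (Fin n) (Fin n) ℝ) :
    Tendsto (fun x : Fin n → ℝ => T *ᵥ x) (𝓝 0) (𝓝 0) := by
  have h := (LinearMap.toContinuousLinearMap (Matrix.toLin' T)).continuous.tendsto 0
  rwa [map_zero] at h

theorem analyticAt_comp_mulVec {E : Type*} [NormedAddCommGroup E] [NormedSpace ℝ E]
    {s : (Fin n → ℝ) → E} (hs : AnalyticAt ℝ s 0) (T : Matrix (Fin n) (Fin n) ℝ) :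
    AnalyticAt ℝ (fun x => s (T *ᵥ x)) 0 := by
  refine AnalyticAt.fun_comp (g := s) (by rwa [mulVec_zero]) ?_
  exact (LinearMap.toContinuousLinearMap (Matrix.toLin' T)).analyticAt 0

theorem grad_comp_mulVec (hT : IsUnit T.det) (V : (Fin n → ℝ) → ℝ) (x : Fin n → ℝ) :
    grad (fun x => V (T *ᵥ x)) x = Tᵀ *ᵥ grad V (T *ᵥ x) := by
  have h1 : fderiv ℝ (fun x => V (T *ᵥ x)) x = _ :=
    (mulVecEquiv hT).comp_right_fderiv (f := V) (x := x)
  ext i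
  rw [grad, h1]
  show fderiv ℝ V (T *ᵥ x) (T *ᵥ Pi.single i 1) = _
  rw [fderiv_apply_eq_grad, dotProduct_mulVec, dotProduct_single, mul_one, mulVec_transpose]

theorem hess_comp_mulVec (hT : IsUnit T.det) {V : (Fin n → ℝ) → ℝ} (hV : AnalyticAt ℝ V 0) :
    hess (fun x => V (T *ᵥ x)) = Tᵀ * hess V * T := by
  have key : ∀ y i, (y ᵥ* hess fun x => V (T *ᵥ x)) i = (y ᵥ* (Tᵀ * hess V * T)) i := by
    intro y i
    rw [← fderiv_grad (analyticAt_comp_mulVec hV T)]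
    have h0 : HasFDerivAt (grad V) (fderiv ℝ (grad V) 0) (T *ᵥ 0) := by
      rw [mulVec_zero]; exact (grad_analyticAt hV).differentiableAt.hasFDerivAt
    have h1 := (LinearMap.toContinuousLinearMap (Matrix.toLin' Tᵀ)).hasFDerivAt.comp (0 : Fin n → ℝ)
      (h0.comp (0 : Fin n → ℝ) (LinearMap.toContinuousLinearMap (Matrix.toLin' T)).hasFDerivAt)
    have h2 : grad (fun x => V (T *ᵥ x)) = fun x => Tᵀ *ᵥ grad V (T *ᵥ x) :=
      funext (grad_comp_mulVec hT V)
    rw [h2]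
    refine (congrFun (congrArg (fun L => L y) h1.fderiv) i).trans ?_
    show (Tᵀ *ᵥ (fderiv ℝ (grad V) 0 (T *ᵥ y))) i = _
    have h3 : fderiv ℝ (grad V) 0 (T *ᵥ y) = (T *ᵥ y) ᵥ* hess V :=
      funext fun j => fderiv_grad hV _ j
    rw [h3, mulVec_transpose, vecMul_vecMul, ← vecMul_transpose, vecMul_vecMul, Matrix.mul_assoc]
  ext i j
  simpa using key (Pi.single i 1) j

namespace Problem

variable {p : Problem n m}

theorem transform_one (p : Problem n m) : p.transform 1 = p := by
  simp [transform]

theorem transform_inv (p : Problem n m) (hT : IsUnit T.det) :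
    (p.transform T⁻¹).transform T = p := by
  simp only [transform, nonsing_inv_nonsing_inv _ hT, mulVec_mulVec, mul_nonsing_inv _ hT,
    one_mulVec, ← Matrix.mul_assoc, Matrix.one_mul]

theorem Assumptions.fderiv_f (hp : p.Assumptions) (y : Fin n → ℝ) :
    fderiv ℝ p.f 0 y = p.F1 *ᵥ y := by
  ext i
  have h1 : fderiv ℝ p.f 0 y i = fderiv ℝ (fun x => p.f x i) 0 y :=
    (fderiv_apply hp.f_analytic.differentiableAt ..).symm ▸ rfl
  rw [h1, fderiv_apply_eq_grad, mulVec]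
  congr 1
  ext j
  exact hp.fderiv_f_apply i j

theorem transform_G0 (p : Problem n m) (T : Matrix (Fin n) (Fin n) ℝ) :
    (p.transform T).G0 = T * p.G0 := by
  simp [transform, G0]

theorem Assumptions.transform_F1 (hp : p.Assumptions) (T : Matrix (Fin n) (Fin n) ℝ) :
    (p.transform T).F1 = T * p.F1 * T⁻¹ := by
  have h0 : HasFDerivAt p.f (fderiv ℝ p.f 0) (T⁻¹ *ᵥ 0) := by
    rw [mulVec_zero]; exact hp.f_analytic.differentiableAt.hasFDerivAt
  have h1 := (LinearMap.toContinuousLinearMap (Matrix.toLin' T)).hasFDerivAt.comp (0 : Fin n → ℝ)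
    (h0.comp (0 : Fin n → ℝ) (LinearMap.toContinuousLinearMap (Matrix.toLin' T⁻¹)).hasFDerivAt)
  ext i j
  refine (congrFun (congrArg (fun L => L (Pi.single j 1)) h1.fderiv) i).trans ?_
  show (T *ᵥ (fderiv ℝ p.f 0 (T⁻¹ *ᵥ Pi.single j 1))) i = _
  rw [hp.fderiv_f, mulVec_mulVec, mulVec_mulVec, mulVec_single_one]
  rfl

theorem Assumptions.transform_Q1 (hp : p.Assumptions) (hT : IsUnit T.det) :
    (p.transform T).Q1 = T⁻¹ᵀ * p.Q1 * T⁻¹ :=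
  hess_comp_mulVec (isUnit_nonsing_inv_det _ hT) hp.Q_analytic

theorem Assumptions.transform (hp : p.Assumptions) (hT : IsUnit T.det) :
    (p.transform T).Assumptions where
  f_analytic := by
    have h := analyticAt_comp_mulVec hp.f_analytic T⁻¹
    exact ((LinearMap.toContinuousLinearMap (Matrix.toLin' T)).analyticAt _).comp h
  g_analytic i j := by
    show AnalyticAt ℝ (fun x => ∑ k, T i k * p.g (T⁻¹ *ᵥ x) k j) 0
    exact Finset.univ.analyticAt_fun_sum fun k _ =>
      analyticAt_const.mul (analyticAt_comp_mulVec (hp.g_analytic k j) T⁻¹)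
  f_zero := by
    show T *ᵥ p.f (T⁻¹ *ᵥ 0) = 0
    rw [mulVec_zero, hp.f_zero, mulVec_zero]
  stabilizable := by
    obtain ⟨L, hL⟩ := hp.stabilizable
    refine ⟨L * T⁻¹, ?_⟩
    have h := isHurwitz_conj hT hL
    rwa [hp.transform_F1, transform_G0, ← Matrix.mul_assoc, ← Matrix.add_mul, Matrix.mul_assoc T,
      ← Matrix.mul_add]
  Q_analytic := analyticAt_comp_mulVec hp.Q_analytic T⁻¹
  Q_zero := by
    show p.Q (T⁻¹ *ᵥ 0) = 0
    rw [mulVec_zero, hp.Q_zero]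
  Q_pos x hx := hp.Q_pos _ fun h => hx <| by
    rw [← one_mulVec x, ← mul_nonsing_inv _ hT, ← mulVec_mulVec, h, mulVec_zero]
  Q1_nonneg := by
    rw [hp.transform_Q1 hT]
    exact posSemidef_transpose_mul_mul _ hp.Q1_nonneg
  no_imaginary_mode w z h1 h2 := by
    have hTS : T.map (algebraMap ℝ ℂ) * T⁻¹.map (algebraMap ℝ ℂ) = 1 := by
      rw [← Matrix.map_mul, mul_nonsing_inv _ hT, Matrix.map_one _ (map_zero _) (map_one _)]
    have hST : T⁻¹.map (algebraMap ℝ ℂ) * T.map (algebraMap ℝ ℂ) = 1 := by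
      rw [← Matrix.map_mul, nonsing_inv_mul _ hT, Matrix.map_one _ (map_zero _) (map_one _)]
    have hTS' : Tᵀ.map (algebraMap ℝ ℂ) * T⁻¹ᵀ.map (algebraMap ℝ ℂ) = 1 := by
      rw [← Matrix.map_mul, ← transpose_mul, nonsing_inv_mul _ hT, transpose_one,
        Matrix.map_one _ (map_zero _) (map_one _)]
    rw [hp.transform_F1, Matrix.map_mul, Matrix.map_mul] at h1
    rw [hp.transform_Q1 hT, Matrix.map_mul, Matrix.map_mul] at h2
    have h3 : T⁻¹.map (algebraMap ℝ ℂ) *ᵥ z = 0 := by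
      refine hp.no_imaginary_mode w _ ?_ ?_
      · have h := congrArg (T⁻¹.map (algebraMap ℝ ℂ) *ᵥ ·) h1
        simp only [mulVec_mulVec, mulVec_smul] at h
        rwa [← Matrix.mul_assoc, ← Matrix.mul_assoc, hST, Matrix.one_mul, ← mulVec_mulVec] at h
      · have h := congrArg (Tᵀ.map (algebraMap ℝ ℂ) *ᵥ ·) h2
        simp only [mulVec_mulVec, mulVec_zero] at h
        rwa [← Matrix.mul_assoc, ← Matrix.mul_assoc, hTS', Matrix.one_mul, ← mulVec_mulVec] at h
    rw [← one_mulVec z, ← hTS, ← mulVec_mulVec, h3, mulVec_zero]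
  R_differentiable := hp.R_differentiable
  R_analytic := hp.R_analytic
  R_even := hp.R_even
  R_zero := hp.R_zero
  R_pos := hp.R_pos
  R1_pos := hp.R1_pos
  rho_injective := hp.rho_injective

theorem Assumptions.transform_closedLoop (hp : p.Assumptions) (hT : IsUnit T.det)
    (P : Matrix (Fin n) (Fin n) ℝ) :
    (p.transform T).closedLoop (T⁻¹ᵀ * P * T⁻¹) = T * p.closedLoop P * T⁻¹ := by
  have h1 : Tᵀ * (T⁻¹ᵀ * P) = P := by
    rw [← Matrix.mul_assoc, ← transpose_mul, nonsing_inv_mul _ hT, transpose_one, Matrix.one_mul]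
  rw [closedLoop, closedLoop, hp.transform_F1, transform_G0, show (p.transform T).R1 = p.R1 from rfl,
    transpose_mul, Matrix.mul_sub, Matrix.sub_mul]
  congr 1
  calc T * p.G0 * p.R1⁻¹ * (p.G0ᵀ * Tᵀ) * (T⁻¹ᵀ * P * T⁻¹)
      = T * p.G0 * p.R1⁻¹ * p.G0ᵀ * (Tᵀ * (T⁻¹ᵀ * P)) * T⁻¹ := by simp only [Matrix.mul_assoc]
    _ = _ := by rw [h1]; simp only [Matrix.mul_assoc]

theorem Assumptions.isStabilizingARE_transform (hp : p.Assumptions) (hT : IsUnit T.det)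
    {P : Matrix (Fin n) (Fin n) ℝ} (h : p.IsStabilizingARE P) :
    (p.transform T).IsStabilizingARE (T⁻¹ᵀ * P * T⁻¹) where
  posSemidef := posSemidef_transpose_mul_mul _ h.posSemidef
  are := by
    have h1 : ∀ X : Matrix (Fin n) (Fin n) ℝ, Tᵀ * (T⁻¹ᵀ * X) = X := fun X => by
      rw [← Matrix.mul_assoc, ← transpose_mul, nonsing_inv_mul _ hT, transpose_one, Matrix.one_mul]
    have h2 : ∀ X : Matrix (Fin n) (Fin n) ℝ, T⁻¹ * (T * X) = X := fun X => by
      rw [← Matrix.mul_assoc, nonsing_inv_mul _ hT, Matrix.one_mul]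
    have h3 : ∀ X : Matrix (Fin n) (Fin m) ℝ, T⁻¹ * (T * X) = X := fun X => by
      rw [← Matrix.mul_assoc, nonsing_inv_mul _ hT, Matrix.one_mul]
    have h4 := congrArg (fun X => T⁻¹ᵀ * X * T⁻¹) h.are
    simp only [Matrix.mul_sub, Matrix.mul_add, Matrix.sub_mul, Matrix.add_mul, Matrix.mul_zero,
      Matrix.zero_mul] at h4
    rw [hp.transform_F1, hp.transform_Q1 hT, transform_G0,
      show (p.transform T).R1 = p.R1 from rfl, ← h4]
    simp only [transpose_mul, Matrix.mul_assoc, h1, h2, h3]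
  hurwitz := by
    rw [hp.transform_closedLoop hT]
    exact isHurwitz_conj hT h.hurwitz

theorem Assumptions.transform_areSol (hp : p.Assumptions) (hT : IsUnit T.det) :
    (p.transform T).areSol = T⁻¹ᵀ * p.areSol * T⁻¹ :=
  (hp.transform hT).areSol_eq (hp.isStabilizingARE_transform hT hp.isStabilizingARE_areSol)

theorem Assumptions.transform_Fc (hp : p.Assumptions) (hT : IsUnit T.det) :
    (p.transform T).Fc = T * p.Fc * T⁻¹ := by
  rw [Fc, hp.transform_areSol hT, hp.transform_closedLoop hT]; rfl

theorem transform_field (p : Problem n m) (hT : IsUnit T.det) (x : Fin n → ℝ) (u : Fin m → ℝ) :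
    (p.transform T).f (T *ᵥ x) + (p.transform T).g (T *ᵥ x) *ᵥ u = T *ᵥ (p.f x + p.g x *ᵥ u) := by
  simp [transform, nonsing_inv_mul _ hT, mulVec_add, mulVec_mulVec]

theorem IsTrajectory.transform (hT : IsUnit T.det) {x₀ : Fin n → ℝ} {x : ℝ → Fin n → ℝ}
    {u : ℝ → Fin m → ℝ} (h : p.IsTrajectory x₀ x u) :
    (p.transform T).IsTrajectory (T *ᵥ x₀) (fun t => T *ᵥ x t) u where
  continuousOn := (mulVecEquiv hT).continuous.comp_continuousOn h.continuousOn
  memLp := h.memLp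
  integrable t ht := by
    simp only [transform_field p hT]
    exact ⟨(mulVecEquiv hT).toContinuousLinearMap.integrable_comp (h.integrable t ht).1,
      (mulVecEquiv hT).toContinuousLinearMap.integrable_comp (h.integrable t ht).2⟩
  eq_integral t ht := by
    simp only [transform_field p hT]
    have h1 := (mulVecEquiv hT).toContinuousLinearMap.intervalIntegral_comp_comm (h.integrable t ht)
    refine (congrArg (T *ᵥ ·) (h.eq_integral t ht)).trans ?_
    rw [mulVec_add]
    exact congrArg (T *ᵥ x₀ + ·) h1.symm

theorem value_transform_le (p : Problem n m) (hT : IsUnit T.det) (x₀ : Fin n → ℝ) :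
    (p.transform T).value (T *ᵥ x₀) ≤ p.value x₀ := by
  refine le_iInf fun x => le_iInf fun u => le_iInf fun h => ?_
  refine (iInf_le_of_le _ (iInf_le_of_le u (iInf_le_of_le (h.transform hT) ?_)))
  refine le_of_eq (lintegral_congr fun t => ?_)
  simp [Problem.transform, nonsing_inv_mul _ hT, mulVec_mulVec]

theorem value_transform (p : Problem n m) (hT : IsUnit T.det) (x₀ : Fin n → ℝ) :
    (p.transform T).value (T *ᵥ x₀) = p.value x₀ := by
  refine le_antisymm (value_transform_le p hT x₀) ?_
  -- The reverse inequality is the same one for the inverse change of coordinates.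
  have h := value_transform_le (p.transform T) (isUnit_nonsing_inv_det _ hT) (T *ᵥ x₀)
  have h2 := transform_inv p (isUnit_nonsing_inv_det _ hT)
  rw [nonsing_inv_nonsing_inv _ hT] at h2
  rwa [h2, mulVec_mulVec, nonsing_inv_mul _ hT, one_mulVec] at h

/-- Gradients transform by the inverse transpose, so the pairings `h · f` and `gᵀ h` do not change.
-/
theorem hjb_transform (p : Problem n m) (hT : IsUnit T.det) (h x : Fin n → ℝ) :
    (p.transform T).hjb (T⁻¹ᵀ *ᵥ h) (T *ᵥ x) = p.hjb h x := by
  have h1 : Tᵀ *ᵥ (T⁻¹ᵀ *ᵥ h) = h := by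
    rw [mulVec_mulVec, ← transpose_mul, nonsing_inv_mul _ hT, transpose_one, one_mulVec]
  have h2 : T⁻¹ *ᵥ (T *ᵥ x) = x := by rw [mulVec_mulVec, nonsing_inv_mul _ hT, one_mulVec]
  have h3 : (T⁻¹ᵀ *ᵥ h) ⬝ᵥ (T *ᵥ p.f x) = h ⬝ᵥ p.f x := by
    rw [dotProduct_mulVec, ← mulVec_transpose, h1]
  simp only [hjb, transform, h2, h3, transpose_mul, ← mulVec_mulVec, h1]
  rfl

end Problem

theorem IsLocalSolution.transform {p : Problem n m} {V : (Fin n → ℝ) → ℝ}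
    (h : IsLocalSolution p V) (hp : p.Assumptions) (hT : IsUnit T.det) :
    IsLocalSolution (p.transform T) fun x => V (T⁻¹ *ᵥ x) where
  analytic := analyticAt_comp_mulVec h.analytic T⁻¹
  zero := by rw [mulVec_zero, h.zero]
  grad_zero := by
    rw [grad_comp_mulVec (isUnit_nonsing_inv_det _ hT), mulVec_zero, h.grad_zero, mulVec_zero]
  hess := by
    rw [hess_comp_mulVec (isUnit_nonsing_inv_det _ hT) h.analytic, h.hess, hp.transform_areSol hT]
  hjb := by
    filter_upwards [(tendsto_mulVec_zero T⁻¹).eventually h.hjb] with x hx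
    rw [grad_comp_mulVec (isUnit_nonsing_inv_det _ hT), ← hx, ← Problem.hjb_transform p hT,
      mulVec_mulVec _ T T⁻¹, mul_nonsing_inv _ hT, one_mulVec]

/-- Multiplying `Fᵀ T² + T² F + I = 0` by `T⁻¹` on both sides shows that `T F T⁻¹` and its transpose
add up to `-T⁻²`. -/
theorem posDef_neg_add_transpose_of_isLyapunov {F : Matrix (Fin n) (Fin n) ℝ} (hT : T.PosDef)
    (h : IsLyapunov F (T * T)) : (-(T * F * T⁻¹ + (T * F * T⁻¹)ᵀ)).PosDef := by
  have hu : IsUnit T.det := isUnit_iff_ne_zero.2 hT.det_pos.ne'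
  have hs : Tᵀ = T := (posDef_iff_real.1 hT).1
  have hi : T⁻¹ᵀ = T⁻¹ := by rw [transpose_nonsing_inv, hs]
  have h1 : -(T * F * T⁻¹ + (T * F * T⁻¹)ᵀ) = T⁻¹ᴴ * 1 * T⁻¹ := by
    have h2 := congrArg (fun X => T⁻¹ * X * T⁻¹) h.2
    simp only [Matrix.mul_add, Matrix.add_mul, Matrix.mul_zero, Matrix.zero_mul] at h2
    have h3 : T⁻¹ * (Fᵀ * (T * T)) * T⁻¹ = (T * F * T⁻¹)ᵀ := by
      rw [transpose_mul, transpose_mul, hi, hs]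
      simp only [Matrix.mul_assoc, mul_nonsing_inv _ hu, Matrix.mul_one]
    have h4 : T⁻¹ * (T * T * F) * T⁻¹ = T * F * T⁻¹ := by
      simp only [← Matrix.mul_assoc, nonsing_inv_mul _ hu, Matrix.one_mul]
    rw [h3, h4, add_comm (T * F * T⁻¹)ᵀ] at h2
    rw [conjTranspose_eq_transpose_of_trivial, hi]
    exact neg_eq_of_add_eq_zero_right h2
  rw [h1]
  refine PosDef.one.conjTranspose_mul_mul_same ?_
  intro x y hxy
  have h5 : T *ᵥ (T⁻¹ *ᵥ x) = T *ᵥ (T⁻¹ *ᵥ y) := congrArg (T *ᵥ ·) hxy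
  simpa only [mulVec_mulVec, mul_nonsing_inv _ hu, one_mulVec] using h5

theorem Problem.Assumptions.posDef_transform_lyapunovSqrt {p : Problem n m} (hp : p.Assumptions) :
    (-((p.transform (lyapunovSqrt p.Fc)).Fc +
      (p.transform (lyapunovSqrt p.Fc)).Fcᵀ)).PosDef := by
  have h := hp.isHurwitz_Fc.lyapunovSqrt_spec
  rw [hp.transform_Fc (isUnit_iff_ne_zero.2 h.1.det_pos.ne')]
  exact posDef_neg_add_transpose_of_isLyapunov h.1 h.2

/-- The closed-loop matrix need not be dissipative in the given coordinates, but it is after scaling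
by the root of the Lyapunov solution. The equation is solved there and the solution pulled back. -/
theorem Problem.Assumptions.exists_localSolution {p : Problem n m} (hp : p.Assumptions) :
    ∃ V, IsLocalSolution p V := by
  have hT : IsUnit (lyapunovSqrt p.Fc).det :=
    isUnit_iff_ne_zero.2 hp.isHurwitz_Fc.lyapunovSqrt_spec.1.det_pos.ne'
  obtain ⟨V, hV⟩ := (hp.transform hT).exists_isLocalSolution hp.posDef_transform_lyapunovSqrt
  have h := hV.transform (hp.transform hT) (isUnit_nonsing_inv_det _ hT)
  have h2 := p.transform_inv (isUnit_nonsing_inv_det _ hT)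
  rw [nonsing_inv_nonsing_inv _ hT] at h2
  rw [h2] at h
  exact ⟨_, h⟩

/-- Algorithm 1 computes the coefficients of the value function. -/
theorem Problem.Assumptions.exists_algorithm1 {p : Problem n m} (hp : p.Assumptions) :
    ∃ P : Comp.Series n (Fin n),
      (∀ N k : ℕ, 1 ≤ k → k ≤ N → (algorithm1 p N).val k = P k) ∧ SolvesExactly p P := by
  obtain ⟨V, hV⟩ := hp.exists_localSolution
  have hM : ∀ k, 2 ≤ k → IsUnit (Mmat p.Fc k).det := fun k _ =>
    isUnit_det_Mmat_of_isHurwitz hp.isHurwitz_Fc k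
  have hM' : ∀ k, 2 ≤ k → IsUnit (Mmat hp.formalData.Fc k).det := hM
  -- Both series solve the formal HJB equation with the gradient symmetry, and the solution is
  -- unique because all `M_k` are invertible; dissipativity in the given coordinates plays no role
  -- here.
  have h : hp.formalData.coeffs = gradCoeffs V :=
    FormalData.IsSolution.eq hM' (FormalData.isSolution_coeffs hM') (hV.isSolution hp)
  refine ⟨gradCoeffs V, fun N k _ hk => ?_, hV.solvesExactly hp⟩
  rw [algorithm1_val hp hM N k hk, h]

end

end NLR

namespace NLR
open Matrix Asymptotics

/-! ### The scaling of the second algorithm and the main theorem -/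

section

variable {n m : ℕ} (p : Problem n m) (θ : ℝ) (N : ℕ)

theorem Comp.closedLoop_val (P₁ : Matrix (Fin n) (Fin n) ℝ) :
    (Comp.closedLoop p P₁).val = p.closedLoop P₁ := rfl

open Classical in
/-- The transformation matrix of the second algorithm. -/
noncomputable def scaling : Matrix (Fin n) (Fin n) ℝ :=
  if WellConditioned θ p.Fc then 1 else lyapunovSqrt p.Fc

open Classical in
theorem algorithm2_val :
    (algorithm2 p θ N).val = (scaling p θ, (algorithm1 (p.transform (scaling p θ)) N).val) := by
  have h1 : (Comp.closedLoop p p.areSol).val = p.Fc := Comp.closedLoop_val p _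
  by_cases h : WellConditioned θ p.Fc
  · rw [scaling, if_pos h, p.transform_one]
    show Comp.val (if decide (WellConditioned θ (Comp.closedLoop p p.areSol).val) = true
      then _ else _) = _
    rw [h1, if_pos (decide_eq_true h)]
    rfl
  · rw [scaling, if_neg h]
    show Comp.val (if decide (WellConditioned θ (Comp.closedLoop p p.areSol).val) = true
      then _ else _) = _
    rw [h1, if_neg (by simpa using h)]
    rfl

variable {p}

theorem Problem.Assumptions.scaling_posDef (hp : p.Assumptions) : (scaling p θ).PosDef := by
  rw [scaling]
  split_ifs
  · exact PosDef.one
  · exact hp.isHurwitz_Fc.lyapunovSqrt_spec.1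

/-- Without a transformation this is the first half of the test, up to the factor two; otherwise it
is the effect of the Lyapunov scaling. Either way the condition numbers of the transformed `M_k` are
bounded uniformly. -/
theorem Problem.Assumptions.posDef_transform_scaling (hp : p.Assumptions) :
    (-((p.transform (scaling p θ)).Fc + (p.transform (scaling p θ)).Fcᵀ)).PosDef := by
  rw [scaling]
  split_ifs with h
  · rw [p.transform_one]
    have h2 := h.1.smul (zero_lt_two' ℝ)
    rwa [smul_neg, smul_smul, mul_one_div_cancel two_ne_zero, one_smul] at h2
  · exact hp.posDef_transform_lyapunovSqrt

end

end NLR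

theorem mainTheorem1 (n m : ℕ) :
    -- the number of steps is bounded by a polynomial in the order
    (∃ c : Polynomial ℕ, ∀ p : NLR.Problem n m, p.Assumptions → ∀ N : ℕ,
      (NLR.algorithm1 p N).steps ≤ c.eval N ∧
      ∀ θ : ℝ, (NLR.algorithm2 p θ N).steps ≤ c.eval N) ∧
    ∀ p : NLR.Problem n m, p.Assumptions →
      -- the first algorithm
      ((∃! P₁, p.IsStabilizingARE P₁) ∧
        (∀ k : ℕ, 1 ≤ k → IsUnit (NLR.Mmat p.Fc k).det) ∧
        ∃ P : NLR.Comp.Series n (Fin n),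
          (∀ N k : ℕ, 1 ≤ k → k ≤ N → (NLR.algorithm1 p N).val k = P k) ∧
          NLR.SolvesExactly p P) ∧
      -- the second algorithm
      ∀ θ : ℝ, ∃ (T : Matrix (Fin n) (Fin n) ℝ) (P : NLR.Comp.Series n (Fin n)),
        (∀ N : ℕ, (NLR.algorithm2 p θ N).val.1 = T) ∧
        T.PosDef ∧
        (NLR.WellConditioned θ p.Fc → T = 1) ∧
        (¬ NLR.WellConditioned θ p.Fc → NLR.IsLyapunov p.Fc (T * T)) ∧
        (∃! P₁, (p.transform T).IsStabilizingARE P₁) ∧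
        (∀ N k : ℕ, 1 ≤ k → k ≤ N → (NLR.algorithm2 p θ N).val.2 k = P k) ∧
        NLR.SolvesExactly (p.transform T) P ∧
        (∀ x : Fin n → ℝ, (p.transform T).value (Matrix.mulVec T x) = p.value x) ∧
        (∀ᶠ x in nhds (0 : Fin n → ℝ),
          HasSum (fun k : ℕ => Matrix.mulVec T x ⬝ᵥ
            Matrix.mulVec (P (k + 1)) (NLR.powVec (Matrix.mulVec T x) (k + 1)) / ((k : ℝ) + 2))
            (p.valueR x)) ∧
        ∃ B : ℝ, ∀ k : ℕ, 1 ≤ k →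
          IsUnit (NLR.Mmat (p.transform T).Fc k).det ∧
          NLR.condNumber (NLR.Mmat (p.transform T).Fc k) ≤ B := by
  open NLR in
  refine ⟨?_, fun p hp => ⟨⟨hp.existsUnique_isStabilizingARE, fun k _ =>
    isUnit_det_Mmat_of_isHurwitz hp.isHurwitz_Fc k, hp.exists_algorithm1⟩, fun θ => ?_⟩⟩
  · obtain ⟨c, hc⟩ := NLR.exists_polynomial_steps_le n m
    exact ⟨c, fun p _ N => hc p N⟩
  have hT := hp.scaling_posDef θ
  have hu : IsUnit (scaling p θ).det := isUnit_iff_ne_zero.2 hT.det_pos.ne'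
  obtain ⟨P, hP, hs⟩ := (hp.transform hu).exists_algorithm1
  obtain ⟨μ, hμ, hdis⟩ := exists_dissipative_of_posDef (hp.posDef_transform_scaling θ)
  refine ⟨scaling p θ, P, fun N => by rw [algorithm2_val], hT, fun h => if_pos h, fun h => ?_,
    (hp.transform hu).existsUnique_isStabilizingARE, fun N k h1 hk => ?_, hs,
    p.value_transform hu, ?_, _, fun k _ =>
      ⟨isUnit_det_Mmat_of_dissipative hμ hdis k, condNumber_Mmat_le hμ hdis k⟩⟩
  · rw [show scaling p θ = lyapunovSqrt p.Fc from if_neg h]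
    exact hp.isHurwitz_Fc.lyapunovSqrt_spec.2
  · rw [algorithm2_val]
    exact hP N k h1 hk
  -- The series for the transformed value function is evaluated at `T x`, which is near the origin
  -- when `x` is, and invariance of the value replaces its sum by the original one.
  · filter_upwards [(tendsto_mulVec_zero (scaling p θ)).eventually hs.value_series] with x hx
    rwa [show (p.transform (scaling p θ)).valueR (Matrix.mulVec (scaling p θ) x) = p.valueR x from
      congrArg ENNReal.toReal (p.value_transform hu x)] at hx
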